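/- **Setting.** Let $H=\sum_\mu E_\mu|\mu\rangle\langle\mu|$ be a Hamiltonian on $n$ qubits with a fixed orthonormal eigenbasis, $\beta,\Omega>0$, and $\rho_\beta=e^{-\beta H}/\mathrm{Tr}\,e^{-\beta H}$. A random coupling operator $V$ is of ETH form if in the eigenbasis $\langle\mu|V|\nu\rangle=v_\mu\delta_{\mu\nu}+\sigma_{\mu\nu}R_{\mu\nu}$, where $v_\mu\in\mathbb R$ and $\sigma_{\nu\mu}=\overline{\sigma_{\mu\nu}}$ may themselves be random (random choice of the local operator) and $R_{\mu\nu}=R_{\nu\mu}$ are independent standard real Gaussians, independent of $(v,\sigma)$. Its size is at most $\kappa>0$ if $\mathbb E\,e^{\|V\|/\kappa}\le 2$, with $\|\cdot\|$ the operator norm. *Algorithm* with parameters $d,n_a\in\mathbb N$, $\gamma>0$, $\lambda>0$. Start with $\rho_0=|z\rangle\langle z|$ for a uniformly random computational basis state $z\in\{0,1\}^n$. In cycle $k=0,\dots,d-1$ draw, all independently, $t_k$ with density $\gamma e^{-\gamma t}$ on $t\ge0$ and, for $j=1,\dots,n_a$, $\omega_{kj}$ uniform on $[-\Omega,\Omega]$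 and a copy $V_{kj}$ of $V$; reset the $n_a$ ancilla qubits to $\sigma_{\beta k}=\bigotimes_{j}\bigl[n(\beta\omega_{kj})|0\rangle\langle0|+n(-\beta\omega_{kj})|1\rangle\langle1|\bigr]$ with $n(x)=1/(1+e^x)$; and set $\rho_{k+1}=\mathrm{Tr}_a\bigl(U_k(\rho_k\otimes\sigma_{\beta k})U_k^\dagger\bigr)$, where $U_k=e^{-i\mathcal H_kt_k}$ and $\mathcal H_k=H\otimes I+I\otimes\tfrac12\sum_j\omega_{kj}Z_j+\lambda\sum_jV_{kj}\otimes X_j$. Let $\mathbb E[\rho_d]$ be the expected output; the expected total evolution time is $\mathbb E\sum_kt_k$. *Classical chain.* For $C>0$ and $\Omega_{\mu\nu}=E_\mu-E_\nu$ let $$T_{\mu\nu}=(1-\tau_\nu)\delta_{\mu\nu}+C\,\frac{2\pi\,\mathbb E|\langle\mu|V|\nu\rangle|^2}{1+e^{\beta\Omega_{\mu\nu}}}\,f(\Omega_{\mu\nu}/\Omega),\qquad f(x)=\frac1\pi\Bigl[\arctan\tfrac{\Omega(1-x)}{\gamma}+\arctan\tfrac{\Omega(1+x)}{\gamma}\Bigr],$$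 with $\tau_\nu$ such that $\sum_\mu T_{\mu\nu}=1$. If $T$ is entrywise nonnegative, its mixing time is the least $k$ such that, from every starting level, the distribution after $k$ steps is within total variation distance $1/4$ of the Gibbs distribution $\propto e^{-\beta E_\mu}$ ($\infty$ if there is no such $k$). Its gap $\Delta$ is $1$ minus the second largest modulus of an eigenvalue of $T$, counted with multiplicity. **Theorem.** For all $\kappa,C>0$ there are constants $c_d,c_\gamma,c_\lambda,c_a,c_t,c_m>0$ and exponents $p_d,p_\gamma,p_\lambda,p_a,p_t\in\mathbb N$, depending only on $\kappa$ and $C$, such that for every $n$, every $H$, every ETH coupling ensemble of size at most $\kappa$, and all $\beta,\Omega>0$: 1. (*Mixing time $O(n/\Delta)$.*) If $\gamma>0$, $|E_\mu|\le hn$ for all $\mu$, $T$ is nonnegative and $\Delta>0$, then the mixing time of $T$ is at most $\lceil c_m(1+\beta h)\,n/\Delta\rceil$. 2. (*Accuracy and runtime.*) Let $0<\epsilon\le1$, let $m\ge1$ be an integer with $\epsilon\le\beta m\Omega$, put $L=\log\bigl(2+m(1+\beta\Omega)/\epsilon\bigr)$ and choose $$d=\Bigl\lceil c_d\frac{m^2}{\epsilon}L^{p_d}\Bigr\rceil,\quad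 \gamma^{-1}=c_\gamma\frac{\beta m}{\epsilon}L^{p_\gamma},\quad \lambda=c_\lambda\frac{\epsilon^{3/2}}{\beta m^{3/2}}L^{-p_\lambda},\quad n_a=\Bigl\lceil c_a\frac{\beta m\Omega}{\epsilon}L^{p_a}\Bigr\rceil .$$ If, for this $\gamma$, $T$ is nonnegative with mixing time at most $m$, then $\|\mathbb E[\rho_d]-\rho_\beta\|_1\le\epsilon$, and the expected total evolution time is $d/\gamma\le c_t\,\dfrac{\beta m^3}{\epsilon^2}L^{p_t}$. -/

import Mathlib

open MeasureTheory ProbabilityTheory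
open scoped ENNReal NNReal Matrix Kronecker

noncomputable section

namespace ErgodicGibbs

/-- Labels of the computational basis of `n` qubits (`false` stands for `|0⟩`). -/
abbrev Bits (n : ℕ) : Type := Fin n → Bool

/-! ### Matrices: norms, partial trace, Gibbs state -/

/-- Operator norm of a matrix acting on the Hilbert space `ℂ^ι`. -/
def opNorm {ι : Type*} [Fintype ι] [DecidableEq ι] (A : Matrix ι ι ℂ) : ℝ :=
  ‖Matrix.toEuclideanCLM (n := ι) (𝕜 := ℂ) A‖

/-- Trace norm: the sum of the singular values. -/
def traceNorm {ι : Type*} [Fintype ι] [DecidableEq ι] (A : Matrix ι ι ℂ) : ℝ :=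
  ∑ i, Real.sqrt ((Matrix.isHermitian_conjTranspose_mul_self A).eigenvalues i)

/-- Partial trace over the second (ancilla) factor. -/
def traceAnc {ι α : Type*} [Fintype α] (M : Matrix (ι × α) (ι × α) ℂ) : Matrix ι ι ℂ :=
  Matrix.of fun i j => ∑ a, M (i, a) (j, a)

/-- The Gibbs state `exp (-β H) / Tr exp (-β H)`. -/
def gibbs {ι : Type*} [Fintype ι] [DecidableEq ι] (β : ℝ) (H : Matrix ι ι ℂ) : Matrix ι ι ℂ :=
  (NormedSpace.exp (-(β : ℂ) • H)).trace⁻¹ • NormedSpace.exp (-(β : ℂ) • H)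

/-! ### Ancilla qubits -/

/-- Thermal occupation `n(x) = 1 / (1 + exp x)`. -/
def occ (x : ℝ) : ℝ := 1 / (1 + Real.exp x)

/-- Pauli `X` on the `m`-th of `na` ancilla qubits. -/
def pauliX {na : ℕ} (m : Fin na) : Matrix (Bits na) (Bits na) ℂ :=
  Matrix.of fun a b => if a = Function.update b m (!(b m)) then 1 else 0

/-- Pauli `Z` on the `m`-th of `na` ancilla qubits. -/
def pauliZ {na : ℕ} (m : Fin na) : Matrix (Bits na) (Bits na) ℂ :=
  Matrix.diagonal fun b => if b m then -1 else 1

/-- Ancilla Hamiltonian `½ ∑ ω_m Z_m`. -/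
def ancHam {na : ℕ} (ω : Fin na → ℝ) : Matrix (Bits na) (Bits na) ℂ :=
  (1 / 2 : ℂ) • ∑ m, (ω m : ℂ) • pauliZ m

/-- Product of the single-qubit thermal states
`n(βω_m) |0⟩⟨0| + n(-βω_m) |1⟩⟨1|`. -/
def ancThermal {na : ℕ} (β : ℝ) (ω : Fin na → ℝ) : Matrix (Bits na) (Bits na) ℂ :=
  Matrix.diagonal fun b =>
    ((∏ m, (if b m then occ (-(β * ω m)) else occ (β * ω m)) : ℝ) : ℂ)

/-! ### The system and its random ETH couplings -/

/-- A system of `n` qubits with a diagonalized Hamiltonian, together with an ensemble of random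
coupling operators of ETH form: in the energy eigenbasis the operator with label `θ` has the entries
`⟨μ|V|ν⟩ = v_μ(θ) δ_{μν} + σ_{μν}(θ) R_{μν}`, with `R` standard Gaussian (see `coupling`).
The label `θ` is drawn from a probability measure on `Θ`. -/
structure EthSystem (n : ℕ) (Θ : Type*) [MeasurableSpace Θ] where
  /-- the target Hamiltonian, in the computational basis -/
  ham : Matrix (Bits n) (Bits n) ℂ
  /-- unitary whose columns are the energy eigenvectors `|μ⟩` -/
  eig : Matrix.unitaryGroup (Bits n) ℂ
  /-- the eigenenergies `E_μ` -/
  energy : Bits n → ℝ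
  ham_eq : ham = (eig : Matrix (Bits n) (Bits n) ℂ) *
    Matrix.diagonal (fun μ => (energy μ : ℂ)) * (eig : Matrix (Bits n) (Bits n) ℂ)ᴴ
  /-- the smooth diagonal part `v_μ` -/
  diag : Θ → Bits n → ℝ
  /-- the amplitudes `σ_{μν}` -/
  amp : Θ → Bits n → Bits n → ℂ
  measurable_diag : Measurable diag
  measurable_amp : Measurable amp
  amp_symm : ∀ θ μ ν, amp θ ν μ = star (amp θ μ ν)

variable {n : ℕ} {Θ : Type*} [MeasurableSpace Θ]

/-- Randomness of one coupling operator: its label, and the Gaussian variables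
`R_{μν} = R_{νμ}`, indexed by unordered pairs. -/
abbrev CouplingData (n : ℕ) (Θ : Type*) : Type _ := Θ × (Sym2 (Bits n) → ℝ)

/-- Law of one coupling operator: the label has law `P`, the Gaussians are independent standard
normals, independent of the label. -/
def couplingLaw (n : ℕ) (P : Measure Θ) : Measure (CouplingData n Θ) :=
  P.prod (Measure.pi fun _ => gaussianReal 0 1)

namespace EthSystem

/-- Matrix element `⟨μ|V|ν⟩` of the coupling operator in the energy eigenbasis. -/
def elem (S : EthSystem n Θ) (x : CouplingData n Θ) (μ ν : Bits n) : ℂ :=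
  (if μ = ν then (S.diag x.1 μ : ℂ) else 0) + S.amp x.1 μ ν * (x.2 s(μ, ν) : ℂ)

/-- The coupling operator `V`, in the computational basis. -/
def coupling (S : EthSystem n Θ) (x : CouplingData n Θ) : Matrix (Bits n) (Bits n) ℂ :=
  (S.eig : Matrix (Bits n) (Bits n) ℂ) * Matrix.of (S.elem x) *
    (S.eig : Matrix (Bits n) (Bits n) ℂ)ᴴ

/-- `‖V‖` has size at most `κ`: `E exp (‖V‖ / κ) ≤ 2`
(for a bounded coupling, `‖V‖ ≤ κ log 2` is enough). -/
def CouplingSize (S : EthSystem n Θ) (P : Measure Θ) (κ : ℝ) : Prop :=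
  ∫⁻ x, ENNReal.ofReal (Real.exp (opNorm (S.coupling x) / κ)) ∂(couplingLaw n P) ≤ 2

/-! ### The algorithm -/

/-- Total Hamiltonian `H ⊗ 1 + 1 ⊗ H_anc + λ ∑ V_m ⊗ X_m` of one cycle. -/
def totalHam (S : EthSystem n Θ) {na : ℕ} (lam : ℝ) (ω : Fin na → ℝ)
    (x : Fin na → CouplingData n Θ) : Matrix (Bits n × Bits na) (Bits n × Bits na) ℂ :=
  S.ham ⊗ₖ (1 : Matrix (Bits na) (Bits na) ℂ) + (1 : Matrix (Bits n) (Bits n) ℂ) ⊗ₖ ancHam ω +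
    (lam : ℂ) • ∑ m, S.coupling (x m) ⊗ₖ pauliX m

end EthSystem

/-- Randomness of one cycle: the evolution time, and for every ancilla qubit its frequency and
the coupling operator attached to it. -/
abbrev CycleData (n na : ℕ) (Θ : Type*) : Type _ := ℝ × (Fin na → ℝ × CouplingData n Θ)

/-- Law of one cycle: the time has density `γ exp (-γ t)` on `t ≥ 0`, the frequencies are uniform
on `[-Ω, Ω]`, and everything is independent. -/
def cycleLaw (n na : ℕ) (P : Measure Θ) (γ Ω : ℝ) : Measure (CycleData n na Θ) :=
  (expMeasure γ).prod (Measure.pi fun _ =>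
    (ProbabilityTheory.cond volume (Set.Icc (-Ω) Ω)).prod (couplingLaw n P))

namespace EthSystem

/-- One cycle, `ρ ↦ Tr_a (U (ρ ⊗ σ_β) U†)` with `U = exp (-i 𝓗 t)`. -/
def cycle (S : EthSystem n Θ) {na : ℕ} (β lam : ℝ) (y : CycleData n na Θ)
    (ρ : Matrix (Bits n) (Bits n) ℂ) : Matrix (Bits n) (Bits n) ℂ :=
  let ω : Fin na → ℝ := fun m => (y.2 m).1
  let U := NormedSpace.exp
    ((-(Complex.I * (y.1 : ℂ))) • S.totalHam lam ω (fun m => (y.2 m).2))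
  traceAnc (U * (ρ ⊗ₖ ancThermal β ω) * Uᴴ)

/-- The random state after `d` cycles, from the computational basis state `|z⟩⟨z|`. -/
def run (S : EthSystem n Θ) {na : ℕ} (β lam : ℝ) (z : Bits n) :
    (d : ℕ) → (Fin d → CycleData n na Θ) → Matrix (Bits n) (Bits n) ℂ
  | 0, _ => Matrix.single z z 1
  | d + 1, y => S.cycle β lam (y (Fin.last d)) (S.run β lam z d fun k => y k.castSucc)

/-- The expected output `E[ρ_d]` (entrywise expectation): the initial basis state is uniformly
random and the cycles are independent. -/
def expectedOutput (S : EthSystem n Θ) (P : Measure Θ) (β Ω γ lam : ℝ) (na d : ℕ) :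
    Matrix (Bits n) (Bits n) ℂ :=
  Matrix.of fun i j => (Fintype.card (Bits n) : ℂ)⁻¹ * ∑ z : Bits n,
    ∫ y, S.run β lam z d y i j ∂(Measure.pi fun _ : Fin d => cycleLaw n na P γ Ω)

end EthSystem

/-- Expected total evolution time of `d` cycles. -/
def expectedTime (n na : ℕ) (P : Measure Θ) (γ Ω : ℝ) (d : ℕ) : ℝ :=
  ∫ y, ∑ k : Fin d, (y k).1 ∂(Measure.pi fun _ : Fin d => cycleLaw n na P γ Ω)

/-! ### The classical Markov chain -/

/-- Smoothed window `f(x) = (arctan (Ω(1-x)/γ) + arctan (Ω(1+x)/γ)) / π`. -/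
def window (Ω γ x : ℝ) : ℝ :=
  (Real.arctan (Ω / γ * (1 - x)) + Real.arctan (Ω / γ * (1 + x))) / Real.pi

namespace EthSystem

/-- `σ²_{μν} = E_V |⟨μ|V|ν⟩|²`. -/
def variance (S : EthSystem n Θ) (P : Measure Θ) (μ ν : Bits n) : ℝ :=
  ∫ x, ‖S.elem x μ ν‖ ^ 2 ∂(couplingLaw n P)

/-- The transition amplitude `C · 2π σ²_{μν} / (1 + exp (β Ω_{μν})) · f(Ω_{μν} / Ω)` from `ν` to
`μ`, where `Ω_{μν} = E_μ - E_ν`. -/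
def rate (S : EthSystem n Θ) (P : Measure Θ) (C β Ω γ : ℝ) (μ ν : Bits n) : ℝ :=
  C * (2 * Real.pi * S.variance P μ ν / (1 + Real.exp (β * (S.energy μ - S.energy ν)))) *
    window Ω γ ((S.energy μ - S.energy ν) / Ω)

/-- The Metropolis-type matrix `T_{μν} = (1 - τ_ν) δ_{μν} + rate μ ν`, with `τ_ν` chosen so that
every column sums to one. -/
def transition (S : EthSystem n Θ) (P : Measure Θ) (C β Ω γ : ℝ) :
    Matrix (Bits n) (Bits n) ℝ :=
  Matrix.of fun μ ν =>
    (if μ = ν then 1 - ∑ κ, S.rate P C β Ω γ κ ν else 0) + S.rate P C β Ω γ μ ν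

/-- The Gibbs distribution on the energy levels. -/
def gibbsWeight (S : EthSystem n Θ) (β : ℝ) (μ : Bits n) : ℝ :=
  Real.exp (-(β * S.energy μ)) / ∑ ν, Real.exp (-(β * S.energy ν))

end EthSystem

/-- Mixing time of a column-stochastic matrix `T` towards the distribution `p`: the least `k` such
that, from every starting state, the distribution after `k` steps is within total variation
distance `1/4` of `p` (`⊤` if there is no such `k`). -/
def mixingTime {ι : Type*} [Fintype ι] [DecidableEq ι] (T : Matrix ι ι ℝ) (p : ι → ℝ) : ℕ∞ :=
  ⨅ (k : ℕ) (_ : ∀ ν, (1 / 2) * ∑ μ, |(T ^ k) μ ν - p μ| ≤ 1 / 4), (k : ℕ∞)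

/-- Spectral gap of a stochastic matrix: `1` minus the second largest modulus of an eigenvalue,
with multiplicity (one copy of the eigenvalue `1` is removed). -/
def spectralGap {ι : Type*} [Fintype ι] [DecidableEq ι] (T : Matrix ι ι ℝ) : ℝ :=
  1 - ((T.charpoly.roots.erase 1).map fun z => |z|).fold max 0

end ErgodicGibbs

end

/-! In the energy eigenbasis the law of the couplings is invariant under `R μν ↦ s μ * s ν * R μν`
for signs `s`, and this substitution conjugates the total Hamiltonian by a diagonal sign matrix.
Hence the averaged cycle maps diagonal states to diagonal states (`kern_sign`, `meanKern_offDiag`).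
The random initial basis state averages to the maximally mixed state, so the expected output is a
classical population vector in the eigenbasis (`expectedOutput_eq`), and its trace distance from the
Gibbs state is an `ℓ¹` distance (`traceNorm_eq_of_diagonal`). It remains to show that a cycle acts
on populations almost as the lazy step `(1 - α) + α T` with `α = λ² n_a / (C Ω γ)`.

This is done in the Heisenberg picture, testing with diagonal observables. Averaging over the
exponential time turns the evolved observable into `γ` times the resolvent `res` of the derivation
`i [h, ·]`, so perturbation theory is the iteration of `res_add_eq`. For one ancilla the first and
third orders have no diagonal entries, and the second order gives Lorentzians of width `γ`
(`res_add_apply_self`). Their average over frequency and thermal occupation is the golden-rule rate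
in `T`, up to the variation of the occupation across the Lorentzian (`abs_thermal_lorentz_sub_le`).

The total coupling to all ancillas is in general too large to be expanded at once. Instead the
expectation is regarded as a function of the set of coupled ancillas. A set function with small
mixed second differences is nearly additive (`norm_sub_sum_singleton_le`), and then the one-ancilla
calculation suffices. Mixed differences and fourth-order remainders must be shown smaller than their
operator-norm bounds, because an ancilla of random frequency is rarely resonant.

For this, operators are decomposed by the parity with which they flip two chosen ancillas. On a
block of given parity the evolution carries a phase linear in the two frequencies, so after a
Fourier transform in the frequencies the resolvent becomes a damped average of translates
(`opSymbol_res_le_of_phase`), while a coupling switches the parity. The norms of the transforms obey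
scalar inequalities. Translations commute, so averages in the directions of the odd blocks can be
moved onto the transform of the thermal frequency law, which decays like `1 / (Ω |a|)`. Each
independent direction then costs only `gainConst`, of order `log / Ω`, in place of `1 / γ`
(`fourierBound_thermalLaw`), and every contribution to a mixed difference uses two of them
(`PairSystem.bound`). Large couplings, to which the expansion does not apply, are rare by the
exponential moment.

A chain with mixing time `m` halves zero-sum vectors every `m` steps, so `d α` of order `m L`
relaxes the initial error below `ε` (`lone_perturbed_chain_le`). Up to logarithms, the three main
errors of a cycle are `α` times `α` for pairs of ancillas, `β γ` for the rates and `λ² / γ²` for the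
remainder. The parameters make each of these factors of order `ε / m`. The bound on the mixing time
by the gap comes from symmetrizing the reversible chain with the square roots of the Gibbs weights
(`sum_abs_pow_sub_le_of_reversible`). -/

noncomputable section

namespace ErgodicGibbs

set_option linter.unusedSectionVars false

/-! ### Heisenberg evolution and its resolvent in a C*-algebra -/

section Heisenberg

variable {𝒜 : Type*} [CStarAlgebra 𝒜]

/-- The derivation `F ↦ i [w, F]`. -/
def ad (w F : 𝒜) : 𝒜 := Complex.I • (w * F - F * w)

/-- Heisenberg evolution `F ↦ exp (i s h) F exp (-i s h)`. -/
def evol (h : 𝒜) (s : ℝ) (F : 𝒜) : 𝒜 :=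
  NormedSpace.exp ((Complex.I * (s : ℂ)) • h) * F * NormedSpace.exp ((-(Complex.I * (s : ℂ))) • h)

/-- Laplace transform of the Heisenberg evolution. -/
def res (γ : ℝ) (h F : 𝒜) : 𝒜 := ∫ s in Set.Ioi (0 : ℝ), Real.exp (-γ * s) • evol h s F

lemma ad_add (w F G : 𝒜) : ad w (F + G) = ad w F + ad w G := by
  simp only [ad, mul_add, add_mul, ← smul_add]; congr 1; abel

lemma ad_sub (w F G : 𝒜) : ad w (F - G) = ad w F - ad w G := by
  simp only [ad, mul_sub, sub_mul, ← smul_sub]; congr 1; abel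

lemma ad_add_left (v w F : 𝒜) : ad (v + w) F = ad v F + ad w F := by
  simp only [ad, mul_add, add_mul, ← smul_add]; congr 1; abel

lemma norm_ad_le (w F : 𝒜) : ‖ad w F‖ ≤ 2 * ‖w‖ * ‖F‖ := by
  rw [ad, norm_smul, Complex.norm_I, one_mul]
  calc _ ≤ ‖w * F‖ + ‖F * w‖ := norm_sub_le _ _
    _ ≤ ‖w‖ * ‖F‖ + ‖F‖ * ‖w‖ := add_le_add (norm_mul_le _ _) (norm_mul_le _ _)
    _ = _ := by ring

lemma continuous_exp_cstar : Continuous (NormedSpace.exp : 𝒜 → 𝒜) :=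
  let _ : NormedAlgebra ℚ 𝒜 := NormedAlgebra.restrictScalars ℚ ℂ 𝒜
  NormedSpace.exp_continuous

lemma continuous_evol : Continuous fun p : ℝ × 𝒜 × 𝒜 => evol p.2.1 p.1 p.2.2 := by
  unfold evol
  have h1 : Continuous fun p : ℝ × 𝒜 × 𝒜 => (Complex.I * (p.1 : ℂ)) • p.2.1 := by fun_prop
  have h2 : Continuous fun p : ℝ × 𝒜 × 𝒜 => (-(Complex.I * (p.1 : ℂ))) • p.2.1 := by fun_prop
  exact ((continuous_exp_cstar.comp h1).mul (by fun_prop)).mul (continuous_exp_cstar.comp h2)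

lemma exp_smul_mem_unitary {h : 𝒜} (hh : IsSelfAdjoint h) (s : ℝ) :
    NormedSpace.exp ((Complex.I * (s : ℂ)) • h) ∈ unitary 𝒜 := by
  let _ : NormedAlgebra ℚ 𝒜 := NormedAlgebra.restrictScalars ℚ ℂ 𝒜
  apply NormedSpace.exp_mem_unitary_of_mem_skewAdjoint
  rw [skewAdjoint.mem_iff, star_smul, hh.star_eq, ← neg_smul]
  simp

lemma norm_evol {h : 𝒜} (hh : IsSelfAdjoint h) (s : ℝ) (F : 𝒜) : ‖evol h s F‖ = ‖F‖ := by
  unfold evol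
  have h2 : NormedSpace.exp ((-(Complex.I * (s : ℂ))) • h) ∈ unitary 𝒜 := by
    simpa using exp_smul_mem_unitary hh (-s)
  rw [CStarRing.norm_mul_mem_unitary _ h2, CStarRing.norm_mem_unitary_mul _
    (exp_smul_mem_unitary hh s)]

lemma evol_add (h : 𝒜) (s : ℝ) (F G : 𝒜) : evol h s (F + G) = evol h s F + evol h s G := by
  simp [evol, mul_add, add_mul]

lemma evol_smul (h : 𝒜) (s : ℝ) (c : ℂ) (F : 𝒜) : evol h s (c • F) = c • evol h s F := by
  simp [evol]

lemma evol_sub (h : 𝒜) (s : ℝ) (F G : 𝒜) : evol h s (F - G) = evol h s F - evol h s G := by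
  simp [evol, mul_sub, sub_mul]

lemma commute_exp_smul {z h : 𝒜} (hz : Commute z h) (c : ℂ) :
    Commute z (NormedSpace.exp (c • h)) := by
  let _ : NormedAlgebra ℚ 𝒜 := NormedAlgebra.restrictScalars ℚ ℂ 𝒜
  exact (hz.smul_right c).exp_right

lemma evol_mul_left {z h : 𝒜} (hz : Commute z h) (s : ℝ) (F : 𝒜) :
    evol h s (z * F) = z * evol h s F := by
  have := commute_exp_smul hz (Complex.I * (s : ℂ))
  simp only [evol, ← mul_assoc, this.eq]

lemma evol_mul_right {z h : 𝒜} (hz : Commute z h) (s : ℝ) (F : 𝒜) :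
    evol h s (F * z) = evol h s F * z := by
  have := commute_exp_smul hz (-(Complex.I * (s : ℂ)))
  simp only [evol, mul_assoc, this.eq]

lemma exp_smul_add (h : 𝒜) (a b : ℂ) :
    NormedSpace.exp ((a + b) • h) = NormedSpace.exp (a • h) * NormedSpace.exp (b • h) := by
  let _ : NormedAlgebra ℚ 𝒜 := NormedAlgebra.restrictScalars ℚ ℂ 𝒜
  rw [add_smul, NormedSpace.exp_add_of_commute]
  exact ((Commute.refl h).smul_left _).smul_right _

lemma exp_mul_exp_neg (h : 𝒜) (a : ℂ) :
    NormedSpace.exp (a • h) * NormedSpace.exp ((-a) • h) = 1 := by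
  rw [← exp_smul_add, add_neg_cancel, zero_smul, NormedSpace.exp_zero]

lemma evol_of_commute {h F : 𝒜} (hF : Commute F h) (s : ℝ) : evol h s F = F := by
  have := commute_exp_smul hF (Complex.I * (s : ℂ))
  rw [evol, ← this.eq, mul_assoc, exp_mul_exp_neg, mul_one]

lemma hasDerivAt_evol (h F : 𝒜) (s : ℝ) :
    HasDerivAt (fun s => evol h s F) (evol h s (ad h F)) s := by
  have key : ∀ c : ℂ, HasDerivAt (fun s : ℝ => NormedSpace.exp ((c * (s : ℂ)) • h))
      (NormedSpace.exp ((c * (s : ℂ)) • h) * (c • h)) s := by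
    intro c
    have h1 := hasDerivAt_exp_smul_const (𝕂 := ℝ) (c • h) s
    have e : ∀ s : ℝ, (s • (c • h) : 𝒜) = (c * (s : ℂ)) • h := fun s => by
      rw [← Complex.coe_smul, smul_smul, mul_comm]
    simpa only [e] using h1
  have h1 := key Complex.I
  have h2 := key (-Complex.I)
  simp only [neg_mul] at h2
  have := (h1.mul_const F).mul h2
  unfold evol
  convert! this using 1
  have c2 := commute_exp_smul (Commute.refl h) (-(Complex.I * (s : ℂ)))
  have c3 := c2.eq
  generalize NormedSpace.exp ((-(Complex.I * (s : ℂ))) • h) = E at c3 ⊢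
  generalize NormedSpace.exp ((Complex.I * (s : ℂ)) • h) = E'
  simp only [ad, mul_smul_comm, smul_mul_assoc, neg_smul, mul_neg, mul_assoc, ← c3,
    sub_eq_add_neg, mul_add, add_mul, smul_add, neg_mul, smul_neg]

lemma integrable_exp_evol {γ : ℝ} (hγ : 0 < γ) {h : 𝒜} (hh : IsSelfAdjoint h) (F : 𝒜) :
    IntegrableOn (fun s => Real.exp (-γ * s) • evol h s F) (Set.Ioi 0) := by
  have hi : IntegrableOn (fun s : ℝ => Real.exp (-γ * s) * ‖F‖) (Set.Ioi 0) :=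
    (integrableOn_exp_mul_Ioi (by linarith) 0).mul_const _
  refine Integrable.mono' hi ?_ (.of_forall fun s => ?_)
  · apply Continuous.aestronglyMeasurable
    have : Continuous fun s : ℝ => evol h s F :=
      continuous_evol.comp (g := fun p : ℝ × 𝒜 × 𝒜 => evol p.2.1 p.1 p.2.2)
        (f := fun s => (s, h, F)) (by fun_prop)
    fun_prop
  · rw [norm_smul, norm_evol hh, Real.norm_eq_abs, abs_of_pos (Real.exp_pos _)]

lemma integral_exp_neg_Ioi {γ : ℝ} (hγ : 0 < γ) :
    ∫ s in Set.Ioi (0 : ℝ), Real.exp (-γ * s) = γ⁻¹ := by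
  rw [integral_exp_mul_Ioi (by linarith)]; simp [neg_div_neg_eq]

lemma norm_res_le {γ : ℝ} (hγ : 0 < γ) {h : 𝒜} (hh : IsSelfAdjoint h) (F : 𝒜) :
    ‖res γ h F‖ ≤ γ⁻¹ * ‖F‖ := by
  refine (norm_integral_le_integral_norm _).trans ?_
  simp_rw [norm_smul, norm_evol hh, Real.norm_eq_abs, Real.abs_exp]
  rw [integral_mul_const, integral_exp_neg_Ioi hγ]

lemma res_add {γ : ℝ} (hγ : 0 < γ) {h : 𝒜} (hh : IsSelfAdjoint h) (F G : 𝒜) :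
    res γ h (F + G) = res γ h F + res γ h G := by
  unfold res
  rw [← integral_add (integrable_exp_evol hγ hh F) (integrable_exp_evol hγ hh G)]
  simp_rw [evol_add, smul_add]

lemma res_smul (γ : ℝ) (h : 𝒜) (c : ℂ) (F : 𝒜) : res γ h (c • F) = c • res γ h F := by
  unfold res
  rw [← integral_smul]
  simp_rw [evol_smul, smul_comm c]

lemma res_sub {γ : ℝ} (hγ : 0 < γ) {h : 𝒜} (hh : IsSelfAdjoint h) (F G : 𝒜) :
    res γ h (F - G) = res γ h F - res γ h G := by
  unfold res
  rw [← integral_sub (integrable_exp_evol hγ hh F) (integrable_exp_evol hγ hh G)]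
  simp_rw [evol_sub, smul_sub]

lemma res_of_commute {γ : ℝ} (hγ : 0 < γ) {h F : 𝒜} (hF : Commute F h) :
    res γ h F = γ⁻¹ • F := by
  unfold res
  simp_rw [evol_of_commute hF]
  rw [integral_smul_const, integral_exp_neg_Ioi hγ]

lemma res_mul_left {γ : ℝ} (hγ : 0 < γ) {z h : 𝒜} (hh : IsSelfAdjoint h) (hz : Commute z h)
    (F : 𝒜) : res γ h (z * F) = z * res γ h F := by
  unfold res
  simp_rw [evol_mul_left hz]
  have := (ContinuousLinearMap.mul ℝ 𝒜 z).integral_comp_comm (integrable_exp_evol hγ hh F)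
  simpa using this

lemma res_mul_right {γ : ℝ} (hγ : 0 < γ) {z h : 𝒜} (hh : IsSelfAdjoint h) (hz : Commute z h)
    (F : 𝒜) : res γ h (F * z) = res γ h F * z := by
  unfold res
  simp_rw [evol_mul_right hz]
  have := ((ContinuousLinearMap.mul ℝ 𝒜).flip z).integral_comp_comm (integrable_exp_evol hγ hh F)
  simpa using this

lemma ad_res {γ : ℝ} (hγ : 0 < γ) {h : 𝒜} (hh : IsSelfAdjoint h) (F : 𝒜) :
    ad h (res γ h F) = res γ h (ad h F) := by
  unfold ad
  rw [res_smul, res_sub hγ hh, res_mul_left hγ hh (Commute.refl h),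
    res_mul_right hγ hh (Commute.refl h)]

/-- The integrand is the derivative of `-exp (-γ s) • evol h s F`, so only the boundary term at `s =
0` survives. Thus `res γ h` inverts `γ - ad h`, which turns integrals into algebra. -/
lemma res_sub_ad {γ : ℝ} (hγ : 0 < γ) {h : 𝒜} (hh : IsSelfAdjoint h) (F : 𝒜) :
    res γ h ((γ : ℂ) • F - ad h F) = F := by
  have hd : ∀ s ∈ Set.Ici (0 : ℝ), HasDerivAt (fun s => -(Real.exp (-γ * s) • evol h s F))
      (Real.exp (-γ * s) • evol h s ((γ : ℂ) • F - ad h F)) s := by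
    intro s _
    have h1 : HasDerivAt (fun s : ℝ => Real.exp (-γ * s)) (Real.exp (-γ * s) * (-γ)) s := by
      simpa using ((hasDerivAt_id s).const_mul (-γ)).exp
    convert! (h1.smul (hasDerivAt_evol h F s)).neg using 1
    rw [evol_sub, evol_smul, Complex.coe_smul, smul_sub, smul_smul, mul_neg, neg_smul]
    abel
  have hlim : Filter.Tendsto (fun s => -(Real.exp (-γ * s) • evol h s F)) Filter.atTop
      (nhds 0) := by
    rw [tendsto_zero_iff_norm_tendsto_zero]
    simp_rw [norm_neg, norm_smul, norm_evol hh, Real.norm_eq_abs, Real.abs_exp]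
    have : Filter.Tendsto (fun s : ℝ => Real.exp (-γ * s)) Filter.atTop (nhds 0) := by
      apply Real.tendsto_exp_atBot.comp
      exact Filter.tendsto_id.const_mul_atTop_of_neg (by linarith)
    simpa using this.mul_const ‖F‖
  have := integral_Ioi_of_hasDerivAt_of_tendsto' hd (integrable_exp_evol hγ hh _) hlim
  rw [res, this]
  simp [evol]

/-- Second resolvent identity, from applying `res γ h` to the equation that `res γ (h + w) F`
solves. All expansions iterate it with the exact resolvent kept in the last factor, so no
convergence question arises. -/
lemma res_add_eq {γ : ℝ} (hγ : 0 < γ) {h w : 𝒜} (hh : IsSelfAdjoint h) (hw : IsSelfAdjoint w)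
    (F : 𝒜) : res γ (h + w) F = res γ h F + res γ h (ad w (res γ (h + w) F)) := by
  have hhw := hh.add hw
  have h1 := res_sub_ad hγ hhw F
  rw [res_sub hγ hhw, res_smul, ← ad_res hγ hhw] at h1
  have h2 := res_sub_ad hγ hh (res γ (h + w) F)
  rw [← res_add hγ hh]
  have h3 : (γ : ℂ) • res γ (h + w) F - ad h (res γ (h + w) F) =
      F + ad w (res γ (h + w) F) := by
    rw [ad_add_left] at h1
    nth_rewrite 3 [← h1]
    abel
  rw [← h3, h2]

lemma norm_res_sub_res_le {γ : ℝ} (hγ : 0 < γ) {h h' : 𝒜} (hh : IsSelfAdjoint h)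
    (hh' : IsSelfAdjoint h') (F : 𝒜) :
    ‖res γ h' F - res γ h F‖ ≤ 2 * γ⁻¹ ^ 2 * ‖h' - h‖ * ‖F‖ := by
  have := res_add_eq hγ hh (hh'.sub hh) F
  rw [add_sub_cancel] at this
  rw [this, add_sub_cancel_left]
  calc _ ≤ γ⁻¹ * (2 * ‖h' - h‖ * (γ⁻¹ * ‖F‖)) := by
        refine (norm_res_le hγ hh _).trans ?_
        have : 0 < γ⁻¹ := inv_pos.2 hγ
        gcongr
        refine (norm_ad_le _ _).trans ?_
        gcongr
        exact norm_res_le hγ hh' F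
    _ = _ := by ring

/-- The difference splits into a change of `F`, controlled by `γ⁻¹`, and a change of `h`, for which
the second resolvent identity gives a Lipschitz bound. This makes frequency averages of resolvents
measurable. -/
lemma continuous_res {γ : ℝ} (hγ : 0 < γ) {X : Type*} [TopologicalSpace X] {h F : X → 𝒜}
    (hc : Continuous h) (hs : ∀ x, IsSelfAdjoint (h x)) (hF : Continuous F) :
    Continuous fun x => res γ (h x) (F x) := by
  rw [continuous_iff_continuousAt]
  intro x
  rw [ContinuousAt, tendsto_iff_norm_sub_tendsto_zero]
  have hb : ∀ y, ‖res γ (h y) (F y) - res γ (h x) (F x)‖ ≤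
      γ⁻¹ * ‖F y - F x‖ + 2 * γ⁻¹ ^ 2 * ‖h y - h x‖ * ‖F x‖ := by
    intro y
    have : res γ (h y) (F y) - res γ (h x) (F x) =
        res γ (h y) (F y - F x) + (res γ (h y) (F x) - res γ (h x) (F x)) := by
      rw [res_sub hγ (hs y)]; abel
    rw [this]
    exact (norm_add_le _ _).trans (add_le_add (norm_res_le hγ (hs y) _)
      (norm_res_sub_res_le hγ (hs x) (hs y) _))
  refine squeeze_zero (fun _ => norm_nonneg _) hb ?_
  have : Continuous fun y => γ⁻¹ * ‖F y - F x‖ + 2 * γ⁻¹ ^ 2 * ‖h y - h x‖ * ‖F x‖ := by fun_prop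
  simpa using this.tendsto x

end Heisenberg

/-! ### Averages of translates, and the majorant systems they satisfy -/

section Majorant

variable {X : Type*} [AddCommGroup X] [MeasurableSpace X] [MeasurableAdd₂ X]

/-- Average of the translates of `ψ` with respect to `k`. -/
def transAvg (k : Measure X) (ψ : X → ℝ≥0∞) (x : X) : ℝ≥0∞ := ∫⁻ y, ψ (x + y) ∂k

lemma transAvg_mono {k : Measure X} {ψ φ : X → ℝ≥0∞} (h : ∀ x, ψ x ≤ φ x) (x : X) :
    transAvg k ψ x ≤ transAvg k φ x := lintegral_mono fun _ => h _

lemma measurable_transAvg {k : Measure X} [SFinite k] {ψ : X → ℝ≥0∞} (h : Measurable ψ) :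
    Measurable (transAvg k ψ) := by
  unfold transAvg
  exact (h.comp measurable_add).lintegral_prod_right'

lemma transAvg_add {k : Measure X} {ψ φ : X → ℝ≥0∞} (h : Measurable ψ) (x : X) :
    transAvg k (fun x => ψ x + φ x) x = transAvg k ψ x + transAvg k φ x :=
  lintegral_add_left (h.comp (measurable_const_add x)) _

lemma transAvg_const_mul {k : Measure X} {ψ : X → ℝ≥0∞} (c : ℝ≥0∞) (h : Measurable ψ) (x : X) :
    transAvg k (fun x => c * ψ x) x = c * transAvg k ψ x :=
  lintegral_const_mul _ (h.comp (measurable_const_add x))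

lemma transAvg_const_mul_add {k : Measure X} {φ ψ : X → ℝ≥0∞} (c : ℝ≥0∞) (hφ : Measurable φ)
    (hψ : Measurable ψ) (x : X) :
    transAvg k (fun x => c * (φ x + ψ x)) x = c * (transAvg k φ x + transAvg k ψ x) := by
  rw [transAvg_const_mul c (hφ.add hψ) (ψ := fun x => φ x + ψ x), transAvg_add hφ]

lemma transAvg_le {k : Measure X} {ψ : X → ℝ≥0∞} {t c : ℝ≥0∞} (hk : k Set.univ ≤ t)
    (h : ∀ x, ψ x ≤ c) (x : X) : transAvg k ψ x ≤ t * c := by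
  calc transAvg k ψ x ≤ ∫⁻ _, c ∂k := lintegral_mono fun _ => h _
    _ = c * k Set.univ := by simp
    _ ≤ t * c := by rw [mul_comm]; gcongr

/-- Tonelli and commutativity of the group. It lets any kernel be moved next to the source term,
where its average is small. -/
lemma transAvg_comm {k l : Measure X} [SFinite k] [SFinite l] {ψ : X → ℝ≥0∞} (h : Measurable ψ)
    (x : X) : transAvg k (transAvg l ψ) x = transAvg l (transAvg k ψ) x := by
  unfold transAvg
  rw [lintegral_lintegral_swap]
  · simp_rw [add_right_comm]
  · exact (h.comp ((measurable_const_add x |>.comp measurable_fst).add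
      measurable_snd)).aemeasurable

/-- Supremum of the twofold averages over the pairs of measures taken from `k`, `l`, `m`. -/
def pairSup (k l m : Measure X) (ψ : X → ℝ≥0∞) : ℝ≥0∞ :=
  ⨆ x, (transAvg l (transAvg k ψ) x + transAvg l (transAvg m ψ) x + transAvg k (transAvg m ψ) x)

/-- Absorption of a feedback term into the left side. It fails at `⊤`, so each use needs a crude
finite bound beforehand. -/
lemma le_two_mul_of_le_add_half {x A c : ℝ≥0∞} (hx : x ≠ ⊤) (hc : c ≤ 1 / 2)
    (h : x ≤ A + c * x) : x ≤ 2 * A := by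
  by_cases hA : A = ⊤
  · simp [hA]
  have h1 : x ≤ A + 1 / 2 * x := h.trans (by gcongr)
  lift x to ℝ≥0 using hx
  lift A to ℝ≥0 using hA
  rw [show (1 / 2 : ℝ≥0∞) = ((1 / 2 : ℝ≥0) : ℝ≥0∞) by
    rw [ENNReal.coe_div (by norm_num)]; norm_num] at h1
  norm_cast at h1 ⊢
  have h2 : (x : ℝ) ≤ A + 1 / 2 * x := by exact_mod_cast h1
  have : (x : ℝ) ≤ 2 * A := by linarith
  exact_mod_cast this

section pairSup

variable {k l m : Measure X} [SFinite k] [SFinite l] [SFinite m]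

lemma pairSup_mono {ψ φ : X → ℝ≥0∞} (h : ∀ x, ψ x ≤ φ x) :
    pairSup k l m ψ ≤ pairSup k l m φ := by
  refine iSup_mono fun x => ?_
  have := fun k : Measure X => transAvg_mono (k := k) h
  gcongr <;> exact transAvg_mono (this _) x

lemma pairSup_add {ψ φ : X → ℝ≥0∞} (hψ : Measurable ψ) :
    pairSup k l m (fun x => ψ x + φ x) ≤ pairSup k l m ψ + pairSup k l m φ := by
  refine iSup_le fun x => ?_
  have e : ∀ (k : Measure X) [SFinite k], transAvg k (fun x => ψ x + φ x) =
      fun x => transAvg k ψ x + transAvg k φ x := fun k _ => funext (transAvg_add hψ)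
  have h1 := le_iSup (fun x => (transAvg l (transAvg k ψ) x + transAvg l (transAvg m ψ) x +
    transAvg k (transAvg m ψ) x)) x
  have h2 := le_iSup (fun x => (transAvg l (transAvg k φ) x + transAvg l (transAvg m φ) x +
    transAvg k (transAvg m φ) x)) x
  rw [e k, e m, transAvg_add (measurable_transAvg hψ), transAvg_add (measurable_transAvg hψ),
    transAvg_add (measurable_transAvg hψ)]
  refine le_trans (le_of_eq ?_) (add_le_add h1 h2)
  ring

lemma pairSup_const_mul {ψ : X → ℝ≥0∞} (hψ : Measurable ψ) (c : ℝ≥0∞) :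
    pairSup k l m (fun x => c * ψ x) ≤ c * pairSup k l m ψ := by
  refine iSup_le fun x => ?_
  have e : ∀ (k : Measure X) [SFinite k], transAvg k (fun x => c * ψ x) =
      fun x => c * transAvg k ψ x := fun k _ => funext (transAvg_const_mul c hψ)
  have h1 := le_iSup (fun x => (transAvg l (transAvg k ψ) x + transAvg l (transAvg m ψ) x +
    transAvg k (transAvg m ψ) x)) x
  rw [e k, e m, transAvg_const_mul c (measurable_transAvg hψ),
    transAvg_const_mul c (measurable_transAvg hψ), transAvg_const_mul c (measurable_transAvg hψ),
    ← mul_add, ← mul_add]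
  exact mul_le_mul_right h1 c

/-- A further average commutes past the pair and costs only its total mass, so the smallness
provided by the pair is kept. -/
lemma pairSup_transAvg {ψ : X → ℝ≥0∞} (hψ : Measurable ψ) {j : Measure X} [SFinite j]
    {t : ℝ≥0∞} (hj : j Set.univ ≤ t) :
    pairSup k l m (transAvg j ψ) ≤ t * pairSup k l m ψ := by
  refine iSup_le fun x => ?_
  have e : ∀ (k l : Measure X) [SFinite k] [SFinite l] (x : X),
      transAvg l (transAvg k (transAvg j ψ)) x = transAvg j (transAvg l (transAvg k ψ)) x := by
    intro k l _ _ x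
    rw [show transAvg k (transAvg j ψ) = transAvg j (transAvg k ψ) from
      funext (transAvg_comm hψ)]
    exact transAvg_comm (measurable_transAvg hψ) x
  rw [e k l, e m l, e m k, ← transAvg_add (measurable_transAvg (measurable_transAvg hψ)),
    ← transAvg_add (ψ := fun x => transAvg l (transAvg k ψ) x + transAvg l (transAvg m ψ) x)
      ((measurable_transAvg (measurable_transAvg hψ)).add
      (measurable_transAvg (measurable_transAvg hψ)))]
  exact transAvg_le hj (fun x => le_iSup (fun x => (transAvg l (transAvg k ψ) x +
    transAvg l (transAvg m ψ) x + transAvg k (transAvg m ψ) x)) x) x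

lemma pairSup_le_of_bound {ψ : X → ℝ≥0∞} {t N : ℝ≥0∞} (hk : k Set.univ ≤ t)
    (hl : l Set.univ ≤ t) (hm : m Set.univ ≤ t) (h : ∀ x, ψ x ≤ N) :
    pairSup k l m ψ ≤ 3 * (t * (t * N)) := by
  refine iSup_le fun x => ?_
  have h1 := transAvg_le hl (transAvg_le hk h) x
  have h2 := transAvg_le hl (transAvg_le hm h) x
  have h3 := transAvg_le hk (transAvg_le hm h) x
  calc _ ≤ t * (t * N) + t * (t * N) + t * (t * N) := by gcongr
    _ = _ := by ring

end pairSup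

/-- The system of inequalities satisfied by the parity components in the two-ancilla problem. -/
structure PairSystem (k : Bool × Bool → Measure X) (e : ℝ≥0∞) (a : X → ℝ≥0∞)
    (f : Bool × Bool → X → ℝ≥0∞) (d00 d01 d10 d00' m : X → ℝ≥0∞) : Prop where
  f00 : ∀ x, f (false, false) x ≤ transAvg (k (false, false))
    (fun x => a x + e * (f (true, false) x + f (false, true) x)) x
  f10 : ∀ x, f (true, false) x ≤ transAvg (k (true, false))
    (fun x => e * (f (false, false) x + f (true, true) x)) x
  f01 : ∀ x, f (false, true) x ≤ transAvg (k (false, true))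
    (fun x => e * (f (true, true) x + f (false, false) x)) x
  f11 : ∀ x, f (true, true) x ≤ transAvg (k (true, true))
    (fun x => e * (f (false, true) x + f (true, false) x)) x
  hd00 : ∀ x, d00 x ≤ transAvg (k (false, false)) (fun x => e * (f (true, false) x + d01 x)) x
  hd01 : ∀ x, d01 x ≤ transAvg (k (false, true)) (fun x => e * (f (true, true) x + d00 x)) x
  hd00' : ∀ x, d00' x ≤ transAvg (k (false, false)) (fun x => e * (d10 x + f (false, true) x)) x
  hd10 : ∀ x, d10 x ≤ transAvg (k (true, false)) (fun x => e * (d00' x + f (true, true) x)) x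
  hm : ∀ x, m x ≤ transAvg (k (false, false)) (fun x => e * (d10 x + d01 x)) x

section system

variable {k : Bool × Bool → Measure X} [∀ p, SFinite (k p)] {t e N : ℝ≥0∞} {a : X → ℝ≥0∞}
  {f : Bool × Bool → X → ℝ≥0∞}

lemma pairSup_comp_le {k l m j : Measure X} [SFinite k] [SFinite l] [SFinite m] [SFinite j]
    (hj : j Set.univ ≤ t) {F φ ψ : X → ℝ≥0∞} (hφ : Measurable φ) (hψ : Measurable ψ)
    (h : ∀ x, F x ≤ transAvg j (fun x => e * (φ x + ψ x)) x) :
    pairSup k l m F ≤ t * e * (pairSup k l m φ + pairSup k l m ψ) := by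
  calc pairSup k l m F ≤ pairSup k l m (transAvg j (fun x => e * (φ x + ψ x))) := pairSup_mono h
    _ ≤ t * pairSup k l m (fun x => e * (φ x + ψ x)) :=
        pairSup_transAvg (by fun_prop) hj
    _ ≤ t * (e * pairSup k l m (fun x => φ x + ψ x)) := by
        gcongr; exact pairSup_const_mul (by fun_prop) e
    _ ≤ t * (e * (pairSup k l m φ + pairSup k l m ψ)) := by gcongr; exact pairSup_add hφ
    _ = _ := by ring

/-- One of the two odd components of the mixed difference. -/
lemma odd_component_le {k00 k10 k01 k11 : Measure X} [SFinite k00] [SFinite k10] [SFinite k01]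
    [SFinite k11] (h00 : k00 Set.univ ≤ t) (h01 : k01 Set.univ ≤ t)
    (hte : t * e ≤ 1 / 4) (hN : N ≠ ⊤) {f10 f00 f11 f01 d00 d01 : X → ℝ≥0∞}
    (mf10 : Measurable f10) (mf11 : Measurable f11) (mf00 : Measurable f00)
    (mf01 : Measurable f01) (md00 : Measurable d00) (md01 : Measurable d01)
    (hd : ∀ x, d01 x ≤ N) {A₁ A₂ : ℝ≥0∞}
    (hs1 : ∀ x, transAvg k01 (transAvg k10 f00) x + transAvg k01 (transAvg k10 f11) x ≤ A₁)
    (hs2 : ∀ x, transAvg k01 (transAvg k11 f01) x + transAvg k01 (transAvg k11 f10) x ≤ A₂)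
    (hf10 : ∀ x, f10 x ≤ transAvg k10 (fun x => e * (f00 x + f11 x)) x)
    (hf11 : ∀ x, f11 x ≤ transAvg k11 (fun x => e * (f01 x + f10 x)) x)
    (hd00 : ∀ x, d00 x ≤ transAvg k00 (fun x => e * (f10 x + d01 x)) x)
    (hd01 : ∀ x, d01 x ≤ transAvg k01 (fun x => e * (f11 x + d00 x)) x) (x : X) :
    d01 x ≤ 2 * (e * (e * A₂ + t * e * (e * A₁))) := by
  -- Every path into `d01` through `f` passes `k01` together with `k10` or `k11`, two independent
  -- directions. The only other path is the loop `d01 → d00 → d01`, which costs `(t e)²` and is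
  -- absorbed.
  set D := ⨆ x, d01 x with hD
  have hDx : ∀ x, d01 x ≤ D := le_iSup d01
  have hDt : D ≠ ⊤ := ne_top_of_le_ne_top hN (iSup_le hd)
  have b11 : ∀ x, transAvg k01 f11 x ≤ e * A₂ := by
    intro x
    refine (transAvg_mono hf11 x).trans ?_
    have : transAvg k11 (fun x => e * (f01 x + f10 x)) =
        fun x => e * (transAvg k11 f01 x + transAvg k11 f10 x) := by
      funext y
      rw [transAvg_const_mul_add e mf01 mf10]
    rw [this, transAvg_const_mul_add e (measurable_transAvg mf01) (measurable_transAvg mf10)]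
    gcongr; exact hs2 x
  have b10 : ∀ x, transAvg k01 f10 x ≤ e * A₁ := by
    intro x
    refine (transAvg_mono hf10 x).trans ?_
    have : transAvg k10 (fun x => e * (f00 x + f11 x)) =
        fun x => e * (transAvg k10 f00 x + transAvg k10 f11 x) := by
      funext y
      rw [transAvg_const_mul_add e mf00 mf11]
    rw [this, transAvg_const_mul_add e (measurable_transAvg mf00) (measurable_transAvg mf11)]
    gcongr; exact hs1 x
  have b00 : ∀ x, transAvg k01 d00 x ≤ t * (e * (e * A₁ + t * D)) := by
    intro x
    refine (transAvg_mono hd00 x).trans ?_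
    rw [transAvg_comm (by fun_prop)]
    refine transAvg_le h00 (fun y => ?_) x
    rw [transAvg_const_mul_add e mf10 md01]
    gcongr
    · exact b10 y
    · exact transAvg_le h01 hDx y
  have key : ∀ x, d01 x ≤ e * (e * A₂ + t * e * (e * A₁)) + (t * e) * (t * e) * D := by
    intro x
    refine (hd01 x).trans ?_
    rw [transAvg_const_mul_add e mf11 md00]
    calc _ ≤ e * (e * A₂ + t * (e * (e * A₁ + t * D))) := by gcongr; exacts [b11 x, b00 x]
      _ = _ := by ring
  have hc : (t * e) * (t * e) ≤ 1 / 2 := by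
    calc (t * e) * (t * e) ≤ 1 / 4 * 1 := by
          gcongr; exact hte.trans (by simp)
      _ ≤ 1 / 2 := by
          rw [mul_one]
          exact ENNReal.div_le_div_left (by norm_num) _
  exact (hDx x).trans (le_two_mul_of_le_add_half hDt hc (iSup_le key))

/-- In the application `f` belongs to the resolvent with both couplings, `d00, d01` to its
difference from the one lacking the first coupling, `d00', d10` to the difference from the one
lacking the second, and `m` to the mixed difference. Write `S` for `pairSup`. Absorption bounds the
sum of all `S (f p)` by `2 t S a`, with a further factor `2 t e` for the two odd components. Each
odd difference `d01`, `d10` is then at most `12 t² e³ S a`, and one more coupling and resolvent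
bring `t e`. -/
lemma PairSystem.bound {d00 d01 d10 d00' m : X → ℝ≥0∞}
    (H : PairSystem k e a f d00 d01 d10 d00' m)
    (hk : ∀ p, k p Set.univ ≤ t) (ht : t ≠ ⊤) (hte : t * e ≤ 1 / 4) (hN : N ≠ ⊤)
    (ma : Measurable a) (mf : ∀ p, Measurable (f p)) (md00 : Measurable d00)
    (md01 : Measurable d01) (md10 : Measurable d10) (md00' : Measurable d00')
    (bf : ∀ p x, f p x ≤ N) (bd01 : ∀ x, d01 x ≤ N) (bd10 : ∀ x, d10 x ≤ N) (x : X) :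
    m x ≤ 24 * (t ^ 3 * e ^ 4) *
      pairSup (k (true, false)) (k (false, true)) (k (true, true)) a := by
  set S := pairSup (k (true, false)) (k (false, true)) (k (true, true)) with hS
  have c00 : S (f (false, false)) ≤ t * S a + t * e * (S (f (true, false)) + S (f (false, true))) := by
    calc S (f (false, false)) ≤ S (transAvg (k (false, false))
          (fun x => a x + e * (f (true, false) x + f (false, true) x))) := pairSup_mono H.f00
      _ ≤ t * S (fun x => a x + e * (f (true, false) x + f (false, true) x)) :=
          pairSup_transAvg (by have := mf (true, false); have := mf (false, true); fun_prop) (hk _)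
      _ ≤ t * (S a + e * (S (f (true, false)) + S (f (false, true)))) := by
          gcongr
          refine (pairSup_add ma).trans ?_
          gcongr
          refine (pairSup_const_mul ((mf _).add (mf _)) e).trans ?_
          gcongr
          exact pairSup_add (mf _)
      _ = _ := by ring
  have c10 : S (f (true, false)) ≤ _ := pairSup_comp_le (hk _) (mf _) (mf _) H.f10
  have c01 : S (f (false, true)) ≤ _ := pairSup_comp_le (hk _) (mf _) (mf _) H.f01
  have c11 : S (f (true, true)) ≤ _ := pairSup_comp_le (hk _) (mf _) (mf _) H.f11
  set T := S (f (false, false)) + S (f (true, true)) + (S (f (true, false)) + S (f (false, true)))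
    with hT
  have hfin : ∀ p, S (f p) ≠ ⊤ := fun p => ne_top_of_le_ne_top
    (by finiteness) (pairSup_le_of_bound (hk _) (hk _) (hk _) (bf p))
  have hTt : T ≠ ⊤ := by
    have h1 := hfin (false, false); have h2 := hfin (true, false)
    have h3 := hfin (false, true); have h4 := hfin (true, true)
    finiteness
  have odd : S (f (true, false)) + S (f (false, true)) ≤ 2 * (t * e) * T := by
    calc _ ≤ t * e * (S (f (false, false)) + S (f (true, true))) +
          t * e * (S (f (true, true)) + S (f (false, false))) := add_le_add c10 c01
      _ = 2 * (t * e) * (S (f (false, false)) + S (f (true, true))) := by ring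
      _ ≤ 2 * (t * e) * T := by gcongr; exact le_self_add
  have hTle : T ≤ 2 * (t * S a) := by
    apply le_two_mul_of_le_add_half hTt (c := 2 * (t * e))
    · calc 2 * (t * e) ≤ 2 * (1 / 4) := by gcongr
        _ = 1 / 2 := by
          rw [← mul_div_assoc, mul_one]
          rw [ENNReal.div_eq_div_iff] <;> norm_num
    · calc T ≤ (t * S a + t * e * (S (f (true, false)) + S (f (false, true)))) +
            t * e * (S (f (false, true)) + S (f (true, false))) +
            (t * e * (S (f (false, false)) + S (f (true, true))) +
            t * e * (S (f (true, true)) + S (f (false, false)))) := by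
              exact add_le_add (add_le_add c00 c11) (add_le_add c10 c01)
        _ = _ := by rw [hT]; ring
  have hodd : S (f (true, false)) + S (f (false, true)) ≤ 4 * (t ^ 2 * e * S a) := by
    refine odd.trans ?_
    calc _ ≤ 2 * (t * e) * (2 * (t * S a)) := by gcongr
      _ = _ := by ring
  have heven : S (f (false, false)) + S (f (true, true)) ≤ 2 * (t * S a) :=
    le_trans le_self_add hTle
  have p1 : ∀ ψ x, transAvg (k (false, true)) (transAvg (k (true, false)) ψ) x ≤ S ψ :=
    fun ψ x => le_trans (le_self_add.trans le_self_add) (le_iSup (fun x =>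
      (transAvg (k (false, true)) (transAvg (k (true, false)) ψ) x +
      transAvg (k (false, true)) (transAvg (k (true, true)) ψ) x +
      transAvg (k (true, false)) (transAvg (k (true, true)) ψ) x)) x)
  have p2 : ∀ ψ x, transAvg (k (false, true)) (transAvg (k (true, true)) ψ) x ≤ S ψ :=
    fun ψ x => le_trans (le_add_self.trans le_self_add) (le_iSup (fun x =>
      (transAvg (k (false, true)) (transAvg (k (true, false)) ψ) x +
      transAvg (k (false, true)) (transAvg (k (true, true)) ψ) x +
      transAvg (k (true, false)) (transAvg (k (true, true)) ψ) x)) x)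
  have p3 : ∀ ψ x, transAvg (k (true, false)) (transAvg (k (true, true)) ψ) x ≤ S ψ :=
    fun ψ x => le_trans le_add_self (le_iSup (fun x =>
      (transAvg (k (false, true)) (transAvg (k (true, false)) ψ) x +
      transAvg (k (false, true)) (transAvg (k (true, true)) ψ) x +
      transAvg (k (true, false)) (transAvg (k (true, true)) ψ) x)) x)
  have p1' : ∀ ψ x, Measurable ψ →
      transAvg (k (true, false)) (transAvg (k (false, true)) ψ) x ≤ S ψ :=
    fun ψ x hψ => by rw [transAvg_comm hψ]; exact p1 ψ x
  have hd01 := odd_component_le (hk (false, false)) (hk (false, true)) hte hN (mf (true, false))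
    (mf (true, true)) (mf (false, false)) (mf (false, true)) md00 md01 bd01
    (fun x => (add_le_add (p1 _ x) (p1 _ x)).trans heven)
    (fun x => (add_le_add (p2 _ x) (p2 _ x)).trans ((add_comm _ _).trans_le hodd))
    H.f10 H.f11 H.hd00 H.hd01
  -- The same lemma with the ancillas exchanged. The pair `k10, k01` now occurs in the opposite
  -- order, hence `p1'`.
  have hd10 := odd_component_le (hk (false, false)) (hk (true, false)) hte hN (mf (false, true))
    (mf (true, true)) (mf (false, false)) (mf (true, false)) md00' md10 bd10
    (fun x => (add_le_add (p1' _ x (mf _)) (p1' _ x (mf _))).trans heven)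
    (fun x => (add_le_add (p3 _ x) (p3 _ x)).trans hodd)
    (fun x => by simpa only [add_comm] using H.f01 x)
    (fun x => by simpa only [add_comm] using H.f11 x)
    (fun x => by simpa only [add_comm] using H.hd00' x)
    (fun x => by simpa only [add_comm] using H.hd10 x)
  refine (H.hm x).trans ?_
  refine (transAvg_le (hk _) (fun y => mul_le_mul_right (add_le_add (hd10 y) (hd01 y)) e) x).trans ?_
  apply le_of_eq
  ring

/-- The analogous bound for one ancilla. -/
lemma single_bound {k0 k1 : Measure X} [SFinite k0] [SFinite k1] {f0 f1 y1 y2 y3 r : X → ℝ≥0∞}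
    (hk0 : k0 Set.univ ≤ t) (hk1 : k1 Set.univ ≤ t) (ht : t ≠ ⊤) (hte : t * e ≤ 1 / 4)
    (hN : N ≠ ⊤) (ma : Measurable a) (mf0 : Measurable f0) (mf1 : Measurable f1)
    (bf : ∀ x, f0 x ≤ N)
    (hf0 : ∀ x, f0 x ≤ transAvg k0 (fun x => a x + e * f1 x) x)
    (hf1 : ∀ x, f1 x ≤ transAvg k1 (fun x => e * f0 x) x)
    (h1 : ∀ x, y1 x ≤ transAvg k1 (fun x => e * f0 x) x)
    (h2 : ∀ x, y2 x ≤ transAvg k0 (fun x => e * y1 x) x)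
    (h3 : ∀ x, y3 x ≤ transAvg k1 (fun x => e * y2 x) x)
    (hr : ∀ x, r x ≤ transAvg k0 (fun x => e * y3 x) x)
    {S : ℝ≥0∞} (hS : ∀ x, transAvg k1 a x ≤ S) (x : X) :
    r x ≤ 2 * (t ^ 4 * e ^ 4) * S := by
  set s := ⨆ x, transAvg k1 f0 x with hs
  have hsx : ∀ x, transAvg k1 f0 x ≤ s := le_iSup (transAvg k1 f0)
  have hst : s ≠ ⊤ := ne_top_of_le_ne_top (by finiteness : t * N ≠ ⊤)
    (iSup_le fun x => transAvg_le hk1 bf x)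
  -- Two couplings lead from `f0` back to itself, so the feedback is `(t e)²`, while the source
  -- enters as `k1` averaged over `a`, where the bound `S` applies.
  have hs2 : s ≤ 2 * (t * S) := by
    apply le_two_mul_of_le_add_half hst (c := (t * e) * (t * e))
    · calc (t * e) * (t * e) ≤ 1 / 4 * 1 := by
            gcongr; exact hte.trans (by simp)
        _ ≤ 1 / 2 := by
            rw [mul_one]
            exact ENNReal.div_le_div_left (by norm_num) _
    · refine iSup_le fun x => (transAvg_mono hf0 x).trans ?_
      rw [transAvg_comm (by fun_prop)]
      calc _ ≤ t * (S + e * (t * (e * s))) := by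
            refine transAvg_le hk0 (fun y => ?_) x
            rw [transAvg_add ma, transAvg_const_mul e mf1]
            gcongr
            · exact hS y
            · refine transAvg_le hk1 (fun z => (hf1 z).trans ?_) y
              rw [transAvg_const_mul e mf0]
              gcongr; exact hsx z
        _ = _ := by ring
  have b1 : ∀ x, y1 x ≤ e * s := fun x => (h1 x).trans (by
    rw [transAvg_const_mul e mf0]; gcongr; exact hsx x)
  have b2 : ∀ x, y2 x ≤ t * (e * (e * s)) := fun x => (h2 x).trans
    (transAvg_le hk0 (fun y => by gcongr; exact b1 y) x)
  have b3 : ∀ x, y3 x ≤ t * (e * (t * (e * (e * s)))) := fun x => (h3 x).trans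
    (transAvg_le hk1 (fun y => by gcongr; exact b2 y) x)
  calc r x ≤ t * (e * (t * (e * (t * (e * (e * s)))))) := (hr x).trans
        (transAvg_le hk0 (fun y => by gcongr; exact b3 y) x)
    _ ≤ t * (e * (t * (e * (t * (e * (e * (2 * (t * S)))))))) := by gcongr
    _ = _ := by ring

end system

end Majorant

/-! ### Frequency averages of resolvents for two distinguished ancillas -/

section TwoAncilla

variable {𝒜 : Type*} [CStarAlgebra 𝒜]

/-- Eigenvalue of `Z` on a basis state. -/
def bsgn (b : Bool) : ℝ := if b then -1 else 1

/-- Energy of two ancilla qubits in the basis state `b`. -/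
def ancEnergy (b : Bool × Bool) (ω : ℝ × ℝ) : ℝ := (bsgn b.1 * ω.1 + bsgn b.2 * ω.2) / 2

/-- Flip the bits of `b` selected by `p`. -/
def flipBy (p b : Bool × Bool) : Bool × Bool := (xor p.1 b.1, xor p.2 b.2)

/-- Frequency carried by the block from the basis state `flipBy p b` to `b`. -/
def blockDir (p b : Bool × Bool) : ℝ × ℝ :=
  (if p.1 then bsgn b.1 else 0, if p.2 then bsgn b.2 else 0)

lemma flipBy_flipBy (p q b : Bool × Bool) : flipBy p (flipBy q b) = flipBy (flipBy p q) b := by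
  simp [flipBy]

/-- Only flipped ancillas contribute, so a block of parity `p` oscillates with a linear form in
their frequencies alone. Its coefficients are the direction of translation in Fourier space. -/
lemma ancEnergy_sub (p b : Bool × Bool) (ω : ℝ × ℝ) :
    ancEnergy b ω - ancEnergy (flipBy p b) ω =
      (blockDir p b).1 * ω.1 + (blockDir p b).2 * ω.2 := by
  rcases p with ⟨_ | _, _ | _⟩ <;> rcases b with ⟨_ | _, _ | _⟩ <;>
    simp [ancEnergy, flipBy, blockDir, bsgn] <;> ring

/-- Two ancillas with frequencies `ω` inside an environment: `P b` are the projections to their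
basis states, `h ω` is the Hamiltonian, and `h0` its part without the two ancillas. -/
structure TwoAncilla (𝒜 : Type*) [CStarAlgebra 𝒜] where
  P : Bool × Bool → 𝒜
  h : ℝ × ℝ → 𝒜
  h0 : 𝒜
  norm_P : ∀ b, ‖P b‖ ≤ 1
  sum_P : ∑ b, P b = 1
  orth : ∀ b c, b ≠ c → P b * P c = 0
  h_sa : ∀ ω, IsSelfAdjoint (h ω)
  h0_sa : IsSelfAdjoint h0
  h_cont : Continuous h
  P_h0 : ∀ b, Commute (P b) h0
  h_P : ∀ ω b, h ω * P b = (h0 + (ancEnergy b ω : ℂ) • 1) * P b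
  P_h : ∀ ω b, P b * h ω = P b * (h0 + (ancEnergy b ω : ℂ) • 1)

/-- Continuous bounded families of operators. -/
def IsFamily (F : ℝ × ℝ → 𝒜) : Prop := Continuous F ∧ ∃ C, ∀ ω, ‖F ω‖ ≤ C

lemma IsFamily.add {F G : ℝ × ℝ → 𝒜} (hF : IsFamily F) (hG : IsFamily G) :
    IsFamily fun ω => F ω + G ω := by
  obtain ⟨c, C, hC⟩ := hF
  obtain ⟨d, D, hD⟩ := hG
  exact ⟨c.add d, C + D, fun ω => (norm_add_le _ _).trans (add_le_add (hC ω) (hD ω))⟩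

lemma IsFamily.sub {F G : ℝ × ℝ → 𝒜} (hF : IsFamily F) (hG : IsFamily G) :
    IsFamily fun ω => F ω - G ω := by
  obtain ⟨c, C, hC⟩ := hF
  obtain ⟨d, D, hD⟩ := hG
  exact ⟨c.sub d, C + D, fun ω => (norm_sub_le _ _).trans (add_le_add (hC ω) (hD ω))⟩

lemma IsFamily.mul_left {F : ℝ × ℝ → 𝒜} (hF : IsFamily F) (a : 𝒜) :
    IsFamily fun ω => a * F ω := by
  obtain ⟨c, C, hC⟩ := hF
  exact ⟨by fun_prop, ‖a‖ * C, fun ω => (norm_mul_le _ _).trans (by gcongr; exact hC ω)⟩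

lemma IsFamily.mul_right {F : ℝ × ℝ → 𝒜} (hF : IsFamily F) (a : 𝒜) :
    IsFamily fun ω => F ω * a := by
  obtain ⟨c, C, hC⟩ := hF
  exact ⟨by fun_prop, C * ‖a‖, fun ω => (norm_mul_le _ _).trans (by gcongr; exact hC ω)⟩

lemma IsFamily.ad {F : ℝ × ℝ → 𝒜} (hF : IsFamily F) (w : 𝒜) :
    IsFamily fun ω => ad w (F ω) := by
  obtain ⟨c, C, hC⟩ := (hF.mul_left w).sub (hF.mul_right w)
  exact ⟨c.const_smul Complex.I, C, fun ω => by
    refine le_trans (le_of_eq ?_) (hC ω)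
    simp [ErgodicGibbs.ad, norm_smul]⟩

lemma isFamily_const (A : 𝒜) : IsFamily fun _ => A := ⟨continuous_const, ‖A‖, fun _ => le_rfl⟩

lemma IsFamily.sum {ι : Type*} (s : Finset ι) {F : ι → ℝ × ℝ → 𝒜} (hF : ∀ i, IsFamily (F i)) :
    IsFamily fun ω => ∑ i ∈ s, F i ω := by
  classical
  induction s using Finset.induction_on with
  | empty => simpa using isFamily_const (0 : 𝒜)
  | insert a s ha ih => simp only [Finset.sum_insert ha]; exact (hF a).add ih

lemma IsFamily.res {γ : ℝ} (hγ : 0 < γ) {h F : ℝ × ℝ → 𝒜} (hF : IsFamily F) (hc : Continuous h)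
    (hs : ∀ ω, IsSelfAdjoint (h ω)) : IsFamily fun ω => res γ (h ω) (F ω) := by
  obtain ⟨c, C, hC⟩ := hF
  refine ⟨continuous_res hγ hc hs c, γ⁻¹ * C, fun ω => (norm_res_le hγ (hs ω) _).trans ?_⟩
  have := inv_pos.2 hγ
  gcongr; exact hC ω

variable (ν : Measure (ℝ × ℝ)) [IsFiniteMeasure ν]

/-- Fourier transform of an operator family. -/
def opFourier (F : ℝ × ℝ → 𝒜) (x : ℝ × ℝ) : 𝒜 :=
  ∫ ω, Complex.exp (-(Complex.I * ((x.1 * ω.1 + x.2 * ω.2 : ℝ) : ℂ))) • F ω ∂ν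

/-- Norm of the Fourier transform of an operator family. -/
def opSymbol (F : ℝ × ℝ → 𝒜) (x : ℝ × ℝ) : ℝ≥0∞ := ‖opFourier ν F x‖ₑ

lemma norm_exp_neg_I_mul (r : ℝ) : ‖Complex.exp (-(Complex.I * (r : ℂ)))‖ = 1 := by
  rw [Complex.norm_exp]; simp

variable {ν}

lemma integrable_phase {F : ℝ × ℝ → 𝒜} (hF : IsFamily F) (x : ℝ × ℝ) :
    Integrable (fun ω : ℝ × ℝ =>
      Complex.exp (-(Complex.I * ((x.1 * ω.1 + x.2 * ω.2 : ℝ) : ℂ))) • F ω) ν := by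
  obtain ⟨c, C, hC⟩ := hF
  refine Integrable.mono' (integrable_const C) ?_ (.of_forall fun ω => ?_)
  · apply Continuous.aestronglyMeasurable; fun_prop
  · rw [norm_smul, norm_exp_neg_I_mul, one_mul]; exact hC ω

lemma continuous_opFourier {F : ℝ × ℝ → 𝒜} (hF : IsFamily F) : Continuous (opFourier ν F) := by
  obtain ⟨c, C, hC⟩ := hF
  refine continuous_of_dominated (bound := fun _ => C) (fun x => ?_) (fun x => ?_)
    (integrable_const C) (.of_forall fun ω => ?_)
  · apply Continuous.aestronglyMeasurable; fun_prop
  · refine .of_forall fun ω => ?_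
    rw [norm_smul, norm_exp_neg_I_mul, one_mul]; exact hC ω
  · fun_prop

lemma measurable_opSymbol {F : ℝ × ℝ → 𝒜} (hF : IsFamily F) : Measurable (opSymbol ν F) :=
  (continuous_opFourier hF).enorm.measurable

lemma opSymbol_le_of_norm_le {F : ℝ × ℝ → 𝒜} {C : ℝ} (hC : ∀ ω, ‖F ω‖ ≤ C) (x : ℝ × ℝ) :
    opSymbol ν F x ≤ ENNReal.ofReal (C * ν.real Set.univ) := by
  have hC0 : 0 ≤ C := (norm_nonneg _).trans (hC 0)
  rw [opSymbol, ← ofReal_norm]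
  apply ENNReal.ofReal_le_ofReal
  refine (norm_integral_le_of_norm_le_const (C := C) (.of_forall fun ω => ?_)).trans le_rfl
  rw [norm_smul, norm_exp_neg_I_mul, one_mul]; exact hC ω

lemma IsFamily.opSymbol_bound {F : ℝ × ℝ → 𝒜} (hF : IsFamily F) :
    ∃ N : ℝ≥0∞, N ≠ ⊤ ∧ ∀ x, opSymbol ν F x ≤ N := by
  obtain ⟨_, C, hC⟩ := hF
  exact ⟨_, ENNReal.ofReal_ne_top, opSymbol_le_of_norm_le hC⟩

lemma opFourier_add {F G : ℝ × ℝ → 𝒜} (hF : IsFamily F) (hG : IsFamily G) (x : ℝ × ℝ) :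
    opFourier ν (fun ω => F ω + G ω) x = opFourier ν F x + opFourier ν G x := by
  unfold opFourier
  rw [← integral_add (integrable_phase hF x) (integrable_phase hG x)]
  simp_rw [smul_add]

lemma opSymbol_add_le {F G : ℝ × ℝ → 𝒜} (hF : IsFamily F) (hG : IsFamily G) (x : ℝ × ℝ) :
    opSymbol ν (fun ω => F ω + G ω) x ≤ opSymbol ν F x + opSymbol ν G x := by
  rw [opSymbol, opFourier_add hF hG]; exact enorm_add_le _ _

lemma opFourier_clm {F : ℝ × ℝ → 𝒜} (hF : IsFamily F) (T : 𝒜 →L[ℂ] 𝒜) (x : ℝ × ℝ) :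
    opFourier ν (fun ω => T (F ω)) x = T (opFourier ν F x) := by
  unfold opFourier
  rw [← T.integral_comp_comm (integrable_phase hF x)]
  simp

lemma opFourier_mul_left {F : ℝ × ℝ → 𝒜} (hF : IsFamily F) (a : 𝒜) (x : ℝ × ℝ) :
    opFourier ν (fun ω => a * F ω) x = a * opFourier ν F x :=
  opFourier_clm hF (ContinuousLinearMap.mul ℂ 𝒜 a) x

lemma opFourier_mul_right {F : ℝ × ℝ → 𝒜} (hF : IsFamily F) (a : 𝒜) (x : ℝ × ℝ) :
    opFourier ν (fun ω => F ω * a) x = opFourier ν F x * a :=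
  opFourier_clm hF ((ContinuousLinearMap.mul ℂ 𝒜).flip a) x

lemma opFourier_ad {F : ℝ × ℝ → 𝒜} (hF : IsFamily F) (w : 𝒜) (x : ℝ × ℝ) :
    opFourier ν (fun ω => ad w (F ω)) x = ad w (opFourier ν F x) := by
  have := opFourier_clm (ν := ν) hF (Complex.I • ((ContinuousLinearMap.mul ℂ 𝒜 w) -
    (ContinuousLinearMap.mul ℂ 𝒜).flip w)) x
  simpa [ad] using this

lemma opSymbol_ad_le {F : ℝ × ℝ → 𝒜} (hF : IsFamily F) {w : 𝒜} {η : ℝ} (hw : ‖w‖ ≤ η)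
    (x : ℝ × ℝ) : opSymbol ν (fun ω => ad w (F ω)) x ≤ ENNReal.ofReal (2 * η) * opSymbol ν F x := by
  have h0 : 0 ≤ η := (norm_nonneg _).trans hw
  rw [opSymbol, opSymbol, opFourier_ad hF, ← ofReal_norm, ← ofReal_norm,
    ← ENNReal.ofReal_mul (by positivity)]
  apply ENNReal.ofReal_le_ofReal
  refine (norm_ad_le _ _).trans ?_
  gcongr

/-- Two-sided exponential weight along the direction `w`. -/
def expLine (γ : ℝ) (w : ℝ × ℝ) : Measure (ℝ × ℝ) :=
  (volume.withDensity fun s : ℝ => ENNReal.ofReal (Real.exp (-γ * |s|))).map fun s => s • w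

lemma integrable_exp_neg_abs {γ : ℝ} (hγ : 0 < γ) :
    Integrable (fun s : ℝ => Real.exp (-γ * |s|)) ∧ ∫ s : ℝ, Real.exp (-γ * |s|) = 2 * γ⁻¹ := by
  have h1 : IntegrableOn (fun s : ℝ => Real.exp (-γ * |s|)) (Set.Ioi 0) := by
    refine (integrableOn_exp_mul_Ioi (by linarith : -γ < 0) 0).congr_fun (fun s hs => ?_)
      measurableSet_Ioi
    simp only [abs_of_pos (Set.mem_Ioi.1 hs)]
  refine ⟨?_, ?_⟩
  · have h2 : IntegrableOn (fun s : ℝ => Real.exp (-γ * |s|)) (Set.Iic 0) := by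
      refine (integrableOn_exp_mul_Iic hγ 0).congr_fun (fun s hs => ?_) measurableSet_Iic
      simp only [abs_of_nonpos (Set.mem_Iic.1 hs), neg_mul_neg]
    rw [← integrableOn_univ, ← Set.Iic_union_Ioi (a := (0 : ℝ))]
    exact h2.union h1
  · rw [integral_comp_abs (f := fun s => Real.exp (-γ * s)), integral_exp_neg_Ioi hγ]

instance (γ : ℝ) (w : ℝ × ℝ) : SFinite (expLine γ w) := by unfold expLine; infer_instance

lemma transAvg_expLine (γ : ℝ) (w : ℝ × ℝ) {ψ : ℝ × ℝ → ℝ≥0∞} (hψ : Measurable ψ) (x : ℝ × ℝ) :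
    transAvg (expLine γ w) ψ x =
      ∫⁻ s : ℝ, ENNReal.ofReal (Real.exp (-γ * |s|)) * ψ (x + s • w) := by
  rw [transAvg, expLine, lintegral_map (by fun_prop) (by fun_prop),
    lintegral_withDensity_eq_lintegral_mul _ (by fun_prop) (by fun_prop)]
  rfl

lemma expLine_univ {γ : ℝ} (hγ : 0 < γ) (w : ℝ × ℝ) :
    expLine γ w Set.univ = ENNReal.ofReal (2 * γ⁻¹) := by
  rw [expLine, Measure.map_apply (by fun_prop) .univ, Set.preimage_univ,
    withDensity_apply _ .univ, Measure.restrict_univ,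
    ← ofReal_integral_eq_lintegral_ofReal (integrable_exp_neg_abs hγ).1
      (.of_forall fun s => (Real.exp_pos _).le), (integrable_exp_neg_abs hγ).2]

/-- Weights that control the resolvent on the block of parity `p`. -/
def blockWeight (γ : ℝ) (p : Bool × Bool) : Measure (ℝ × ℝ) :=
  ∑ b : Bool × Bool, expLine γ (blockDir p b)

instance (γ : ℝ) (p : Bool × Bool) : SFinite (blockWeight γ p) := by
  unfold blockWeight
  rw [← Measure.sum_fintype]
  infer_instance

lemma blockWeight_univ {γ : ℝ} (hγ : 0 < γ) (p : Bool × Bool) :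
    blockWeight γ p Set.univ = ENNReal.ofReal (8 * γ⁻¹) := by
  rw [blockWeight, Measure.finsetSum_apply]
  simp only [expLine_univ hγ, Finset.sum_const, Finset.card_univ, Fintype.card_prod,
    Fintype.card_bool, nsmul_eq_mul]
  rw [show (8 * γ⁻¹) = 4 * (2 * γ⁻¹) by ring, ENNReal.ofReal_mul (by norm_num : (0:ℝ) ≤ 4)]
  norm_num

lemma transAvg_blockWeight (γ : ℝ) (p : Bool × Bool) (ψ : ℝ × ℝ → ℝ≥0∞) (x : ℝ × ℝ) :
    transAvg (blockWeight γ p) ψ x = ∑ b, transAvg (expLine γ (blockDir p b)) ψ x := by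
  rw [transAvg, blockWeight, lintegral_finsetSum_measure]; rfl

lemma norm_mul3_le {a b : 𝒜} (ha : ‖a‖ ≤ 1) (hb : ‖b‖ ≤ 1) (F : 𝒜) : ‖a * F * b‖ ≤ ‖F‖ := by
  calc ‖a * F * b‖ ≤ ‖a‖ * ‖F‖ * ‖b‖ := (norm_mul_le _ _).trans (by gcongr; exact norm_mul_le _ _)
    _ ≤ 1 * ‖F‖ * 1 := by gcongr
    _ = ‖F‖ := by ring

namespace TwoAncilla

variable (M : TwoAncilla 𝒜)

lemma P_comm (ω : ℝ × ℝ) (b : Bool × Bool) : Commute (M.P b) (M.h ω) := by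
  have : Commute (M.P b) (M.h0 + (ancEnergy b ω : ℂ) • 1) :=
    (M.P_h0 b).add_right ((Commute.one_right _).smul_right _)
  rw [Commute, SemiconjBy, M.P_h, M.h_P, this.eq]

/-- On the range of `P b` the two ancillas contribute a scalar to the Hamiltonian. Exponentiating
the intertwining relation `h_P` turns this scalar into a phase. -/
lemma exp_mul_P (c : ℂ) (ω : ℝ × ℝ) (b : Bool × Bool) :
    NormedSpace.exp (c • M.h ω) * M.P b =
      Complex.exp (c * ancEnergy b ω) • (NormedSpace.exp (c • M.h0) * M.P b) := by
  let _ : NormedAlgebra ℚ 𝒜 := NormedAlgebra.restrictScalars ℚ ℂ 𝒜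
  have h1 : SemiconjBy (M.P b) (c • (M.h0 + (ancEnergy b ω : ℂ) • 1)) (c • M.h ω) := by
    rw [SemiconjBy, mul_smul_comm, smul_mul_assoc, M.h_P, (M.P_h0 b).add_right
      ((Commute.one_right _).smul_right _)]
  have h2 := h1.exp_right
  rw [SemiconjBy] at h2
  rw [← h2, smul_add, smul_smul, NormedSpace.exp_add_of_commute
    (((Commute.one_right _).smul_right _).smul_left c),
    ← Algebra.algebraMap_eq_smul_one, ← NormedSpace.algebraMap_exp_comm,
    ← Complex.exp_eq_exp_ℂ, Algebra.algebraMap_eq_smul_one, mul_smul_comm, mul_one,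
    mul_smul_comm, (commute_exp_smul (M.P_h0 b) c).eq]

lemma P_mul_exp (c : ℂ) (ω : ℝ × ℝ) (b : Bool × Bool) :
    M.P b * NormedSpace.exp (c • M.h ω) =
      Complex.exp (c * ancEnergy b ω) • (M.P b * NormedSpace.exp (c • M.h0)) := by
  rw [(commute_exp_smul (M.P_comm ω b) c).eq, exp_mul_P, (commute_exp_smul (M.P_h0 b) c).eq]

lemma evol_sandwich (ω : ℝ × ℝ) (s : ℝ) (b c : Bool × Bool) (F : 𝒜) :
    evol (M.h ω) s (M.P b * F * M.P c) =
      Complex.exp (Complex.I * ((s * (ancEnergy b ω - ancEnergy c ω) : ℝ) : ℂ)) •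
        evol M.h0 s (M.P b * F * M.P c) := by
  unfold evol
  rw [show NormedSpace.exp ((Complex.I * (s : ℂ)) • M.h ω) * (M.P b * F * M.P c) *
      NormedSpace.exp ((-(Complex.I * (s : ℂ))) • M.h ω) =
      (NormedSpace.exp ((Complex.I * (s : ℂ)) • M.h ω) * M.P b) * F *
      (M.P c * NormedSpace.exp ((-(Complex.I * (s : ℂ))) • M.h ω)) by simp only [mul_assoc],
    exp_mul_P, P_mul_exp, smul_mul_assoc, smul_mul_assoc, mul_smul_comm, smul_smul,
    ← Complex.exp_add]
  congr 1
  · congr 1; push_cast; ring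
  · simp only [mul_assoc]

/-- Component of parity `p`. -/
def blk (p : Bool × Bool) (F : 𝒜) : 𝒜 := ∑ b, M.P b * F * M.P (flipBy p b)

lemma P_mul_P (b c : Bool × Bool) : M.P b * M.P c = if b = c then M.P b else 0 := by
  split_ifs with h
  · subst h
    have := congrArg (M.P b * ·) M.sum_P
    simp only [Finset.mul_sum, mul_one] at this
    rwa [Finset.sum_eq_single b (fun c _ hc => M.orth b c (Ne.symm hc)) (by simp)] at this
  · exact M.orth b c h

lemma blk_add (p : Bool × Bool) (F G : 𝒜) : M.blk p (F + G) = M.blk p F + M.blk p G := by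
  simp [blk, mul_add, add_mul, Finset.sum_add_distrib]

lemma blk_smul (p : Bool × Bool) (c : ℂ) (F : 𝒜) : M.blk p (c • F) = c • M.blk p F := by
  simp [blk, Finset.smul_sum]

lemma blk_sub (p : Bool × Bool) (F G : 𝒜) : M.blk p (F - G) = M.blk p F - M.blk p G := by
  simp [blk, mul_sub, sub_mul, Finset.sum_sub_distrib]

lemma P_blk_P (p b : Bool × Bool) (F : 𝒜) :
    M.P b * M.blk p F * M.P (flipBy p b) = M.P b * F * M.P (flipBy p b) := by
  rw [blk, Finset.mul_sum, Finset.sum_mul, Finset.sum_eq_single b]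
  · rw [show M.P b * (M.P b * F * M.P (flipBy p b)) * M.P (flipBy p b) =
      (M.P b * M.P b) * F * (M.P (flipBy p b) * M.P (flipBy p b)) by simp only [mul_assoc],
      P_mul_P, P_mul_P, if_pos rfl, if_pos rfl]
  · intro c _ hc
    rw [← mul_assoc, ← mul_assoc, P_mul_P, if_neg (Ne.symm hc)]
    simp
  · simp

lemma blk_of_commute {A : 𝒜} (hA : ∀ b, Commute A (M.P b)) (p : Bool × Bool) :
    M.blk p A = if p = (false, false) then A else 0 := by
  have : ∀ b, M.P b * A * M.P (flipBy p b) = if p = (false, false) then A * M.P b else 0 := by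
    intro b
    rw [← (hA b).eq, mul_assoc, P_mul_P]
    have : b = flipBy p b ↔ p = (false, false) := by revert p b; decide
    simp only [this, mul_ite, mul_zero]
  rw [blk, Finset.sum_congr rfl fun b _ => this b]
  split_ifs
  · rw [← Finset.mul_sum, M.sum_P, mul_one]
  · simp

/-- A coupling that permutes the projections by `q` shifts the parity by `q`. This selection rule
gives the majorant system its shape. -/
lemma blk_ad {q : Bool × Bool} {w : 𝒜} (hw : ∀ b, w * M.P b = M.P (flipBy q b) * w)
    (p : Bool × Bool) (F : 𝒜) : M.blk p (ad w F) = ad w (M.blk (flipBy q p) F) := by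
  have inv : ∀ b, flipBy q (flipBy q b) = b := fun b => by simp [flipBy]
  have hw' : ∀ b, M.P b * w = w * M.P (flipBy q b) := fun b => by
    rw [hw, inv]
  unfold ad
  rw [blk_smul, blk_sub]
  congr 2
  · rw [blk, blk, Finset.mul_sum, ← Equiv.sum_comp (Function.Involutive.toPerm (flipBy q) inv)]
    refine Finset.sum_congr rfl fun b _ => ?_
    change M.P (flipBy q b) * (w * F) * M.P (flipBy p (flipBy q b)) = _
    rw [← mul_assoc, hw', inv, flipBy_flipBy]
    have : flipBy p q = flipBy q p := by simp [flipBy, Bool.xor_comm]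
    rw [this]; simp only [mul_assoc]
  · rw [blk, blk, Finset.sum_mul]
    refine Finset.sum_congr rfl fun b _ => ?_
    rw [← mul_assoc (M.P b), mul_assoc _ w, hw, flipBy_flipBy]
    simp only [mul_assoc]

lemma isFamily_blk (p : Bool × Bool) {F : ℝ × ℝ → 𝒜} (hF : IsFamily F) :
    IsFamily fun ω => M.blk p (F ω) :=
  IsFamily.sum _ fun _ => (hF.mul_left _).mul_right _

lemma blk_res {γ : ℝ} (hγ : 0 < γ) (p : Bool × Bool) (ω : ℝ × ℝ) (F : 𝒜) :
    M.blk p (res γ (M.h ω) F) = ∑ b, res γ (M.h ω) (M.P b * M.blk p F * M.P (flipBy p b)) := by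
  refine Finset.sum_congr rfl fun b _ => ?_
  rw [P_blk_P, res_mul_right hγ (M.h_sa ω) (M.P_comm ω _),
    res_mul_left hγ (M.h_sa ω) (M.P_comm ω _)]

end TwoAncilla

end TwoAncilla

/-! ### Scalar inequalities for the Fourier symbols of parity components -/

section TwoAncillaBounds

variable {𝒜 : Type*} [CStarAlgebra 𝒜] {ν : Measure (ℝ × ℝ)} [IsFiniteMeasure ν] {γ : ℝ}

/-- The phase shifts the Fourier variable by `s • w`, so the transform of the resolvent is a time
integral of translates, each evolved isometrically by `h0`. The one-sided time integral is enlarged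
to the two-sided weight of `expLine`, so that the sign of the direction becomes irrelevant. -/
lemma opSymbol_res_le_of_phase (hγ : 0 < γ) {h G : ℝ × ℝ → 𝒜} {h0 : 𝒜} (h0sa : IsSelfAdjoint h0)
    (hG : IsFamily G) (w : ℝ × ℝ)
    (hp : ∀ ω s, evol (h ω) s (G ω) =
      Complex.exp (Complex.I * ((s * (w.1 * ω.1 + w.2 * ω.2) : ℝ) : ℂ)) • evol h0 s (G ω))
    (x : ℝ × ℝ) :
    opSymbol ν (fun ω => res γ (h ω) (G ω)) x ≤ transAvg (expLine γ w) (opSymbol ν G) x := by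
  have hGm := measurable_opSymbol (ν := ν) hG
  obtain ⟨c, C, hC⟩ := id hG
  have ce : Continuous fun p : (ℝ × ℝ) × ℝ => evol h0 p.2 (G p.1) :=
    continuous_evol.comp (g := fun p : ℝ × 𝒜 × 𝒜 => evol p.2.1 p.1 p.2.2)
      (f := fun p : (ℝ × ℝ) × ℝ => (p.2, h0, G p.1)) (by fun_prop)
  have e1 : opFourier ν (fun ω => res γ (h ω) (G ω)) x =
      ∫ s in Set.Ioi (0 : ℝ), Real.exp (-γ * s) • evol h0 s (opFourier ν G (x - s • w)) := by
    have step : ∀ ω : ℝ × ℝ,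
        Complex.exp (-(Complex.I * ((x.1 * ω.1 + x.2 * ω.2 : ℝ) : ℂ))) • res γ (h ω) (G ω) =
        ∫ s in Set.Ioi (0 : ℝ), Real.exp (-γ * s) •
          (Complex.exp (-(Complex.I * (((x - s • w).1 * ω.1 + (x - s • w).2 * ω.2 : ℝ) : ℂ))) •
            evol h0 s (G ω)) := by
      intro ω
      rw [res, ← integral_smul]
      congr 1
      funext s
      rw [hp, smul_comm, smul_smul, ← Complex.exp_add]
      congr 3
      simp only [Prod.fst_sub, Prod.snd_sub, Prod.smul_fst, Prod.smul_snd, smul_eq_mul]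
      push_cast
      ring
    unfold opFourier
    simp_rw [step]
    rw [integral_integral_swap]
    · congr 1
      funext s
      rw [integral_smul]
      congr 1
      have h1 := opFourier_mul_right (ν := ν)
        (hG.mul_left (NormedSpace.exp ((Complex.I * (s : ℂ)) • h0)))
        (NormedSpace.exp ((-(Complex.I * (s : ℂ))) • h0)) (x - s • w)
      rw [opFourier_mul_left hG] at h1
      exact h1
    · have hb : Integrable (fun p : (ℝ × ℝ) × ℝ => C * Real.exp (-γ * p.2))
          (ν.prod (volume.restrict (Set.Ioi 0))) :=
        Integrable.mul_prod (integrable_const C) (integrableOn_exp_mul_Ioi (by linarith) 0)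
      refine Integrable.mono' hb ?_ (.of_forall fun p => ?_)
      · apply Continuous.aestronglyMeasurable
        unfold Function.uncurry
        fun_prop
      · rw [Function.uncurry, norm_smul, norm_smul, norm_exp_neg_I_mul, one_mul, norm_evol h0sa,
          Real.norm_eq_abs, Real.abs_exp, mul_comm]
        gcongr
        exact hC _
  rw [opSymbol, e1, transAvg_expLine γ w hGm]
  refine (enorm_integral_le_lintegral_enorm _).trans ?_
  rw [← lintegral_neg_eq_self (μ := volume)
    (fun s : ℝ => ENNReal.ofReal (Real.exp (-γ * |s|)) * opSymbol ν G (x + s • w))]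
  refine le_trans (le_of_eq ?_) (setLIntegral_le_lintegral (Set.Ioi 0) _)
  refine setLIntegral_congr_fun measurableSet_Ioi fun s hs => ?_
  have hs' := Set.mem_Ioi.1 hs
  simp only [opSymbol]
  rw [← ofReal_norm, norm_smul, norm_evol h0sa, Real.norm_eq_abs, Real.abs_exp,
    ENNReal.ofReal_mul (Real.exp_pos _).le, ofReal_norm, abs_neg, abs_of_pos hs', neg_smul,
    ← sub_eq_add_neg]

namespace TwoAncilla

variable (M : TwoAncilla 𝒜)

lemma opSymbol_mul3_le {a b : 𝒜} (ha : ‖a‖ ≤ 1) (hb : ‖b‖ ≤ 1) {F : ℝ × ℝ → 𝒜} (hF : IsFamily F)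
    (x : ℝ × ℝ) : opSymbol ν (fun ω => a * F ω * b) x ≤ opSymbol ν F x := by
  rw [opSymbol, opFourier_mul_right (hF.mul_left a), opFourier_mul_left hF, opSymbol,
    enorm_le_iff_norm_le]
  exact norm_mul3_le ha hb _

lemma opSymbol_sum_le {ι : Type*} (s : Finset ι) {F : ι → ℝ × ℝ → 𝒜} (hF : ∀ i, IsFamily (F i))
    (x : ℝ × ℝ) : opSymbol ν (fun ω => ∑ i ∈ s, F i ω) x ≤ ∑ i ∈ s, opSymbol ν (F i) x := by
  classical
  induction s using Finset.induction_on with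
  | empty => simp [opSymbol, opFourier]
  | insert a s ha ih =>
    simp only [Finset.sum_insert ha]
    exact (opSymbol_add_le (hF a) (IsFamily.sum s hF) x).trans (by gcongr)

/-- The four blocks of one parity may move in different directions, so their bounds are added, and
compression by projections does not increase a symbol. -/
lemma opSymbol_blk_res_le (hγ : 0 < γ) (p : Bool × Bool) {G : ℝ × ℝ → 𝒜} (hG : IsFamily G)
    (x : ℝ × ℝ) : opSymbol ν (fun ω => M.blk p (res γ (M.h ω) (G ω))) x ≤
      transAvg (blockWeight γ p) (opSymbol ν fun ω => M.blk p (G ω)) x := by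
  have hb := M.isFamily_blk p hG
  simp_rw [M.blk_res hγ]
  have hs : ∀ b, IsFamily fun ω => M.P b * M.blk p (G ω) * M.P (flipBy p b) :=
    fun b => (hb.mul_left _).mul_right _
  refine (opSymbol_sum_le _ (fun b => (hs b).res hγ M.h_cont M.h_sa) x).trans ?_
  rw [transAvg_blockWeight]
  refine Finset.sum_le_sum fun b _ => ?_
  refine (opSymbol_res_le_of_phase hγ M.h0_sa (hs b) (blockDir p b) (fun ω s => ?_) x).trans ?_
  · rw [M.evol_sandwich, ancEnergy_sub]
  · exact transAvg_mono (fun y => opSymbol_mul3_le (M.norm_P _) (M.norm_P _) hb y) x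

/-- Symbol of the component of parity `p`. -/
def sym (ν : Measure (ℝ × ℝ)) (p : Bool × Bool) (F : ℝ × ℝ → 𝒜) : ℝ × ℝ → ℝ≥0∞ :=
  opSymbol ν fun ω => M.blk p (F ω)

lemma measurable_sym (p : Bool × Bool) {F : ℝ × ℝ → 𝒜} (hF : IsFamily F) :
    Measurable (M.sym ν p F) := measurable_opSymbol (M.isFamily_blk p hF)

variable {M} {w w₁ w₂ : 𝒜} {η : ℝ}

lemma sym_ad_le {q : Bool × Bool} (hw : ∀ b, w * M.P b = M.P (flipBy q b) * w) (hη : ‖w‖ ≤ η)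
    (p : Bool × Bool) {F : ℝ × ℝ → 𝒜} (hF : IsFamily F) (x : ℝ × ℝ) :
    M.sym ν p (fun ω => ad w (F ω)) x ≤ ENNReal.ofReal (2 * η) * M.sym ν (flipBy q p) F x := by
  unfold sym
  simp_rw [M.blk_ad hw]
  exact opSymbol_ad_le (M.isFamily_blk _ hF) hη x

lemma sym_add_le (p : Bool × Bool) {F G : ℝ × ℝ → 𝒜} (hF : IsFamily F) (hG : IsFamily G)
    (x : ℝ × ℝ) : M.sym ν p (fun ω => F ω + G ω) x ≤ M.sym ν p F x + M.sym ν p G x := by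
  unfold sym
  simp_rw [M.blk_add]
  exact opSymbol_add_le (M.isFamily_blk _ hF) (M.isFamily_blk _ hG) x

lemma sym_res_ad_le (hγ : 0 < γ) {q : Bool × Bool} (hw : ∀ b, w * M.P b = M.P (flipBy q b) * w)
    (hη : ‖w‖ ≤ η) (p : Bool × Bool) {F : ℝ × ℝ → 𝒜} (hF : IsFamily F) (x : ℝ × ℝ) :
    M.sym ν p (fun ω => res γ (M.h ω) (ad w (F ω))) x ≤
      transAvg (blockWeight γ p)
        (fun x => ENNReal.ofReal (2 * η) * M.sym ν (flipBy q p) F x) x :=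
  (M.opSymbol_blk_res_le hγ p (hF.ad w) x).trans (transAvg_mono (sym_ad_le hw hη p hF) x)

lemma sym_res_ad_add_le (hγ : 0 < γ) (hw₁ : ∀ b, w₁ * M.P b = M.P (flipBy (true, false) b) * w₁)
    (hw₂ : ∀ b, w₂ * M.P b = M.P (flipBy (false, true) b) * w₂) (hη₁ : ‖w₁‖ ≤ η) (hη₂ : ‖w₂‖ ≤ η)
    (p : Bool × Bool) {F G : ℝ × ℝ → 𝒜} (hF : IsFamily F) (hG : IsFamily G) (x : ℝ × ℝ) :
    M.sym ν p (fun ω => res γ (M.h ω) (ad w₁ (F ω) + ad w₂ (G ω))) x ≤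
      transAvg (blockWeight γ p) (fun x => ENNReal.ofReal (2 * η) *
        (M.sym ν (flipBy (true, false) p) F x + M.sym ν (flipBy (false, true) p) G x)) x := by
  refine (M.opSymbol_blk_res_le hγ p ((hF.ad w₁).add (hG.ad w₂)) x).trans
    (transAvg_mono (fun y => ?_) x)
  refine (sym_add_le p (hF.ad w₁) (hG.ad w₂) y).trans ?_
  rw [mul_add]
  exact add_le_add (sym_ad_le hw₁ hη₁ p hF y) (sym_ad_le hw₂ hη₂ p hG y)

lemma commute_flipBy_zero (b : Bool × Bool) : flipBy (false, false) b = b := by simp [flipBy]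

lemma isFamily_res_const (hγ : 0 < γ) (hw : IsSelfAdjoint w) (A : 𝒜) :
    IsFamily fun ω => res γ (M.h ω + w) A :=
  (isFamily_const A).res hγ (M.h_cont.add continuous_const) (fun ω => (M.h_sa ω).add hw)

lemma isFamily_res_h (hγ : 0 < γ) {F : ℝ × ℝ → 𝒜} (hF : IsFamily F) :
    IsFamily fun ω => res γ (M.h ω) (F ω) := hF.res hγ M.h_cont M.h_sa

lemma sym_const_zero {A : 𝒜} (hA : ∀ b, Commute A (M.P b)) :
    M.sym ν (false, false) (fun _ => A) = opSymbol ν (fun _ => A) := by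
  unfold sym; simp_rw [M.blk_of_commute hA]; simp

lemma sym_const_ne {A : 𝒜} (hA : ∀ b, Commute A (M.P b)) {p : Bool × Bool}
    (hp : p ≠ (false, false)) : M.sym ν p (fun _ => A) = 0 := by
  unfold sym; simp_rw [M.blk_of_commute hA, if_neg hp]; funext x; simp [opSymbol, opFourier]

/-- The mixed second difference of resolvents with respect to two ancillas. -/
def mixedDiff (M : TwoAncilla 𝒜) (γ : ℝ) (w₁ w₂ A : 𝒜) (ω : ℝ × ℝ) : 𝒜 :=
  res γ (M.h ω + (w₁ + w₂)) A - res γ (M.h ω + w₁) A - res γ (M.h ω + w₂) A + res γ (M.h ω) A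

/-- The second resolvent identity gives closed equations for `F`, `F - F1`, `F - F2` and the mixed
difference, and their parity components form a `PairSystem` with `t = 8 / γ` and `e = 2 η`. The
condition `64 η ≤ γ` says exactly that `t e ≤ 1 / 4`. -/
theorem sym_mixedDiff_le (hγ : 0 < γ) (sa₁ : IsSelfAdjoint w₁) (sa₂ : IsSelfAdjoint w₂)
    (hw₁ : ∀ b, w₁ * M.P b = M.P (flipBy (true, false) b) * w₁)
    (hw₂ : ∀ b, w₂ * M.P b = M.P (flipBy (false, true) b) * w₂) (hη₁ : ‖w₁‖ ≤ η) (hη₂ : ‖w₂‖ ≤ η)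
    (hη : 64 * η ≤ γ) {A : 𝒜} (hA : ∀ b, Commute A (M.P b)) (x : ℝ × ℝ) :
    M.sym ν (false, false) (mixedDiff M γ w₁ w₂ A) x ≤
      24 * (ENNReal.ofReal (8 * γ⁻¹) ^ 3 * ENNReal.ofReal (2 * η) ^ 4) *
        pairSup (blockWeight γ (true, false)) (blockWeight γ (false, true))
          (blockWeight γ (true, true)) (opSymbol ν fun _ => A) := by
  have hη0 : 0 ≤ η := (norm_nonneg _).trans hη₁
  have sa12 := sa₁.add sa₂
  have fA : IsFamily fun _ : ℝ × ℝ => A := isFamily_const A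
  set F : ℝ × ℝ → 𝒜 := fun ω => res γ (M.h ω + (w₁ + w₂)) A with hF
  set F1 : ℝ × ℝ → 𝒜 := fun ω => res γ (M.h ω + w₁) A with hF1
  set F2 : ℝ × ℝ → 𝒜 := fun ω => res γ (M.h ω + w₂) A with hF2
  have fF : IsFamily F := isFamily_res_const hγ sa12 A
  have fF1 : IsFamily F1 := isFamily_res_const hγ sa₁ A
  have fF2 : IsFamily F2 := isFamily_res_const hγ sa₂ A
  have fD1 : IsFamily fun ω => F ω - F2 ω := fF.sub fF2
  have fD2 : IsFamily fun ω => F ω - F1 ω := fF.sub fF1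
  have rF : ∀ ω, F ω = res γ (M.h ω) (A + (ad w₁ (F ω) + ad w₂ (F ω))) := fun ω => by
    have := res_add_eq hγ (M.h_sa ω) sa12 A
    rw [res_add hγ (M.h_sa ω), ← ad_add_left]; exact this
  have rF1 : ∀ ω, F1 ω = res γ (M.h ω) (A + ad w₁ (F1 ω)) := fun ω => by
    rw [res_add hγ (M.h_sa ω)]; exact res_add_eq hγ (M.h_sa ω) sa₁ A
  have rF2 : ∀ ω, F2 ω = res γ (M.h ω) (A + ad w₂ (F2 ω)) := fun ω => by
    rw [res_add hγ (M.h_sa ω)]; exact res_add_eq hγ (M.h_sa ω) sa₂ A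
  have rD1 : (fun ω => F ω - F2 ω) =
      fun ω => res γ (M.h ω) (ad w₁ (F ω) + ad w₂ (F ω - F2 ω)) := by
    funext ω
    conv_lhs => rw [rF ω, rF2 ω, ← res_sub hγ (M.h_sa ω)]
    congr 1
    rw [ad_sub]; abel
  have rD2 : (fun ω => F ω - F1 ω) =
      fun ω => res γ (M.h ω) (ad w₁ (F ω - F1 ω) + ad w₂ (F ω)) := by
    funext ω
    conv_lhs => rw [rF ω, rF1 ω, ← res_sub hγ (M.h_sa ω)]
    congr 1
    rw [ad_sub]; abel
  -- The source `A` cancels, and each coupling acts only on the difference made by the other one.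
  have rM : mixedDiff M γ w₁ w₂ A =
      fun ω => res γ (M.h ω) (ad w₁ (F ω - F1 ω) + ad w₂ (F ω - F2 ω)) := by
    funext ω
    change F ω - F1 ω - F2 ω + res γ (M.h ω) A = _
    conv_lhs => rw [rF ω, rF1 ω, rF2 ω, ← res_sub hγ (M.h_sa ω), ← res_sub hγ (M.h_sa ω),
      ← res_add hγ (M.h_sa ω)]
    congr 1
    rw [ad_sub, ad_sub]; abel
  have rF' : F = fun ω => res γ (M.h ω) A + res γ (M.h ω) (ad w₁ (F ω) + ad w₂ (F ω)) := by
    funext ω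
    conv_lhs => rw [rF ω, res_add hγ (M.h_sa ω)]
  have comp := fun (p : Bool × Bool) (F G : ℝ × ℝ → 𝒜) (hF : IsFamily F) (hG : IsFamily G) =>
    sym_res_ad_add_le (ν := ν) (M := M) hγ hw₁ hw₂ hη₁ hη₂ p hF hG
  -- The observable commutes with the projections, so it is a source only for the even parity.
  have fne : ∀ p, p ≠ (false, false) → ∀ x, M.sym ν p F x ≤ transAvg (blockWeight γ p)
      (fun x => ENNReal.ofReal (2 * η) * (M.sym ν (flipBy (true, false) p) F x +
        M.sym ν (flipBy (false, true) p) F x)) x := by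
    intro p hp x
    rw [rF']
    refine (sym_add_le p (isFamily_res_h hγ fA)
      (isFamily_res_h hγ ((fF.ad w₁).add (fF.ad w₂))) x).trans ?_
    have h0 : M.sym ν p (fun ω => res γ (M.h ω) A) x ≤ 0 := by
      refine (M.opSymbol_blk_res_le hγ p fA x).trans (le_of_eq ?_)
      have := sym_const_ne (ν := ν) hA hp
      unfold sym at this
      rw [this]; simp [transAvg]
    rw [← rF']
    calc _ ≤ 0 + _ := add_le_add h0 (comp p _ _ fF fF x)
      _ = _ := zero_add _
  have H : PairSystem (blockWeight γ) (ENNReal.ofReal (2 * η)) (opSymbol ν fun _ => A)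
      (fun p => M.sym ν p F) (M.sym ν (false, false) fun ω => F ω - F2 ω)
      (M.sym ν (false, true) fun ω => F ω - F2 ω) (M.sym ν (true, false) fun ω => F ω - F1 ω)
      (M.sym ν (false, false) fun ω => F ω - F1 ω)
      (M.sym ν (false, false) (mixedDiff M γ w₁ w₂ A)) :=
    { f00 := fun x => by
        have h1 : M.sym ν (false, false) F x ≤ transAvg (blockWeight γ (false, false))
            (M.sym ν (false, false) fun ω => A + (ad w₁ (F ω) + ad w₂ (F ω))) x := by
          conv_lhs => rw [show F = _ from funext rF]
          exact M.opSymbol_blk_res_le hγ _ (fA.add ((fF.ad w₁).add (fF.ad w₂))) x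
        refine h1.trans (transAvg_mono (fun y => ?_) x)
        refine (sym_add_le _ fA ((fF.ad w₁).add (fF.ad w₂)) y).trans ?_
        rw [sym_const_zero hA, mul_add]
        gcongr
        refine (sym_add_le _ (fF.ad w₁) (fF.ad w₂) y).trans ?_
        exact add_le_add (sym_ad_le hw₁ hη₁ _ fF y) (sym_ad_le hw₂ hη₂ _ fF y)
      f10 := fne _ (by simp)
      f01 := fne _ (by simp)
      f11 := fne _ (by simp)
      hd00 := fun x => by
        conv_lhs => rw [rD1]
        exact comp _ _ _ fF fD1 x
      hd01 := fun x => by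
        conv_lhs => rw [rD1]
        exact comp _ _ _ fF fD1 x
      hd00' := fun x => by
        conv_lhs => rw [rD2]
        exact comp _ _ _ fD2 fF x
      hd10 := fun x => by
        conv_lhs => rw [rD2]
        exact comp _ _ _ fD2 fF x
      hm := fun x => by
        rw [rM]
        exact comp _ _ _ fD2 fD1 x }
  -- These bounds only provide the finiteness needed for absorption and do not enter the estimate.
  have bd : ∀ (p : Bool × Bool) {G : ℝ × ℝ → 𝒜}, IsFamily G →
      ∃ N : ℝ≥0∞, N ≠ ⊤ ∧ ∀ x, M.sym ν p G x ≤ N :=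
    fun p _ hG => (M.isFamily_blk p hG).opSymbol_bound
  choose N hN1 hN2 using fun p => bd p fF
  obtain ⟨N1, hN11, hN12⟩ := bd (false, true) fD1
  obtain ⟨N2, hN21, hN22⟩ := bd (true, false) fD2
  refine H.bound (t := ENNReal.ofReal (8 * γ⁻¹)) (N := ∑ p, N p + (N1 + N2))
    (fun p => (blockWeight_univ hγ p).le) ENNReal.ofReal_ne_top ?_ ?_
    (measurable_opSymbol fA) (fun p => M.measurable_sym p fF) (M.measurable_sym _ fD1)
    (M.measurable_sym _ fD1) (M.measurable_sym _ fD2) (M.measurable_sym _ fD2)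
    (fun p x => (hN2 p x).trans ?_) (fun x => (hN12 x).trans ?_) (fun x => (hN22 x).trans ?_) x
  · rw [← ENNReal.ofReal_mul (by positivity), show (1 / 4 : ℝ≥0∞) = ENNReal.ofReal (1 / 4) by
      rw [ENNReal.ofReal_div_of_pos (by norm_num)]; simp]
    apply ENNReal.ofReal_le_ofReal
    rw [show 8 * γ⁻¹ * (2 * η) = (16 * η) / γ by field_simp; ring, div_le_iff₀ hγ]
    linarith
  · have : ∑ p, N p ≠ ⊤ := by simp [hN1]
    finiteness
  · exact (Finset.single_le_sum (f := N) (fun _ _ => zero_le) (Finset.mem_univ p)).trans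
      le_self_add
  · exact le_self_add.trans le_add_self
  · exact le_add_self.trans le_add_self

/-- Fourth-order remainder of the resolvent of one ancilla. -/
def singleRem (M : TwoAncilla 𝒜) (γ : ℝ) (w A : 𝒜) (ω : ℝ × ℝ) : 𝒜 :=
  res γ (M.h ω) (ad w (res γ (M.h ω) (ad w (res γ (M.h ω) (ad w (res γ (M.h ω) (ad w
    (res γ (M.h ω + w) A))))))))

/-- Parity alternates along the four couplings. The innermost of the four resolvents is therefore
odd and supplies the small factor `S`, up to `2 t e`, while the three outer ones contribute `t e`
each. -/
theorem sym_singleRem_le (hγ : 0 < γ) (sa : IsSelfAdjoint w)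
    (hw : ∀ b, w * M.P b = M.P (flipBy (true, false) b) * w) (hη₁ : ‖w‖ ≤ η)
    (hη : 64 * η ≤ γ) {A : 𝒜} (hA : ∀ b, Commute A (M.P b)) {S : ℝ≥0∞}
    (hS : ∀ x, transAvg (blockWeight γ (true, false)) (opSymbol ν fun _ => A) x ≤ S) (x : ℝ × ℝ) :
    M.sym ν (false, false) (singleRem M γ w A) x ≤
      2 * (ENNReal.ofReal (8 * γ⁻¹) ^ 4 * ENNReal.ofReal (2 * η) ^ 4) * S := by
  have hη0 : 0 ≤ η := (norm_nonneg _).trans hη₁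
  have fA : IsFamily fun _ : ℝ × ℝ => A := isFamily_const A
  set F : ℝ × ℝ → 𝒜 := fun ω => res γ (M.h ω + w) A with hF
  have fF : IsFamily F := isFamily_res_const hγ sa A
  have rF : F = fun ω => res γ (M.h ω) (A + ad w (F ω)) := by
    funext ω
    rw [res_add hγ (M.h_sa ω)]; exact res_add_eq hγ (M.h_sa ω) sa A
  have f1 : IsFamily fun ω => res γ (M.h ω) (ad w (F ω)) := isFamily_res_h hγ (fF.ad w)
  have f2 : IsFamily fun ω => res γ (M.h ω) (ad w (res γ (M.h ω) (ad w (F ω)))) :=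
    isFamily_res_h hγ (f1.ad w)
  have f3 : IsFamily fun ω => res γ (M.h ω) (ad w (res γ (M.h ω) (ad w
      (res γ (M.h ω) (ad w (F ω)))))) := isFamily_res_h hγ (f2.ad w)
  have comp := fun (p : Bool × Bool) (F : ℝ × ℝ → 𝒜) (hF : IsFamily F) =>
    sym_res_ad_le (ν := ν) (M := M) hγ hw hη₁ p hF
  obtain ⟨N, hN1, hN2⟩ := (M.isFamily_blk (false, false) fF).opSymbol_bound (ν := ν)
  refine single_bound (t := ENNReal.ofReal (8 * γ⁻¹)) (a := opSymbol ν fun _ => A)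
    (k0 := blockWeight γ (false, false)) (k1 := blockWeight γ (true, false))
    (f0 := M.sym ν (false, false) F) (f1 := M.sym ν (true, false) F)
    (blockWeight_univ hγ _).le (blockWeight_univ hγ _).le ENNReal.ofReal_ne_top ?_ hN1
    (measurable_opSymbol fA) (M.measurable_sym _ fF) (M.measurable_sym _ fF) hN2
    (fun x => ?_) (fun x => ?_) (comp (true, false) _ fF) (comp (false, false) _ f1)
    (comp (true, false) _ f2) (comp (false, false) _ f3) hS x
  · rw [← ENNReal.ofReal_mul (by positivity), show (1 / 4 : ℝ≥0∞) = ENNReal.ofReal (1 / 4) by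
      rw [ENNReal.ofReal_div_of_pos (by norm_num)]; simp]
    apply ENNReal.ofReal_le_ofReal
    rw [show 8 * γ⁻¹ * (2 * η) = (16 * η) / γ by field_simp; ring, div_le_iff₀ hγ]
    linarith
  · conv_lhs => rw [rF]
    refine (M.opSymbol_blk_res_le hγ _ (fA.add (fF.ad w)) x).trans (transAvg_mono (fun y => ?_) x)
    refine (sym_add_le _ fA (fF.ad w) y).trans ?_
    rw [sym_const_zero hA]
    gcongr
    exact sym_ad_le hw hη₁ _ fF y
  · conv_lhs => rw [rF]
    refine (M.opSymbol_blk_res_le hγ _ (fA.add (fF.ad w)) x).trans (transAvg_mono (fun y => ?_) x)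
    refine (sym_add_le _ fA (fF.ad w) y).trans ?_
    rw [sym_const_ne hA (by simp)]
    simp only [Pi.zero_apply, zero_add]
    exact sym_ad_le hw hη₁ _ fF y

end TwoAncilla

end TwoAncillaBounds

/-! ### Damped Fourier transforms of product frequency laws -/

section Fourier

/-- Fourier transform of a finite measure on the line. -/
def lineFourier (μ : Measure ℝ) (a : ℝ) : ℂ := ∫ ω, Complex.exp (-(Complex.I * ((a * ω : ℝ) : ℂ))) ∂μ

/-- The Fourier transform of `μ`, damped at rate `γ`, has uniform `L¹` bound `B`. -/
def FourierBound (γ : ℝ) (μ : Measure ℝ) (B : ℝ≥0∞) : Prop :=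
  ∀ c : ℝ, ∫⁻ s : ℝ, ENNReal.ofReal (Real.exp (-γ * |s|)) * ‖lineFourier μ (c + s)‖ₑ ≤ B

lemma continuous_lineFourier (μ : Measure ℝ) [IsFiniteMeasure μ] : Continuous (lineFourier μ) := by
  refine continuous_of_dominated (bound := fun _ => 1) (fun x => ?_) (fun x => ?_)
    (integrable_const 1) (.of_forall fun ω => ?_)
  · apply Continuous.aestronglyMeasurable; fun_prop
  · exact .of_forall fun ω => (norm_exp_neg_I_mul _).le
  · fun_prop

lemma enorm_lineFourier_le (μ : Measure ℝ) [IsFiniteMeasure μ] (hμ : μ.real Set.univ ≤ 1) (a : ℝ) :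
    ‖lineFourier μ a‖ₑ ≤ 1 := by
  rw [← enorm_one (G := ℝ), enorm_le_iff_norm_le, norm_one]
  refine (norm_integral_le_of_norm_le_const (C := 1)
    (.of_forall fun ω => (norm_exp_neg_I_mul _).le)).trans ?_
  rwa [one_mul]

variable {𝒜 : Type*} [CStarAlgebra 𝒜] {μ₁ μ₂ : Measure ℝ} [IsFiniteMeasure μ₁]
  [IsFiniteMeasure μ₂] {γ : ℝ} {B : ℝ≥0∞}

/-- For a constant observable the transform factorizes, so the decay in each variable is that of a
single frequency law. -/
lemma opSymbol_const (A : 𝒜) (x : ℝ × ℝ) : opSymbol (μ₁.prod μ₂) (fun _ => A) x =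
    ‖lineFourier μ₁ x.1‖ₑ * (‖lineFourier μ₂ x.2‖ₑ * ‖A‖ₑ) := by
  have : opFourier (μ₁.prod μ₂) (fun _ => A) x =
      (lineFourier μ₁ x.1 * lineFourier μ₂ x.2) • A := by
    rw [opFourier, integral_smul_const, lineFourier, lineFourier, ← integral_prod_mul]
    congr 2
    funext ω
    rw [← Complex.exp_add]
    congr 1
    push_cast; ring
  rw [opSymbol, this, enorm_smul, enorm_mul, mul_assoc]

/-- Reflection of the damped integral. -/
lemma lintegral_damped_sign (g : ℝ → ℝ≥0∞) (c ε : ℝ) (hε : ε = 1 ∨ ε = -1) :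
    ∫⁻ s : ℝ, ENNReal.ofReal (Real.exp (-γ * |s|)) * g (c + s * ε) =
      ∫⁻ s : ℝ, ENNReal.ofReal (Real.exp (-γ * |s|)) * g (c + s) := by
  rcases hε with rfl | rfl
  · simp
  · rw [← lintegral_neg_eq_self (μ := volume)
      (fun s : ℝ => ENNReal.ofReal (Real.exp (-γ * |s|)) * g (c + s))]
    simp

lemma transAvg_expLine_fst {g₁ g₂ : ℝ → ℝ≥0∞} (m₁ : Measurable g₁) (m₂ : Measurable g₂)
    (h₁ : ∀ c, ∫⁻ s : ℝ, ENNReal.ofReal (Real.exp (-γ * |s|)) * g₁ (c + s) ≤ B)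
    {ε : ℝ} (hε : ε = 1 ∨ ε = -1) (x : ℝ × ℝ) :
    transAvg (expLine γ (ε, 0)) (fun x => g₁ x.1 * g₂ x.2) x ≤ B * g₂ x.2 := by
  rw [transAvg_expLine _ _ (by fun_prop)]
  simp only [Prod.fst_add, Prod.smul_fst, smul_eq_mul, Prod.snd_add, Prod.smul_snd, mul_zero,
    add_zero, ← mul_assoc]
  rw [lintegral_mul_const _ (by fun_prop), lintegral_damped_sign _ _ _ hε]
  gcongr; exact h₁ _

lemma transAvg_expLine_snd {g₁ g₂ : ℝ → ℝ≥0∞} (m₁ : Measurable g₁) (m₂ : Measurable g₂)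
    (h₂ : ∀ c, ∫⁻ s : ℝ, ENNReal.ofReal (Real.exp (-γ * |s|)) * g₂ (c + s) ≤ B)
    {ε : ℝ} (hε : ε = 1 ∨ ε = -1) (x : ℝ × ℝ) :
    transAvg (expLine γ (0, ε)) (fun x => g₁ x.1 * g₂ x.2) x ≤ B * g₁ x.1 := by
  rw [transAvg_expLine _ _ (by fun_prop)]
  simp only [Prod.fst_add, Prod.smul_fst, smul_eq_mul, Prod.snd_add, Prod.smul_snd, mul_zero,
    add_zero, mul_left_comm _ (g₁ _)]
  rw [lintegral_const_mul _ (by fun_prop), lintegral_damped_sign _ _ _ hε, mul_comm B]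
  gcongr; exact h₂ _

lemma bsgn_eq (b : Bool) : bsgn b = 1 ∨ bsgn b = -1 := by cases b <;> simp [bsgn]

lemma blockDir_fst {p b : Bool × Bool} (hp : p.1 = true) :
    (blockDir p b).1 = 1 ∨ (blockDir p b).1 = -1 := by
  rcases b with ⟨_ | _, _⟩ <;> simp [blockDir, bsgn, hp]

lemma blockDir_snd {p b : Bool × Bool} (hp : p.2 = true) :
    (blockDir p b).2 = 1 ∨ (blockDir p b).2 = -1 := by
  rcases b with ⟨_, _ | _⟩ <;> simp [blockDir, bsgn, hp]

lemma transAvg_blockWeight_le {p : Bool × Bool} {ψ : ℝ × ℝ → ℝ≥0∞} {x : ℝ × ℝ} {c : ℝ≥0∞}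
    (h : ∀ b, transAvg (expLine γ (blockDir p b)) ψ x ≤ c) :
    transAvg (blockWeight γ p) ψ x ≤ 4 * c := by
  rw [transAvg_blockWeight]
  refine (Finset.sum_le_sum fun b _ => h b).trans ?_
  simp

lemma transAvg_expLine_damped {g : ℝ → ℝ≥0∞} (m : Measurable g)
    (h : ∀ c, ∫⁻ s : ℝ, ENNReal.ofReal (Real.exp (-γ * |s|)) * g (c + s) ≤ B)
    {w : ℝ × ℝ} (c : ℝ≥0∞) (x : ℝ × ℝ) (i : Bool)
    (hw : (if i then w.2 else w.1) = 1 ∨ (if i then w.2 else w.1) = -1) :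
    transAvg (expLine γ w) (fun x => c * g (if i then x.2 else x.1)) x ≤ c * B := by
  have mi : Measurable fun x : ℝ × ℝ => g (if i then x.2 else x.1) := by
    cases i <;> simp <;> fun_prop
  rw [transAvg_const_mul c mi, transAvg_expLine _ _ mi]
  have : ∀ s : ℝ, (if i then (x + s • w).2 else (x + s • w).1) =
      (if i then x.2 else x.1) + s * (if i then w.2 else w.1) := by
    intro s; cases i <;> simp
  simp_rw [this]
  rw [lintegral_damped_sign _ _ _ hw]
  gcongr
  exact h _

/-- The twofold averages of a product of Fourier transforms gain a factor `B` for each ancilla. -/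
lemma pairSup_opSymbol_const_le (h₁ : FourierBound γ μ₁ B) (h₂ : FourierBound γ μ₂ B) (A : 𝒜) :
    pairSup (blockWeight γ (true, false)) (blockWeight γ (false, true))
      (blockWeight γ (true, true)) (opSymbol (μ₁.prod μ₂) fun _ => A) ≤ 48 * B ^ 2 * ‖A‖ₑ := by
  have m₁ : Measurable fun a => ‖lineFourier μ₁ a‖ₑ := (continuous_lineFourier μ₁).enorm.measurable
  have m₂ : Measurable fun a => ‖lineFourier μ₂ a‖ₑ := (continuous_lineFourier μ₂).enorm.measurable
  have mp : Measurable (opSymbol (μ₁.prod μ₂) fun _ => A) := measurable_opSymbol (isFamily_const A)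
  have e : (opSymbol (μ₁.prod μ₂) fun _ => A) =
      fun x => ‖A‖ₑ * (‖lineFourier μ₁ x.1‖ₑ * ‖lineFourier μ₂ x.2‖ₑ) := by
    funext x; rw [opSymbol_const]; ring
  have mm : Measurable fun x : ℝ × ℝ => ‖lineFourier μ₁ x.1‖ₑ * ‖lineFourier μ₂ x.2‖ₑ :=
    (m₁.comp measurable_fst).mul (m₂.comp measurable_snd)
  have k10 : ∀ x, transAvg (blockWeight γ (true, false)) (opSymbol (μ₁.prod μ₂) fun _ => A) x ≤
      4 * (‖A‖ₑ * B) * ‖lineFourier μ₂ x.2‖ₑ := by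
    intro x
    rw [mul_assoc]
    refine transAvg_blockWeight_le fun b => ?_
    rw [e, transAvg_const_mul _ mm, mul_assoc]
    gcongr
    rw [show blockDir (true, false) b = (bsgn b.1, 0) by simp [blockDir]]
    exact transAvg_expLine_fst m₁ m₂ h₁ (bsgn_eq _) x
  have k01 : ∀ x, transAvg (blockWeight γ (false, true)) (opSymbol (μ₁.prod μ₂) fun _ => A) x ≤
      4 * (‖A‖ₑ * B) * ‖lineFourier μ₁ x.1‖ₑ := by
    intro x
    rw [mul_assoc]
    refine transAvg_blockWeight_le fun b => ?_
    rw [e, transAvg_const_mul _ mm, mul_assoc]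
    gcongr
    rw [show blockDir (false, true) b = (0, bsgn b.2) by simp [blockDir]]
    exact transAvg_expLine_snd m₁ m₂ h₂ (bsgn_eq _) x
  -- The directions of parity `(true, true)` move both coordinates. The axis average is therefore
  -- carried out innermost, removing its own coordinate, after which the diagonal average only sees
  -- the other one.
  have fin : ∀ x,
      (transAvg (blockWeight γ (false, true)) (transAvg (blockWeight γ (true, false))
        (opSymbol (μ₁.prod μ₂) fun _ => A)) x ≤ 4 * (4 * (‖A‖ₑ * B) * B)) ∧
      (transAvg (blockWeight γ (false, true)) (transAvg (blockWeight γ (true, true))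
        (opSymbol (μ₁.prod μ₂) fun _ => A)) x ≤ 4 * (4 * (‖A‖ₑ * B) * B)) ∧
      (transAvg (blockWeight γ (true, false)) (transAvg (blockWeight γ (true, true))
        (opSymbol (μ₁.prod μ₂) fun _ => A)) x ≤ 4 * (4 * (‖A‖ₑ * B) * B)) := by
    intro x
    refine ⟨(transAvg_mono k10 x).trans (transAvg_blockWeight_le fun b => ?_), ?_, ?_⟩
    · simpa using transAvg_expLine_damped m₂ h₂ (4 * (‖A‖ₑ * B)) x true
        (w := blockDir (false, true) b) (by simpa using blockDir_snd rfl)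
    · rw [transAvg_comm mp]
      refine (transAvg_mono k01 x).trans (transAvg_blockWeight_le fun b => ?_)
      simpa using transAvg_expLine_damped m₁ h₁ (4 * (‖A‖ₑ * B)) x false
        (w := blockDir (true, true) b) (by simpa using blockDir_fst rfl)
    · rw [transAvg_comm mp]
      refine (transAvg_mono k10 x).trans (transAvg_blockWeight_le fun b => ?_)
      simpa using transAvg_expLine_damped m₂ h₂ (4 * (‖A‖ₑ * B)) x true
        (w := blockDir (true, true) b) (by simpa using blockDir_snd rfl)
  refine iSup_le fun x => ?_
  obtain ⟨a, b, c⟩ := fin x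
  refine (add_le_add (add_le_add a b) c).trans (le_of_eq ?_)
  ring

lemma transAvg_opSymbol_const_le (h₁ : FourierBound γ μ₁ B) (hμ : μ₂.real Set.univ ≤ 1) (A : 𝒜)
    (x : ℝ × ℝ) : transAvg (blockWeight γ (true, false)) (opSymbol (μ₁.prod μ₂) fun _ => A) x ≤
      4 * B * ‖A‖ₑ := by
  have m₁ : Measurable fun a => ‖lineFourier μ₁ a‖ₑ := (continuous_lineFourier μ₁).enorm.measurable
  rw [mul_assoc]
  refine transAvg_blockWeight_le fun b => ?_
  have : ∀ x, opSymbol (μ₁.prod μ₂) (fun _ => A) x ≤ ‖A‖ₑ * ‖lineFourier μ₁ x.1‖ₑ := by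
    intro x
    rw [opSymbol_const, mul_comm]
    gcongr
    calc _ ≤ 1 * ‖A‖ₑ := by gcongr; exact enorm_lineFourier_le μ₂ hμ _
      _ = _ := one_mul _
  refine (transAvg_mono this x).trans ?_
  have := transAvg_expLine_damped m₁ h₁ ‖A‖ₑ x false (w := blockDir (true, false) b)
    (by simpa using blockDir_fst rfl)
  simpa [mul_comm] using this

open TwoAncilla in
/-- Frequency average of the mixed second difference. -/
theorem norm_integral_mixedDiff_le (M : TwoAncilla 𝒜) {w₁ w₂ : 𝒜} {η b : ℝ} (hγ : 0 < γ)
    (sa₁ : IsSelfAdjoint w₁) (sa₂ : IsSelfAdjoint w₂)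
    (hw₁ : ∀ b, w₁ * M.P b = M.P (flipBy (true, false) b) * w₁)
    (hw₂ : ∀ b, w₂ * M.P b = M.P (flipBy (false, true) b) * w₂) (hη₁ : ‖w₁‖ ≤ η) (hη₂ : ‖w₂‖ ≤ η)
    (hη : 64 * η ≤ γ) {A : 𝒜} (hA : ∀ b, Commute A (M.P b)) (hA1 : ‖A‖ ≤ 1) (hb : 0 ≤ b)
    (h₁ : FourierBound γ μ₁ (ENNReal.ofReal b)) (h₂ : FourierBound γ μ₂ (ENNReal.ofReal b)) :
    ‖∫ ω, M.blk (false, false) (mixedDiff M γ w₁ w₂ A ω) ∂(μ₁.prod μ₂)‖ ≤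
      2 ^ 24 * (η ^ 4 * b ^ 2 / γ ^ 3) := by
  have hη0 : 0 ≤ η := (norm_nonneg _).trans hη₁
  have h := (sym_mixedDiff_le (ν := μ₁.prod μ₂) hγ sa₁ sa₂ hw₁ hw₂ hη₁ hη₂ hη hA 0).trans
    (mul_le_mul_right (pairSup_opSymbol_const_le h₁ h₂ A) _)
  -- The Fourier transform at zero is the plain frequency average.
  have e : sym M (μ₁.prod μ₂) (false, false) (mixedDiff M γ w₁ w₂ A) 0 =
      ‖∫ ω, M.blk (false, false) (mixedDiff M γ w₁ w₂ A ω) ∂(μ₁.prod μ₂)‖ₑ := by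
    simp [sym, opSymbol, opFourier]
  have hA' : ‖A‖ₑ ≤ ENNReal.ofReal 1 := by
    rw [← ofReal_norm]; exact ENNReal.ofReal_le_ofReal hA1
  rw [e, ← ofReal_norm] at h
  have h2 := h.trans (mul_le_mul_right (mul_le_mul_right hA' _) _)
  rw [show (24 : ℝ≥0∞) = ENNReal.ofReal 24 by simp, show (48 : ℝ≥0∞) = ENNReal.ofReal 48 by simp,
    ← ENNReal.ofReal_pow (by positivity), ← ENNReal.ofReal_pow (by positivity),
    ← ENNReal.ofReal_pow (by positivity), ← ENNReal.ofReal_mul (by positivity),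
    ← ENNReal.ofReal_mul (by positivity), ← ENNReal.ofReal_mul (by positivity),
    ← ENNReal.ofReal_mul (by positivity), ← ENNReal.ofReal_mul (by positivity),
    ENNReal.ofReal_le_ofReal_iff (by positivity)] at h2
  refine h2.trans ?_
  have : 0 ≤ η ^ 4 * b ^ 2 / γ ^ 3 := by positivity
  -- The constant is `24 * 8 ^ 3 * 2 ^ 4 * 48`, rounded up to a power of two.
  calc _ = 9437184 * (η ^ 4 * b ^ 2 / γ ^ 3) := by field_simp; ring
    _ ≤ _ := by gcongr; norm_num

open TwoAncilla in
/-- Frequency average of the fourth-order remainder for one ancilla. -/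
theorem norm_integral_singleRem_le (M : TwoAncilla 𝒜) {w : 𝒜} {η b : ℝ} (hγ : 0 < γ)
    (sa : IsSelfAdjoint w) (hw : ∀ b, w * M.P b = M.P (flipBy (true, false) b) * w)
    (hη₁ : ‖w‖ ≤ η) (hη : 64 * η ≤ γ) {A : 𝒜} (hA : ∀ b, Commute A (M.P b)) (hA1 : ‖A‖ ≤ 1)
    (hb : 0 ≤ b) (h₁ : FourierBound γ μ₁ (ENNReal.ofReal b)) (hμ : μ₂.real Set.univ ≤ 1) :
    ‖∫ ω, M.blk (false, false) (singleRem M γ w A ω) ∂(μ₁.prod μ₂)‖ ≤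
      2 ^ 19 * (η ^ 4 * b / γ ^ 4) := by
  have hη0 : 0 ≤ η := (norm_nonneg _).trans hη₁
  have h := sym_singleRem_le (ν := μ₁.prod μ₂) hγ sa hw hη₁ hη hA
    (transAvg_opSymbol_const_le h₁ hμ A) 0
  have e : sym M (μ₁.prod μ₂) (false, false) (singleRem M γ w A) 0 =
      ‖∫ ω, M.blk (false, false) (singleRem M γ w A ω) ∂(μ₁.prod μ₂)‖ₑ := by
    simp [sym, opSymbol, opFourier]
  have hA' : ‖A‖ₑ ≤ ENNReal.ofReal 1 := by
    rw [← ofReal_norm]; exact ENNReal.ofReal_le_ofReal hA1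
  rw [e, ← ofReal_norm] at h
  have h2 := h.trans (mul_le_mul_right (mul_le_mul_right hA' _) _)
  rw [show (2 : ℝ≥0∞) = ENNReal.ofReal 2 by simp, show (4 : ℝ≥0∞) = ENNReal.ofReal 4 by simp,
    ← ENNReal.ofReal_pow (by positivity), ← ENNReal.ofReal_pow (by positivity),
    ← ENNReal.ofReal_mul (by positivity), ← ENNReal.ofReal_mul (by positivity),
    ← ENNReal.ofReal_mul (by positivity), ← ENNReal.ofReal_mul (by positivity),
    ← ENNReal.ofReal_mul (by positivity),
    ENNReal.ofReal_le_ofReal_iff (by positivity)] at h2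
  refine h2.trans (le_of_eq ?_)
  field_simp
  ring

end Fourier

/-! ### Thermal occupations and Fourier decay of the thermal frequency laws -/

section Scalars

/-- Thermal weight of the ancilla basis state `b`. -/
def boltz (β : ℝ) (b : Bool) (ω : ℝ) : ℝ := if b then occ (-(β * ω)) else occ (β * ω)

/-- Uniform law of the ancilla frequencies. -/
def freqLaw (Ω : ℝ) : Measure ℝ := ProbabilityTheory.cond volume (Set.Icc (-Ω) Ω)

lemma occ_pos (x : ℝ) : 0 < occ x := by unfold occ; positivity

lemma occ_add_occ_neg (x : ℝ) : occ x + occ (-x) = 1 := by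
  unfold occ
  rw [Real.exp_neg]
  have := Real.exp_pos x
  field_simp
  ring

lemma occ_le_one (x : ℝ) : occ x ≤ 1 := by
  linarith [occ_add_occ_neg x, occ_pos (-x)]

lemma hasDerivAt_occ (x : ℝ) : HasDerivAt occ (-(occ x * occ (-x))) x := by
  have h1 : HasDerivAt (fun x => 1 + Real.exp x) (Real.exp x) x :=
    (Real.hasDerivAt_exp x).const_add 1
  have hp : 1 + Real.exp x ≠ 0 := by positivity
  have h2 := (h1.inv hp)
  have e : (fun x => (1 + Real.exp x)⁻¹) = occ := by funext y; simp [occ]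
  rw [show ((fun x => 1 + Real.exp x)⁻¹ : ℝ → ℝ) = occ from e] at h2
  convert! h2 using 1
  unfold occ
  rw [Real.exp_neg]
  have := Real.exp_pos x
  field_simp
  ring

lemma continuous_occ : Continuous occ :=
  continuous_iff_continuousAt.2 fun x => (hasDerivAt_occ x).continuousAt

lemma boltz_pos (β : ℝ) (b : Bool) (ω : ℝ) : 0 < boltz β b ω := by
  unfold boltz; split_ifs <;> exact occ_pos _

lemma boltz_le_one (β : ℝ) (b : Bool) (ω : ℝ) : boltz β b ω ≤ 1 := by
  unfold boltz; split_ifs <;> exact occ_le_one _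

lemma boltz_eq (β : ℝ) (b : Bool) (ω : ℝ) : boltz β b ω = occ (bsgn b * β * ω) := by
  cases b <;> simp [boltz, bsgn]

lemma sum_boltz (β ω : ℝ) : ∑ b, boltz β b ω = 1 := by
  simp [boltz, add_comm, occ_add_occ_neg]

lemma continuous_boltz (β : ℝ) (b : Bool) : Continuous (boltz β b) := by
  simp_rw [funext (boltz_eq β b)]
  exact continuous_occ.comp (by fun_prop)

lemma abs_occ_sub_occ_le (x y : ℝ) : |occ x - occ y| ≤ min 1 |x - y| := by
  refine le_min ?_ ?_
  · rw [abs_le]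
    constructor <;> linarith [occ_pos x, occ_pos y, occ_le_one x, occ_le_one y]
  · have := Convex.norm_image_sub_le_of_norm_hasDerivWithin_le (f := occ) (C := 1)
      (s := Set.univ) (x := y) (y := x)
      (f' := fun x => -(occ x * occ (-x))) (fun x _ => (hasDerivAt_occ x).hasDerivWithinAt)
      (fun x _ => by
        rw [norm_neg, Real.norm_eq_abs, abs_of_pos (mul_pos (occ_pos _) (occ_pos _))]
        exact mul_le_one₀ (occ_le_one _) (occ_pos _).le (occ_le_one _))
      convex_univ (Set.mem_univ _) (Set.mem_univ _)
    simpa using this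

variable {Ω : ℝ}

lemma freqLaw_eq :
    freqLaw Ω = (ENNReal.ofReal (2 * Ω))⁻¹ • volume.restrict (Set.Icc (-Ω) Ω) := by
  rw [freqLaw, ProbabilityTheory.cond, Real.volume_Icc]
  congr 3; ring

lemma isProbabilityMeasure_freqLaw (hΩ : 0 < Ω) : IsProbabilityMeasure (freqLaw Ω) := by
  apply ProbabilityTheory.cond_isProbabilityMeasure_of_finite
  · rw [Real.volume_Icc]; simp; linarith
  · rw [Real.volume_Icc]; exact ENNReal.ofReal_ne_top

lemma integral_freqLaw (hΩ : 0 < Ω) {E : Type*} [NormedAddCommGroup E] [NormedSpace ℝ E]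
    (f : ℝ → E) : ∫ ω, f ω ∂(freqLaw Ω) = (2 * Ω)⁻¹ • ∫ ω in (-Ω)..Ω, f ω := by
  rw [freqLaw_eq, integral_smul_measure, ENNReal.toReal_inv,
    ENNReal.toReal_ofReal (by positivity), intervalIntegral.integral_of_le (by linarith),
    integral_Icc_eq_integral_Ioc]

/-- The frequency law weighted by the thermal weight of the state `b`. -/
def thermalLaw (β Ω : ℝ) (b : Bool) : Measure ℝ :=
  (freqLaw Ω).withDensity fun ω => ENNReal.ofReal (boltz β b ω)

lemma integral_thermalLaw (β : ℝ) (b : Bool) {E : Type*} [NormedAddCommGroup E] [NormedSpace ℝ E]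
    (f : ℝ → E) : ∫ ω, f ω ∂(thermalLaw β Ω b) = ∫ ω, boltz β b ω • f ω ∂(freqLaw Ω) := by
  have h : (fun ω => ENNReal.ofReal (boltz β b ω)) =
      fun ω => ((Real.toNNReal (boltz β b ω) : ℝ≥0) : ℝ≥0∞) := rfl
  rw [thermalLaw, h, integral_withDensity_eq_integral_smul
    (continuous_boltz β b).measurable.real_toNNReal]
  congr 1
  funext ω
  rw [NNReal.smul_def, Real.coe_toNNReal _ (boltz_pos _ _ _).le]

lemma thermalLaw_univ_le (hΩ : 0 < Ω) (β : ℝ) (b : Bool) : thermalLaw β Ω b Set.univ ≤ 1 := by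
  have := isProbabilityMeasure_freqLaw hΩ
  rw [thermalLaw, withDensity_apply _ .univ, Measure.restrict_univ]
  calc _ ≤ ∫⁻ _, 1 ∂(freqLaw Ω) := lintegral_mono fun ω => by
        simpa using boltz_le_one β b ω
    _ = 1 := by simp

lemma isFiniteMeasure_thermalLaw (hΩ : 0 < Ω) (β : ℝ) (b : Bool) :
    IsFiniteMeasure (thermalLaw β Ω b) := ⟨(thermalLaw_univ_le hΩ β b).trans_lt (by simp)⟩

lemma thermalLaw_real_univ_le (hΩ : 0 < Ω) (β : ℝ) (b : Bool) :
    (thermalLaw β Ω b).real Set.univ ≤ 1 :=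
  ENNReal.toReal_le_of_le_ofReal (by norm_num) (by simpa using thermalLaw_univ_le hΩ β b)

/-- The occupation is monotone with values in `(0, 1)`, so its total variation is at most one at
every temperature. This keeps the Fourier bounds uniform in `β`. -/
lemma abs_integral_deriv_occ_le (k : ℝ) :
    ∫ ω in (-Ω)..Ω, |k * -(occ (k * ω) * occ (-(k * ω)))| ≤ 1 := by
  have hd : ∀ ω, HasDerivAt (fun ω => occ (k * ω)) (k * -(occ (k * ω) * occ (-(k * ω)))) ω := by
    intro ω
    have := (hasDerivAt_occ (k * ω)).comp ω ((hasDerivAt_id ω).const_mul k)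
    convert! this using 1
    simp; ring
  have hc : Continuous fun ω => k * -(occ (k * ω) * occ (-(k * ω))) := by
    have := continuous_occ
    fun_prop
  have hI := intervalIntegral.integral_eq_sub_of_hasDerivAt (a := -Ω) (b := Ω)
    (fun ω _ => hd ω) (hc.intervalIntegrable _ _)
  rcases le_total 0 k with hk | hk
  · have e : ∀ ω, |k * -(occ (k * ω) * occ (-(k * ω)))| =
        -(k * -(occ (k * ω) * occ (-(k * ω)))) := fun ω => by
      apply abs_of_nonpos
      rw [mul_neg]
      have := mul_nonneg hk (mul_pos (occ_pos (k * ω)) (occ_pos (-(k * ω)))).le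
      linarith
    simp_rw [e]
    rw [intervalIntegral.integral_neg, hI]
    linarith [occ_pos (k * Ω), occ_le_one (k * -Ω)]
  · have e : ∀ ω, |k * -(occ (k * ω) * occ (-(k * ω)))| =
        k * -(occ (k * ω) * occ (-(k * ω))) := fun ω => by
      apply abs_of_nonneg
      rw [mul_neg, ← neg_mul]
      exact mul_nonneg (by linarith) (mul_pos (occ_pos (k * ω)) (occ_pos (-(k * ω)))).le
    simp_rw [e]
    rw [hI]
    linarith [occ_pos (k * -Ω), occ_le_one (k * Ω)]

/-- One integration by parts. The boundary weights add up to one, the total variation is at most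
one, and together they give the `2`. -/
lemma norm_integral_occ_phase_le (hΩ : 0 < Ω) (k : ℝ) {a : ℝ} (ha : a ≠ 0) :
    ‖∫ ω in (-Ω)..Ω, (occ (k * ω) : ℂ) * Complex.exp (-(Complex.I * ((a * ω : ℝ) : ℂ)))‖ ≤
      2 / |a| := by
  have ha' : (-(Complex.I * (a : ℂ))) ≠ 0 := by simp [ha]
  have hu : ∀ ω : ℝ, HasDerivAt (fun ω : ℝ => (occ (k * ω) : ℂ))
      ((k * -(occ (k * ω) * occ (-(k * ω))) : ℝ) : ℂ) ω := by
    intro ω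
    have := (hasDerivAt_occ (k * ω)).comp ω ((hasDerivAt_id ω).const_mul k)
    refine HasDerivAt.ofReal_comp (f := fun ω => occ (k * ω)) ?_
    convert! this using 1
    simp; ring
  have hv : ∀ ω : ℝ, HasDerivAt
      (fun ω : ℝ => Complex.exp (-(Complex.I * ((a * ω : ℝ) : ℂ))) / (-(Complex.I * (a : ℂ))))
      (Complex.exp (-(Complex.I * ((a * ω : ℝ) : ℂ)))) ω := by
    intro ω
    have h1 : HasDerivAt (fun ω : ℝ => -(Complex.I * ((a * ω : ℝ) : ℂ))) (-(Complex.I * (a : ℂ))) ω := by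
      have := ((hasDerivAt_id ω).const_mul a).ofReal_comp.const_mul Complex.I |>.fun_neg
      simpa using this
    have := (h1.cexp).div_const (-(Complex.I * (a : ℂ)))
    rwa [mul_div_assoc, div_self ha', mul_one] at this
  have co := continuous_occ
  have cu : Continuous fun ω : ℝ => ((k * -(occ (k * ω) * occ (-(k * ω))) : ℝ) : ℂ) := by fun_prop
  have cv : Continuous fun ω : ℝ => Complex.exp (-(Complex.I * ((a * ω : ℝ) : ℂ))) := by fun_prop
  rw [intervalIntegral.integral_mul_deriv_eq_deriv_mul (fun ω _ => hu ω) (fun ω _ => hv ω)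
    (cu.intervalIntegrable _ _) (cv.intervalIntegrable _ _)]
  have nv : ∀ ω : ℝ, ‖Complex.exp (-(Complex.I * ((a * ω : ℝ) : ℂ))) / (-(Complex.I * (a : ℂ)))‖ =
      1 / |a| := by
    intro ω
    rw [norm_div, norm_exp_neg_I_mul, norm_neg, norm_mul, Complex.norm_I, one_mul,
      Complex.norm_real, Real.norm_eq_abs]
  have no : ∀ x : ℝ, ‖(occ x : ℂ)‖ = occ x := fun x => by
    rw [Complex.norm_real, Real.norm_eq_abs, abs_of_pos (occ_pos x)]
  refine (norm_sub_le _ _).trans ?_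
  have hs : occ (k * Ω) + occ (k * -Ω) = 1 := by
    rw [mul_neg]; exact occ_add_occ_neg _
  have h1 := norm_sub_le ((occ (k * Ω) : ℂ) *
    (Complex.exp (-(Complex.I * ((a * Ω : ℝ) : ℂ))) / (-(Complex.I * (a : ℂ)))))
    ((occ (k * -Ω) : ℂ) *
    (Complex.exp (-(Complex.I * ((a * -Ω : ℝ) : ℂ))) / (-(Complex.I * (a : ℂ)))))
  rw [norm_mul, norm_mul, nv, nv, no, no, ← add_mul, hs, one_mul] at h1
  have h2 : ‖∫ ω in (-Ω)..Ω, ((k * -(occ (k * ω) * occ (-(k * ω))) : ℝ) : ℂ) *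
      (Complex.exp (-(Complex.I * ((a * ω : ℝ) : ℂ))) / (-(Complex.I * (a : ℂ))))‖ ≤ 1 / |a| := by
    refine (intervalIntegral.norm_integral_le_integral_norm (by linarith)).trans ?_
    simp_rw [norm_mul, nv, Complex.norm_real, Real.norm_eq_abs]
    rw [intervalIntegral.integral_mul_const]
    have := abs_integral_deriv_occ_le (Ω := Ω) k
    have ha2 : 0 < 1 / |a| := by positivity
    nlinarith
  calc _ ≤ 1 / |a| + 1 / |a| := add_le_add h1 h2
    _ = _ := by ring

lemma norm_lineFourier_thermalLaw_le (hΩ : 0 < Ω) (β : ℝ) (b : Bool) (a : ℝ) :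
    ‖lineFourier (thermalLaw β Ω b) a‖ ≤ 2 / (1 + Ω * |a|) := by
  have := isFiniteMeasure_thermalLaw hΩ β b
  have h1 : ‖lineFourier (thermalLaw β Ω b) a‖ ≤ 1 := by
    have := enorm_lineFourier_le (thermalLaw β Ω b) (thermalLaw_real_univ_le hΩ β b) a
    rwa [← enorm_one (G := ℝ), enorm_le_iff_norm_le, norm_one] at this
  have h2 : ‖lineFourier (thermalLaw β Ω b) a‖ * (Ω * |a|) ≤ 1 := by
    rcases eq_or_ne a 0 with rfl | ha
    · simp
    have := norm_integral_occ_phase_le hΩ (bsgn b * β) ha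
    rw [lineFourier, integral_thermalLaw, integral_freqLaw hΩ, norm_smul, Real.norm_eq_abs,
      abs_of_pos (by positivity)]
    simp_rw [boltz_eq, Complex.real_smul]
    have ha' : 0 < |a| := abs_pos.2 ha
    calc _ ≤ (2 * Ω)⁻¹ * (2 / |a|) * (Ω * |a|) := by gcongr
      _ = 1 := by field_simp
  rw [le_div_iff₀ (by positivity)]
  linarith

/-- Uniform `L¹` bound of the damped Fourier transform of the thermal frequency law. -/
def gainConst (Ω γ : ℝ) : ℝ := 4 / Ω * (1 + Real.log (1 + Ω / γ))

lemma gainConst_pos {γ : ℝ} (hΩ : 0 < Ω) (hγ : 0 < γ) : 0 < gainConst Ω γ := by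
  have : 0 ≤ Real.log (1 + Ω / γ) := Real.log_nonneg (by have := div_pos hΩ hγ; linarith)
  unfold gainConst; positivity

lemma lintegral_log_profile {γ : ℝ} (hΩ : 0 < Ω) (hγ : 0 < γ) :
    ∫⁻ u : ℝ, ENNReal.ofReal (if |u| ≤ γ⁻¹ then 2 / (1 + Ω * |u|) else 0) =
      ENNReal.ofReal (4 / Ω * Real.log (1 + Ω / γ)) := by
  have hg : 0 < γ⁻¹ := inv_pos.2 hγ
  have e : (fun u : ℝ => if |u| ≤ γ⁻¹ then 2 / (1 + Ω * |u|) else 0) =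
      (Set.Icc (-γ⁻¹) γ⁻¹).indicator fun u => 2 / (1 + Ω * |u|) := by
    funext u
    simp [Set.indicator_apply, Set.mem_Icc, abs_le]
  have hc : Continuous fun u : ℝ => 2 / (1 + Ω * |u|) := by
    refine Continuous.div (by fun_prop) (by fun_prop) fun u => ?_
    have : 0 ≤ Ω * |u| := by positivity
    linarith
  have hi : Integrable (fun u : ℝ => if |u| ≤ γ⁻¹ then 2 / (1 + Ω * |u|) else 0) := by
    rw [e]
    exact (hc.integrableOn_Icc).integrable_indicator measurableSet_Icc
  have hpos : ∀ u : ℝ, 0 < 1 + Ω * |u| := fun u => by positivity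
  rw [← ofReal_integral_eq_lintegral_ofReal hi (.of_forall fun u => by
    simp only [Pi.zero_apply]; split_ifs <;> positivity)]
  congr 1
  rw [integral_comp_abs (f := fun u => if u ≤ γ⁻¹ then 2 / (1 + Ω * u) else 0)]
  have e2 : ∫ u in Set.Ioi (0 : ℝ), (if u ≤ γ⁻¹ then 2 / (1 + Ω * u) else 0) =
      ∫ u in (0 : ℝ)..γ⁻¹, 2 / (1 + Ω * u) := by
    rw [intervalIntegral.integral_of_le hg.le, ← integral_indicator measurableSet_Ioi,
      ← integral_indicator measurableSet_Ioc]
    congr 1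
    funext u
    simp only [Set.indicator_apply, Set.mem_Ioi, Set.mem_Ioc]
    split_ifs <;> simp_all
  rw [e2]
  have hd : ∀ u ∈ Set.uIcc (0 : ℝ) γ⁻¹,
      HasDerivAt (fun u => 2 / Ω * Real.log (1 + Ω * u)) (2 / (1 + Ω * u)) u := by
    intro u hu
    rw [Set.uIcc_of_le hg.le] at hu
    have hp : 1 + Ω * u ≠ 0 := by have := hu.1; positivity
    have := (((hasDerivAt_id u).const_mul Ω).const_add 1).log hp |>.const_mul (2 / Ω)
    convert! this using 1
    simp; field_simp
  have hci : IntervalIntegrable (fun u => 2 / (1 + Ω * u)) volume 0 γ⁻¹ := by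
    refine ContinuousOn.intervalIntegrable fun u hu => ?_
    rw [Set.uIcc_of_le hg.le] at hu
    have hp : 1 + Ω * u ≠ 0 := by have := hu.1; positivity
    exact ContinuousAt.continuousWithinAt (ContinuousAt.div (by fun_prop) (by fun_prop) hp)
  rw [intervalIntegral.integral_eq_sub_of_hasDerivAt hd hci]
  simp [div_eq_mul_inv]; ring

/-- For `|c + s| ≤ 1 / γ` the decay `2 / (1 + Ω |u|)` integrates to a logarithm. Beyond that the
transform is at most `2 γ / Ω`, against a damping weight of mass `2 / γ`. The trivial bound would be
`2 / γ`, so the gain is `γ / Ω` up to a logarithm. -/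
lemma fourierBound_thermalLaw {γ : ℝ} (hΩ : 0 < Ω) (hγ : 0 < γ) (β : ℝ) (b : Bool) :
    FourierBound γ (thermalLaw β Ω b) (ENNReal.ofReal (gainConst Ω γ)) := by
  intro c
  have hpt : ∀ s : ℝ, ENNReal.ofReal (Real.exp (-γ * |s|)) *
      ‖lineFourier (thermalLaw β Ω b) (c + s)‖ₑ ≤
      ENNReal.ofReal (if |c + s| ≤ γ⁻¹ then 2 / (1 + Ω * |c + s|) else 0) +
        ENNReal.ofReal (2 * γ / Ω * Real.exp (-γ * |s|)) := by
    intro s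
    have h1 := norm_lineFourier_thermalLaw_le hΩ β b (c + s)
    have hexp : Real.exp (-γ * |s|) ≤ 1 := Real.exp_le_one_iff.2 (by
      have := abs_nonneg s; nlinarith)
    rw [← ofReal_norm, ← ENNReal.ofReal_mul (Real.exp_pos _).le,
      ← ENNReal.ofReal_add (by split_ifs <;> positivity) (by positivity)]
    apply ENNReal.ofReal_le_ofReal
    split_ifs with h
    · have h0 : 0 ≤ 2 * γ / Ω * Real.exp (-γ * |s|) := by positivity
      calc _ ≤ 1 * (2 / (1 + Ω * |c + s|)) := by gcongr
        _ ≤ _ := by linarith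
    · push Not at h
      rw [zero_add, mul_comm]
      gcongr
      refine h1.trans ?_
      have : Ω / γ ≤ 1 + Ω * |c + s| := by
        have : Ω * γ⁻¹ ≤ Ω * |c + s| := by gcongr
        rw [div_eq_mul_inv]; linarith
      calc 2 / (1 + Ω * |c + s|) ≤ 2 / (Ω / γ) := by gcongr
        _ = _ := by field_simp
  refine (lintegral_mono hpt).trans ?_
  rw [lintegral_add_right _ (by fun_prop), lintegral_add_left_eq_self
    (fun u : ℝ => ENNReal.ofReal (if |u| ≤ γ⁻¹ then 2 / (1 + Ω * |u|) else 0)) c,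
    lintegral_log_profile hΩ hγ, ← ofReal_integral_eq_lintegral_ofReal
    ((integrable_exp_neg_abs hγ).1.const_mul _) (.of_forall fun s => by positivity),
    integral_const_mul, (integrable_exp_neg_abs hγ).2, ← ENNReal.ofReal_add]
  · apply ENNReal.ofReal_le_ofReal
    apply le_of_eq
    unfold gainConst
    field_simp
    ring
  · have : 0 ≤ Real.log (1 + Ω / γ) := Real.log_nonneg (by have := div_pos hΩ hγ; linarith)
    positivity
  · positivity

end Scalars

/-! ### Lorentzian integrals and exponentially distributed times -/

section LorentzianIntegrals

variable {Ω γ β : ℝ}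

/-- Origin of the smoothed window of the chain: it is the share of the Lorentzian at `E` covered by
the available ancilla frequencies. -/
lemma integral_lorentzian (hγ : 0 < γ) (hΩ : 0 < Ω) (E : ℝ) :
    ∫ ω in (-Ω)..Ω, 2 / (γ ^ 2 + (E - ω) ^ 2) = 2 * Real.pi / γ * window Ω γ (E / Ω) := by
  have hd : ∀ ω ∈ Set.uIcc (-Ω) Ω, HasDerivAt (fun ω => 2 / γ * Real.arctan ((ω - E) / γ))
      (2 / (γ ^ 2 + (E - ω) ^ 2)) ω := by
    intro ω _
    have := ((((hasDerivAt_id ω).sub_const E).div_const γ).arctan).const_mul (2 / γ)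
    convert! this using 1
    have h1 : γ ^ 2 + (E - ω) ^ 2 ≠ 0 := by positivity
    have h2 : 1 + ((id ω - E) / γ) ^ 2 ≠ 0 := by positivity
    simp only [id] at h2 ⊢
    field_simp
    ring
  have hc : Continuous fun ω : ℝ => 2 / (γ ^ 2 + (E - ω) ^ 2) :=
    Continuous.div (by fun_prop) (by fun_prop) fun ω => by positivity
  rw [intervalIntegral.integral_eq_sub_of_hasDerivAt hd (hc.intervalIntegrable _ _), window]
  have e1 : Ω / γ * (1 - E / Ω) = (Ω - E) / γ := by field_simp
  have e2 : Ω / γ * (1 + E / Ω) = -((-Ω - E) / γ) := by field_simp; ring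
  rw [e1, e2, Real.arctan_neg]
  field_simp
  ring

/-- Integrable majorant of `min 1 (β|u|)` times a Lorentzian. -/
def cutLorentz (β γ u : ℝ) : ℝ := if u ≤ β⁻¹ then 2 * β * u / (γ ^ 2 + u ^ 2) else 2 * u ^ (-2 : ℝ)

/-- Splitting at the thermal scale `β⁻¹`, the linear factor leaves a logarithm below it and the tail
`u ^ (-2)` gives `2 β` above it. -/
lemma integral_cutLorentz (hγ : 0 < γ) (hβ : 0 < β) :
    IntegrableOn (cutLorentz β γ) (Set.Ioi 0) ∧
    ∫ u in Set.Ioi (0 : ℝ), cutLorentz β γ u = β * Real.log (1 + (1 / (β * γ)) ^ 2) + 2 * β := by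
  have hb : 0 < β⁻¹ := inv_pos.2 hβ
  have hc : Continuous fun u : ℝ => 2 * β * u / (γ ^ 2 + u ^ 2) :=
    Continuous.div (by fun_prop) (by fun_prop) fun ω => by positivity
  have e1 : Set.EqOn (fun u : ℝ => 2 * β * u / (γ ^ 2 + u ^ 2)) (cutLorentz β γ)
      (Set.Ioc 0 β⁻¹) := fun u hu => by simp [cutLorentz, hu.2]
  have e2 : Set.EqOn (fun u : ℝ => 2 * u ^ (-2 : ℝ)) (cutLorentz β γ) (Set.Ioi β⁻¹) :=
    fun u hu => by simp [cutLorentz, not_le.2 (Set.mem_Ioi.1 hu)]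
  have i1 : IntegrableOn (cutLorentz β γ) (Set.Ioc 0 β⁻¹) :=
    (hc.integrableOn_Ioc).congr_fun e1 measurableSet_Ioc
  have i2 : IntegrableOn (cutLorentz β γ) (Set.Ioi β⁻¹) :=
    have i3 : IntegrableOn (fun u : ℝ => 2 * u ^ (-2 : ℝ)) (Set.Ioi β⁻¹) :=
      (integrableOn_Ioi_rpow_of_lt (by norm_num : (-2 : ℝ) < -1) hb).const_mul 2
    i3.congr_fun e2 measurableSet_Ioi
  rw [← Set.Ioc_union_Ioi_eq_Ioi hb.le]
  refine ⟨i1.union i2, ?_⟩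
  rw [setIntegral_union (Set.Ioc_disjoint_Ioi le_rfl) measurableSet_Ioi i1 i2,
    ← setIntegral_congr_fun measurableSet_Ioc e1, ← setIntegral_congr_fun measurableSet_Ioi e2,
    integral_const_mul, integral_Ioi_rpow_of_lt (by norm_num) hb,
    ← intervalIntegral.integral_of_le hb.le]
  have hd : ∀ u ∈ Set.uIcc 0 β⁻¹, HasDerivAt (fun u => β * Real.log (γ ^ 2 + u ^ 2))
      (2 * β * u / (γ ^ 2 + u ^ 2)) u := by
    intro u _
    have hp : γ ^ 2 + u ^ 2 ≠ 0 := by positivity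
    have := (((hasDerivAt_pow 2 u).const_add (γ ^ 2)).log hp).const_mul β
    convert! this using 1
    simp; ring
  rw [intervalIntegral.integral_eq_sub_of_hasDerivAt hd (hc.intervalIntegrable _ _)]
  have : (β⁻¹) ^ ((-2 : ℝ) + 1) = β := by
    norm_num [Real.rpow_neg_one]
  rw [this, ← mul_sub, ← Real.log_div (by positivity) (by positivity)]
  congr 1
  · congr 2
    field_simp
    ring
  · ring

lemma min_mul_lorentz_le (hβ : 0 < β) (u : ℝ) :
    min 1 (β * |u|) * (2 / (γ ^ 2 + u ^ 2)) ≤ cutLorentz β γ |u| := by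
  unfold cutLorentz
  split_ifs with h
  · calc _ ≤ (β * |u|) * (2 / (γ ^ 2 + u ^ 2)) := by gcongr; exact min_le_right _ _
      _ = _ := by rw [sq_abs]; ring
  · have hu : 0 < |u| := (inv_pos.2 hβ).trans (not_le.1 h)
    calc _ ≤ 1 * (2 / (γ ^ 2 + u ^ 2)) := by gcongr; exact min_le_left _ _
      _ ≤ 2 / (u ^ 2) := by
        rw [one_mul]
        have : 0 < u ^ 2 := by rw [← sq_abs]; positivity
        gcongr
        nlinarith [sq_nonneg γ]
      _ = _ := by
        rw [Real.rpow_neg hu.le, show (2 : ℝ) = ((2 : ℕ) : ℝ) by norm_num, Real.rpow_natCast, sq_abs]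
        norm_num [div_eq_mul_inv]

/-- Replacing the occupation at the ancilla frequency by the one at the transition frequency. -/
lemma abs_thermal_lorentz_sub_le (hγ : 0 < γ) (hΩ : 0 < Ω) (hβ : 0 < β) (E : ℝ) :
    |(∫ ω in (-Ω)..Ω, occ (β * ω) * (2 / (γ ^ 2 + (E - ω) ^ 2))) -
      occ (β * E) * (2 * Real.pi / γ * window Ω γ (E / Ω))| ≤
      4 * β * (1 + Real.log (1 + 1 / (β * γ))) := by
  have hc : Continuous fun ω : ℝ => 2 / (γ ^ 2 + (E - ω) ^ 2) :=
    Continuous.div (by fun_prop) (by fun_prop) fun ω => by positivity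
  have co := continuous_occ
  rw [← integral_lorentzian hγ hΩ, ← intervalIntegral.integral_const_mul,
    ← intervalIntegral.integral_sub (by apply Continuous.intervalIntegrable; fun_prop)
      (by apply Continuous.intervalIntegrable; fun_prop)]
  obtain ⟨hi, hI⟩ := integral_cutLorentz hγ hβ
  have hiw : Integrable fun u : ℝ => cutLorentz β γ |u| := by
    rw [← integrableOn_univ, ← Set.Iic_union_Ioi (a := (0 : ℝ))]
    refine IntegrableOn.union ?_ (hi.congr_fun (fun u hu => by
      rw [abs_of_pos (Set.mem_Ioi.1 hu)]) measurableSet_Ioi)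
    have := hi.comp_neg
    rw [Set.neg_Ioi, neg_zero] at this
    rw [integrableOn_Iic_iff_integrableOn_Iio]
    exact this.congr_fun (fun u hu => by
      simp only [abs_of_neg (Set.mem_Iio.1 hu)]) measurableSet_Iio
  -- The occupation changes by at most `min 1 (β |E - ω|)`. This vanishes at the centre of the
  -- Lorentzian, so the error is logarithmic in `1 / (β γ)` although the Lorentzian itself has mass
  -- of order `1 / γ`.
  have hle : ∀ ω, ‖occ (β * ω) * (2 / (γ ^ 2 + (E - ω) ^ 2)) -
      occ (β * E) * (2 / (γ ^ 2 + (E - ω) ^ 2))‖ ≤ cutLorentz β γ |E - ω| := by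
    intro ω
    refine le_trans ?_ (min_mul_lorentz_le hβ _)
    have hp : 0 < 2 / (γ ^ 2 + (E - ω) ^ 2) := by positivity
    rw [← sub_mul, norm_mul, Real.norm_eq_abs, Real.norm_eq_abs, abs_of_pos hp]
    gcongr
    refine (abs_occ_sub_occ_le _ _).trans (le_of_eq ?_)
    rw [← mul_sub, abs_mul, abs_of_pos hβ, abs_sub_comm]
  have hint : Integrable fun ω : ℝ => cutLorentz β γ |E - ω| := hiw.comp_sub_left E
  rw [intervalIntegral.integral_of_le (by linarith), ← Real.norm_eq_abs]
  refine (norm_integral_le_of_norm_le hint.integrableOn (.of_forall hle)).trans ?_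
  have hnn : ∀ u : ℝ, 0 ≤ cutLorentz β γ |u| := fun u => by
    unfold cutLorentz; split_ifs <;> positivity
  refine (setIntegral_le_integral hint (.of_forall fun ω => hnn _)).trans ?_
  rw [integral_sub_left_eq_self (fun u => cutLorentz β γ |u|) volume E,
    integral_comp_abs (f := cutLorentz β γ), hI]
  have hy : 0 ≤ 1 / (β * γ) := by positivity
  have : Real.log (1 + (1 / (β * γ)) ^ 2) ≤ 2 * Real.log (1 + 1 / (β * γ)) := by
    generalize 1 / (β * γ) = y at hy
    have h2 : 2 * Real.log (1 + y) = Real.log ((1 + y) ^ 2) := by rw [Real.log_pow]; norm_num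
    rw [h2]
    exact Real.log_le_log (by positivity) (by nlinarith)
  nlinarith

lemma integral_expMeasure {E : Type*} [NormedAddCommGroup E] [NormedSpace ℝ E]
    (hγ : 0 < γ) (f : ℝ → E) :
    ∫ t, f t ∂(expMeasure γ) = γ • ∫ t in Set.Ioi (0 : ℝ), Real.exp (-γ * t) • f t := by
  have h : expMeasure γ = volume.withDensity
      (fun t => ((Real.toNNReal (exponentialPDFReal γ t) : ℝ≥0) : ℝ≥0∞)) := rfl
  rw [h, integral_withDensity_eq_integral_smul
    (measurable_exponentialPDFReal γ).real_toNNReal, ← integral_smul,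
    ← integral_Ici_eq_integral_Ioi, ← integral_indicator measurableSet_Ici]
  congr 1
  funext t
  rw [NNReal.smul_def, Real.coe_toNNReal _ (exponentialPDFReal_nonneg hγ t),
    Set.indicator_apply, exponentialPDFReal, gammaPDFReal]
  split_ifs with h1 h2 h2 <;> simp_all [smul_smul]
  exact absurd h2 (not_le.2 h1)

lemma integral_id_expMeasure (hγ : 0 < γ) : ∫ t, t ∂(expMeasure γ) = γ⁻¹ := by
  rw [integral_expMeasure hγ]
  have := Real.integral_rpow_mul_exp_neg_mul_Ioi (a := 2) (r := γ) (by norm_num) hγ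
  have e : ∀ t : ℝ, Real.exp (-γ * t) • t = t ^ ((2 : ℝ) - 1) * Real.exp (-(γ * t)) := by
    intro t; norm_num [mul_comm]
  simp_rw [e]
  rw [this]
  norm_num
  field_simp

lemma integrable_id_expMeasure (hγ : 0 < γ) : Integrable (fun t : ℝ => t) (expMeasure γ) := by
  -- A non-integrable function has integral `0` by convention, so a nonzero value proves
  -- integrability.
  apply Integrable.of_integral_ne_zero
  rw [integral_id_expMeasure hγ]
  positivity

end LorentzianIntegrals

/-! ### Markov chains: contraction and mixing times -/

section Contraction

variable {ι : Type*} [Fintype ι] [DecidableEq ι] {T : Matrix ι ι ℝ}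

/-- The `ℓ¹` norm. -/
def lone (f : ι → ℝ) : ℝ := ∑ i, |f i|

lemma lone_nonneg (f : ι → ℝ) : 0 ≤ lone f := Finset.sum_nonneg fun _ _ => abs_nonneg _

lemma lone_add_le (f g : ι → ℝ) : lone (f + g) ≤ lone f + lone g := by
  rw [lone, lone, lone, ← Finset.sum_add_distrib]
  exact Finset.sum_le_sum fun i _ => abs_add_le _ _

lemma lone_smul (c : ℝ) (f : ι → ℝ) : lone (c • f) = |c| * lone f := by
  simp [lone, abs_mul, Finset.mul_sum]

lemma lone_mulVec_le {M : Matrix ι ι ℝ} {c : ℝ} (hM : ∀ ν, ∑ μ, |M μ ν| ≤ c) (f : ι → ℝ) :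
    lone (M *ᵥ f) ≤ c * lone f := by
  calc lone (M *ᵥ f) ≤ ∑ μ, ∑ ν, |M μ ν| * |f ν| := by
        refine Finset.sum_le_sum fun μ _ => (Finset.abs_sum_le_sum_abs _ _).trans (le_of_eq ?_)
        simp [abs_mul]
    _ = ∑ ν, (∑ μ, |M μ ν|) * |f ν| := by rw [Finset.sum_comm]; simp [Finset.sum_mul]
    _ ≤ ∑ ν, c * |f ν| := Finset.sum_le_sum fun ν _ => by gcongr; exact hM ν
    _ = _ := by rw [lone, Finset.mul_sum]

lemma lone_stochastic_le (h0 : ∀ μ ν, 0 ≤ T μ ν) (h1 : ∀ ν, ∑ μ, T μ ν = 1) (f : ι → ℝ) :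
    lone (T *ᵥ f) ≤ lone f := by
  refine (lone_mulVec_le (c := 1) (fun ν => ?_) f).trans (le_of_eq (one_mul _))
  simp only [abs_of_nonneg (h0 _ _), h1, le_refl]

lemma lone_pow_mulVec_le (h0 : ∀ μ ν, 0 ≤ T μ ν) (h1 : ∀ ν, ∑ μ, T μ ν = 1) (k : ℕ) (f : ι → ℝ) :
    lone ((T ^ k) *ᵥ f) ≤ lone f := by
  induction k with
  | zero => simp
  | succ k ih =>
    rw [pow_succ', ← Matrix.mulVec_mulVec]
    exact (lone_stochastic_le h0 h1 _).trans ih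

lemma sum_mulVec_of_stochastic (h1 : ∀ ν, ∑ μ, T μ ν = 1) (f : ι → ℝ) :
    ∑ μ, (T *ᵥ f) μ = ∑ ν, f ν := by
  simp only [Matrix.mulVec, dotProduct]
  rw [Finset.sum_comm]
  simp [← Finset.sum_mul, h1]

lemma sum_pow_mulVec_of_stochastic (h1 : ∀ ν, ∑ μ, T μ ν = 1) (k : ℕ) (f : ι → ℝ) :
    ∑ μ, ((T ^ k) *ᵥ f) μ = ∑ ν, f ν := by
  induction k with
  | zero => simp
  | succ k ih => rw [pow_succ', ← Matrix.mulVec_mulVec, sum_mulVec_of_stochastic h1, ih]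

lemma exists_le_of_mixingTime_le {p : ι → ℝ} {m : ℕ} (h : mixingTime T p ≤ m) :
    ∃ k ≤ m, ∀ ν, (1 / 2) * ∑ μ, |(T ^ k) μ ν - p μ| ≤ 1 / 4 := by
  by_contra! hc
  have : ((m + 1 : ℕ) : ℕ∞) ≤ mixingTime T p := by
    refine le_iInf₂ fun k hk => ?_
    by_contra! hlt
    have hkm : k ≤ m := by
      have : k < m + 1 := by exact_mod_cast hlt
      omega
    obtain ⟨ν, hν⟩ := hc k hkm
    exact absurd (hk ν) (not_le.2 hν)
  have h2 := this.trans h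
  have : m + 1 ≤ m := by exact_mod_cast h2
  omega

/-- On zero-sum vectors `T ^ k` may be replaced by `T ^ k` minus the matrix whose columns all equal
`p`, and the mixing condition bounds the columns of that difference by `1 / 2` in `ℓ¹`. Further
stochastic steps do not increase the norm, which passes from `k` to `m`. -/
lemma lone_pow_mul_le {p : ι → ℝ} {m : ℕ} (h0 : ∀ μ ν, 0 ≤ T μ ν) (h1 : ∀ ν, ∑ μ, T μ ν = 1)
    (h : mixingTime T p ≤ m) (j : ℕ) {f : ι → ℝ} (hf : ∑ i, f i = 0) :
    lone ((T ^ (m * j)) *ᵥ f) ≤ (1 / 2) ^ j * lone f := by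
  obtain ⟨k, hk, hT⟩ := exists_le_of_mixingTime_le h
  have half : ∀ g : ι → ℝ, ∑ i, g i = 0 → lone ((T ^ m) *ᵥ g) ≤ 1 / 2 * lone g := by
    intro g hg
    obtain ⟨l, rfl⟩ := Nat.exists_eq_add_of_le' hk
    rw [pow_add, ← Matrix.mulVec_mulVec]
    refine (lone_pow_mulVec_le h0 h1 l _).trans ?_
    have : (T ^ k) *ᵥ g = (Matrix.of fun μ ν => (T ^ k) μ ν - p μ) *ᵥ g := by
      funext μ
      simp [Matrix.mulVec, dotProduct, sub_mul, Finset.sum_sub_distrib, ← Finset.mul_sum, hg]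
    rw [this]
    refine lone_mulVec_le (fun ν => ?_) g
    have := hT ν
    simp only [Matrix.of_apply]
    linarith
  induction j with
  | zero => simp
  | succ j ih =>
    rw [Nat.mul_succ, add_comm, pow_add, ← Matrix.mulVec_mulVec]
    refine (half _ (by rw [sum_pow_mulVec_of_stochastic h1, hf])).trans ?_
    rw [pow_succ]
    linarith

/-- Decay rate per step of a chain with mixing time at most `m`. -/
def mixRate (m : ℕ) : ℝ := Real.exp (-(Real.log 2 / m))

/-- Full blocks of `m` steps halve the norm. The incomplete block is not used, and replacing it by
geometric decay costs the factor `2`. -/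
lemma lone_pow_mulVec_le_mixRate {p : ι → ℝ} {m : ℕ} (hm : 1 ≤ m) (h0 : ∀ μ ν, 0 ≤ T μ ν)
    (h1 : ∀ ν, ∑ μ, T μ ν = 1) (h : mixingTime T p ≤ m) (k : ℕ) {f : ι → ℝ}
    (hf : ∑ i, f i = 0) : lone ((T ^ k) *ᵥ f) ≤ 2 * lone f * mixRate m ^ k := by
  have hm0 : (0 : ℝ) < m := by exact_mod_cast hm
  rw [← Nat.mod_add_div k m, pow_add, ← Matrix.mulVec_mulVec]
  refine (lone_pow_mulVec_le h0 h1 _ _).trans ((lone_pow_mul_le h0 h1 h _ hf).trans ?_)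
  have hmod : ((k % m : ℕ) : ℝ) ≤ m := by exact_mod_cast (Nat.mod_lt k hm).le
  have e1 : mixRate m ^ (k % m + m * (k / m)) = mixRate m ^ (k % m) * (1 / 2) ^ (k / m) := by
    rw [pow_add, pow_mul]
    congr 2
    rw [mixRate, ← Real.exp_nat_mul, mul_neg, mul_div_cancel₀ _ hm0.ne', Real.exp_neg,
      Real.exp_log two_pos]
    norm_num
  have e2 : 1 / 2 ≤ mixRate m ^ (k % m) := by
    rw [mixRate, ← Real.exp_nat_mul, ← Real.exp_log (by norm_num : (0 : ℝ) < 1 / 2)]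
    apply Real.exp_le_exp.2
    rw [one_div, Real.log_inv, mul_neg, neg_le_neg_iff, mul_div_assoc', div_le_iff₀ hm0, mul_comm]
    gcongr
  rw [e1]
  have h3 : (0 : ℝ) ≤ (1 / 2) ^ (k / m) * lone f := mul_nonneg (by positivity) (lone_nonneg f)
  nlinarith

/-- The rate is `2 ^ (-1 / m)`, which convexity of the exponential bounds by the chord between the
values `1` and `1 / 2`. -/
lemma mixRate_le {m : ℕ} (hm : 1 ≤ m) : mixRate m ≤ 1 - 1 / (2 * m) := by
  have hm0 : (1 : ℝ) ≤ m := by exact_mod_cast hm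
  have hx : 0 < 1 / (m : ℝ) := by positivity
  have hx1 : 1 / (m : ℝ) ≤ 1 := by rw [div_le_one (by positivity)]; exact hm0
  have hc := convexOn_exp.2 (Set.mem_univ (0 : ℝ)) (Set.mem_univ (-Real.log 2))
    (sub_nonneg.2 hx1) hx.le (by ring)
  simp only [smul_eq_mul, mul_zero, zero_add, Real.exp_zero, Real.exp_neg,
    Real.exp_log two_pos] at hc
  have : mixRate m = Real.exp (1 / (m : ℝ) * -Real.log 2) := by
    rw [mixRate]; congr 1; ring
  rw [this]
  refine hc.trans (le_of_eq ?_)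
  field_simp
  ring

/-- A slow lazy chain followed up to errors of size `δ` per step. -/
lemma lone_perturbed_chain_le {p : ι → ℝ} {m : ℕ} (hm : 1 ≤ m) (h0 : ∀ μ ν, 0 ≤ T μ ν)
    (h1 : ∀ ν, ∑ μ, T μ ν = 1) (h : mixingTime T p ≤ m) (hp : T *ᵥ p = p) {α δ : ℝ} (hα0 : 0 ≤ α)
    (hα1 : α ≤ 1) (q : ℕ → ι → ℝ) (hq : ∑ i, q 0 i = ∑ i, p i)
    (hstep : ∀ k, lone (q (k + 1) - ((1 - α) • q k + α • (T *ᵥ q k))) ≤ δ) (d : ℕ) :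
    lone (q d - p) ≤ d * δ + 2 * lone (q 0 - p) * Real.exp (-(α * d / (2 * m))) := by
  -- The deviation splits into the exact lazy evolution `g` of the initial deviation and the
  -- accumulated errors `r`. The decay of `g` is claimed after `j` further steps of `T`, for every
  -- `j`, since the mixing time controls powers of `T`. The induction then goes through even though
  -- a single step need not contract.
  have hsplit : ∃ g r : ℕ → ι → ℝ, ∀ k, q k - p = g k + r k ∧ lone (r k) ≤ k * δ ∧
      ∀ j, lone ((T ^ j) *ᵥ g k) ≤
        2 * lone (q 0 - p) * (1 - α + α * mixRate m) ^ k * mixRate m ^ j := by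
    let N : (ι → ℝ) → ι → ℝ := fun f => (1 - α) • f + α • (T *ᵥ f)
    let g : ℕ → ι → ℝ := fun k => N^[k] (q 0 - p)
    refine ⟨g, fun k => q k - p - g k, fun k => ⟨(add_sub_cancel _ _).symm, ?_⟩⟩
    have hg : ∀ k, g (k + 1) = N (g k) := fun k => Function.iterate_succ_apply' _ _ _
    induction k with
    | zero =>
      have e : q 0 - p - g 0 = 0 := by simp [g]
      constructor
      · simp only [e]; simp [lone]
      · intro j
        refine (lone_pow_mulVec_le_mixRate hm h0 h1 h j (f := g 0) ?_).trans (le_of_eq ?_)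
        · simp [g, hq]
        · simp [g]
    | succ k ih =>
      constructor
      · have e : q (k + 1) - p - g (k + 1) =
            (q (k + 1) - ((1 - α) • q k + α • (T *ᵥ q k))) + N (q k - p - g k) := by
          rw [hg]
          simp only [N, Matrix.mulVec_sub, hp, smul_sub, sub_smul, one_smul]
          abel
        simp only [e]
        refine (lone_add_le _ _).trans ?_
        have hN : lone (N (q k - p - g k)) ≤ lone (q k - p - g k) := by
          refine (lone_add_le _ _).trans ?_
          rw [lone_smul, lone_smul, abs_of_nonneg hα0, abs_of_nonneg (sub_nonneg.2 hα1)]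
          nlinarith [lone_stochastic_le h0 h1 (q k - p - g k)]
        have := hstep k
        have := ih.1
        push_cast
        linarith
      · intro j
        rw [hg]
        simp only [N, Matrix.mulVec_add, Matrix.mulVec_smul, Matrix.mulVec_mulVec, ← pow_succ]
        refine (lone_add_le _ _).trans ?_
        rw [lone_smul, lone_smul, abs_of_nonneg hα0, abs_of_nonneg (sub_nonneg.2 hα1)]
        have a1 := mul_le_mul_of_nonneg_left (ih.2 j) (sub_nonneg.2 hα1)
        have a2 := mul_le_mul_of_nonneg_left (ih.2 (j + 1)) hα0
        refine (add_le_add a1 a2).trans (le_of_eq ?_)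
        ring
  obtain ⟨g, r, hgr⟩ := hsplit
  obtain ⟨e, hr, hg⟩ := hgr d
  rw [e]
  refine (lone_add_le _ _).trans ?_
  have h2 := hg 0
  simp only [pow_zero, Matrix.one_mulVec, mul_one] at h2
  have hm0 : (0 : ℝ) < m := by exact_mod_cast hm
  have h3 : 1 - α + α * mixRate m ≤ Real.exp (-(α / (2 * m))) := by
    have := mul_le_mul_of_nonneg_left (mixRate_le hm) hα0
    refine le_trans ?_ (Real.add_one_le_exp _)
    have e : α * (1 - 1 / (2 * (m : ℝ))) = α - α / (2 * m) := by ring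
    linarith
  have h4 : (1 - α + α * mixRate m) ^ d ≤ Real.exp (-(α * d / (2 * m))) := by
    refine (pow_le_pow_left₀ ?_ h3 d).trans (le_of_eq ?_)
    · have : 0 ≤ mixRate m := (Real.exp_pos _).le
      have := mul_nonneg hα0 this
      linarith
    · rw [← Real.exp_nat_mul]; congr 1; ring
  have h5 : 0 ≤ 2 * lone (q 0 - p) := by have := lone_nonneg (q 0 - p); linarith
  have := mul_le_mul_of_nonneg_left h4 h5
  linarith

end Contraction

/-! ### From the spectral gap to the convergence of reversible chains -/

section SpectralGap

variable {ι : Type*} [Fintype ι] [DecidableEq ι]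

lemma le_fold_max {s : Multiset ℝ} {x : ℝ} (hx : x ∈ s) : x ≤ s.fold max 0 := by
  induction s using Multiset.induction_on with
  | empty => simp at hx
  | cons a s ih =>
    rw [Multiset.fold_cons_left]
    rcases Multiset.mem_cons.1 hx with rfl | h
    · exact le_max_left _ _
    · exact (ih h).trans (le_max_right _ _)

lemma fold_max_nonneg (s : Multiset ℝ) : 0 ≤ s.fold max 0 := by
  induction s using Multiset.induction_on with
  | empty => simp
  | cons a s ih => rw [Multiset.fold_cons_left]; exact ih.trans (le_max_right _ _)

lemma spectralGap_le_one (T : Matrix ι ι ℝ) : spectralGap T ≤ 1 := by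
  unfold spectralGap
  linarith [fold_max_nonneg ((T.charpoly.roots.erase 1).map fun z => |z|)]

/-- On the complement of its top eigenvector, a symmetric matrix contracts by its gap. -/
lemma IsHermitian.sum_sq_mulVec_le {S : Matrix ι ι ℝ} (hS : S.IsHermitian) {v : ι → ℝ}
    (hv : S *ᵥ v = v) (hv0 : v ≠ 0) (hgap : 0 < spectralGap S) {g : ι → ℝ} (hg : v ⬝ᵥ g = 0) :
    ∑ i, (S *ᵥ g) i ^ 2 ≤ (1 - spectralGap S) ^ 2 * ∑ i, g i ^ 2 := by
  let b := hS.eigenvectorBasis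
  have hT : Sᵀ = S := by rw [← Matrix.conjTranspose_eq_transpose_of_trivial]; exact hS
  have parseval : ∀ f : ι → ℝ, ∑ i, ((b i : ι → ℝ) ⬝ᵥ f) ^ 2 = ∑ i, f i ^ 2 := by
    intro f
    have := b.sum_sq_norm_inner_right (WithLp.toLp 2 f)
    rw [EuclideanSpace.norm_sq_eq] at this
    simp only [Real.norm_eq_abs, sq_abs] at this
    rw [← this]
    refine Finset.sum_congr rfl fun i _ => ?_
    congr 1
    simp [PiLp.inner_apply, dotProduct, mul_comm]
  have hb : ∀ (i) (f : ι → ℝ), (b i : ι → ℝ) ⬝ᵥ (S *ᵥ f) =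
      hS.eigenvalues i * ((b i : ι → ℝ) ⬝ᵥ f) := by
    intro i f
    rw [Matrix.dotProduct_mulVec, ← Matrix.mulVec_transpose, hT]
    erw [hS.mulVec_eigenvectorBasis i]
    simp [b]
  have hvi : ∀ i, hS.eigenvalues i ≠ 1 → (b i : ι → ℝ) ⬝ᵥ v = 0 := by
    intro i hi
    have := hb i v
    rw [hv] at this
    by_contra hne
    exact hi (mul_right_cancel₀ hne (by linarith))
  have hroots : S.charpoly.roots = Multiset.map hS.eigenvalues Finset.univ.val := by
    simpa using hS.roots_charpoly_eq_eigenvalues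
  obtain ⟨i₀, hi₀⟩ : ∃ i, (b i : ι → ℝ) ⬝ᵥ v ≠ 0 := by
    by_contra! hc
    have := parseval v
    simp only [hc] at this
    apply hv0
    funext i
    have h0 : ∑ i, v i ^ 2 = 0 := by rw [← this]; simp
    have := (Finset.sum_eq_zero_iff_of_nonneg (fun i _ => sq_nonneg (v i))).1 h0 i
      (Finset.mem_univ _)
    simpa using this
  have h1 : hS.eigenvalues i₀ = 1 := by
    by_contra hne
    exact hi₀ (hvi i₀ hne)
  -- The erased copy of the root `1` is attributed to the index `i₀`, so all other eigenvalues
  -- remain in the multiset that defines the gap.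
  have hlam : ∀ i, i ≠ i₀ → |hS.eigenvalues i| ≤ 1 - spectralGap S := by
    intro i hi
    rw [spectralGap, sub_sub_cancel]
    apply le_fold_max
    apply Multiset.mem_map_of_mem
    rw [hroots, ← Finset.insert_erase (Finset.mem_univ i₀),
      Finset.insert_val_of_notMem (Finset.notMem_erase _ _), Multiset.map_cons, h1,
      Multiset.erase_cons_head]
    exact Multiset.mem_map_of_mem _ (Finset.mem_erase.2 ⟨hi, Finset.mem_univ _⟩)
  have hne1 : ∀ i, i ≠ i₀ → hS.eigenvalues i ≠ 1 := by
    intro i hi he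
    have := hlam i hi
    rw [he, abs_one] at this
    linarith
  -- Positivity of the gap makes the eigenvalue `1` simple, so `v` is parallel to `b i₀` and
  -- orthogonality to one is orthogonality to the other.
  have hgi : (b i₀ : ι → ℝ) ⬝ᵥ g = 0 := by
    have hinner := b.sum_inner_mul_inner (WithLp.toLp 2 v) (WithLp.toLp 2 g)
    have e : ∀ i (f : ι → ℝ), inner ℝ (b i) (WithLp.toLp 2 f) = (b i : ι → ℝ) ⬝ᵥ f := by
      intro i f
      simp [PiLp.inner_apply, dotProduct, mul_comm]
    rw [Finset.sum_eq_single i₀] at hinner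
    · rw [real_inner_comm, e, e] at hinner
      have e2 : inner ℝ (WithLp.toLp 2 v) (WithLp.toLp 2 g) = v ⬝ᵥ g := by
        simp [PiLp.inner_apply, dotProduct, mul_comm]
      rw [e2, hg] at hinner
      exact (mul_eq_zero.1 hinner).resolve_left hi₀
    · intro i _ hi
      rw [real_inner_comm, e, hvi i (hne1 i hi), zero_mul]
    · simp
  rw [← parseval, ← parseval g, Finset.mul_sum]
  refine Finset.sum_le_sum fun i _ => ?_
  rw [hb, mul_pow]
  by_cases hi : i = i₀
  · rw [hi, hgi]; simp
  · gcongr ?_ * _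
    rw [← sq_abs]
    exact pow_le_pow_left₀ (abs_nonneg _) (hlam i hi) 2

/-- A chain reversible with respect to `p` approaches `p` at the rate given by its gap. -/
lemma sum_abs_pow_sub_le_of_reversible {T : Matrix ι ι ℝ} {p : ι → ℝ} (hp : ∀ i, 0 < p i)
    (hp1 : ∑ i, p i = 1) (h1 : ∀ ν, ∑ μ, T μ ν = 1) (hrev : ∀ μ ν, T μ ν * p ν = T ν μ * p μ)
    (hgap : 0 < spectralGap T) (k : ℕ) (ν : ι) :
    ∑ μ, |(T ^ k) μ ν - p μ| ≤ (1 - spectralGap T) ^ k * Real.sqrt (1 / p ν) := by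
  let r : ι → ℝ := fun i => Real.sqrt (p i)
  have hr : ∀ i, 0 < r i := fun i => Real.sqrt_pos.2 (hp i)
  have hrr : ∀ i, r i * r i = p i := fun i => Real.mul_self_sqrt (hp i).le
  let D : Matrix ι ι ℝ := Matrix.diagonal r
  let D' : Matrix ι ι ℝ := Matrix.diagonal fun i => (r i)⁻¹
  have hDD' : D * D' = 1 := by
    simp only [D, D', Matrix.diagonal_mul_diagonal, mul_inv_cancel₀ (hr _).ne', Matrix.diagonal_one]
  have hD'D : D' * D = 1 := by
    simp only [D, D', Matrix.diagonal_mul_diagonal, inv_mul_cancel₀ (hr _).ne', Matrix.diagonal_one]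
  -- Detailed balance makes this conjugate of `T` by square roots of `p` symmetric. It has the
  -- characteristic polynomial of `T`, hence the same gap, and fixes the vector of square roots.
  let S : Matrix ι ι ℝ := D' * (T * D)
  have hSgap : spectralGap S = spectralGap T := by
    have : S.charpoly = T.charpoly := by
      simp only [S]
      rw [Matrix.charpoly_mul_comm, Matrix.mul_assoc, hDD', Matrix.mul_one]
    rw [spectralGap, this, spectralGap]
  have hSe : ∀ μ ν, S μ ν = (r μ)⁻¹ * (T μ ν * r ν) := by
    intro μ ν
    simp [S, D, D', Matrix.diagonal_mul, Matrix.mul_diagonal]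
  have hS : S.IsHermitian := by
    ext μ ν
    rw [Matrix.conjTranspose_apply, hSe, hSe, star_trivial]
    have := hrev μ ν
    rw [← hrr, ← hrr] at this
    have h2 := (hr μ).ne'
    have h3 := (hr ν).ne'
    field_simp
    nlinarith
  have hTp : T *ᵥ p = p := by
    funext μ
    simp only [Matrix.mulVec, dotProduct]
    rw [Finset.sum_congr rfl fun ν _ => hrev μ ν, ← Finset.sum_mul, h1, one_mul]
  have hv : S *ᵥ r = r := by
    funext μ
    have := congrFun hTp μ
    simp only [Matrix.mulVec, dotProduct] at this ⊢
    simp only [hSe, mul_assoc, hrr, ← Finset.mul_sum, this]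
    rw [← hrr, ← mul_assoc, inv_mul_cancel₀ (hr μ).ne', one_mul]
  have hv0 : r ≠ 0 := fun h => (hr ν).ne' (congrFun h ν)
  let f : ι → ℝ := fun i => (if i = ν then 1 else 0) - p i
  let g : ι → ℝ := fun i => (r i)⁻¹ * f i
  have hrg : r ⬝ᵥ g = 0 := by
    simp only [dotProduct, g, ← mul_assoc, mul_inv_cancel₀ (hr _).ne', one_mul, f]
    simp [hp1]
  have hperp : ∀ k, r ⬝ᵥ ((S ^ k) *ᵥ g) = 0 := by
    intro k
    induction k with
    | zero => simpa using hrg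
    | succ k ih =>
      have hT : Sᵀ = S := by rw [← Matrix.conjTranspose_eq_transpose_of_trivial]; exact hS
      rw [pow_succ', ← Matrix.mulVec_mulVec, Matrix.dotProduct_mulVec, ← Matrix.mulVec_transpose,
        hT, hv, ih]
  have hdecay : ∀ k, ∑ i, ((S ^ k) *ᵥ g) i ^ 2 ≤
      ((1 - spectralGap T) ^ k) ^ 2 * ∑ i, g i ^ 2 := by
    intro k
    induction k with
    | zero => simp
    | succ k ih =>
      rw [pow_succ', ← Matrix.mulVec_mulVec]
      refine (IsHermitian.sum_sq_mulVec_le hS hv hv0 (by rwa [hSgap]) (hperp k)).trans ?_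
      rw [hSgap]
      refine (mul_le_mul_of_nonneg_left ih (sq_nonneg _)).trans (le_of_eq ?_)
      ring
  have hSk : ∀ k, S ^ k = D' * (T ^ k * D) := by
    intro k
    induction k with
    | zero => simp [hD'D]
    | succ k ih =>
      rw [pow_succ', ih, pow_succ']
      simp only [S, Matrix.mul_assoc]
      rw [← Matrix.mul_assoc D D', hDD', Matrix.one_mul]
  have hTf : (T ^ k) *ᵥ f = D *ᵥ ((S ^ k) *ᵥ g) := by
    have : g = D' *ᵥ f := by funext i; simp [g, D', Matrix.mulVec_diagonal]
    rw [this, hSk, Matrix.mulVec_mulVec, Matrix.mulVec_mulVec]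
    congr 1
    simp only [Matrix.mul_assoc, hDD', Matrix.mul_one]
    rw [← Matrix.mul_assoc, hDD', Matrix.one_mul]
  have hTkp : (T ^ k) *ᵥ p = p := by
    clear hTf
    induction k with
    | zero => simp
    | succ k ih => rw [pow_succ, ← Matrix.mulVec_mulVec, hTp, ih]
  have hcol : ∀ μ, (T ^ k) μ ν - p μ = r μ * ((S ^ k) *ᵥ g) μ := by
    intro μ
    have := congrFun hTf μ
    rw [Matrix.mulVec_diagonal] at this
    rw [← this]
    have e : f = Pi.single ν 1 - p := by funext i; simp [f, Pi.single_apply]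
    rw [e, Matrix.mulVec_sub, hTkp]
    simp
  -- The exact value is `1 / p ν - 1`, the `χ²` distance of the point mass at `ν` from `p`.
  have hg2 : ∑ i, g i ^ 2 ≤ 1 / p ν := by
    have e : ∀ i, g i ^ 2 = (if i = ν then 1 / p ν - 2 else 0) + p i := by
      intro i
      have hri : r i ^ 2 = p i := by rw [sq, hrr]
      have := (hp i).ne'
      simp only [g, mul_pow, inv_pow, hri, f]
      split_ifs with h
      · subst h; field_simp; ring
      · field_simp; ring
    simp only [e, Finset.sum_add_distrib, hp1]
    simp
    linarith
  have hq0 : 0 ≤ 1 - spectralGap T := by linarith [spectralGap_le_one T]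
  -- Cauchy–Schwarz against the square roots of `p`, whose squares sum to one, returns from `ℓ²` to
  -- `ℓ¹`.
  calc ∑ μ, |(T ^ k) μ ν - p μ| = ∑ μ, r μ * |((S ^ k) *ᵥ g) μ| := by
        refine Finset.sum_congr rfl fun μ _ => ?_
        rw [hcol, abs_mul, abs_of_pos (hr μ)]
    _ ≤ Real.sqrt (∑ μ, r μ ^ 2) * Real.sqrt (∑ μ, |((S ^ k) *ᵥ g) μ| ^ 2) :=
        Real.sum_mul_le_sqrt_mul_sqrt _ _ _
    _ = Real.sqrt (∑ μ, ((S ^ k) *ᵥ g) μ ^ 2) := by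
        simp only [sq_abs]
        simp only [sq (r _), hrr, hp1]
        simp
    _ ≤ Real.sqrt (((1 - spectralGap T) ^ k) ^ 2 * (1 / p ν)) := by
        apply Real.sqrt_le_sqrt
        refine (hdecay k).trans ?_
        gcongr
    _ = _ := by
        rw [Real.sqrt_mul (sq_nonneg _), Real.sqrt_sq (pow_nonneg hq0 k)]

end SpectralGap

/-! ### The classical chain of an ETH system -/

section Chain

variable {n : ℕ} {Θ : Type*} [MeasurableSpace Θ] (S : EthSystem n Θ) (P : Measure Θ)

namespace EthSystem

lemma elem_symm (x : CouplingData n Θ) (μ ν : Bits n) : S.elem x ν μ = star (S.elem x μ ν) := by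
  rw [elem, elem, S.amp_symm, Sym2.eq_swap]
  by_cases h : μ = ν
  · subst h; simp
  · simp [h, Ne.symm h]

lemma variance_symm (μ ν : Bits n) : S.variance P μ ν = S.variance P ν μ := by
  simp only [variance, S.elem_symm _ ν μ, norm_star]

lemma variance_nonneg (μ ν : Bits n) : 0 ≤ S.variance P μ ν :=
  integral_nonneg fun _ => by positivity

end EthSystem

lemma window_neg (Ω γ x : ℝ) : window Ω γ (-x) = window Ω γ x := by
  rw [window, window, sub_neg_eq_add, ← sub_eq_add_neg, add_comm]

namespace EthSystem

lemma sum_exp_energy_pos (β : ℝ) : 0 < ∑ ν, Real.exp (-(β * S.energy ν)) :=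
  Finset.sum_pos (fun _ _ => Real.exp_pos _) Finset.univ_nonempty

lemma gibbsWeight_pos (β : ℝ) (μ : Bits n) : 0 < S.gibbsWeight β μ :=
  div_pos (Real.exp_pos _) (S.sum_exp_energy_pos β)

lemma sum_gibbsWeight (β : ℝ) : ∑ μ, S.gibbsWeight β μ = 1 := by
  simp only [gibbsWeight]
  rw [← Finset.sum_div, div_self (S.sum_exp_energy_pos β).ne']

/-- Detailed balance. The variance and the window are symmetric, and `exp (-β E_ν) / (1 + exp (β
(E_μ - E_ν)))` is symmetric in the two levels. -/
lemma rate_mul_gibbsWeight (C β Ω γ : ℝ) (μ ν : Bits n) :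
    S.rate P C β Ω γ μ ν * S.gibbsWeight β ν = S.rate P C β Ω γ ν μ * S.gibbsWeight β μ := by
  have h1 : (S.energy μ - S.energy ν) / Ω = -((S.energy ν - S.energy μ) / Ω) := by ring
  have h2 : Real.exp (-(β * S.energy ν)) / (1 + Real.exp (β * (S.energy μ - S.energy ν))) =
      Real.exp (-(β * S.energy μ)) / (1 + Real.exp (β * (S.energy ν - S.energy μ))) := by
    rw [div_eq_div_iff (by positivity) (by positivity), mul_add, mul_add, ← Real.exp_add,
      ← Real.exp_add]
    ring_nf
  rw [rate, rate, h1, window_neg, S.variance_symm P μ ν, gibbsWeight, gibbsWeight]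
  calc _ = C * (2 * Real.pi * S.variance P ν μ) * window Ω γ ((S.energy ν - S.energy μ) / Ω) /
        (∑ ν, Real.exp (-(β * S.energy ν))) *
        (Real.exp (-(β * S.energy ν)) / (1 + Real.exp (β * (S.energy μ - S.energy ν)))) := by ring
    _ = _ := by rw [h2]; ring

lemma transition_mul_gibbsWeight (C β Ω γ : ℝ) (μ ν : Bits n) :
    S.transition P C β Ω γ μ ν * S.gibbsWeight β ν =
      S.transition P C β Ω γ ν μ * S.gibbsWeight β μ := by
  by_cases h : μ = ν
  · rw [h]
  · simp only [transition, Matrix.of_apply, if_neg h, if_neg (Ne.symm h), zero_add]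
    exact S.rate_mul_gibbsWeight P C β Ω γ μ ν

lemma sum_transition (C β Ω γ : ℝ) (ν : Bits n) : ∑ μ, S.transition P C β Ω γ μ ν = 1 := by
  simp [transition, Finset.sum_add_distrib]

lemma transition_mulVec_gibbsWeight (C β Ω γ : ℝ) :
    S.transition P C β Ω γ *ᵥ S.gibbsWeight β = S.gibbsWeight β := by
  funext μ
  simp only [Matrix.mulVec, dotProduct]
  rw [Finset.sum_congr rfl fun ν _ => S.transition_mul_gibbsWeight P C β Ω γ μ ν,
    ← Finset.sum_mul, sum_transition, one_mul]

/-- There are `2 ^ n ≤ exp n` levels, and all Boltzmann factors lie between `exp (-β h n)` and `exp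
(β h n)`. -/
lemma inv_gibbsWeight_le {β h : ℝ} (hβ : 0 < β) (hE : ∀ μ, |S.energy μ| ≤ h * n) (ν : Bits n) :
    1 / S.gibbsWeight β ν ≤ Real.exp ((1 + 2 * (β * h)) * n) := by
  rw [gibbsWeight, one_div_div, div_le_iff₀ (Real.exp_pos _)]
  have h1 : ∀ μ, Real.exp (-(β * S.energy μ)) ≤ Real.exp (β * (h * n)) := fun μ => by
    apply Real.exp_le_exp.2
    have := mul_le_mul_of_nonneg_left (hE μ) hβ.le
    have h3 := mul_le_mul_of_nonneg_left (neg_abs_le (S.energy μ)) hβ.le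
    linarith
  have h2 : Real.exp (-(β * (h * n))) ≤ Real.exp (-(β * S.energy ν)) := by
    apply Real.exp_le_exp.2
    have := mul_le_mul_of_nonneg_left ((le_abs_self _).trans (hE ν)) hβ.le
    linarith
  have h3 : (2 : ℝ) ^ n ≤ Real.exp n := by
    have : Real.exp n = Real.exp 1 ^ n := by rw [← Real.exp_nat_mul, mul_one]
    rw [this]
    exact pow_le_pow_left₀ (by norm_num) (by linarith [Real.add_one_le_exp 1]) n
  calc ∑ μ, Real.exp (-(β * S.energy μ)) ≤ ∑ _μ : Bits n, Real.exp (β * (h * n)) :=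
        Finset.sum_le_sum fun μ _ => h1 μ
    _ = 2 ^ n * Real.exp (β * (h * n)) := by simp
    _ ≤ Real.exp n * Real.exp (β * (h * n)) := by gcongr
    _ = Real.exp ((1 + 2 * (β * h)) * n) * Real.exp (-(β * (h * n))) := by
        rw [← Real.exp_add, ← Real.exp_add]; congr 1; ring
    _ ≤ _ := by gcongr

/-- The mixing time of the classical chain is of order `n` over the gap. -/
theorem mixingTime_transition_le {C β Ω γ h : ℝ} (hβ : 0 < β)
    (hE : ∀ μ, |S.energy μ| ≤ h * n) (hgap : 0 < spectralGap (S.transition P C β Ω γ)) :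
    mixingTime (S.transition P C β Ω γ) (S.gibbsWeight β) ≤
      (⌈2 * (1 + β * h) * n / spectralGap (S.transition P C β Ω γ)⌉₊ : ℕ∞) := by
  set T := S.transition P C β Ω γ with hT
  set k := ⌈2 * (1 + β * h) * n / spectralGap T⌉₊ with hk
  refine iInf₂_le k fun ν => ?_
  -- Without qubits the claimed time is zero, so the two distributions on the single level must
  -- agree exactly.
  rcases Nat.eq_zero_or_pos n with rfl | hn
  · have h1 := S.sum_gibbsWeight β
    have h2 : ∀ μ : Bits 0, S.gibbsWeight β μ = 1 := fun μ => by
      rw [← h1, Fintype.sum_unique]; congr 1; exact Subsingleton.elim _ _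
    simp [hk, h2, Subsingleton.elim _ ν]
  have hn1 : (1 : ℝ) ≤ n := by exact_mod_cast hn
  have hh : 0 ≤ h := by
    have := (abs_nonneg _).trans (hE ν)
    by_contra! hlt
    nlinarith
  have hβh : 0 ≤ β * h := mul_nonneg hβ.le hh
  have key := sum_abs_pow_sub_le_of_reversible (S.gibbsWeight_pos β) (S.sum_gibbsWeight β)
    (S.sum_transition P C β Ω γ) (S.transition_mul_gibbsWeight P C β Ω γ) hgap k ν
  have hq : (1 - spectralGap T) ^ k ≤ Real.exp (-(2 * (1 + β * h) * n)) := by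
    have h0 : 0 ≤ 1 - spectralGap T := by linarith [spectralGap_le_one T]
    have h1 : 1 - spectralGap T ≤ Real.exp (-spectralGap T) := by
      linarith [Real.add_one_le_exp (-spectralGap T)]
    refine (pow_le_pow_left₀ h0 h1 k).trans ?_
    rw [← Real.exp_nat_mul]
    apply Real.exp_le_exp.2
    have := (div_le_iff₀ hgap).1 (Nat.le_ceil (2 * (1 + β * h) * n / spectralGap T))
    rw [← hk] at this
    linarith
  have hs : Real.sqrt (1 / S.gibbsWeight β ν) ≤ Real.exp ((1 + 2 * (β * h)) * n / 2) := by
    rw [Real.exp_half]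
    exact Real.sqrt_le_sqrt (S.inv_gibbsWeight_le hβ hE ν)
  -- The factor `2` in the number of steps beats the square root of the inverse weight and leaves an
  -- exponent of at most `-1`.
  have hfin : Real.exp (-(2 * (1 + β * h) * n)) * Real.exp ((1 + 2 * (β * h)) * n / 2) ≤ 1 / 2 := by
    rw [← Real.exp_add]
    have h1 : -(2 * (1 + β * h) * n) + (1 + 2 * (β * h)) * n / 2 ≤ -1 := by nlinarith
    refine (Real.exp_le_exp.2 h1).trans ?_
    rw [Real.exp_neg, one_div]
    exact inv_anti₀ two_pos (by linarith [Real.add_one_le_exp 1])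
  have := mul_le_mul hq hs (Real.sqrt_nonneg _) (Real.exp_pos _).le
  linarith

end EthSystem

end Chain

/-! ### Moments of the coupling operators -/

section Moments

variable {n : ℕ} {Θ : Type*} [MeasurableSpace Θ] (S : EthSystem n Θ) {P : Measure Θ}

instance isProbabilityMeasure_couplingLaw [IsProbabilityMeasure P] :
    IsProbabilityMeasure (couplingLaw n P) := by
  unfold couplingLaw; infer_instance

open scoped Matrix.Norms.L2Operator

namespace EthSystem

lemma measurable_elem (μ ν : Bits n) : Measurable fun x : CouplingData n Θ => S.elem x μ ν := by
  have h1 : Measurable fun θ : Θ => S.diag θ μ := (measurable_pi_apply μ).comp S.measurable_diag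
  have h2 : Measurable fun θ : Θ => S.amp θ μ ν :=
    (measurable_pi_apply ν).comp ((measurable_pi_apply μ).comp S.measurable_amp)
  have h3 : Measurable fun x : CouplingData n Θ => S.diag x.1 μ := h1.comp measurable_fst
  have h4 : Measurable fun x : CouplingData n Θ => S.amp x.1 μ ν := h2.comp measurable_fst
  have h5 : Measurable fun x : CouplingData n Θ => x.2 s(μ, ν) :=
    (measurable_pi_apply _).comp measurable_snd
  unfold elem
  split_ifs
  · exact (Complex.measurable_ofReal.comp h3).add (h4.mul (Complex.measurable_ofReal.comp h5))
  · exact measurable_const.add (h4.mul (Complex.measurable_ofReal.comp h5))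

/-- The coupling operator in the energy eigenbasis. -/
def elemMat (x : CouplingData n Θ) : Matrix (Bits n) (Bits n) ℂ := Matrix.of (S.elem x)

lemma isHermitian_elemMat (x : CouplingData n Θ) : (S.elemMat x).IsHermitian := by
  ext μ ν
  simp [elemMat, S.elem_symm x μ ν]

lemma stronglyMeasurable_elemMat : StronglyMeasurable S.elemMat := by
  have : Measurable fun x => (S.elem x : Bits n → Bits n → ℂ) :=
    measurable_pi_iff.2 fun μ => measurable_pi_iff.2 fun ν => S.measurable_elem μ ν
  exact this.stronglyMeasurable

lemma opNorm_coupling (x : CouplingData n Θ) : opNorm (S.coupling x) = ‖S.elemMat x‖ := by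
  change ‖S.coupling x‖ = _
  rw [coupling, Matrix.mul_assoc]
  have h1 := S.eig.2
  have h2 : (S.eig : Matrix (Bits n) (Bits n) ℂ)ᴴ ∈ unitary (Matrix (Bits n) (Bits n) ℂ) :=
    Unitary.star_mem h1
  rw [CStarRing.norm_mem_unitary_mul _ h1, CStarRing.norm_mul_mem_unitary _ h2]
  rfl

variable {S} {κ : ℝ}

lemma CouplingSize.integrable_exp (h : S.CouplingSize P κ) :
    Integrable (fun x => Real.exp (‖S.elemMat x‖ / κ)) (couplingLaw n P) ∧
      ∫ x, Real.exp (‖S.elemMat x‖ / κ) ∂(couplingLaw n P) ≤ 2 := by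
  simp only [CouplingSize, opNorm_coupling] at h
  have hm : AEStronglyMeasurable (fun x => Real.exp (‖S.elemMat x‖ / κ)) (couplingLaw n P) := by
    have := S.stronglyMeasurable_elemMat.norm.measurable
    exact (Real.measurable_exp.comp (this.div_const κ)).aestronglyMeasurable
  have hi : Integrable (fun x => Real.exp (‖S.elemMat x‖ / κ)) (couplingLaw n P) := by
    refine ⟨hm, ?_⟩
    rw [hasFiniteIntegral_iff_ofReal (.of_forall fun x => (Real.exp_pos _).le)]
    exact h.trans_lt ENNReal.ofNat_lt_top
  refine ⟨hi, ?_⟩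
  rw [integral_eq_lintegral_of_nonneg_ae (.of_forall fun x => (Real.exp_pos _).le) hm]
  exact ENNReal.toReal_le_of_le_ofReal two_pos.le (by simpa using h)

/-- Quantities dominated by the exponential moment. -/
lemma CouplingSize.integral_le_of_le_exp (h : S.CouplingSize P κ) {f : CouplingData n Θ → ℝ}
    {c : ℝ} (hm : AEStronglyMeasurable f (couplingLaw n P)) (h0 : ∀ x, 0 ≤ f x)
    (hf : ∀ x, f x ≤ c * Real.exp (‖S.elemMat x‖ / κ)) (hc : 0 ≤ c) :
    Integrable f (couplingLaw n P) ∧ ∫ x, f x ∂(couplingLaw n P) ≤ 2 * c := by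
  obtain ⟨hi, hI⟩ := h.integrable_exp
  have hf' : Integrable f (couplingLaw n P) :=
    (hi.const_mul c).mono' hm (.of_forall fun x => by
      rw [Real.norm_eq_abs, abs_of_nonneg (h0 x)]; exact hf x)
  refine ⟨hf', (integral_mono hf' (hi.const_mul c) hf).trans ?_⟩
  rw [integral_const_mul]
  nlinarith

end EthSystem

lemma pow_le_factorial_mul_exp (k : ℕ) {x : ℝ} (hx : 0 ≤ x) :
    x ^ k ≤ k.factorial * Real.exp x := by
  have := Real.pow_div_factorial_le_exp x hx k
  rwa [div_le_iff₀ (by positivity), mul_comm] at this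

namespace EthSystem

variable {S} {κ : ℝ}

lemma CouplingSize.integral_norm_pow_le (h : S.CouplingSize P κ) (hκ : 0 < κ) (k : ℕ) :
    Integrable (fun x => ‖S.elemMat x‖ ^ k) (couplingLaw n P) ∧
      ∫ x, ‖S.elemMat x‖ ^ k ∂(couplingLaw n P) ≤ 2 * (k.factorial * κ ^ k) := by
  refine h.integral_le_of_le_exp
    ((S.stronglyMeasurable_elemMat.norm.pow k).aestronglyMeasurable) (fun x => by positivity)
    (fun x => ?_) (by positivity)
  have := pow_le_factorial_mul_exp k (x := ‖S.elemMat x‖ / κ) (by positivity)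
  rw [div_pow, div_le_iff₀ (by positivity)] at this
  linarith

/-- Moments on the event that the coupling is exceptionally large. -/
lemma CouplingSize.integral_indicator_norm_pow_le (h : S.CouplingSize P κ) (hκ : 0 < κ) (k : ℕ)
    (r : ℝ) :
    Integrable (fun x => if r < ‖S.elemMat x‖ then ‖S.elemMat x‖ ^ k else 0) (couplingLaw n P) ∧
      ∫ x, (if r < ‖S.elemMat x‖ then ‖S.elemMat x‖ ^ k else 0) ∂(couplingLaw n P) ≤
        2 * (k.factorial * (2 * κ) ^ k * Real.exp (-(r / (2 * κ)))) := by
  have hm := S.stronglyMeasurable_elemMat.norm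
  refine h.integral_le_of_le_exp ?_ (fun x => ?_) (fun x => ?_) (by positivity)
  · refine (Measurable.ite ?_ (hm.measurable.pow_const k) measurable_const).aestronglyMeasurable
    exact measurableSet_lt measurable_const hm.measurable
  · split_ifs <;> positivity
  · split_ifs with hr
    · have := pow_le_factorial_mul_exp k (x := ‖S.elemMat x‖ / (2 * κ)) (by positivity)
      rw [div_pow, div_le_iff₀ (by positivity)] at this
      refine this.trans ?_
      have h1 : Real.exp (‖S.elemMat x‖ / (2 * κ)) ≤
          Real.exp (-(r / (2 * κ))) * Real.exp (‖S.elemMat x‖ / κ) := by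
        rw [← Real.exp_add]
        apply Real.exp_le_exp.2
        have : r / (2 * κ) ≤ ‖S.elemMat x‖ / (2 * κ) := by gcongr
        have e : ‖S.elemMat x‖ / κ = 2 * (‖S.elemMat x‖ / (2 * κ)) := by field_simp
        linarith
      calc _ = (k.factorial * (2 * κ) ^ k) * Real.exp (‖S.elemMat x‖ / (2 * κ)) := by ring
        _ ≤ (k.factorial * (2 * κ) ^ k) *
            (Real.exp (-(r / (2 * κ))) * Real.exp (‖S.elemMat x‖ / κ)) := by gcongr
        _ = _ := by ring
    · positivity

end EthSystem

/-- Columns of a matrix are bounded by its operator norm. -/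
lemma sum_sq_norm_col_le {ι : Type*} [Fintype ι] [DecidableEq ι] (M : Matrix ι ι ℂ) (ν : ι) :
    ∑ μ, ‖M μ ν‖ ^ 2 ≤ ‖M‖ ^ 2 := by
  have h := Matrix.l2_opNorm_mulVec M (EuclideanSpace.single ν 1)
  rw [PiLp.norm_single, norm_one, mul_one] at h
  have h2 := pow_le_pow_left₀ (norm_nonneg _) h 2
  rw [EuclideanSpace.norm_sq_eq] at h2
  simpa using h2

lemma norm_entry_le {ι : Type*} [Fintype ι] [DecidableEq ι] (M : Matrix ι ι ℂ) (μ ν : ι) :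
    ‖M μ ν‖ ≤ ‖M‖ := by
  have h := sum_sq_norm_col_le M ν
  have h2 := Finset.single_le_sum (f := fun μ => ‖M μ ν‖ ^ 2) (fun i _ => sq_nonneg _)
    (Finset.mem_univ μ)
  exact le_of_sq_le_sq (h2.trans h) (norm_nonneg _)

namespace EthSystem

variable {S} {κ : ℝ}

lemma CouplingSize.integrable_sq_elem (h : S.CouplingSize P κ) (hκ : 0 < κ) (μ ν : Bits n) :
    Integrable (fun x => ‖S.elem x μ ν‖ ^ 2) (couplingLaw n P) := by
  refine (h.integral_norm_pow_le hκ 2).1.mono'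
    (((S.measurable_elem μ ν).norm.pow_const 2).aestronglyMeasurable) (.of_forall fun x => ?_)
  rw [Real.norm_eq_abs, abs_of_nonneg (by positivity)]
  exact pow_le_pow_left₀ (norm_nonneg _) (norm_entry_le (S.elemMat x) μ ν) 2

/-- Columns of an operator have `ℓ²` norm at most its operator norm. The total strength of all
transitions from a level is thus bounded independently of the dimension. -/
lemma CouplingSize.sum_variance_le (h : S.CouplingSize P κ) (hκ : 0 < κ) (ν : Bits n) :
    ∑ μ, S.variance P μ ν ≤ 4 * κ ^ 2 := by
  simp only [variance]
  rw [← integral_finsetSum _ fun μ _ => h.integrable_sq_elem hκ μ ν]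
  have h2 := h.integral_norm_pow_le hκ 2
  refine (integral_mono (integrable_finsetSum _ fun μ _ => h.integrable_sq_elem hκ μ ν) h2.1
    fun x => sum_sq_norm_col_le (S.elemMat x) ν).trans (h2.2.trans (le_of_eq ?_))
  norm_num [Nat.factorial]
  ring

end EthSystem

end Moments

/-! ### The system with its ancillas, in the energy eigenbasis -/

section Model

open scoped Matrix.Norms.L2Operator

variable {ι : Type*} [Fintype ι] [DecidableEq ι] {na : ℕ}

/-- Energy of an uncoupled basis state. -/
def freeEnergy (e : ι → ℝ) (ω : Fin na → ℝ) (x : ι × Bits na) : ℝ :=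
  e x.1 + (∑ m, bsgn (x.2 m) * ω m) / 2

/-- Hamiltonian without couplings. -/
def freeHam (e : ι → ℝ) (ω : Fin na → ℝ) : Matrix (ι × Bits na) (ι × Bits na) ℂ :=
  Matrix.diagonal fun x => (freeEnergy e ω x : ℂ)

/-- Coupling to the `m`-th ancilla. -/
def flipTerm (lam : ℝ) (V : Fin na → Matrix ι ι ℂ) (m : Fin na) :
    Matrix (ι × Bits na) (ι × Bits na) ℂ := (lam : ℂ) • (V m ⊗ₖ pauliX m)

/-- Hamiltonian with the couplings to the ancillas in `s`. -/
def partHam (e : ι → ℝ) (lam : ℝ) (V : Fin na → Matrix ι ι ℂ) (s : Finset (Fin na))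
    (ω : Fin na → ℝ) : Matrix (ι × Bits na) (ι × Bits na) ℂ :=
  freeHam e ω + ∑ m ∈ s, flipTerm lam V m

/-- A system observable that is diagonal in the energy eigenbasis. -/
def obs (na : ℕ) (a : ι → ℝ) : Matrix (ι × Bits na) (ι × Bits na) ℂ :=
  Matrix.diagonal fun x => (a x.1 : ℂ)

/-- Flip the `m`-th bit. -/
def flipBit (m : Fin na) (b : Bits na) : Bits na := Function.update b m (!(b m))

lemma flipBit_same (m : Fin na) (b : Bits na) : flipBit m b m = !(b m) := by simp [flipBit]

lemma flipBit_of_ne {m k : Fin na} (h : k ≠ m) (b : Bits na) : flipBit m b k = b k := by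
  simp [flipBit, h]

lemma flipBit_flipBit (m : Fin na) (b : Bits na) : flipBit m (flipBit m b) = b := by
  simp [flipBit]

lemma flipTerm_apply (lam : ℝ) (V : Fin na → Matrix ι ι ℂ) (m : Fin na) (x y : ι × Bits na) :
    flipTerm lam V m x y = if x.2 = flipBit m y.2 then (lam : ℂ) * V m x.1 y.1 else 0 := by
  have hX : pauliX m x.2 y.2 = if x.2 = flipBit m y.2 then 1 else 0 := rfl
  rw [flipTerm, Matrix.smul_apply, Matrix.kroneckerMap_apply, hX]
  by_cases h : x.2 = flipBit m y.2
  · rw [if_pos h, if_pos h]; simp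
  · rw [if_neg h, if_neg h]; simp

lemma mul_diagonal_eq_diagonal_mul {X : Type*} [Fintype X] [DecidableEq X] {M : Matrix X X ℂ}
    {d d' : X → ℂ} (h : ∀ x y, M x y ≠ 0 → d' x = d y) :
    M * Matrix.diagonal d = Matrix.diagonal d' * M := by
  ext x y
  rw [Matrix.mul_diagonal, Matrix.diagonal_mul]
  by_cases hM : M x y = 0
  · simp [hM]
  · rw [h x y hM, mul_comm]

lemma flipTerm_mul_diagonal (lam : ℝ) (V : Fin na → Matrix ι ι ℂ) (m : Fin na)
    {d d' : ι × Bits na → ℂ} (h : ∀ (μ ν : ι) (b : Bits na), d' (μ, flipBit m b) = d (ν, b)) :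
    flipTerm lam V m * Matrix.diagonal d = Matrix.diagonal d' * flipTerm lam V m := by
  apply mul_diagonal_eq_diagonal_mul
  rintro ⟨μ, b⟩ ⟨ν, c⟩ hxy
  rw [flipTerm_apply] at hxy
  have hb : b = flipBit m c := by
    by_contra hne
    exact hxy (if_neg hne)
  rw [hb]
  exact h μ ν c

lemma isSelfAdjoint_diagonal {X : Type*} [DecidableEq X] (d : X → ℝ) :
    IsSelfAdjoint (Matrix.diagonal fun x => (d x : ℂ)) := by
  rw [IsSelfAdjoint, Matrix.star_eq_conjTranspose, Matrix.diagonal_conjTranspose]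
  congr 1
  funext x
  simp

lemma isSelfAdjoint_freeHam (e : ι → ℝ) (ω : Fin na → ℝ) : IsSelfAdjoint (freeHam e ω) :=
  isSelfAdjoint_diagonal _

lemma pauliX_conjTranspose (m : Fin na) : (pauliX m)ᴴ = pauliX m := by
  ext b c
  have : b = flipBit m c ↔ c = flipBit m b :=
    ⟨fun h => by rw [h, flipBit_flipBit], fun h => by rw [h, flipBit_flipBit]⟩
  simp only [pauliX, Matrix.conjTranspose_apply, Matrix.of_apply]
  change star (if c = flipBit m b then (1 : ℂ) else 0) = if b = flipBit m c then 1 else 0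
  simp only [this]
  split_ifs <;> simp

lemma pauliX_mul_self (m : Fin na) : pauliX m * pauliX m = 1 := by
  ext b c
  rw [Matrix.mul_apply, Finset.sum_eq_single (flipBit m c)]
  · have h1 : pauliX m (flipBit m c) c = 1 := by simp [pauliX, flipBit]
    have h2 : pauliX m b (flipBit m c) = if b = c then 1 else 0 := by
      change (if b = flipBit m (flipBit m c) then (1 : ℂ) else 0) = _
      rw [flipBit_flipBit]
    rw [h1, h2, mul_one, Matrix.one_apply]
  · intro k _ hk
    have : pauliX m k c = 0 := if_neg hk
    rw [this, mul_zero]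
  · simp

lemma isSelfAdjoint_flipTerm {lam : ℝ} {V : Fin na → Matrix ι ι ℂ} {m : Fin na}
    (hV : (V m).IsHermitian) : IsSelfAdjoint (flipTerm lam V m) := by
  rw [IsSelfAdjoint, Matrix.star_eq_conjTranspose, flipTerm, Matrix.conjTranspose_smul,
    Matrix.conjTranspose_kronecker, pauliX_conjTranspose, hV.eq]
  simp

lemma isSelfAdjoint_sum_flipTerm {lam : ℝ} {V : Fin na → Matrix ι ι ℂ}
    (hV : ∀ m, (V m).IsHermitian) (s : Finset (Fin na)) :
    IsSelfAdjoint (∑ m ∈ s, flipTerm lam V m) :=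
  isSelfAdjoint_sum s fun m _ => isSelfAdjoint_flipTerm (hV m)

lemma isSelfAdjoint_partHam {e : ι → ℝ} {lam : ℝ} {V : Fin na → Matrix ι ι ℂ}
    (hV : ∀ m, (V m).IsHermitian) (s : Finset (Fin na)) (ω : Fin na → ℝ) :
    IsSelfAdjoint (partHam e lam V s ω) :=
  (isSelfAdjoint_freeHam e ω).add (isSelfAdjoint_sum_flipTerm hV s)

/-- Tensoring with the identity of the ancillas. -/
def tensorOne (ι : Type*) [Fintype ι] [DecidableEq ι] (β : Type*) [Fintype β] [DecidableEq β] :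
    Matrix ι ι ℂ →⋆ₐ[ℂ] Matrix (ι × β) (ι × β) ℂ where
  toFun A := A ⊗ₖ (1 : Matrix β β ℂ)
  map_one' := by simp
  map_mul' A B := by rw [← Matrix.mul_kronecker_mul, Matrix.one_mul]
  map_zero' := by simp
  map_add' A B := by rw [Matrix.add_kronecker]
  commutes' c := by
    rw [Algebra.algebraMap_eq_smul_one, Algebra.algebraMap_eq_smul_one, Matrix.smul_kronecker,
      Matrix.one_kronecker_one]
  map_star' A := by
    rw [Matrix.star_eq_conjTranspose, Matrix.star_eq_conjTranspose, Matrix.conjTranspose_kronecker,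
      Matrix.conjTranspose_one]

lemma norm_flipTerm_le (lam : ℝ) (V : Fin na → Matrix ι ι ℂ) (m : Fin na) :
    ‖flipTerm lam V m‖ ≤ |lam| * ‖V m‖ := by
  have e : V m ⊗ₖ pauliX m =
      tensorOne ι (Bits na) (V m) * ((1 : Matrix ι ι ℂ) ⊗ₖ pauliX m) := by
    change _ = (V m ⊗ₖ (1 : Matrix (Bits na) (Bits na) ℂ)) * _
    rw [← Matrix.mul_kronecker_mul, Matrix.one_mul, Matrix.mul_one]
  have hu : ((1 : Matrix ι ι ℂ) ⊗ₖ pauliX (na := na) m) ∈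
      unitary (Matrix (ι × Bits na) (ι × Bits na) ℂ) := by
    have h2 : star ((1 : Matrix ι ι ℂ) ⊗ₖ pauliX (na := na) m) = (1 : Matrix ι ι ℂ) ⊗ₖ pauliX m := by
      rw [Matrix.star_eq_conjTranspose, Matrix.conjTranspose_kronecker, pauliX_conjTranspose,
        Matrix.conjTranspose_one]
    rw [Unitary.mem_iff, h2, ← Matrix.mul_kronecker_mul, pauliX_mul_self, Matrix.one_mul,
      Matrix.one_kronecker_one]
    exact ⟨rfl, rfl⟩
  rw [flipTerm, norm_smul, e, CStarRing.norm_mul_mem_unitary _ hu]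
  gcongr
  · simp
  · exact NonUnitalStarAlgHom.norm_apply_le (tensorOne ι (Bits na)) (V m)

lemma norm_diagonal_le {X : Type*} [Fintype X] [DecidableEq X] {d : X → ℂ} (h : ∀ x, ‖d x‖ ≤ 1) :
    ‖(Matrix.diagonal d : Matrix X X ℂ)‖ ≤ 1 := by
  rw [Matrix.l2_opNorm_diagonal]
  exact (pi_norm_le_iff_of_nonneg zero_le_one).2 h

lemma norm_obs_le {a : ι → ℝ} (ha : ∀ ν, |a ν| ≤ 1) : ‖obs na a‖ ≤ 1 :=
  norm_diagonal_le fun x => by simpa using ha x.1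

lemma continuous_freeEnergy (e : ι → ℝ) (x : ι × Bits na) :
    Continuous fun ω => freeEnergy e ω x := by
  unfold freeEnergy
  fun_prop

lemma continuous_freeHam (e : ι → ℝ) :
    Continuous fun ω : Fin na → ℝ => freeHam e ω :=
  Continuous.matrix_diagonal (continuous_pi fun x =>
    Complex.continuous_ofReal.comp (continuous_freeEnergy e x))

lemma sum_update_bsgn (b : Bits na) (ω : Fin na → ℝ) (i : Fin na) (u : ℝ) :
    ∑ m, bsgn (b m) * Function.update ω i u m =
      bsgn (b i) * u + ∑ m, bsgn (b m) * Function.update ω i 0 m := by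
  rw [← Finset.add_sum_erase _ _ (Finset.mem_univ i),
    ← Finset.add_sum_erase _ (fun m => bsgn (b m) * Function.update ω i 0 m) (Finset.mem_univ i)]
  simp only [Function.update_self, mul_zero, zero_add]
  congr 1
  refine Finset.sum_congr rfl fun m hm => ?_
  rw [Function.update_of_ne (Finset.ne_of_mem_erase hm),
    Function.update_of_ne (Finset.ne_of_mem_erase hm)]

/-- Set two frequencies. -/
def setTwo (ω : Fin na → ℝ) (i j : Fin na) (p : ℝ × ℝ) : Fin na → ℝ :=
  Function.update (Function.update ω i p.1) j p.2

lemma continuous_setTwo (ω : Fin na → ℝ) (i j : Fin na) : Continuous (setTwo ω i j) := by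
  have h : Continuous fun _ : ℝ × ℝ => ω := continuous_const
  exact (h.update i continuous_fst).update j continuous_snd

lemma freeEnergy_setTwo (e : ι → ℝ) (ω : Fin na → ℝ) {i j : Fin na} (hij : i ≠ j) (p : ℝ × ℝ)
    (x : ι × Bits na) : freeEnergy e (setTwo ω i j p) x =
      freeEnergy e (setTwo ω i j 0) x + ancEnergy (x.2 i, x.2 j) p := by
  simp only [freeEnergy, setTwo, ancEnergy, Prod.fst_zero, Prod.snd_zero]
  rw [sum_update_bsgn _ _ j p.2, Function.update_comm hij, sum_update_bsgn _ _ i p.1,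
    Function.update_comm hij]
  ring

/-- Projection to the basis states of two ancillas. -/
def pairProj (ι : Type*) [DecidableEq ι] (i j : Fin na) (b : Bool × Bool) :
    Matrix (ι × Bits na) (ι × Bits na) ℂ :=
  Matrix.diagonal fun x => if (x.2 i, x.2 j) = b then 1 else 0

lemma flipTerm_mul_pairProj_of_ne (lam : ℝ) (V : Fin na → Matrix ι ι ℂ) {m i j : Fin na}
    (hi : i ≠ m) (hj : j ≠ m) (b : Bool × Bool) :
    Commute (pairProj ι i j b) (flipTerm lam V m) := by
  refine (flipTerm_mul_diagonal lam V m fun μ ν c => ?_).symm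
  simp only [flipBit_of_ne hi, flipBit_of_ne hj]

lemma commute_diagonal {X : Type*} [Fintype X] [DecidableEq X] (d d' : X → ℂ) :
    Commute (Matrix.diagonal d) (Matrix.diagonal d') := by
  rw [Commute, SemiconjBy, Matrix.diagonal_mul_diagonal, Matrix.diagonal_mul_diagonal]
  simp only [mul_comm]

lemma freeHam_setTwo_mul_pairProj (e : ι → ℝ) (ω : Fin na → ℝ) {i j : Fin na} (hij : i ≠ j)
    (p : ℝ × ℝ) (b : Bool × Bool) : freeHam e (setTwo ω i j p) * pairProj ι i j b =
      (freeHam e (setTwo ω i j 0) + (ancEnergy b p : ℂ) • 1) * pairProj ι i j b := by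
  rw [freeHam, freeHam, pairProj, ← Matrix.diagonal_one, ← Matrix.diagonal_smul,
    Matrix.diagonal_add, Matrix.diagonal_mul_diagonal, Matrix.diagonal_mul_diagonal]
  congr 1
  funext x
  split_ifs with h
  · rw [freeEnergy_setTwo e ω hij, h]; simp
  · simp

/-- Two coupled ancillas singled out from the rest. -/
def pairModel (e : ι → ℝ) (lam : ℝ) {V : Fin na → Matrix ι ι ℂ} (hV : ∀ m, (V m).IsHermitian)
    {s : Finset (Fin na)} {i j : Fin na} (hij : i ≠ j) (hi : i ∉ s) (hj : j ∉ s)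
    (ω : Fin na → ℝ) : TwoAncilla (Matrix (ι × Bits na) (ι × Bits na) ℂ) where
  P := pairProj ι i j
  h p := partHam e lam V s (setTwo ω i j p)
  h0 := partHam e lam V s (setTwo ω i j 0)
  norm_P b := norm_diagonal_le fun x => by split_ifs <;> simp
  sum_P := by
    simp only [pairProj]
    rw [← Matrix.diagonal_one]
    ext x y
    rw [Matrix.sum_apply]
    by_cases hxy : x = y
    · subst hxy; simp
    · simp [hxy]
  orth b c hbc := by
    rw [pairProj, pairProj, Matrix.diagonal_mul_diagonal, ← Matrix.diagonal_zero]
    congr 1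
    funext x
    split_ifs with h1 h2
    · exact absurd (h1.symm.trans h2) hbc
    all_goals simp
  h_sa p := isSelfAdjoint_partHam hV s _
  h0_sa := isSelfAdjoint_partHam hV s _
  h_cont := ((continuous_freeHam e).comp (continuous_setTwo ω i j)).add continuous_const
  P_h0 b := (commute_diagonal _ _).add_right (Commute.sum_right _ _ _ fun m hm =>
    flipTerm_mul_pairProj_of_ne lam V (ne_of_mem_of_not_mem hm hi).symm
      (ne_of_mem_of_not_mem hm hj).symm b)
  h_P p b := by
    simp only [partHam, add_mul]
    rw [freeHam_setTwo_mul_pairProj e ω hij, add_mul]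
    abel
  P_h p b := by
    have hc : ∀ p, Commute (pairProj ι i j b) (freeHam e (setTwo ω i j p)) := fun p =>
      commute_diagonal _ _
    simp only [partHam, mul_add]
    rw [(hc p).eq, freeHam_setTwo_mul_pairProj e ω hij, add_mul, (hc 0).eq]
    simp only [smul_mul_assoc, mul_smul_comm, one_mul, mul_one]
    abel

/-- Projection to the basis states of one ancilla. -/
def singleProj (ι : Type*) [DecidableEq ι] (j : Fin na) (b : Bool × Bool) :
    Matrix (ι × Bits na) (ι × Bits na) ℂ :=
  Matrix.diagonal fun x => if (x.2 j, false) = b then 1 else 0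

lemma freeEnergy_update (e : ι → ℝ) (ω : Fin na → ℝ) (j : Fin na) (u : ℝ) (x : ι × Bits na) :
    freeEnergy e (Function.update ω j u) x =
      freeEnergy e (Function.update ω j 0) x + bsgn (x.2 j) * u / 2 := by
  simp only [freeEnergy]
  rw [sum_update_bsgn _ _ j u]
  ring

/-- One coupled ancilla singled out, with a dummy second one. -/
def singleModel (e : ι → ℝ) (j : Fin na) (ω : Fin na → ℝ) :
    TwoAncilla (Matrix (ι × Bits na) (ι × Bits na) ℂ) where
  P := singleProj ι j
  -- The dummy ancilla stays in the state `false`, of energy `p.2 / 2`. Projections whose second bit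
  -- is `true` vanish.
  h p := freeHam e (Function.update ω j p.1) + ((p.2 / 2 : ℝ) : ℂ) • 1
  h0 := freeHam e (Function.update ω j 0)
  norm_P b := norm_diagonal_le fun x => by split_ifs <;> simp
  sum_P := by
    simp only [singleProj]
    rw [← Matrix.diagonal_one]
    ext x y
    rw [Matrix.sum_apply]
    by_cases hxy : x = y
    · subst hxy; simp
    · simp [hxy]
  orth b c hbc := by
    rw [singleProj, singleProj, Matrix.diagonal_mul_diagonal, ← Matrix.diagonal_zero]
    congr 1
    funext x
    split_ifs with h1 h2
    · exact absurd (h1.symm.trans h2) hbc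
    all_goals simp
  h_sa p := (isSelfAdjoint_freeHam e _).add (by
    rw [← Matrix.diagonal_one, ← Matrix.diagonal_smul]
    have := isSelfAdjoint_diagonal fun _ : ι × Bits na => p.2 / 2
    convert! this using 2
    funext x
    simp)
  h0_sa := isSelfAdjoint_freeHam e _
  h_cont := ((continuous_freeHam e).comp (continuous_const.update j continuous_fst)).add
    (by fun_prop)
  P_h0 b := commute_diagonal _ _
  h_P p b := by
    rw [freeHam, freeHam, singleProj, ← Matrix.diagonal_one, ← Matrix.diagonal_smul,
      ← Matrix.diagonal_smul, Matrix.diagonal_add, Matrix.diagonal_add,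
      Matrix.diagonal_mul_diagonal, Matrix.diagonal_mul_diagonal]
    congr 1
    funext x
    split_ifs with h
    · rw [freeEnergy_update e ω j, ← h]
      simp [ancEnergy, bsgn]
      ring
    · simp
  P_h p b := by
    rw [freeHam, freeHam, singleProj, ← Matrix.diagonal_one, ← Matrix.diagonal_smul,
      ← Matrix.diagonal_smul, Matrix.diagonal_add, Matrix.diagonal_add,
      Matrix.diagonal_mul_diagonal, Matrix.diagonal_mul_diagonal]
    congr 1
    funext x
    split_ifs with h
    · rw [freeEnergy_update e ω j, ← h]
      simp [ancEnergy, bsgn]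
      ring
    · simp

lemma flipTerm_mul_pairProj_fst (lam : ℝ) (V : Fin na → Matrix ι ι ℂ) {i j : Fin na} (hij : i ≠ j)
    (b : Bool × Bool) : flipTerm lam V i * pairProj ι i j b =
      pairProj ι i j (flipBy (true, false) b) * flipTerm lam V i := by
  refine flipTerm_mul_diagonal lam V i fun μ ν c => ?_
  simp only [flipBit_same, flipBit_of_ne hij.symm]
  refine if_congr ?_ rfl rfl
  rcases b with ⟨_ | _, _ | _⟩ <;> cases c i <;> cases c j <;> simp [flipBy]

lemma flipTerm_mul_pairProj_snd (lam : ℝ) (V : Fin na → Matrix ι ι ℂ) {i j : Fin na} (hij : i ≠ j)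
    (b : Bool × Bool) : flipTerm lam V j * pairProj ι i j b =
      pairProj ι i j (flipBy (false, true) b) * flipTerm lam V j := by
  refine flipTerm_mul_diagonal lam V j fun μ ν c => ?_
  simp only [flipBit_same, flipBit_of_ne hij]
  refine if_congr ?_ rfl rfl
  rcases b with ⟨_ | _, _ | _⟩ <;> cases c i <;> cases c j <;> simp [flipBy]

lemma flipTerm_mul_singleProj (lam : ℝ) (V : Fin na → Matrix ι ι ℂ) (j : Fin na)
    (b : Bool × Bool) : flipTerm lam V j * singleProj ι j b =
      singleProj ι j (flipBy (true, false) b) * flipTerm lam V j := by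
  refine flipTerm_mul_diagonal lam V j fun μ ν c => ?_
  simp only [flipBit_same]
  refine if_congr ?_ rfl rfl
  rcases b with ⟨_ | _, _ | _⟩ <;> cases c j <;> simp [flipBy]

/-- Matrix entries are continuous functionals for the operator norm. -/
def entryCLM (X : Type*) [Fintype X] [DecidableEq X] (x y : X) : Matrix X X ℂ →L[ℝ] ℂ :=
  LinearMap.mkContinuous
    { toFun := fun M => M x y, map_add' := fun _ _ => rfl, map_smul' := fun _ _ => rfl } 1
    fun M => by rw [one_mul]; exact norm_entry_le M x y

lemma entryCLM_apply {X : Type*} [Fintype X] [DecidableEq X] (x y : X) (M : Matrix X X ℂ) :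
    entryCLM X x y M = M x y := rfl

/-- Dropping the blocks that flip an ancilla leaves diagonal entries unchanged, so bounds for the
even component suffice for populations. -/
lemma sum_diagonal_mul_mul_diagonal {X κ : Type*} [Fintype X] [DecidableEq X] [Fintype κ]
    [DecidableEq κ] (f : X → κ) (M : Matrix X X ℂ) (x : X) :
    (∑ b, Matrix.diagonal (fun x => if f x = b then (1 : ℂ) else 0) * M *
      Matrix.diagonal fun x => if f x = b then (1 : ℂ) else 0) x x = M x x := by
  rw [Matrix.sum_apply]
  simp only [Matrix.mul_diagonal, Matrix.diagonal_mul]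
  rw [Finset.sum_eq_single (f x)]
  · simp
  · intro b _ hb; simp [Ne.symm hb]
  · simp

end Model

/-! ### Frequency averages at fixed couplings -/

section Resampling

variable {α X : Type*} [Fintype α] [DecidableEq α] [MeasurableSpace X] (μ : Measure X)
  [IsProbabilityMeasure μ]

/-- Overwriting one coordinate of an independent family by a fresh copy keeps the law. A frequency
can then be averaged with all the others frozen. -/
lemma measurePreserving_resample (i : α) :
    MeasurePreserving (fun q : (α → X) × X => Function.update q.1 i q.2)
      ((Measure.pi fun _ => μ).prod μ) (Measure.pi fun _ => μ) := by
  have hm : Measurable fun q : (α → X) × X => Function.update q.1 i q.2 := by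
    refine measurable_pi_iff.2 fun k => ?_
    by_cases h : k = i
    · subst h; simpa using measurable_snd
    · simp only [Function.update_of_ne h]; exact (measurable_pi_apply k).comp measurable_fst
  refine ⟨hm, (Measure.pi_eq fun s hs => ?_).symm⟩
  rw [Measure.map_apply hm (MeasurableSet.univ_pi hs)]
  have : (fun q : (α → X) × X => Function.update q.1 i q.2) ⁻¹' Set.univ.pi s =
      (Set.univ.pi (Function.update s i Set.univ)) ×ˢ s i := by
    ext q
    simp only [Set.mem_preimage, Set.mem_univ_pi, Set.mem_prod]
    constructor
    · intro h
      refine ⟨fun k => ?_, by simpa using h i⟩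
      by_cases hk : k = i
      · subst hk; simp
      · simpa [hk] using h k
    · rintro ⟨h1, h2⟩ k
      by_cases hk : k = i
      · subst hk; simpa using h2
      · simpa [hk] using h1 k
  rw [this, Measure.prod_prod, Measure.pi_pi, ← Finset.mul_prod_erase _ _ (Finset.mem_univ i),
    ← Finset.mul_prod_erase _ (fun k => μ (s k)) (Finset.mem_univ i)]
  simp only [Function.update_self, measure_univ, one_mul]
  rw [mul_comm]
  congr 1
  refine Finset.prod_congr rfl fun k hk => ?_
  rw [Function.update_of_ne (Finset.ne_of_mem_erase hk)]

lemma measurePreserving_resample_two (i j : α) :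
    MeasurePreserving
      (fun q : (α → X) × X × X => Function.update (Function.update q.1 i q.2.1) j q.2.2)
      ((Measure.pi fun _ => μ).prod (μ.prod μ)) (Measure.pi fun _ => μ) :=
  (measurePreserving_resample μ j).comp
    (((measurePreserving_resample μ i).prod (MeasurePreserving.id μ)).comp
      (measurePreserving_prodAssoc (Measure.pi fun _ => μ) μ μ).symm)

/-- Averages do not change when a coordinate is resampled. -/
lemma norm_integral_le_of_resample {E : Type*} [NormedAddCommGroup E] [NormedSpace ℝ E] (i : α)
    {f : (α → X) → E} (hf : Integrable f (Measure.pi fun _ => μ)) {K : ℝ}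
    (h : ∀ ω, ‖∫ u, f (Function.update ω i u) ∂μ‖ ≤ K) :
    ‖∫ ω, f ω ∂(Measure.pi fun _ => μ)‖ ≤ K := by
  have hp := measurePreserving_resample μ i
  have hi : Integrable (fun q : (α → X) × X => f (Function.update q.1 i q.2))
      ((Measure.pi fun _ => μ).prod μ) := hp.integrable_comp_of_integrable hf
  rw [← hp.map_eq, integral_map hp.measurable.aemeasurable (by
    rw [hp.map_eq]; exact hf.aestronglyMeasurable), integral_prod _ hi]
  refine (norm_integral_le_of_norm_le_const (C := K) (.of_forall h)).trans (le_of_eq ?_)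
  simp

lemma norm_integral_le_of_resample_two {E : Type*} [NormedAddCommGroup E] [NormedSpace ℝ E]
    (i j : α) {f : (α → X) → E} (hf : Integrable f (Measure.pi fun _ => μ)) {K : ℝ}
    (h : ∀ ω, ‖∫ p : X × X, f (Function.update (Function.update ω i p.1) j p.2) ∂(μ.prod μ)‖ ≤ K) :
    ‖∫ ω, f ω ∂(Measure.pi fun _ => μ)‖ ≤ K := by
  have hp := measurePreserving_resample_two μ i j
  have hi : Integrable
      (fun q : (α → X) × X × X => f (Function.update (Function.update q.1 i q.2.1) j q.2.2))
      ((Measure.pi fun _ => μ).prod (μ.prod μ)) := hp.integrable_comp_of_integrable hf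
  rw [← hp.map_eq, integral_map hp.measurable.aemeasurable (by
    rw [hp.map_eq]; exact hf.aestronglyMeasurable), integral_prod _ hi]
  refine (norm_integral_le_of_norm_le_const (C := K) (.of_forall h)).trans (le_of_eq ?_)
  simp

end Resampling

/-! ### Thermal weights of the ancilla states -/

section Weights

variable {na : ℕ} {β Ω : ℝ}

/-- Thermal probability of a basis state of the ancillas. -/
def thermalWeight (β : ℝ) (ω : Fin na → ℝ) (b : Bits na) : ℝ := ∏ m, boltz β (b m) (ω m)

lemma thermalWeight_nonneg (β : ℝ) (ω : Fin na → ℝ) (b : Bits na) : 0 ≤ thermalWeight β ω b :=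
  Finset.prod_nonneg fun m _ => (boltz_pos β (b m) (ω m)).le

lemma sum_prod_bits (f : Fin na → Bool → ℝ) : ∑ b : Bits na, ∏ m, f m (b m) = ∏ m, ∑ c, f m c := by
  rw [Finset.prod_univ_sum, Fintype.piFinset_univ]

lemma sum_thermalWeight (β : ℝ) (ω : Fin na → ℝ) : ∑ b, thermalWeight β ω b = 1 := by
  simp only [thermalWeight]
  rw [sum_prod_bits fun m c => boltz β c (ω m)]
  exact Finset.prod_eq_one fun m _ => sum_boltz β (ω m)

lemma continuous_thermalWeight (β : ℝ) (b : Bits na) :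
    Continuous fun ω => thermalWeight β ω b :=
  continuous_finsetProd _ fun m _ => (continuous_boltz β (b m)).comp (continuous_apply m)

/-- The thermal weight without the factors of the ancillas in `s`. -/
def restWeight (β : ℝ) (s : Finset (Fin na)) (ω : Fin na → ℝ) (b : Bits na) : ℝ :=
  ∏ m, if m ∈ s then 1 else boltz β (b m) (ω m)

lemma restWeight_nonneg (β : ℝ) (s : Finset (Fin na)) (ω : Fin na → ℝ) (b : Bits na) :
    0 ≤ restWeight β s ω b :=
  Finset.prod_nonneg fun m _ => by
    split_ifs
    · exact zero_le_one
    · exact (boltz_pos β (b m) (ω m)).le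

/-- Each removed factor leaves a free sum over two states. This is the price of moving the thermal
weights of distinguished ancillas into their frequency measures. -/
lemma sum_restWeight (β : ℝ) (s : Finset (Fin na)) (ω : Fin na → ℝ) :
    ∑ b, restWeight β s ω b = 2 ^ s.card := by
  simp only [restWeight]
  rw [sum_prod_bits fun m c => if m ∈ s then 1 else boltz β c (ω m)]
  have : ∀ m, (∑ c : Bool, if m ∈ s then (1 : ℝ) else boltz β c (ω m)) = if m ∈ s then 2 else 1 := by
    intro m
    split_ifs
    · simp
    · exact sum_boltz β (ω m)
  simp only [this, Finset.prod_ite, Finset.prod_const, one_pow, mul_one]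
  simp

lemma thermalWeight_update (β : ℝ) (ω : Fin na → ℝ) (j : Fin na) (u : ℝ) (b : Bits na) :
    thermalWeight β (Function.update ω j u) b = boltz β (b j) u * restWeight β {j} ω b := by
  rw [thermalWeight, restWeight, ← Finset.mul_prod_erase _ _ (Finset.mem_univ j),
    ← Finset.mul_prod_erase _ (fun m => if m ∈ ({j} : Finset (Fin na)) then 1 else boltz β (b m) (ω m))
      (Finset.mem_univ j)]
  simp only [Function.update_self, Finset.mem_singleton, if_true, one_mul]
  congr 1
  refine Finset.prod_congr rfl fun m hm => ?_
  have := Finset.ne_of_mem_erase hm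
  rw [Function.update_of_ne this, if_neg this]

lemma thermalWeight_setTwo (β : ℝ) (ω : Fin na → ℝ) {i j : Fin na} (hij : i ≠ j) (p : ℝ × ℝ)
    (b : Bits na) : thermalWeight β (setTwo ω i j p) b =
      boltz β (b i) p.1 * boltz β (b j) p.2 * restWeight β {i, j} ω b := by
  have hj : j ∈ Finset.univ.erase i := by simp [hij.symm]
  rw [thermalWeight, restWeight, ← Finset.mul_prod_erase _ _ (Finset.mem_univ i),
    ← Finset.mul_prod_erase _ (fun m => if m ∈ ({i, j} : Finset (Fin na)) then 1 else boltz β (b m) (ω m))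
      (Finset.mem_univ i), ← Finset.mul_prod_erase _ _ hj,
    ← Finset.mul_prod_erase _ (fun m => if m ∈ ({i, j} : Finset (Fin na)) then 1 else boltz β (b m) (ω m)) hj]
  simp only [setTwo, Function.update_self, Function.update_of_ne hij, Finset.mem_insert,
    Finset.mem_singleton, true_or, or_true, if_true, one_mul, mul_assoc]
  congr 2
  refine Finset.prod_congr rfl fun m hm => ?_
  obtain ⟨h1, h2, -⟩ : m ≠ j ∧ m ≠ i ∧ True := by simpa using hm
  rw [Function.update_of_ne h1, Function.update_of_ne h2, if_neg (by simp [h1, h2])]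

lemma sum_thermalWeight_mul (β : ℝ) (ω : Fin na → ℝ) (j : Fin na) (g : Bool → ℝ) :
    ∑ b, thermalWeight β ω b * g (b j) = ∑ c, boltz β c (ω j) * g c := by
  have h1 : ∀ b : Bits na, thermalWeight β ω b * g (b j) =
      ∏ m, boltz β (b m) (ω m) * (if m = j then g (b m) else 1) := by
    intro b
    rw [Finset.prod_mul_distrib, Finset.prod_ite_eq' Finset.univ j fun m => g (b m)]
    simp [thermalWeight]
  simp only [h1]
  rw [sum_prod_bits fun m c => boltz β c (ω m) * (if m = j then g c else 1),
    ← Finset.mul_prod_erase _ _ (Finset.mem_univ j), Finset.prod_eq_one, mul_one]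
  · simp
  · intro m hm
    simp only [if_neg (Finset.ne_of_mem_erase hm), mul_one]
    exact sum_boltz β (ω m)

lemma integral_prod_thermalLaw {E : Type*} [NormedAddCommGroup E] [NormedSpace ℝ E] (hΩ : 0 < Ω)
    (β : ℝ) (c c' : Bool) (f : ℝ × ℝ → E) :
    ∫ p, f p ∂((thermalLaw β Ω c).prod (thermalLaw β Ω c')) =
      ∫ p, (boltz β c p.1 * boltz β c' p.2) • f p ∂((freqLaw Ω).prod (freqLaw Ω)) := by
  have := isProbabilityMeasure_freqLaw hΩ
  have hm : ∀ c, Measurable fun ω => ENNReal.ofReal (boltz β c ω) := fun c =>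
    (continuous_boltz β c).measurable.ennreal_ofReal
  rw [thermalLaw, thermalLaw, prod_withDensity (hm c) (hm c')]
  have h : (fun z : ℝ × ℝ => ENNReal.ofReal (boltz β c z.1) * ENNReal.ofReal (boltz β c' z.2)) =
      fun z => ((Real.toNNReal (boltz β c z.1 * boltz β c' z.2) : ℝ≥0) : ℝ≥0∞) := by
    funext z
    rw [← ENNReal.ofReal_mul (boltz_pos _ _ _).le]
    rfl
  rw [h, integral_withDensity_eq_integral_smul]
  · congr 1
    funext z
    rw [NNReal.smul_def, Real.coe_toNNReal _ (mul_pos (boltz_pos _ _ _) (boltz_pos _ _ _)).le]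
  · exact (((continuous_boltz β c).measurable.comp measurable_fst).mul
      ((continuous_boltz β c').measurable.comp measurable_snd)).real_toNNReal

end Weights

/-! ### Interference of two ancillas at fixed couplings -/

section PairAverage

open scoped Matrix.Norms.L2Operator

variable {ι : Type*} [Fintype ι] [DecidableEq ι] {na : ℕ} {β Ω γ lam : ℝ} {e a : ι → ℝ}
  {V : Fin na → Matrix ι ι ℂ}

/-- Expectation of an observable after one cycle of random length, for a given initial level and
given frequencies, with only the ancillas in `s` coupled. -/
def meanObs (β γ lam : ℝ) (e a : ι → ℝ) (V : Fin na → Matrix ι ι ℂ) (ν : ι) (s : Finset (Fin na))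
    (ω : Fin na → ℝ) : ℂ :=
  ∑ b, (thermalWeight β ω b * γ) • res γ (partHam e lam V s ω) (obs na a) (ν, b) (ν, b)

lemma continuous_partHam (e : ι → ℝ) (lam : ℝ) (V : Fin na → Matrix ι ι ℂ) (s : Finset (Fin na)) :
    Continuous fun ω => partHam e lam V s ω :=
  (continuous_freeHam e).add continuous_const

lemma continuous_meanObs (hγ : 0 < γ) (hV : ∀ m, (V m).IsHermitian) (ν : ι) (s : Finset (Fin na)) :
    Continuous fun ω => meanObs β γ lam e a V ν s ω := by
  refine continuous_finsetSum _ fun b _ => ?_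
  refine ((continuous_thermalWeight β b).mul continuous_const).smul ?_
  exact (entryCLM _ (ν, b) (ν, b)).continuous.comp
    (continuous_res hγ (continuous_partHam e lam V s) (fun ω => isSelfAdjoint_partHam hV s ω)
      continuous_const)

lemma norm_sum_thermalWeight_smul_le (β : ℝ) (ω : Fin na → ℝ) {f : Bits na → ℂ} {K : ℝ}
    (hf : ∀ b, ‖f b‖ ≤ K) : ‖∑ b, thermalWeight β ω b • f b‖ ≤ K := by
  refine (norm_sum_le _ _).trans ?_
  calc _ ≤ ∑ b, thermalWeight β ω b * K := Finset.sum_le_sum fun b _ => by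
        rw [norm_smul, Real.norm_eq_abs, abs_of_nonneg (thermalWeight_nonneg β ω b)]
        exact mul_le_mul_of_nonneg_left (hf b) (thermalWeight_nonneg β ω b)
    _ = K := by rw [← Finset.sum_mul, sum_thermalWeight, one_mul]

lemma norm_meanObs_le (hγ : 0 < γ) (hV : ∀ m, (V m).IsHermitian) (ha : ∀ ν, |a ν| ≤ 1) (ν : ι)
    (s : Finset (Fin na)) (ω : Fin na → ℝ) : ‖meanObs β γ lam e a V ν s ω‖ ≤ 1 := by
  simp only [meanObs, mul_smul]
  refine norm_sum_thermalWeight_smul_le β ω fun b => ?_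
  rw [norm_smul, Real.norm_eq_abs, abs_of_pos hγ]
  have h1 := (norm_entry_le (res γ (partHam e lam V s ω) (obs na a)) (ν, b) (ν, b)).trans
    ((norm_res_le hγ (isSelfAdjoint_partHam hV s ω) (obs na a)).trans
      (mul_le_mul_of_nonneg_left (norm_obs_le ha) (inv_pos.2 hγ).le))
  calc _ ≤ γ * (γ⁻¹ * 1) := by gcongr
    _ = 1 := by field_simp

lemma integrable_of_continuous_bounded (hΩ : 0 < Ω) {E : Type*} [NormedAddCommGroup E]
    [SecondCountableTopology E] {f : (Fin na → ℝ) → E} (hf : Continuous f) {K : ℝ}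
    (hK : ∀ ω, ‖f ω‖ ≤ K) : Integrable f (Measure.pi fun _ => freqLaw Ω) := by
  have := isProbabilityMeasure_freqLaw hΩ
  exact (integrable_const K).mono' hf.aestronglyMeasurable (.of_forall hK)

lemma pairModel_blk_entry (hV : ∀ m, (V m).IsHermitian) {s : Finset (Fin na)} {i j : Fin na}
    (hij : i ≠ j) (hi : i ∉ s) (hj : j ∉ s) (ω : Fin na → ℝ)
    (F : Matrix (ι × Bits na) (ι × Bits na) ℂ) (x : ι × Bits na) :
    (pairModel e lam hV hij hi hj ω).blk (false, false) F x x = F x x := by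
  simp only [TwoAncilla.blk, TwoAncilla.commute_flipBy_zero]
  exact sum_diagonal_mul_mul_diagonal (fun x : ι × Bits na => (x.2 i, x.2 j)) F x

/-- Mixed second difference of `meanObs` with respect to coupling two more ancillas. -/
def mixedObs (β γ lam : ℝ) (e a : ι → ℝ) (V : Fin na → Matrix ι ι ℂ) (ν : ι) (s : Finset (Fin na))
    (i j : Fin na) (ω : Fin na → ℝ) : ℂ :=
  meanObs β γ lam e a V ν (insert i (insert j s)) ω - meanObs β γ lam e a V ν (insert i s) ω -
    meanObs β γ lam e a V ν (insert j s) ω + meanObs β γ lam e a V ν s ω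

lemma norm_mixedObs_le (hγ : 0 < γ) (hV : ∀ m, (V m).IsHermitian) (ha : ∀ ν, |a ν| ≤ 1) (ν : ι)
    (s : Finset (Fin na)) (i j : Fin na) (ω : Fin na → ℝ) :
    ‖mixedObs β γ lam e a V ν s i j ω‖ ≤ 4 := by
  have h := fun s => norm_meanObs_le (β := β) (lam := lam) (e := e) hγ hV ha ν s ω
  refine (norm_add_le _ _).trans ?_
  have h1 := norm_sub_le (meanObs β γ lam e a V ν (insert i (insert j s)) ω -
    meanObs β γ lam e a V ν (insert i s) ω) (meanObs β γ lam e a V ν (insert j s) ω)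
  have h2 := norm_sub_le (meanObs β γ lam e a V ν (insert i (insert j s)) ω)
    (meanObs β γ lam e a V ν (insert i s) ω)
  linarith [h (insert i (insert j s)), h (insert i s), h (insert j s), h s]

/-- With the other frequencies frozen, the thermal factors of `i` and `j` split off and can serve as
densities of `thermalLaw`, while the operators are those of `pairModel`. -/
lemma mixedObs_setTwo (hV : ∀ m, (V m).IsHermitian) {s : Finset (Fin na)} {i j : Fin na}
    (hij : i ≠ j) (hi : i ∉ s) (hj : j ∉ s) (ω : Fin na → ℝ) (ν : ι) (p : ℝ × ℝ) :
    mixedObs β γ lam e a V ν s i j (setTwo ω i j p) =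
      ∑ b, (restWeight β {i, j} ω b * γ) • ((boltz β (b i) p.1 * boltz β (b j) p.2) •
        TwoAncilla.mixedDiff (pairModel e lam hV hij hi hj ω) γ (flipTerm lam V i) (flipTerm lam V j)
          (obs na a) p (ν, b) (ν, b)) := by
  have hi' : i ∉ insert j s := by simp [hij, hi]
  have h1 : ∀ p, (pairModel e lam hV hij hi hj ω).h p = partHam e lam V s (setTwo ω i j p) :=
    fun _ => rfl
  have h2 : partHam e lam V (insert i s) (setTwo ω i j p) =
      partHam e lam V s (setTwo ω i j p) + flipTerm lam V i := by
    rw [partHam, partHam, Finset.sum_insert hi]; abel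
  have h3 : partHam e lam V (insert j s) (setTwo ω i j p) =
      partHam e lam V s (setTwo ω i j p) + flipTerm lam V j := by
    rw [partHam, partHam, Finset.sum_insert hj]; abel
  have h4 : partHam e lam V (insert i (insert j s)) (setTwo ω i j p) =
      partHam e lam V s (setTwo ω i j p) + (flipTerm lam V i + flipTerm lam V j) := by
    rw [partHam, partHam, Finset.sum_insert hi', Finset.sum_insert hj]; abel
  simp only [mixedObs, meanObs, TwoAncilla.mixedDiff, h1, h2, h3, h4, thermalWeight_setTwo β ω hij]
  rw [← Finset.sum_sub_distrib, ← Finset.sum_sub_distrib, ← Finset.sum_add_distrib]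
  refine Finset.sum_congr rfl fun b _ => ?_
  simp only [Matrix.add_apply, Matrix.sub_apply, Complex.real_smul]
  push_cast
  ring

lemma isFamily_mixedDiff {𝒜 : Type*} [CStarAlgebra 𝒜] (M : TwoAncilla 𝒜) (hγ : 0 < γ)
    {w₁ w₂ : 𝒜} (h₁ : IsSelfAdjoint w₁) (h₂ : IsSelfAdjoint w₂) (A : 𝒜) :
    IsFamily (TwoAncilla.mixedDiff M γ w₁ w₂ A) := by
  have h0 : IsFamily fun ω => res γ (M.h ω) A := TwoAncilla.isFamily_res_h hγ (isFamily_const A)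
  exact (((TwoAncilla.isFamily_res_const hγ (h₁.add h₂) A).sub (TwoAncilla.isFamily_res_const hγ h₁ A)).sub
    (TwoAncilla.isFamily_res_const hγ h₂ A)).add h0

lemma norm_le_of_sum_restWeight (hγ : 0 < γ) {s : Finset (Fin na)} {ω : Fin na → ℝ}
    {f : Bits na → ℂ} {K : ℝ} (hf : ∀ b, ‖f b‖ ≤ K) :
    ‖∑ b, (restWeight β s ω b * γ) • f b‖ ≤ 2 ^ s.card * γ * K := by
  refine (norm_sum_le _ _).trans ?_
  calc _ ≤ ∑ b, restWeight β s ω b * (γ * K) := Finset.sum_le_sum fun b _ => by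
        have := restWeight_nonneg β s ω b
        rw [norm_smul, Real.norm_eq_abs, abs_of_nonneg (by positivity), mul_assoc]
        gcongr
        exact hf b
    _ = _ := by rw [← Finset.sum_mul, sum_restWeight, mul_assoc]

/-- Frequency averages make two ancillas act almost independently. -/
theorem norm_integral_mixedObs_le (hγ : 0 < γ) (hΩ : 0 < Ω) (hV : ∀ m, (V m).IsHermitian)
    (ha : ∀ ν, |a ν| ≤ 1) {s : Finset (Fin na)} {i j : Fin na} (hij : i ≠ j) (hi : i ∉ s)
    (hj : j ∉ s) (ν : ι) {η : ℝ} (hη₁ : |lam| * ‖V i‖ ≤ η) (hη₂ : |lam| * ‖V j‖ ≤ η)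
    (hη : 64 * η ≤ γ) :
    ‖∫ ω, mixedObs β γ lam e a V ν s i j ω ∂(Measure.pi fun _ => freqLaw Ω)‖ ≤
      2 ^ 26 * (η ^ 4 * gainConst Ω γ ^ 2 / γ ^ 2) := by
  have := isProbabilityMeasure_freqLaw hΩ
  have hc : Continuous fun ω => mixedObs β γ lam e a V ν s i j ω :=
    (((continuous_meanObs hγ hV ν _).sub (continuous_meanObs hγ hV ν _)).sub
      (continuous_meanObs hγ hV ν _)).add (continuous_meanObs hγ hV ν _)
  refine norm_integral_le_of_resample_two (freqLaw Ω) i j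
    (integrable_of_continuous_bounded hΩ hc (norm_mixedObs_le hγ hV ha ν s i j)) fun ω => ?_
  change ‖∫ p : ℝ × ℝ, mixedObs β γ lam e a V ν s i j (setTwo ω i j p)
    ∂((freqLaw Ω).prod (freqLaw Ω))‖ ≤ _
  simp only [mixedObs_setTwo hV hij hi hj]
  set M := pairModel e lam hV hij hi hj ω
  set w₁ := flipTerm lam V i
  set w₂ := flipTerm lam V j
  have sa₁ : IsSelfAdjoint w₁ := isSelfAdjoint_flipTerm (hV i)
  have sa₂ : IsSelfAdjoint w₂ := isSelfAdjoint_flipTerm (hV j)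
  have hF : IsFamily (TwoAncilla.mixedDiff M γ w₁ w₂ (obs na a)) := isFamily_mixedDiff M hγ sa₁ sa₂ _
  obtain ⟨hFc, K, hK⟩ := hF
  rw [integral_finsetSum]
  · simp only [integral_smul]
    refine (norm_le_of_sum_restWeight hγ (K := 2 ^ 24 * (η ^ 4 * gainConst Ω γ ^ 2 / γ ^ 3))
      fun b => ?_).trans (le_of_eq ?_)
    · have f₁ := isFiniteMeasure_thermalLaw hΩ β (b i)
      have f₂ := isFiniteMeasure_thermalLaw hΩ β (b j)
      have key := norm_integral_mixedDiff_le (μ₁ := thermalLaw β Ω (b i))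
        (μ₂ := thermalLaw β Ω (b j)) M hγ sa₁ sa₂
        (flipTerm_mul_pairProj_fst lam V hij) (flipTerm_mul_pairProj_snd lam V hij)
        ((norm_flipTerm_le lam V i).trans hη₁) ((norm_flipTerm_le lam V j).trans hη₂) hη
        (A := obs na a) (fun c => commute_diagonal _ _) (norm_obs_le ha) (gainConst_pos hΩ hγ).le
        (fourierBound_thermalLaw hΩ hγ β (b i)) (fourierBound_thermalLaw hΩ hγ β (b j))
      rw [← integral_prod_thermalLaw hΩ]
      refine le_trans (le_of_eq ?_) ((norm_entry_le _ (ν, b) (ν, b)).trans key)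
      have hint : Integrable (fun p => M.blk (false, false) (TwoAncilla.mixedDiff M γ w₁ w₂ (obs na a) p))
          ((thermalLaw β Ω (b i)).prod (thermalLaw β Ω (b j))) := by
        have hFb := isFamily_mixedDiff M hγ sa₁ sa₂ (obs na a)
        have hb : IsFamily fun p => M.blk (false, false) (TwoAncilla.mixedDiff M γ w₁ w₂ (obs na a) p) :=
          IsFamily.sum _ fun c => (hFb.mul_left (M.P c)).mul_right _
        obtain ⟨c, K, hK⟩ := hb
        exact (integrable_const K).mono' c.aestronglyMeasurable (.of_forall hK)
      rw [← entryCLM_apply (ν, b) (ν, b) (∫ p, _ ∂_), ← ContinuousLinearMap.integral_comp_comm _ hint]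
      simp only [entryCLM_apply, M, pairModel_blk_entry]
    -- The two free sums over ancilla states turn `2 ^ 24` into `2 ^ 26`, and the prefactor `γ` of
    -- `meanObs` cancels one power of `γ`.
    · rw [Finset.card_pair hij]
      field_simp
  · intro b _
    have hI : Integrable (fun p : ℝ × ℝ => (boltz β (b i) p.1 * boltz β (b j) p.2) •
        M.mixedDiff γ w₁ w₂ (obs na a) p (ν, b) (ν, b)) ((freqLaw Ω).prod (freqLaw Ω)) := by
      have hb : Continuous fun p : ℝ × ℝ => boltz β (b i) p.1 * boltz β (b j) p.2 :=
        ((continuous_boltz β (b i)).comp continuous_fst).mul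
          ((continuous_boltz β (b j)).comp continuous_snd)
      have hent : Continuous fun p => M.mixedDiff γ w₁ w₂ (obs na a) p (ν, b) (ν, b) :=
        (entryCLM _ (ν, b) (ν, b)).continuous.comp hFc
      refine (integrable_const K).mono' (hb.smul hent).aestronglyMeasurable (.of_forall fun p => ?_)
      rw [norm_smul, Real.norm_eq_abs, abs_of_pos (mul_pos (boltz_pos _ _ _) (boltz_pos _ _ _))]
      have h1 := mul_le_one₀ (boltz_le_one β (b i) p.1) (boltz_pos β (b j) p.2).le
        (boltz_le_one β (b j) p.2)
      have h2 := (norm_entry_le _ (ν, b) (ν, b)).trans (hK p)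
      exact (mul_le_of_le_one_left (norm_nonneg _) h1).trans h2
    exact hI.smul (restWeight β {i, j} ω b * γ)

end PairAverage

/-! ### A single ancilla: second-order perturbation theory -/

section SecondOrder

open scoped Matrix.Norms.L2Operator

variable {X : Type*} [Fintype X] [DecidableEq X] {γ : ℝ}

/-- Real diagonal matrices. -/
def realDiag (d : X → ℝ) : Matrix X X ℂ := Matrix.diagonal fun x => (d x : ℂ)

lemma isSelfAdjoint_realDiag (d : X → ℝ) : IsSelfAdjoint (realDiag d) := isSelfAdjoint_diagonal d

lemma ad_apply (w F : Matrix X X ℂ) (x y : X) :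
    ad w F x y = Complex.I * ((w * F) x y - (F * w) x y) := rfl

lemma gamma_sub_ne_zero (hγ : 0 < γ) (r : ℝ) : (γ : ℂ) - Complex.I * (r : ℂ) ≠ 0 := by
  intro h
  have := congrArg Complex.re h
  simp at this
  exact hγ.ne' this

lemma res_realDiag_apply (hγ : 0 < γ) (d : X → ℝ) (F : Matrix X X ℂ) (x y : X) :
    res γ (realDiag d) F x y = F x y / ((γ : ℂ) - Complex.I * ((d x - d y : ℝ) : ℂ)) := by
  let G : Matrix X X ℂ :=
    Matrix.of fun x y => F x y / ((γ : ℂ) - Complex.I * ((d x - d y : ℝ) : ℂ))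
  have hG : (γ : ℂ) • G - ad (realDiag d) G = F := by
    ext x y
    have h0 := gamma_sub_ne_zero hγ (d x - d y)
    rw [Matrix.sub_apply, Matrix.smul_apply, ad_apply, realDiag, Matrix.diagonal_mul,
      Matrix.mul_diagonal, smul_eq_mul]
    simp only [G, Matrix.of_apply]
    field_simp
    push_cast
    ring
  have := res_sub_ad hγ (isSelfAdjoint_realDiag d) G
  rw [hG] at this
  rw [this]
  rfl

/-- Operators that change the sign of `Z`. -/
def IsOdd (Z F : Matrix X X ℂ) : Prop := F * Z = -(Z * F)

lemma IsOdd.ad {Z w F : Matrix X X ℂ} (hw : IsOdd Z w) (hF : Commute F Z) : IsOdd Z (ad w F) := by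
  have h1 : F * Z = Z * F := hF
  have h2 : w * Z = -(Z * w) := hw
  rw [IsOdd, ErgodicGibbs.ad, smul_mul_assoc, mul_smul_comm, ← smul_neg, sub_mul, mul_sub,
    mul_assoc, h1, ← mul_assoc, h2, mul_assoc F, h2, mul_neg, ← mul_assoc F, h1, neg_mul]
  congr 1
  simp only [mul_assoc]
  abel

lemma commute_ad_of_isOdd {Z w F : Matrix X X ℂ} (hw : IsOdd Z w) (hF : IsOdd Z F) :
    Commute (ad w F) Z := by
  have h1 : F * Z = -(Z * F) := hF
  have h2 : w * Z = -(Z * w) := hw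
  rw [Commute, SemiconjBy, ErgodicGibbs.ad, smul_mul_assoc, mul_smul_comm, sub_mul, mul_sub,
    mul_assoc, h1, mul_neg, ← mul_assoc, h2, mul_assoc F, h2, mul_neg, ← mul_assoc F, h1]
  congr 1
  simp only [neg_mul, neg_neg, mul_assoc]

lemma IsOdd.res {Z h F : Matrix X X ℂ} (hγ : 0 < γ) (hh : IsSelfAdjoint h) (hZ : Commute Z h)
    (hF : IsOdd Z F) : IsOdd Z (res γ h F) := by
  have h1 : F * Z = -(Z * F) := hF
  rw [IsOdd, ← res_mul_right hγ hh hZ, ← res_mul_left hγ hh hZ, h1]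
  have := res_smul γ h (-1) (Z * F)
  rwa [neg_one_smul, neg_one_smul] at this

lemma commute_res {Z h F : Matrix X X ℂ} (hγ : 0 < γ) (hh : IsSelfAdjoint h) (hZ : Commute Z h)
    (hF : Commute F Z) : Commute (res γ h F) Z := by
  rw [Commute, SemiconjBy, ← res_mul_right hγ hh hZ, ← res_mul_left hγ hh hZ, hF.eq]

lemma IsOdd.apply_self {z : X → ℝ} (hz : ∀ x, z x ≠ 0) {F : Matrix X X ℂ}
    (hF : IsOdd (realDiag z) F) (x : X) : F x x = 0 := by
  have := congrFun (congrFun hF x) x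
  rw [realDiag, Matrix.neg_apply, Matrix.mul_diagonal, Matrix.diagonal_mul, mul_comm] at this
  have h2 : (z x : ℂ) * F x x = 0 := by
    have h3 : (2 : ℂ) * ((z x : ℂ) * F x x) = 0 := by linear_combination this
    simpa using h3
  exact (mul_eq_zero.1 h2).resolve_left (by exact_mod_cast hz x)

/-- The two intermediate resolvents have opposite energy differences, and `1 / (γ - iΔ) + 1 / (γ +
iΔ) = 2 γ / (γ² + Δ²)`. The outermost and innermost resolvents act on diagonal entries and give
`γ⁻¹` each. -/
lemma second_order_entry (hγ : 0 < γ) (d a : X → ℝ) {w : Matrix X X ℂ} (hw : IsSelfAdjoint w)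
    (x : X) : res γ (realDiag d) (ad w (res γ (realDiag d) (ad w ((γ⁻¹ : ℝ) • realDiag a)))) x x =
      ((γ⁻¹ * ∑ y, ‖w x y‖ ^ 2 * (a y - a x) * (2 / (γ ^ 2 + (d x - d y) ^ 2)) : ℝ) : ℂ) := by
  have hG : ∀ x y, res γ (realDiag d) (ad w ((γ⁻¹ : ℝ) • realDiag a)) x y =
      Complex.I * (γ : ℂ)⁻¹ * w x y * (a y - a x) / ((γ : ℂ) - Complex.I * ((d x - d y : ℝ) : ℂ)) := by
    intro x y
    rw [res_realDiag_apply hγ, ad_apply, Matrix.mul_smul, Matrix.smul_mul, Matrix.smul_apply,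
      Matrix.smul_apply, realDiag, Matrix.mul_diagonal, Matrix.diagonal_mul]
    simp only [Complex.real_smul]
    push_cast
    ring
  rw [res_realDiag_apply hγ, ad_apply, Matrix.mul_apply, Matrix.mul_apply,
    ← Finset.sum_sub_distrib, Finset.mul_sum, sub_self, Complex.ofReal_zero, mul_zero, sub_zero,
    Finset.sum_div, Complex.ofReal_mul, Complex.ofReal_sum, Finset.mul_sum]
  refine Finset.sum_congr rfl fun y _ => ?_
  rw [hG, hG]
  have hconj : w y x = (starRingEnd ℂ) (w x y) := by
    have := congrFun (congrFun hw y) x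
    rw [Matrix.star_apply] at this
    exact this.symm
  have hn : w x y * w y x = ((‖w x y‖ ^ 2 : ℝ) : ℂ) := by
    rw [hconj, Complex.mul_conj, Complex.normSq_eq_norm_sq]
  have h1 := gamma_sub_ne_zero hγ (d x - d y)
  have h2 := gamma_sub_ne_zero hγ (d y - d x)
  have hγc : (γ : ℂ) ≠ 0 := by exact_mod_cast hγ.ne'
  have h3 : (γ : ℂ) ^ 2 + ((d x : ℂ) - d y) ^ 2 ≠ 0 := by
    have : 0 < γ ^ 2 + (d x - d y) ^ 2 := by positivity
    exact_mod_cast this.ne'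
  have hprod : ((γ : ℂ) - Complex.I * ((d x - d y : ℝ) : ℂ)) *
      ((γ : ℂ) - Complex.I * ((d y - d x : ℝ) : ℂ)) = (γ : ℂ) ^ 2 + ((d x : ℂ) - d y) ^ 2 := by
    push_cast
    linear_combination (-(d x - d y : ℂ) ^ 2) * Complex.I_sq
  have key : Complex.I * (w x y * (Complex.I * (γ : ℂ)⁻¹ * w y x * (a x - a y) /
        ((γ : ℂ) - Complex.I * ((d y - d x : ℝ) : ℂ))) -
      Complex.I * (γ : ℂ)⁻¹ * w x y * (a y - a x) /
        ((γ : ℂ) - Complex.I * ((d x - d y : ℝ) : ℂ)) * w y x) / γ =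
      (γ : ℂ)⁻¹ * (w x y * w y x) * (a y - a x) * (2 / ((γ : ℂ) ^ 2 + ((d x : ℂ) - d y) ^ 2)) := by
    rw [← hprod]
    field_simp
    push_cast
    linear_combination (2 * (γ : ℂ) * (w x y * w y x) * (a x - a y)) * Complex.I_sq
  push_cast at key ⊢
  rw [key, hn]
  push_cast
  ring

/-- Expansion of the resolvent to fourth order in an odd coupling. -/
theorem res_add_apply_self (hγ : 0 < γ) (d a z : X → ℝ) (hz : ∀ x, z x ≠ 0) {w : Matrix X X ℂ}
    (hw : IsSelfAdjoint w) (hodd : IsOdd (realDiag z) w) (x : X) :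
    res γ (realDiag d + w) (realDiag a) x x = res γ (realDiag d) (realDiag a) x x +
      ((γ⁻¹ * ∑ y, ‖w x y‖ ^ 2 * (a y - a x) * (2 / (γ ^ 2 + (d x - d y) ^ 2)) : ℝ) : ℂ) +
      res γ (realDiag d) (ad w (res γ (realDiag d) (ad w (res γ (realDiag d) (ad w
        (res γ (realDiag d) (ad w (res γ (realDiag d + w) (realDiag a))))))))) x x := by
  set D := realDiag d
  have hD : IsSelfAdjoint D := isSelfAdjoint_realDiag d
  set A := realDiag a
  have hAD : Commute A D := commute_diagonal _ _
  have hZD : Commute (realDiag z) D := commute_diagonal _ _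
  have hAZ : Commute A (realDiag z) := commute_diagonal _ _
  have hstep := res_add_eq hγ hD hw A
  have e0 : res γ D A = (γ⁻¹ : ℝ) • A := res_of_commute hγ hAD
  have hK : ∀ F G, res γ D (ad w (F + G)) = res γ D (ad w F) + res γ D (ad w G) := fun F G => by
    rw [ad_add, res_add hγ hD]
  set R := res γ (D + w) A
  set r0 := res γ D A
  -- The sign matrix of `z` grades the algebra. Odd operators have zero diagonal, which removes the
  -- first and third orders.
  have c0 : Commute r0 (realDiag z) := commute_res hγ hD hZD hAZ
  have o1 : IsOdd (realDiag z) (res γ D (ad w r0)) := (hodd.ad c0).res hγ hD hZD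
  have c2 := commute_res hγ hD hZD (commute_ad_of_isOdd hodd o1)
  have o3 := (hodd.ad c2).res hγ hD hZD
  have expand : R = r0 + res γ D (ad w r0) + res γ D (ad w (res γ D (ad w r0))) +
      res γ D (ad w (res γ D (ad w (res γ D (ad w r0))))) +
      res γ D (ad w (res γ D (ad w (res γ D (ad w (res γ D (ad w R))))))) := by
    have s2 : res γ D (ad w R) = res γ D (ad w r0) + res γ D (ad w (res γ D (ad w R))) := by
      conv_lhs => rw [hstep]
      exact hK _ _
    have s3 : res γ D (ad w (res γ D (ad w R))) = res γ D (ad w (res γ D (ad w r0))) +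
        res γ D (ad w (res γ D (ad w (res γ D (ad w R))))) := by
      conv_lhs => rw [s2]
      exact hK _ _
    have s4 : res γ D (ad w (res γ D (ad w (res γ D (ad w R))))) =
        res γ D (ad w (res γ D (ad w (res γ D (ad w r0))))) +
        res γ D (ad w (res γ D (ad w (res γ D (ad w (res γ D (ad w R))))))) := by
      conv_lhs => rw [s3]
      exact hK _ _
    rw [add_assoc, ← s4, add_assoc, ← s3, add_assoc, ← s2]
    exact hstep
  have hx := congrFun (congrFun expand x) x
  simp only [Matrix.add_apply] at hx
  rw [o1.apply_self hz, o3.apply_self hz, add_zero, add_zero] at hx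
  rw [hx]
  congr 2
  rw [e0]
  exact second_order_entry hγ d a hw x

end SecondOrder

/-! ### Expansion for one coupled ancilla at fixed frequencies -/

section SingleAverage

open scoped Matrix.Norms.L2Operator

variable {ι : Type*} [Fintype ι] [DecidableEq ι] {na : ℕ} {β Ω γ lam : ℝ} {e a : ι → ℝ}
  {V : Fin na → Matrix ι ι ℂ}

/-- Second-order change of the observable at given frequencies. -/
def secondObs (β γ lam : ℝ) (e a : ι → ℝ) (V : Fin na → Matrix ι ι ℂ) (ν : ι) (j : Fin na)
    (ω : Fin na → ℝ) : ℝ :=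
  ∑ μ, lam ^ 2 * ‖V j ν μ‖ ^ 2 * (a μ - a ν) *
    ∑ c, boltz β c (ω j) * (2 / (γ ^ 2 + (e ν - e μ + bsgn c * ω j) ^ 2))

/-- Fourth-order remainder of the observable at given frequencies. -/
def remObs (β γ lam : ℝ) (e a : ι → ℝ) (V : Fin na → Matrix ι ι ℂ) (ν : ι) (j : Fin na)
    (ω : Fin na → ℝ) : ℂ :=
  ∑ b, (thermalWeight β ω b * γ) •
    res γ (freeHam e ω) (ad (flipTerm lam V j) (res γ (freeHam e ω) (ad (flipTerm lam V j)
      (res γ (freeHam e ω) (ad (flipTerm lam V j) (res γ (freeHam e ω) (ad (flipTerm lam V j)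
        (res γ (freeHam e ω + flipTerm lam V j) (obs na a))))))))) (ν, b) (ν, b)

lemma bsgn_ne_zero (b : Bool) : bsgn b ≠ 0 := by cases b <;> simp [bsgn]

lemma freeEnergy_sub_flip (e : ι → ℝ) (ω : Fin na → ℝ) (j : Fin na) (μ ν : ι) (b : Bits na) :
    freeEnergy e ω (ν, b) - freeEnergy e ω (μ, flipBit j b) = e ν - e μ + bsgn (b j) * ω j := by
  simp only [freeEnergy]
  rw [← Finset.add_sum_erase _ _ (Finset.mem_univ j),
    ← Finset.add_sum_erase _ (fun m => bsgn (flipBit j b m) * ω m) (Finset.mem_univ j)]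
  have : ∀ m ∈ Finset.univ.erase j, bsgn (flipBit j b m) * ω m = bsgn (b m) * ω m := fun m hm => by
    rw [flipBit_of_ne (Finset.ne_of_mem_erase hm)]
  rw [Finset.sum_congr rfl this, flipBit_same]
  have h : bsgn (!b j) = -bsgn (b j) := by cases b j <;> simp [bsgn]
  rw [h]
  ring

lemma sum_flipTerm_row (lam : ℝ) (V : Fin na → Matrix ι ι ℂ) (j : Fin na) (ν : ι) (b : Bits na)
    (f : ι × Bits na → ℝ) : ∑ y, ‖flipTerm lam V j (ν, b) y‖ ^ 2 * f y =
      ∑ μ, lam ^ 2 * ‖V j ν μ‖ ^ 2 * f (μ, flipBit j b) := by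
  rw [Fintype.sum_prod_type]
  refine Finset.sum_congr rfl fun μ _ => ?_
  rw [Finset.sum_eq_single (flipBit j b)]
  · rw [flipTerm_apply, if_pos (flipBit_flipBit j b).symm, norm_mul, mul_pow]
    simp
  · intro c _ hc
    rw [flipTerm_apply, if_neg]
    · simp
    · intro h
      apply hc
      change b = flipBit j c at h
      rw [h, flipBit_flipBit]
  · simp

/-- Graded by the sign of ancilla `j` the coupling is odd, so the expansion without odd orders
applies. The prefactor `γ` cancels the `γ⁻¹` of the second-order term. -/
lemma meanObs_singleton (hγ : 0 < γ) (hV : ∀ m, (V m).IsHermitian) (ν : ι) (j : Fin na)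
    (ω : Fin na → ℝ) : meanObs β γ lam e a V ν {j} ω = meanObs β γ lam e a V ν ∅ ω +
      (secondObs β γ lam e a V ν j ω : ℂ) + remObs β γ lam e a V ν j ω := by
  let z : ι × Bits na → ℝ := fun x => bsgn (x.2 j)
  have hodd : IsOdd (realDiag z) (flipTerm lam V j) := by
    have h := flipTerm_mul_diagonal (d := fun x => (z x : ℂ)) (d' := fun x => -(z x : ℂ)) lam V j
      (fun μ ν b => by
        simp only [z, flipBit_same]
        cases b j <;> simp [bsgn])
    have h2 : (Matrix.diagonal fun x => -(z x : ℂ)) = -realDiag z := by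
      rw [realDiag, ← Matrix.diagonal_neg]
    rw [h2, neg_mul] at h
    exact h
  have hexp : ∀ b, res γ (partHam e lam V {j} ω) (obs na a) (ν, b) (ν, b) =
      res γ (freeHam e ω) (obs na a) (ν, b) (ν, b) +
      ((γ⁻¹ * ∑ y, ‖flipTerm lam V j (ν, b) y‖ ^ 2 * (a y.1 - a ν) *
        (2 / (γ ^ 2 + (freeEnergy e ω (ν, b) - freeEnergy e ω y) ^ 2)) : ℝ) : ℂ) +
      res γ (freeHam e ω) (ad (flipTerm lam V j) (res γ (freeHam e ω) (ad (flipTerm lam V j)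
      (res γ (freeHam e ω) (ad (flipTerm lam V j) (res γ (freeHam e ω) (ad (flipTerm lam V j)
        (res γ (freeHam e ω + flipTerm lam V j) (obs na a))))))))) (ν, b) (ν, b) := fun b => by
    rw [partHam, Finset.sum_singleton]
    exact res_add_apply_self hγ (freeEnergy e ω) (fun x => a x.1) z (fun x => bsgn_ne_zero _)
      (isSelfAdjoint_flipTerm (hV j)) hodd (ν, b)
  have hempty : partHam e lam V ∅ ω = freeHam e ω := by
    rw [partHam, Finset.sum_empty, add_zero]
  simp only [meanObs, hexp, hempty, smul_add, Finset.sum_add_distrib]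
  rw [remObs]
  congr 2
  have hsec : ∀ b : Bits na, (thermalWeight β ω b * γ) •
      ((γ⁻¹ * ∑ y, ‖flipTerm lam V j (ν, b) y‖ ^ 2 * (a y.1 - a ν) *
        (2 / (γ ^ 2 + (freeEnergy e ω (ν, b) - freeEnergy e ω y) ^ 2)) : ℝ) : ℂ) =
      ((∑ μ, lam ^ 2 * ‖V j ν μ‖ ^ 2 * (a μ - a ν) * (thermalWeight β ω b *
        (2 / (γ ^ 2 + (e ν - e μ + bsgn (b j) * ω j) ^ 2))) : ℝ) : ℂ) := by
    intro b
    rw [Complex.real_smul, ← Complex.ofReal_mul]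
    congr 1
    simp only [mul_assoc]
    rw [sum_flipTerm_row lam V j ν b fun y => (a y.1 - a ν) *
      (2 / (γ ^ 2 + (freeEnergy e ω (ν, b) - freeEnergy e ω y) ^ 2)), mul_inv_cancel_left₀ hγ.ne',
      Finset.mul_sum]
    refine Finset.sum_congr rfl fun μ _ => ?_
    rw [freeEnergy_sub_flip]
    ring
  rw [Finset.sum_congr rfl fun b _ => hsec b, ← Complex.ofReal_sum, Finset.sum_comm, secondObs]
  congr 1
  refine Finset.sum_congr rfl fun μ _ => ?_
  rw [← Finset.mul_sum, sum_thermalWeight_mul β ω j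
    fun c => 2 / (γ ^ 2 + (e ν - e μ + bsgn c * ω j) ^ 2)]

end SingleAverage

/-! ### A single ancilla: frequency average -/

section SingleAverage

open scoped Matrix.Norms.L2Operator

variable {ι : Type*} [Fintype ι] [DecidableEq ι] {na : ℕ} {β Ω γ lam : ℝ} {e a : ι → ℝ}
  {V : Fin na → Matrix ι ι ℂ}

lemma norm_res_ad_le {𝒜 : Type*} [CStarAlgebra 𝒜] (hγ : 0 < γ) {h w F : 𝒜} (hh : IsSelfAdjoint h)
    {η K : ℝ} (hη : ‖w‖ ≤ η) (hF : ‖F‖ ≤ K) : ‖res γ h (ad w F)‖ ≤ 2 * η / γ * K := by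
  have hη0 : 0 ≤ η := (norm_nonneg _).trans hη
  have hK0 : 0 ≤ K := (norm_nonneg _).trans hF
  refine (norm_res_le hγ hh _).trans ?_
  calc γ⁻¹ * ‖ad w F‖ ≤ γ⁻¹ * (2 * η * K) := by
        have := inv_pos.2 hγ
        gcongr
        exact (norm_ad_le w F).trans (by gcongr)
    _ = _ := by ring

/-- A bound without the gain from frequency averaging. It serves for integrability and for
exceptionally large couplings. -/
lemma norm_remObs_le (hγ : 0 < γ) (hV : ∀ m, (V m).IsHermitian) (ha : ∀ ν, |a ν| ≤ 1) (ν : ι)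
    (j : Fin na) {η : ℝ} (hη : |lam| * ‖V j‖ ≤ η) (ω : Fin na → ℝ) :
    ‖remObs β γ lam e a V ν j ω‖ ≤ 16 * (η ^ 4 / γ ^ 4) := by
  simp only [remObs, mul_smul]
  refine norm_sum_thermalWeight_smul_le β ω fun b => ?_
  have hw : ‖flipTerm lam V j‖ ≤ η := (norm_flipTerm_le lam V j).trans hη
  have hs := isSelfAdjoint_flipTerm (lam := lam) (hV j)
  have hh := isSelfAdjoint_freeHam e ω
  have h0 : ‖res γ (freeHam e ω + flipTerm lam V j) (obs na a)‖ ≤ γ⁻¹ * 1 :=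
    (norm_res_le hγ (hh.add hs) _).trans
      (mul_le_mul_of_nonneg_left (norm_obs_le ha) (inv_pos.2 hγ).le)
  have h4 := norm_res_ad_le hγ hh hw (norm_res_ad_le hγ hh hw (norm_res_ad_le hγ hh hw
    (norm_res_ad_le hγ hh hw h0)))
  rw [norm_smul, Real.norm_eq_abs, abs_of_pos hγ]
  refine (mul_le_mul_of_nonneg_left ((norm_entry_le _ (ν, b) (ν, b)).trans h4) hγ.le).trans
    (le_of_eq ?_)
  field_simp
  ring

lemma continuous_ad {𝒜 T : Type*} [CStarAlgebra 𝒜] [TopologicalSpace T] (w : 𝒜) {F : T → 𝒜}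
    (hF : Continuous F) : Continuous fun t => ad w (F t) := by
  unfold ad
  fun_prop

lemma continuous_remObs (hγ : 0 < γ) (hV : ∀ m, (V m).IsHermitian) (ν : ι) (j : Fin na) :
    Continuous fun ω => remObs β γ lam e a V ν j ω := by
  refine continuous_finsetSum _ fun b _ => ?_
  refine ((continuous_thermalWeight β b).mul continuous_const).smul ?_
  refine (entryCLM _ (ν, b) (ν, b)).continuous.comp ?_
  have hs := isSelfAdjoint_flipTerm (lam := lam) (hV j)
  have step : ∀ {F : (Fin na → ℝ) → Matrix (ι × Bits na) (ι × Bits na) ℂ}, Continuous F →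
      Continuous fun ω => res γ (freeHam e ω) (ad (flipTerm lam V j) (F ω)) := fun hF =>
    continuous_res hγ (continuous_freeHam e) (fun ω => isSelfAdjoint_freeHam e ω)
      (continuous_ad _ hF)
  exact step (step (step (step (continuous_res hγ ((continuous_freeHam e).add continuous_const)
    (fun ω => (isSelfAdjoint_freeHam e ω).add hs) continuous_const))))

lemma singleModel_h (j : Fin na) (ω : Fin na → ℝ) (u : ℝ) :
    (singleModel e j ω).h (u, 0) = freeHam e (Function.update ω j u) := by
  change freeHam e (Function.update ω j u) + (((0 : ℝ) / 2 : ℝ) : ℂ) • 1 = _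
  simp

lemma singleModel_blk_entry (j : Fin na) (ω : Fin na → ℝ)
    (F : Matrix (ι × Bits na) (ι × Bits na) ℂ) (x : ι × Bits na) :
    (singleModel e j ω).blk (false, false) F x x = F x x := by
  simp only [TwoAncilla.blk, TwoAncilla.commute_flipBy_zero]
  exact sum_diagonal_mul_mul_diagonal (fun x : ι × Bits na => (x.2 j, false)) F x

lemma remObs_update (j : Fin na) (ω : Fin na → ℝ) (ν : ι) (u : ℝ) :
    remObs β γ lam e a V ν j (Function.update ω j u) =
      ∑ b, (restWeight β {j} ω b * γ) • (boltz β (b j) u •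
        (singleModel e j ω).singleRem γ (flipTerm lam V j) (obs na a) (u, 0) (ν, b) (ν, b)) := by
  simp only [remObs, TwoAncilla.singleRem, singleModel_h, thermalWeight_update]
  refine Finset.sum_congr rfl fun b _ => ?_
  simp only [Complex.real_smul]
  push_cast
  ring

lemma isFamily_singleRem {𝒜 : Type*} [CStarAlgebra 𝒜] (M : TwoAncilla 𝒜) (hγ : 0 < γ)
    {w : 𝒜} (hw : IsSelfAdjoint w) (A : 𝒜) : IsFamily (M.singleRem γ w A) := by
  have step : ∀ {F : ℝ × ℝ → 𝒜}, IsFamily F → IsFamily fun ω => res γ (M.h ω) (ad w (F ω)) :=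
    fun hF => TwoAncilla.isFamily_res_h hγ (hF.ad w)
  exact step (step (step (step (TwoAncilla.isFamily_res_const hγ hw A))))

/-- The fourth-order term of one ancilla gains a factor from the frequency average. -/
theorem norm_integral_remObs_le (hγ : 0 < γ) (hΩ : 0 < Ω) (hV : ∀ m, (V m).IsHermitian)
    (ha : ∀ ν, |a ν| ≤ 1) (j : Fin na) (ν : ι) {η : ℝ} (hη₁ : |lam| * ‖V j‖ ≤ η)
    (hη : 64 * η ≤ γ) :
    ‖∫ ω, remObs β γ lam e a V ν j ω ∂(Measure.pi fun _ => freqLaw Ω)‖ ≤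
      2 ^ 20 * (η ^ 4 * gainConst Ω γ / γ ^ 3) := by
  have := isProbabilityMeasure_freqLaw hΩ
  refine norm_integral_le_of_resample (freqLaw Ω) j
    (integrable_of_continuous_bounded hΩ (continuous_remObs hγ hV ν j)
      (norm_remObs_le hγ hV ha ν j hη₁)) fun ω => ?_
  simp only [remObs_update]
  set M := singleModel e j ω
  set w := flipTerm lam V j
  have sa : IsSelfAdjoint w := isSelfAdjoint_flipTerm (hV j)
  have hF : IsFamily (M.singleRem γ w (obs na a)) := isFamily_singleRem M hγ sa _
  obtain ⟨hFc, K, hK⟩ := hF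
  have hu : Continuous fun u : ℝ => M.singleRem γ w (obs na a) (u, 0) :=
    hFc.comp (continuous_id.prodMk continuous_const)
  rw [integral_finsetSum]
  · simp only [integral_smul]
    refine (norm_le_of_sum_restWeight hγ (K := 2 ^ 19 * (η ^ 4 * gainConst Ω γ / γ ^ 4))
      fun b => ?_).trans (le_of_eq ?_)
    · have f₁ := isFiniteMeasure_thermalLaw hΩ β (b j)
      -- The dummy second frequency is frozen at `0` by a point mass.
      have key := norm_integral_singleRem_le (μ₁ := thermalLaw β Ω (b j))
        (μ₂ := Measure.dirac (0 : ℝ)) M hγ sa (flipTerm_mul_singleProj lam V j)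
        ((norm_flipTerm_le lam V j).trans hη₁) hη
        (A := obs na a) (fun c => commute_diagonal _ _) (norm_obs_le ha) (gainConst_pos hΩ hγ).le
        (fourierBound_thermalLaw hΩ hγ β (b j)) (by simp)
      have hb : IsFamily fun p => M.blk (false, false) (M.singleRem γ w (obs na a) p) :=
        IsFamily.sum _ fun c => ((isFamily_singleRem M hγ sa (obs na a)).mul_left (M.P c)).mul_right _
      obtain ⟨hbc, K', hK'⟩ := hb
      have hmp : Measurable fun u : ℝ => (u, (0 : ℝ)) := measurable_id.prodMk measurable_const
      rw [Measure.prod_dirac, integral_map hmp.aemeasurable hbc.aestronglyMeasurable] at key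
      rw [← integral_thermalLaw]
      refine le_trans (le_of_eq ?_) ((norm_entry_le _ (ν, b) (ν, b)).trans key)
      have hint : Integrable (fun u : ℝ => M.blk (false, false) (M.singleRem γ w (obs na a) (u, 0)))
          (thermalLaw β Ω (b j)) :=
        (integrable_const K').mono' (hbc.comp (continuous_id.prodMk continuous_const)).aestronglyMeasurable
          (.of_forall fun u => hK' _)
      rw [← entryCLM_apply (ν, b) (ν, b) (∫ p, _ ∂_), ← ContinuousLinearMap.integral_comp_comm _ hint]
      simp only [entryCLM_apply, M, singleModel_blk_entry]
    · rw [Finset.card_singleton]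
      field_simp
  · intro b _
    have hI : Integrable (fun u : ℝ => boltz β (b j) u •
        M.singleRem γ w (obs na a) (u, 0) (ν, b) (ν, b)) (freqLaw Ω) := by
      have hent : Continuous fun u : ℝ => M.singleRem γ w (obs na a) (u, 0) (ν, b) (ν, b) :=
        (entryCLM _ (ν, b) (ν, b)).continuous.comp hu
      refine (integrable_const K).mono' ((continuous_boltz β (b j)).smul hent).aestronglyMeasurable
        (.of_forall fun u => ?_)
      rw [norm_smul, Real.norm_eq_abs, abs_of_pos (boltz_pos _ _ _)]
      have h2 := (norm_entry_le _ (ν, b) (ν, b)).trans (hK (u, 0))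
      exact (mul_le_of_le_one_left (norm_nonneg _) (boltz_le_one _ _ _)).trans h2
    exact hI.smul (restWeight β {j} ω b * γ)

/-- Frequency-averaged transition strength at transition energy `E`. -/
def gainCoeff (β Ω γ E : ℝ) : ℝ :=
  Ω⁻¹ * ∫ u in (-Ω)..Ω, occ (β * u) * (2 / (γ ^ 2 + (E - u) ^ 2))

lemma continuous_lorentz (hγ : 0 < γ) (E : ℝ) :
    Continuous fun u : ℝ => 2 / (γ ^ 2 + (E - u) ^ 2) :=
  Continuous.div (by fun_prop) (by fun_prop) fun u => by positivity

/-- The state `true` at frequency `u` acts like the state `false` at `-u`. The two contributions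
agree on the symmetric interval and double `(2 Ω)⁻¹` to `Ω⁻¹`. -/
lemma integral_freqLaw_sum_boltz (hγ : 0 < γ) (hΩ : 0 < Ω) (β E : ℝ) :
    ∫ u, ∑ c, boltz β c u * (2 / (γ ^ 2 + (-E + bsgn c * u) ^ 2)) ∂(freqLaw Ω) =
      gainCoeff β Ω γ E := by
  have h1 : ∀ u, ∑ c, boltz β c u * (2 / (γ ^ 2 + (-E + bsgn c * u) ^ 2)) =
      occ (β * u) * (2 / (γ ^ 2 + (E - u) ^ 2)) +
        occ (β * -u) * (2 / (γ ^ 2 + (E - -u) ^ 2)) := by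
    intro u
    have e1 : (-E + bsgn false * u) ^ 2 = (E - u) ^ 2 := by simp [bsgn]; ring
    have e2 : (-E + bsgn true * u) ^ 2 = (E - -u) ^ 2 := by simp [bsgn]; ring
    simp only [Fintype.sum_bool, e1, e2]
    simp only [boltz, if_true, Bool.false_eq_true, if_false, mul_neg]
    ring
  have hc : Continuous fun u : ℝ => occ (β * u) * (2 / (γ ^ 2 + (E - u) ^ 2)) :=
    (continuous_occ.comp (continuous_const.mul continuous_id)).mul (continuous_lorentz hγ E)
  have hc' : Continuous fun u : ℝ => occ (β * -u) * (2 / (γ ^ 2 + (E - -u) ^ 2)) :=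
    hc.comp continuous_neg
  simp only [h1]
  rw [integral_freqLaw hΩ, intervalIntegral.integral_add (hc.intervalIntegrable _ _)
    (hc'.intervalIntegrable _ _),
    intervalIntegral.integral_comp_neg (fun u => occ (β * u) * (2 / (γ ^ 2 + (E - u) ^ 2))),
    neg_neg, gainCoeff, smul_eq_mul]
  field_simp
  ring

lemma abs_gainCoeff_sub_le (hγ : 0 < γ) (hΩ : 0 < Ω) (hβ : 0 < β) (E : ℝ) :
    |gainCoeff β Ω γ E - 2 * Real.pi / (Ω * γ) * (occ (β * E) * window Ω γ (E / Ω))| ≤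
      4 * (β / Ω) * (1 + Real.log (1 + 1 / (β * γ))) := by
  have h := abs_thermal_lorentz_sub_le hγ hΩ hβ E
  have e : gainCoeff β Ω γ E - 2 * Real.pi / (Ω * γ) * (occ (β * E) * window Ω γ (E / Ω)) =
      Ω⁻¹ * ((∫ ω in (-Ω)..Ω, occ (β * ω) * (2 / (γ ^ 2 + (E - ω) ^ 2))) -
        occ (β * E) * (2 * Real.pi / γ * window Ω γ (E / Ω))) := by
    rw [gainCoeff, mul_sub]
    congr 1
    field_simp
  rw [e, abs_mul, abs_of_pos (inv_pos.2 hΩ)]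
  refine (mul_le_mul_of_nonneg_left h (inv_pos.2 hΩ).le).trans (le_of_eq ?_)
  field_simp

/-- Frequency average of the second-order change. -/
def secondMean (β Ω γ lam : ℝ) (e a : ι → ℝ) (W : Matrix ι ι ℂ) (ν : ι) : ℝ :=
  ∑ μ, lam ^ 2 * ‖W ν μ‖ ^ 2 * (a μ - a ν) * gainCoeff β Ω γ (e μ - e ν)

lemma integral_secondObs (hγ : 0 < γ) (hΩ : 0 < Ω) (j : Fin na) (ν : ι) :
    ∫ ω, secondObs β γ lam e a V ν j ω ∂(Measure.pi fun _ => freqLaw Ω) =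
      secondMean β Ω γ lam e a (V j) ν := by
  have := isProbabilityMeasure_freqLaw hΩ
  have hlor : ∀ (μ : ι) (c : Bool), Continuous fun u : ℝ =>
      boltz β c u * (2 / (γ ^ 2 + (e ν - e μ + bsgn c * u) ^ 2)) := fun μ c =>
    (continuous_boltz β c).mul
      (Continuous.div (by fun_prop) (by fun_prop) fun u => by positivity)
  have hcont : ∀ μ, Continuous fun u : ℝ =>
      ∑ c, boltz β c u * (2 / (γ ^ 2 + (e ν - e μ + bsgn c * u) ^ 2)) := fun μ =>
    continuous_finsetSum _ fun c _ => hlor μ c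
  have hint : ∀ μ, Integrable (fun u : ℝ =>
      ∑ c, boltz β c u * (2 / (γ ^ 2 + (e ν - e μ + bsgn c * u) ^ 2))) (freqLaw Ω) := by
    intro μ
    refine integrable_finsetSum _ fun c _ => ?_
    refine (integrable_const (2 / γ ^ 2)).mono' (hlor μ c).aestronglyMeasurable
      (.of_forall fun u => ?_)
    rw [Real.norm_eq_abs, abs_of_nonneg (by have := boltz_pos β c u; positivity)]
    refine (mul_le_of_le_one_left (by positivity) (boltz_le_one _ _ _)).trans ?_
    gcongr
    nlinarith [sq_nonneg (e ν - e μ + bsgn c * u)]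
  have hev := measurePreserving_eval (fun _ : Fin na => freqLaw Ω) j
  have hcomp : ∀ μ, Integrable (fun ω : Fin na → ℝ =>
      ∑ c, boltz β c (ω j) * (2 / (γ ^ 2 + (e ν - e μ + bsgn c * ω j) ^ 2)))
      (Measure.pi fun _ => freqLaw Ω) := fun μ => hev.integrable_comp_of_integrable (hint μ)
  simp only [secondObs]
  rw [integral_finsetSum _ fun μ _ => (hcomp μ).const_mul _, secondMean]
  refine Finset.sum_congr rfl fun μ _ => ?_
  rw [integral_const_mul]
  congr 1
  have h1 := integral_freqLaw_sum_boltz hγ hΩ β (e μ - e ν)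
  rw [neg_sub] at h1
  rw [← h1]
  conv_rhs => rw [← hev.map_eq]
  rw [integral_map hev.measurable.aemeasurable (hcont μ).aestronglyMeasurable]

/-- Frequency-averaged expectation of an observable after one cycle, at fixed couplings. -/
def freqMean (β Ω γ lam : ℝ) (e a : ι → ℝ) (V : Fin na → Matrix ι ι ℂ) (ν : ι)
    (s : Finset (Fin na)) : ℂ :=
  ∫ ω, meanObs β γ lam e a V ν s ω ∂(Measure.pi fun _ => freqLaw Ω)

lemma freqMean_empty (hγ : 0 < γ) (hΩ : 0 < Ω) (ν : ι) :
    freqMean β Ω γ lam e a V ν ∅ = a ν := by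
  have := isProbabilityMeasure_freqLaw hΩ
  have : ∀ ω, meanObs β γ lam e a V ν ∅ ω = a ν := by
    intro ω
    have h : res γ (partHam e lam V ∅ ω) (obs na a) = γ⁻¹ • obs na a := by
      refine res_of_commute hγ ?_
      rw [partHam, Finset.sum_empty, add_zero]
      exact commute_diagonal _ _
    have h2 : ∀ b, (γ⁻¹ • obs na a) (ν, b) (ν, b) = (γ⁻¹ : ℝ) • (a ν : ℂ) := fun b => by
      rw [Matrix.smul_apply, obs, Matrix.diagonal_apply_eq]
    simp only [meanObs, h, h2, smul_smul, mul_assoc, mul_inv_cancel₀ hγ.ne', mul_one]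
    rw [← Finset.sum_smul, sum_thermalWeight, one_smul]
  simp [freqMean, this]

lemma integrable_meanObs (hγ : 0 < γ) (hΩ : 0 < Ω) (hV : ∀ m, (V m).IsHermitian)
    (ha : ∀ ν, |a ν| ≤ 1) (ν : ι) (s : Finset (Fin na)) :
    Integrable (fun ω => meanObs β γ lam e a V ν s ω) (Measure.pi fun _ => freqLaw Ω) :=
  integrable_of_continuous_bounded hΩ (continuous_meanObs hγ hV ν s)
    (norm_meanObs_le hγ hV ha ν s)

lemma norm_freqMean_le (hγ : 0 < γ) (hΩ : 0 < Ω) (hV : ∀ m, (V m).IsHermitian)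
    (ha : ∀ ν, |a ν| ≤ 1) (ν : ι) (s : Finset (Fin na)) :
    ‖freqMean β Ω γ lam e a V ν s‖ ≤ 1 := by
  have := isProbabilityMeasure_freqLaw hΩ
  refine (norm_integral_le_of_norm_le_const (C := 1)
    (.of_forall (norm_meanObs_le hγ hV ha ν s))).trans (le_of_eq ?_)
  simp

lemma freqMean_singleton_sub (hγ : 0 < γ) (hΩ : 0 < Ω) (hV : ∀ m, (V m).IsHermitian)
    (ha : ∀ ν, |a ν| ≤ 1) (ν : ι) (j : Fin na) :
    freqMean β Ω γ lam e a V ν {j} - freqMean β Ω γ lam e a V ν ∅ -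
        (secondMean β Ω γ lam e a (V j) ν : ℂ) =
      ∫ ω, remObs β γ lam e a V ν j ω ∂(Measure.pi fun _ => freqLaw Ω) := by
  have hi := fun s => integrable_meanObs (β := β) (lam := lam) (e := e) hγ hΩ hV ha ν s
  have hr : Integrable (fun ω => remObs β γ lam e a V ν j ω) (Measure.pi fun _ => freqLaw Ω) :=
    integrable_of_continuous_bounded hΩ (continuous_remObs hγ hV ν j)
      (norm_remObs_le hγ hV ha ν j le_rfl)
  have hs : ∀ ω, (secondObs β γ lam e a V ν j ω : ℂ) =
      meanObs β γ lam e a V ν {j} ω - meanObs β γ lam e a V ν ∅ ω - remObs β γ lam e a V ν j ω := by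
    intro ω
    rw [meanObs_singleton hγ hV]
    ring
  have hI : ∫ ω, (secondObs β γ lam e a V ν j ω : ℂ) ∂(Measure.pi fun _ => freqLaw Ω) =
      (secondMean β Ω γ lam e a (V j) ν : ℂ) := by
    rw [integral_complex_ofReal, integral_secondObs hγ hΩ]
  rw [← hI]
  simp only [hs]
  have h1 : Integrable (fun ω => meanObs β γ lam e a V ν {j} ω - meanObs β γ lam e a V ν ∅ ω)
      (Measure.pi fun _ => freqLaw Ω) := (hi _).sub (hi _)
  rw [integral_sub h1 hr, integral_sub (hi _) (hi _), freqMean, freqMean]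
  ring

end SingleAverage

/-! ### Average over the couplings -/

section Telescope

variable {α E : Type*} [DecidableEq α] [NormedAddCommGroup E]

/-- Adding `j` to `s` instead of to the empty set changes the increment by one mixed difference for
each element of `s`. -/
lemma norm_insert_sub_le {φ : Finset α → E} {ε : ℝ}
    (h : ∀ s i j, i ≠ j → i ∉ s → j ∉ s →
      ‖φ (insert i (insert j s)) - φ (insert i s) - φ (insert j s) + φ s‖ ≤ ε) (j : α)
    (s : Finset α) (hj : j ∉ s) : ‖(φ (insert j s) - φ s) - (φ {j} - φ ∅)‖ ≤ s.card * ε := by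
  induction s using Finset.induction_on with
  | empty => simp
  | insert i s hi ih =>
    have hj' : j ∉ s := fun hm => hj (Finset.mem_insert_of_mem hm)
    have hij : i ≠ j := fun he => hj (he ▸ Finset.mem_insert_self i s)
    have e : (φ (insert j (insert i s)) - φ (insert i s)) - (φ {j} - φ ∅) =
        (φ (insert i (insert j s)) - φ (insert i s) - φ (insert j s) + φ s) +
          ((φ (insert j s) - φ s) - (φ {j} - φ ∅)) := by
      rw [Finset.insert_comm]; abel
    rw [e, Finset.card_insert_of_notMem hi]
    refine (norm_add_le _ _).trans ?_
    have := h s i j hij hi hj'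
    push_cast
    linarith [ih hj']

/-- A set function with small mixed second differences is nearly additive. -/
lemma norm_sub_sum_singleton_le {φ : Finset α → E} {ε : ℝ} (hε : 0 ≤ ε)
    (h : ∀ s i j, i ≠ j → i ∉ s → j ∉ s →
      ‖φ (insert i (insert j s)) - φ (insert i s) - φ (insert j s) + φ s‖ ≤ ε) (s : Finset α) :
    ‖φ s - φ ∅ - ∑ j ∈ s, (φ {j} - φ ∅)‖ ≤ s.card ^ 2 * ε := by
  induction s using Finset.induction_on with
  | empty => simp
  | insert j s hj ih =>
    have e : φ (insert j s) - φ ∅ - ∑ k ∈ insert j s, (φ {k} - φ ∅) =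
        ((φ (insert j s) - φ s) - (φ {j} - φ ∅)) +
          (φ s - φ ∅ - ∑ k ∈ s, (φ {k} - φ ∅)) := by
      rw [Finset.sum_insert hj]; abel
    rw [e, Finset.card_insert_of_notMem hj]
    refine (norm_add_le _ _).trans ?_
    have h1 := norm_insert_sub_le h j s hj
    have h2 : (0 : ℝ) ≤ (s.card : ℝ) := by positivity
    push_cast
    nlinarith

end Telescope

/-! ### Averaging over the couplings, with rare large ones split off -/

section CouplingAverage

open scoped Matrix.Norms.L2Operator

variable {n na : ℕ} {Θ : Type*} [MeasurableSpace Θ] {S : EthSystem n Θ} {P : Measure Θ}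
  [IsProbabilityMeasure P] {β Ω γ lam κ C : ℝ} {a : Bits n → ℝ}

/-- Matrix entries of the observable after a cycle of length `t`, averaged over the thermal state
of the ancillas. -/
def evolObs {ι : Type*} [Fintype ι] [DecidableEq ι] (β lam : ℝ) (e a : ι → ℝ) (ν : ι)
    (s : Finset (Fin na)) (q : ℝ × (Fin na → ℝ) × (Fin na → ι → ι → ℂ)) : ℂ :=
  ∑ b, thermalWeight β q.2.1 b •
    evol (partHam e lam (fun m => Matrix.of (q.2.2 m)) s q.2.1) q.1 (obs na a) (ν, b) (ν, b)

lemma continuous_flipTerm {ι T : Type*} [Fintype ι] [DecidableEq ι] [TopologicalSpace T] (lam : ℝ)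
    {V : T → Fin na → Matrix ι ι ℂ} (hV : ∀ m x y, Continuous fun q => V q m x y) (m : Fin na) :
    Continuous fun q => flipTerm lam (V q) m := by
  refine continuous_matrix fun x y => ?_
  simp only [flipTerm_apply]
  by_cases h : x.2 = flipBit m y.2
  · simp only [if_pos h]; exact continuous_const.mul (hV _ _ _)
  · simp only [if_neg h]; exact continuous_const

lemma continuous_partHam_param {ι T : Type*} [Fintype ι] [DecidableEq ι] [TopologicalSpace T]
    (e : ι → ℝ) (lam : ℝ) {V : T → Fin na → Matrix ι ι ℂ}
    (hV : ∀ m x y, Continuous fun q => V q m x y) {ω : T → Fin na → ℝ} (hω : Continuous ω)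
    (s : Finset (Fin na)) : Continuous fun q => partHam e lam (V q) s (ω q) :=
  ((continuous_freeHam e).comp hω).add (continuous_finsetSum _ fun m _ => continuous_flipTerm lam hV m)

lemma continuous_evol_param {𝒜 T : Type*} [CStarAlgebra 𝒜] [TopologicalSpace T]
    {h : T → 𝒜} (hh : Continuous h) {t : T → ℝ} (ht : Continuous t) (F : 𝒜) :
    Continuous fun q => evol (h q) (t q) F :=
  continuous_evol.comp (ht.prodMk (hh.prodMk continuous_const))

lemma continuous_evolObs {ι : Type*} [Fintype ι] [DecidableEq ι] (β lam : ℝ) (e a : ι → ℝ) (ν : ι)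
    (s : Finset (Fin na)) : Continuous (evolObs β lam e a ν s) := by
  have hham : Continuous fun q : ℝ × (Fin na → ℝ) × (Fin na → ι → ι → ℂ) =>
      partHam e lam (fun m => Matrix.of (q.2.2 m)) s q.2.1 :=
    continuous_partHam_param e lam (fun m x y => by simp only [Matrix.of_apply]; fun_prop)
      (by fun_prop) s
  refine continuous_finsetSum _ fun b _ => ?_
  refine ((continuous_thermalWeight β b).comp (continuous_fst.comp continuous_snd)).smul ?_
  exact (entryCLM _ (ν, b) (ν, b)).continuous.comp
    (continuous_evol_param hham continuous_fst (obs na a))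

lemma norm_evolObs_le {ι : Type*} [Fintype ι] [DecidableEq ι] {lam : ℝ} {e a : ι → ℝ}
    (ha : ∀ ν, |a ν| ≤ 1) (ν : ι) (s : Finset (Fin na)) (t : ℝ) (ω : Fin na → ℝ)
    {V : Fin na → ι → ι → ℂ} (hV : ∀ m, (Matrix.of (V m)).IsHermitian) :
    ‖evolObs β lam e a ν s (t, ω, V)‖ ≤ 1 := by
  refine norm_sum_thermalWeight_smul_le β ω fun b => ?_
  refine (norm_entry_le _ (ν, b) (ν, b)).trans ?_
  rw [norm_evol (isSelfAdjoint_partHam hV s ω)]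
  exact norm_obs_le ha

lemma integral_evolObs {ι : Type*} [Fintype ι] [DecidableEq ι] {e a : ι → ℝ} (hγ : 0 < γ) (ν : ι)
    (s : Finset (Fin na)) (ω : Fin na → ℝ) {V : Fin na → ι → ι → ℂ}
    (hV : ∀ m, (Matrix.of (V m)).IsHermitian) :
    ∫ t, evolObs β lam e a ν s (t, ω, V) ∂(expMeasure γ) =
      meanObs β γ lam e a (fun m => Matrix.of (V m)) ν s ω := by
  have hs := isSelfAdjoint_partHam (e := e) (lam := lam) hV s ω
  have hint := integrable_exp_evol hγ hs (obs na a)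
  have hent : ∀ b : Bits na, IntegrableOn (fun t => Real.exp (-γ * t) •
      evol (partHam e lam (fun m => Matrix.of (V m)) s ω) t (obs na a) (ν, b) (ν, b))
      (Set.Ioi 0) := fun b =>
    (entryCLM _ (ν, b) (ν, b)).integrable_comp hint
  rw [integral_expMeasure hγ]
  simp only [evolObs, Finset.smul_sum, meanObs]
  have hsw : ∀ (b : Bits na) (t : ℝ), Real.exp (-γ * t) • thermalWeight β ω b •
      evol (partHam e lam (fun m => Matrix.of (V m)) s ω) t (obs na a) (ν, b) (ν, b) =
      thermalWeight β ω b • (Real.exp (-γ * t) •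
      evol (partHam e lam (fun m => Matrix.of (V m)) s ω) t (obs na a) (ν, b) (ν, b)) :=
    fun b t => smul_comm _ _ _
  simp only [hsw]
  have hent' : ∀ b : Bits na, IntegrableOn (fun t => thermalWeight β ω b • (Real.exp (-γ * t) •
      evol (partHam e lam (fun m => Matrix.of (V m)) s ω) t (obs na a) (ν, b) (ν, b)))
      (Set.Ioi 0) := fun b => (hent b).smul (thermalWeight β ω b)
  rw [integral_finsetSum _ fun b _ => hent' b, Finset.smul_sum]
  refine Finset.sum_congr rfl fun b _ => ?_
  rw [integral_smul, smul_smul, mul_comm γ]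
  congr 1
  exact (entryCLM _ (ν, b) (ν, b)).integral_comp_comm hint

/-- The frequency-averaged observable for given coupling data. -/
def dataMean (S : EthSystem n Θ) (β Ω γ lam : ℝ) (a : Bits n → ℝ) (ν : Bits n)
    (s : Finset (Fin na)) (x : Fin na → CouplingData n Θ) : ℂ :=
  freqMean β Ω γ lam S.energy a (fun m => S.elemMat (x m)) ν s

lemma measurable_elem_pi (S : EthSystem n Θ) :
    Measurable fun (x : Fin na → CouplingData n Θ) m => (S.elem (x m) : Bits n → Bits n → ℂ) :=
  measurable_pi_iff.2 fun m => measurable_pi_iff.2 fun μ => measurable_pi_iff.2 fun ν =>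
    (S.measurable_elem μ ν).comp (measurable_pi_apply m)

lemma isProbabilityMeasure_expMeasure (hγ : 0 < γ) : IsProbabilityMeasure (expMeasure γ) :=
  ProbabilityTheory.isProbabilityMeasure_expMeasure hγ

lemma stronglyMeasurable_evolObs (S : EthSystem n Θ) (β lam : ℝ) (a : Bits n → ℝ) (ν : Bits n)
    (s : Finset (Fin na)) : StronglyMeasurable
      fun q : ((Fin na → CouplingData n Θ) × (Fin na → ℝ)) × ℝ =>
        evolObs β lam S.energy a ν s (q.2, q.1.2, fun m => S.elem (q.1.1 m)) := by
  have : OpensMeasurableSpace (Bits n → Bits n → ℂ) := inferInstance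
  have : OpensMeasurableSpace (Fin na → Bits n → Bits n → ℂ) := inferInstance
  have : OpensMeasurableSpace ((Fin na → ℝ) × (Fin na → Bits n → Bits n → ℂ)) := inferInstance
  have : OpensMeasurableSpace (ℝ × (Fin na → ℝ) × (Fin na → Bits n → Bits n → ℂ)) := inferInstance
  refine ((continuous_evolObs β lam S.energy a ν s).measurable.comp ?_).stronglyMeasurable
  exact measurable_snd.prodMk ((measurable_snd.comp measurable_fst).prodMk
    ((measurable_elem_pi S).comp (measurable_fst.comp measurable_fst)))

/-- The resolvent is written back as a time integral, because the integrand is jointly continuous in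
time, frequencies and matrix entries. Measurability then survives both integrations. -/
lemma stronglyMeasurable_dataMean (S : EthSystem n Θ) (hγ : 0 < γ) (hΩ : 0 < Ω) (β lam : ℝ)
    (a : Bits n → ℝ) (ν : Bits n) (s : Finset (Fin na)) :
    StronglyMeasurable (dataMean S β Ω γ lam a ν s) := by
  have := isProbabilityMeasure_freqLaw hΩ
  have := isProbabilityMeasure_expMeasure hγ
  have h1 := (stronglyMeasurable_evolObs S β lam a ν s).integral_prod_right' (ν := expMeasure γ)
  have h2 := h1.integral_prod_right' (ν := Measure.pi fun _ => freqLaw Ω)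
  convert! h2 using 1
  funext x
  rw [dataMean, freqMean]
  congr 1
  funext ω
  exact (integral_evolObs hγ ν s ω fun m => S.isHermitian_elemMat (x m)).symm

/-- Observable after one cycle with the ancillas in `s`, averaged over all randomness. -/
def fullMean (S : EthSystem n Θ) (P : Measure Θ) (β Ω γ lam : ℝ) (a : Bits n → ℝ) (ν : Bits n)
    (s : Finset (Fin na)) : ℂ :=
  ∫ x, dataMean S β Ω γ lam a ν s x ∂(Measure.pi fun _ => couplingLaw n P)

lemma norm_dataMean_le (S : EthSystem n Θ) (hγ : 0 < γ) (hΩ : 0 < Ω) (ha : ∀ ν, |a ν| ≤ 1)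
    (ν : Bits n) (s : Finset (Fin na)) (x : Fin na → CouplingData n Θ) :
    ‖dataMean S β Ω γ lam a ν s x‖ ≤ 1 := by
  rw [dataMean]
  exact norm_freqMean_le hγ hΩ (fun m => S.isHermitian_elemMat (x m)) ha ν s

lemma integrable_dataMean (S : EthSystem n Θ) (hγ : 0 < γ) (hΩ : 0 < Ω) (ha : ∀ ν, |a ν| ≤ 1)
    (ν : Bits n) (s : Finset (Fin na)) :
    Integrable (dataMean S β Ω γ lam a ν s) (Measure.pi fun _ => couplingLaw n P) :=
  (integrable_const 1).mono' (stronglyMeasurable_dataMean S hγ hΩ β lam a ν s).aestronglyMeasurable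
    (.of_forall fun x => norm_dataMean_le S hγ hΩ ha ν s x)

lemma norm_fullMean_le (S : EthSystem n Θ) (hγ : 0 < γ) (hΩ : 0 < Ω) (ha : ∀ ν, |a ν| ≤ 1)
    (ν : Bits n) (s : Finset (Fin na)) : ‖fullMean S P β Ω γ lam a ν s‖ ≤ 1 := by
  rw [fullMean]
  refine (norm_integral_le_of_norm_le_const (C := 1) (.of_forall fun x =>
    norm_dataMean_le S hγ hΩ ha ν s x)).trans (le_of_eq ?_)
  simp

lemma fullMean_empty (S : EthSystem n Θ) (hγ : 0 < γ) (hΩ : 0 < Ω) (ν : Bits n) :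
    fullMean (na := na) S P β Ω γ lam a ν ∅ = a ν := by
  simp [fullMean, dataMean, freqMean_empty hγ hΩ]

/-- Averages of functions of one coupling. -/
lemma integral_eval_coupling {f : CouplingData n Θ → ℝ} (hf : Integrable f (couplingLaw n P))
    (j : Fin na) : Integrable (fun x : Fin na → CouplingData n Θ => f (x j))
        (Measure.pi fun _ => couplingLaw n P) ∧
      ∫ x : Fin na → CouplingData n Θ, f (x j) ∂(Measure.pi fun _ => couplingLaw n P) =
        ∫ x, f x ∂(couplingLaw n P) := by
  have hev := measurePreserving_eval (fun _ : Fin na => couplingLaw n P) j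
  refine ⟨hev.integrable_comp_of_integrable hf, ?_⟩
  conv_rhs => rw [← hev.map_eq]
  rw [integral_map hev.measurable.aemeasurable (by
    rw [hev.map_eq]; exact hf.aestronglyMeasurable)]

/-- Bound on the interference of two ancillas. -/
def pairErr (κ Ω γ lam : ℝ) : ℝ :=
  2 ^ 33 * (lam ^ 4 * κ ^ 4 * gainConst Ω γ ^ 2 / γ ^ 2) +
    16 * Real.exp (-(γ / (128 * (lam * κ))))

lemma pairErr_nonneg (κ Ω γ lam : ℝ) : 0 ≤ pairErr κ Ω γ lam := by
  unfold pairErr; positivity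

/-- If both couplings are moderate, frequency averaging applies. Otherwise the trivial bound `4` is
used on an event of exponentially small probability. Both cases are dominated by a sum `Q (x i) + Q
(x j)`, so moments of a single coupling suffice. -/
theorem norm_fullMean_mixed_le (h : S.CouplingSize P κ) (hκ : 0 < κ) (hγ : 0 < γ) (hΩ : 0 < Ω)
    (hlam : 0 < lam) (ha : ∀ ν, |a ν| ≤ 1) (ν : Bits n) (s : Finset (Fin na)) {i j : Fin na}
    (hij : i ≠ j) (hi : i ∉ s) (hj : j ∉ s) :
    ‖fullMean S P β Ω γ lam a ν (insert i (insert j s)) - fullMean S P β Ω γ lam a ν (insert i s) -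
      fullMean S P β Ω γ lam a ν (insert j s) + fullMean S P β Ω γ lam a ν s‖ ≤
      pairErr κ Ω γ lam := by
  have := isProbabilityMeasure_freqLaw hΩ
  have hI := fun s : Finset (Fin na) =>
    integrable_dataMean (P := P) (β := β) (lam := lam) S hγ hΩ ha ν s
  set B := gainConst Ω γ
  -- The largest norm of a coupling for which `η = lam * ‖V‖` satisfies `64 * η ≤ γ`.
  set r := γ / (64 * lam) with hr
  let Q : CouplingData n Θ → ℝ := fun x =>
    2 ^ 26 * (lam ^ 4 * B ^ 2 / γ ^ 2) * ‖S.elemMat x‖ ^ 4 +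
      4 * (if r < ‖S.elemMat x‖ then ‖S.elemMat x‖ ^ 0 else 0)
  have m4 := h.integral_norm_pow_le hκ 4
  have m0 := h.integral_indicator_norm_pow_le hκ 0 r
  have hQ : Integrable Q (couplingLaw n P) := (m4.1.const_mul _).add (m0.1.const_mul _)
  have hQI : ∫ x, Q x ∂(couplingLaw n P) ≤ pairErr κ Ω γ lam / 2 := by
    have e : ∫ x, Q x ∂(couplingLaw n P) = _ :=
      integral_add (m4.1.const_mul (2 ^ 26 * (lam ^ 4 * B ^ 2 / γ ^ 2))) (m0.1.const_mul 4)
    rw [e, integral_const_mul, integral_const_mul]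
    have h1 := mul_le_mul_of_nonneg_left m4.2
      (by positivity : 0 ≤ 2 ^ 26 * (lam ^ 4 * B ^ 2 / γ ^ 2))
    have h2 := m0.2
    have e1 : r / (2 * κ) = γ / (128 * (lam * κ)) := by rw [hr]; field_simp; norm_num
    rw [e1] at h2
    norm_num [Nat.factorial] at h1 h2
    have h3 : 0 ≤ lam ^ 4 * κ ^ 4 * B ^ 2 / γ ^ 2 := by positivity
    have e2 : 67108864 * (lam ^ 4 * B ^ 2 / γ ^ 2) * (2 * (24 * κ ^ 4)) =
        67108864 * 48 * (lam ^ 4 * κ ^ 4 * B ^ 2 / γ ^ 2) := by ring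
    rw [e2] at h1
    rw [pairErr]
    norm_num
    linarith
  have hpt : ∀ x : Fin na → CouplingData n Θ,
      ‖dataMean S β Ω γ lam a ν (insert i (insert j s)) x - dataMean S β Ω γ lam a ν (insert i s) x -
        dataMean S β Ω γ lam a ν (insert j s) x + dataMean S β Ω γ lam a ν s x‖ ≤
      Q (x i) + Q (x j) := by
    intro x
    let V : Fin na → Matrix (Bits n) (Bits n) ℂ := fun m => S.elemMat (x m)
    have hV : ∀ m, (V m).IsHermitian := fun m => S.isHermitian_elemMat (x m)
    have hint := fun s => integrable_meanObs (β := β) (Ω := Ω) (lam := lam) (e := S.energy)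
      hγ hΩ hV ha ν s
    have e : dataMean S β Ω γ lam a ν (insert i (insert j s)) x -
        dataMean S β Ω γ lam a ν (insert i s) x - dataMean S β Ω γ lam a ν (insert j s) x +
        dataMean S β Ω γ lam a ν s x =
        ∫ ω, mixedObs β γ lam S.energy a V ν s i j ω ∂(Measure.pi fun _ => freqLaw Ω) := by
      have i1 : Integrable (fun ω => meanObs β γ lam S.energy a V ν (insert i (insert j s)) ω -
          meanObs β γ lam S.energy a V ν (insert i s) ω) (Measure.pi fun _ => freqLaw Ω) :=
        (hint _).sub (hint _)
      have i2 : Integrable (fun ω => meanObs β γ lam S.energy a V ν (insert i (insert j s)) ω -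
          meanObs β γ lam S.energy a V ν (insert i s) ω -
          meanObs β γ lam S.energy a V ν (insert j s) ω) (Measure.pi fun _ => freqLaw Ω) :=
        i1.sub (hint _)
      simp only [mixedObs]
      rw [integral_add i2 (hint _), integral_sub i1 (hint _), integral_sub (hint _) (hint _)]
      rfl
    rw [e]
    have hv : ∀ m, 0 ≤ ‖V m‖ := fun m => norm_nonneg _
    have hQ4 : ∀ m, 2 ^ 26 * (lam ^ 4 * B ^ 2 / γ ^ 2) * ‖V m‖ ^ 4 ≤ Q (x m) := fun m => by
      simp only [Q, V]
      split_ifs <;> simp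
    have hQbad : ∀ m, r < ‖V m‖ → 4 ≤ Q (x m) := fun m hm => by
      simp only [Q]
      rw [if_pos hm]
      have : 0 ≤ 2 ^ 26 * (lam ^ 4 * B ^ 2 / γ ^ 2) * ‖S.elemMat (x m)‖ ^ 4 := by positivity
      simpa using this
    have hQ0 : ∀ m, 0 ≤ Q (x m) := fun m => le_trans (by positivity) (hQ4 m)
    have trivial_bound : ‖∫ ω, mixedObs β γ lam S.energy a V ν s i j ω
        ∂(Measure.pi fun _ => freqLaw Ω)‖ ≤ 4 := by
      refine (norm_integral_le_of_norm_le_const (C := 4)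
        (.of_forall (norm_mixedObs_le hγ hV ha ν s i j))).trans (le_of_eq ?_)
      simp
    by_cases bi : r < ‖V i‖
    · linarith [hQbad i bi, hQ0 j]
    by_cases bj : r < ‖V j‖
    · linarith [hQbad j bj, hQ0 i]
    push Not at bi bj
    have hmax : ∀ v, v ≤ r → 64 * (lam * v) ≤ γ := fun v hvr => by
      rw [hr, le_div_iff₀ (by positivity)] at hvr
      linarith
    have key := fun η h1 h2 h3 => norm_integral_mixedObs_le (β := β) (e := S.energy) (η := η)
      hγ hΩ hV ha hij hi hj ν (lam := lam) h1 h2 h3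
    rw [abs_of_pos hlam] at key
    rcases le_total ‖V i‖ ‖V j‖ with hle | hle
    · have := key (lam * ‖V j‖) (by gcongr) le_rfl (hmax _ bj)
      refine this.trans ?_
      have e3 : 2 ^ 26 * ((lam * ‖V j‖) ^ 4 * B ^ 2 / γ ^ 2) =
          2 ^ 26 * (lam ^ 4 * B ^ 2 / γ ^ 2) * ‖V j‖ ^ 4 := by ring
      linarith [hQ4 j, hQ0 i]
    · have := key (lam * ‖V i‖) le_rfl (by gcongr) (hmax _ bi)
      refine this.trans ?_
      have e3 : 2 ^ 26 * ((lam * ‖V i‖) ^ 4 * B ^ 2 / γ ^ 2) =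
          2 ^ 26 * (lam ^ 4 * B ^ 2 / γ ^ 2) * ‖V i‖ ^ 4 := by ring
      linarith [hQ4 i, hQ0 j]
  obtain ⟨ii, eqi⟩ := integral_eval_coupling hQ i
  obtain ⟨ij, eqj⟩ := integral_eval_coupling hQ j
  have e : fullMean S P β Ω γ lam a ν (insert i (insert j s)) -
      fullMean S P β Ω γ lam a ν (insert i s) -
      fullMean S P β Ω γ lam a ν (insert j s) + fullMean S P β Ω γ lam a ν s =
      ∫ x, (dataMean S β Ω γ lam a ν (insert i (insert j s)) x -
        dataMean S β Ω γ lam a ν (insert i s) x - dataMean S β Ω γ lam a ν (insert j s) x +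
        dataMean S β Ω γ lam a ν s x) ∂(Measure.pi fun _ => couplingLaw n P) := by
    have i1 : Integrable (fun x => dataMean S β Ω γ lam a ν (insert i (insert j s)) x -
        dataMean S β Ω γ lam a ν (insert i s) x) (Measure.pi fun _ => couplingLaw n P) :=
      (hI _).sub (hI _)
    have i2 : Integrable (fun x => dataMean S β Ω γ lam a ν (insert i (insert j s)) x -
        dataMean S β Ω γ lam a ν (insert i s) x - dataMean S β Ω γ lam a ν (insert j s) x)
        (Measure.pi fun _ => couplingLaw n P) := i1.sub (hI _)
    rw [integral_add i2 (hI _), integral_sub i1 (hI _), integral_sub (hI _) (hI _)]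
    rfl
  rw [e]
  refine (norm_integral_le_of_norm_le (ii.add ij) (.of_forall hpt)).trans ?_
  have e4 := integral_add ii ij
  simp only [Pi.add_apply]
  rw [e4, eqi, eqj]
  linarith

end CouplingAverage

/-! ### One cycle compared with the Markov chain -/

section OneCycle

open scoped Matrix.Norms.L2Operator

variable {n na : ℕ} {Θ : Type*} [MeasurableSpace Θ] {S : EthSystem n Θ} {P : Measure Θ}
  [IsProbabilityMeasure P] {β Ω γ lam κ C : ℝ} {a : Bits n → ℝ}

/-- Bound on the deviation of a single ancilla from second order perturbation theory. -/
def singleErr (κ Ω γ lam : ℝ) : ℝ :=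
  2 ^ 26 * (lam ^ 4 * κ ^ 4 * gainConst Ω γ / γ ^ 3) +
    12288 * (lam ^ 4 * κ ^ 4 / γ ^ 4 * Real.exp (-(γ / (128 * (lam * κ)))))

/-- The average of `secondMean` over the coupling. -/
def drift (S : EthSystem n Θ) (P : Measure Θ) (β Ω γ lam : ℝ) (a : Bits n → ℝ) (ν : Bits n) : ℝ :=
  ∑ μ, lam ^ 2 * S.variance P ν μ * (a μ - a ν) * gainCoeff β Ω γ (S.energy μ - S.energy ν)

lemma integral_secondMean (h : S.CouplingSize P κ) (hκ : 0 < κ) (ν : Bits n) :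
    Integrable (fun x => secondMean β Ω γ lam S.energy a (S.elemMat x) ν) (couplingLaw n P) ∧
    ∫ x, secondMean β Ω γ lam S.energy a (S.elemMat x) ν ∂(couplingLaw n P) =
      drift S P β Ω γ lam a ν := by
  have hi : ∀ μ, Integrable (fun x => lam ^ 2 * ‖S.elem x ν μ‖ ^ 2 * (a μ - a ν) *
      gainCoeff β Ω γ (S.energy μ - S.energy ν)) (couplingLaw n P) := fun μ =>
    (((h.integrable_sq_elem hκ ν μ).const_mul _).mul_const _).mul_const _
  have e : (fun x => secondMean β Ω γ lam S.energy a (S.elemMat x) ν) = fun x =>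
      ∑ μ, lam ^ 2 * ‖S.elem x ν μ‖ ^ 2 * (a μ - a ν) *
      gainCoeff β Ω γ (S.energy μ - S.energy ν) := rfl
  rw [e]
  refine ⟨integrable_finsetSum _ fun μ _ => hi μ, ?_⟩
  rw [integral_finsetSum _ fun μ _ => hi μ, drift]
  refine Finset.sum_congr rfl fun μ _ => ?_
  rw [integral_mul_const, integral_mul_const, integral_const_mul]
  rfl

/-- Same splitting as for pairs. On the event of a large coupling the crude remainder bound still
carries `‖V‖ ^ 4`, hence the fourth moment restricted to that event. -/
lemma norm_fullMean_singleton_sub_le (h : S.CouplingSize P κ) (hκ : 0 < κ) (hγ : 0 < γ)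
    (hΩ : 0 < Ω) (hlam : 0 < lam) (ha : ∀ ν, |a ν| ≤ 1) (ν : Bits n) (j : Fin na) :
    ‖fullMean S P β Ω γ lam a ν {j} - a ν - (drift S P β Ω γ lam a ν : ℂ)‖ ≤
      singleErr κ Ω γ lam := by
  have := isProbabilityMeasure_freqLaw hΩ
  have hB := gainConst_pos hΩ hγ
  set B := gainConst Ω γ with hBdef
  set r := γ / (64 * lam) with hr
  let Q : CouplingData n Θ → ℝ := fun x =>
    2 ^ 20 * (lam ^ 4 * B / γ ^ 3) * ‖S.elemMat x‖ ^ 4 +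
      16 * (lam ^ 4 / γ ^ 4) * (if r < ‖S.elemMat x‖ then ‖S.elemMat x‖ ^ 4 else 0)
  have m4 := h.integral_norm_pow_le hκ 4
  have m5 := h.integral_indicator_norm_pow_le hκ 4 r
  have hQ : Integrable Q (couplingLaw n P) := (m4.1.const_mul _).add (m5.1.const_mul _)
  have hQI : ∫ x, Q x ∂(couplingLaw n P) ≤ singleErr κ Ω γ lam := by
    have e : ∫ x, Q x ∂(couplingLaw n P) = _ :=
      integral_add (m4.1.const_mul (2 ^ 20 * (lam ^ 4 * B / γ ^ 3)))
        (m5.1.const_mul (16 * (lam ^ 4 / γ ^ 4)))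
    rw [e, integral_const_mul, integral_const_mul]
    have h1 := mul_le_mul_of_nonneg_left m4.2
      (by positivity : 0 ≤ 2 ^ 20 * (lam ^ 4 * B / γ ^ 3))
    have h2 := mul_le_mul_of_nonneg_left m5.2 (by positivity : 0 ≤ 16 * (lam ^ 4 / γ ^ 4))
    have e1 : r / (2 * κ) = γ / (128 * (lam * κ)) := by rw [hr]; field_simp; norm_num
    rw [e1] at h2
    have h3 : 0 ≤ lam ^ 4 * κ ^ 4 * B / γ ^ 3 := by positivity
    refine (add_le_add h1 h2).trans ?_
    rw [singleErr, ← hBdef]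
    norm_num [Nat.factorial]
    have e2 : 1048576 * (lam ^ 4 * B / γ ^ 3) * (2 * (24 * κ ^ 4)) =
        1048576 * 48 * (lam ^ 4 * κ ^ 4 * B / γ ^ 3) := by ring
    have e3 : 16 * (lam ^ 4 / γ ^ 4) * (2 * (24 * (2 * κ) ^ 4 * Real.exp (-(γ / (128 * (lam * κ)))))) =
        12288 * (lam ^ 4 * κ ^ 4 / γ ^ 4 * Real.exp (-(γ / (128 * (lam * κ))))) := by ring
    rw [e2, e3]
    linarith
  have hpt : ∀ x : Fin na → CouplingData n Θ,
      ‖dataMean S β Ω γ lam a ν {j} x - a ν -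
        (secondMean β Ω γ lam S.energy a (S.elemMat (x j)) ν : ℂ)‖ ≤ Q (x j) := by
    intro x
    let V : Fin na → Matrix (Bits n) (Bits n) ℂ := fun m => S.elemMat (x m)
    have hV : ∀ m, (V m).IsHermitian := fun m => S.isHermitian_elemMat (x m)
    have e := freqMean_singleton_sub (β := β) (lam := lam) (e := S.energy) hγ hΩ hV ha ν j
    rw [freqMean_empty hγ hΩ ν] at e
    rw [dataMean, e]
    have h0 : 0 ≤ ‖S.elemMat (x j)‖ := norm_nonneg _
    by_cases bj : r < ‖S.elemMat (x j)‖
    · have h1 : ‖∫ ω, remObs β γ lam S.energy a V ν j ω ∂(Measure.pi fun _ => freqLaw Ω)‖ ≤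
          16 * ((lam * ‖V j‖) ^ 4 / γ ^ 4) := by
        refine (norm_integral_le_of_norm_le_const (.of_forall fun ω =>
          norm_remObs_le (β := β) (e := S.energy) (η := lam * ‖V j‖) hγ hV ha ν j
            (by rw [abs_of_pos hlam]) ω)).trans (le_of_eq ?_)
        simp
      refine h1.trans ?_
      simp only [Q, if_pos bj, V]
      have : 0 ≤ 2 ^ 20 * (lam ^ 4 * B / γ ^ 3) * ‖S.elemMat (x j)‖ ^ 4 := by positivity
      have e3 : 16 * ((lam * ‖S.elemMat (x j)‖) ^ 4 / γ ^ 4) =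
        16 * (lam ^ 4 / γ ^ 4) * ‖S.elemMat (x j)‖ ^ 4 := by ring
      linarith
    · push Not at bj
      have hm : 64 * (lam * ‖V j‖) ≤ γ := by
        have : ‖V j‖ ≤ r := bj
        rw [hr, le_div_iff₀ (by positivity)] at this
        linarith
      have h1 := norm_integral_remObs_le (β := β) (e := S.energy) (η := lam * ‖V j‖) hγ hΩ hV ha j ν
            (by rw [abs_of_pos hlam]) hm
      refine h1.trans ?_
      simp only [Q, if_neg bj.not_gt, V]
      rw [← hBdef]
      exact le_of_eq (by ring)
  obtain ⟨ij, eqj⟩ := integral_eval_coupling hQ j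
  obtain ⟨hs1, hs2⟩ := integral_secondMean (S := S) (β := β) (Ω := Ω) (γ := γ) (lam := lam) (a := a)
    h hκ ν
  obtain ⟨is, eqs⟩ := integral_eval_coupling hs1 j
  have hI := integrable_dataMean (P := P) (β := β) (lam := lam) S hγ hΩ ha ν ({j} : Finset (Fin na))
  have e : fullMean S P β Ω γ lam a ν {j} - a ν - (drift S P β Ω γ lam a ν : ℂ) =
      ∫ x, (dataMean S β Ω γ lam a ν {j} x - a ν -
        (secondMean β Ω γ lam S.energy a (S.elemMat (x j)) ν : ℂ))
        ∂(Measure.pi fun _ => couplingLaw n P) := by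
    have i1 : Integrable (fun x => dataMean S β Ω γ lam a ν {j} x - (a ν : ℂ))
      (Measure.pi fun _ => couplingLaw n P) := hI.sub (integrable_const _)
    have i2 : Integrable (fun x : Fin na → CouplingData n Θ =>
      (secondMean β Ω γ lam S.energy a (S.elemMat (x j)) ν : ℂ))
      (Measure.pi fun _ => couplingLaw n P) := is.ofReal
    have e5 : ∫ x : Fin na → CouplingData n Θ,
        (secondMean β Ω γ lam S.energy a (S.elemMat (x j)) ν : ℂ)
        ∂(Measure.pi fun _ => couplingLaw n P) = (drift S P β Ω γ lam a ν : ℂ) := by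
      rw [← hs2, ← eqs]
      exact integral_ofReal
    rw [integral_sub i1 i2, integral_sub hI (integrable_const _), e5]
    simp [fullMean]
  rw [e]
  refine (norm_integral_le_of_norm_le ij (.of_forall hpt)).trans ?_
  rw [eqj]
  exact hQI

/-- Bound on the deviation of the averaged rates from those of the Markov chain. -/
def rateErr (κ β Ω γ lam : ℝ) : ℝ :=
  32 * (lam ^ 2 * κ ^ 2 * (β / Ω) * (1 + Real.log (1 + 1 / (β * γ))))

lemma sum_transition_mul (S : EthSystem n Θ) (P : Measure Θ) (C β Ω γ : ℝ) (a : Bits n → ℝ)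
    (ν : Bits n) : ∑ μ, S.transition P C β Ω γ μ ν * a μ =
      a ν + ∑ μ, S.rate P C β Ω γ μ ν * (a μ - a ν) := by
  simp only [EthSystem.transition, Matrix.of_apply, add_mul, Finset.sum_add_distrib, mul_sub,
    Finset.sum_sub_distrib, ite_mul, zero_mul, Finset.sum_ite_eq', Finset.mem_univ, if_true]
  rw [← Finset.sum_mul]
  ring

/-- The golden-rule value of `gainCoeff`, times `λ² σ²`, is `λ² / (C Ω γ)` times the rate of the
chain. Its error is uniform in the transition energy and is summed with `sum_variance_le`, so the
dimension does not enter. -/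
lemma abs_drift_sub_le (h : S.CouplingSize P κ) (hκ : 0 < κ) (hβ : 0 < β) (hγ : 0 < γ)
    (hΩ : 0 < Ω) (hC : 0 < C) (ha : ∀ ν, |a ν| ≤ 1) (ν : Bits n) :
    |drift S P β Ω γ lam a ν - lam ^ 2 / (C * Ω * γ) *
      (∑ μ, S.transition P C β Ω γ μ ν * a μ - a ν)| ≤ rateErr κ β Ω γ lam := by
  set K := 1 + Real.log (1 + 1 / (β * γ)) with hK
  rw [sum_transition_mul, add_sub_cancel_left, drift, Finset.mul_sum, ← Finset.sum_sub_distrib]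
  refine (Finset.abs_sum_le_sum_abs _ _).trans ?_
  have hterm : ∀ μ, |lam ^ 2 * S.variance P ν μ * (a μ - a ν) *
      gainCoeff β Ω γ (S.energy μ - S.energy ν) -
      lam ^ 2 / (C * Ω * γ) * (S.rate P C β Ω γ μ ν * (a μ - a ν))| ≤
      8 * (lam ^ 2 * (β / Ω) * K) * S.variance P μ ν := by
    intro μ
    have e : lam ^ 2 * S.variance P ν μ * (a μ - a ν) *
      gainCoeff β Ω γ (S.energy μ - S.energy ν) -
      lam ^ 2 / (C * Ω * γ) * (S.rate P C β Ω γ μ ν * (a μ - a ν)) =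
      lam ^ 2 * S.variance P μ ν * (a μ - a ν) * (gainCoeff β Ω γ (S.energy μ - S.energy ν) -
        2 * Real.pi / (Ω * γ) * (occ (β * (S.energy μ - S.energy ν)) *
          window Ω γ ((S.energy μ - S.energy ν) / Ω))) := by
      rw [S.variance_symm P ν μ, EthSystem.rate, occ]
      have : 0 < 1 + Real.exp (β * (S.energy μ - S.energy ν)) := by positivity
      field_simp
    rw [e, abs_mul, abs_mul, abs_mul]
    have hv := S.variance_nonneg P μ ν
    have h1 : |a μ - a ν| ≤ 2 := (abs_sub _ _).trans (by linarith [ha μ, ha ν])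
    have h2 := abs_gainCoeff_sub_le hγ hΩ hβ (S.energy μ - S.energy ν)
    rw [abs_of_nonneg hv, abs_of_nonneg (sq_nonneg lam)]
    calc _ ≤ lam ^ 2 * S.variance P μ ν * 2 * (4 * (β / Ω) * K) := by gcongr
      _ = _ := by ring
  refine (Finset.sum_le_sum fun μ _ => hterm μ).trans ?_
  rw [← Finset.mul_sum, rateErr, ← hK]
  have hs := h.sum_variance_le hκ ν
  have hlog : 0 ≤ Real.log (1 + 1 / (β * γ)) := Real.log_nonneg (by
    have : 0 < 1 / (β * γ) := by positivity
    linarith)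
  have hK0 : 0 ≤ K := by linarith
  calc _ ≤ 8 * (lam ^ 2 * (β / Ω) * K) * (4 * κ ^ 2) := by gcongr
    _ = _ := by ring

/-- Error of one cycle. -/
def cycleErr (κ β Ω γ lam : ℝ) (na : ℕ) : ℝ :=
  na ^ 2 * pairErr κ Ω γ lam + na * (singleErr κ Ω γ lam + rateErr κ β Ω γ lam)

/-- Near additivity reduces the cycle to `na` one-ancilla contributions, each a lazy step of size
`λ² / (C Ω γ)`. -/
theorem norm_fullMean_sub_le (h : S.CouplingSize P κ) (hκ : 0 < κ) (hβ : 0 < β) (hγ : 0 < γ)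
    (hΩ : 0 < Ω) (hC : 0 < C) (hlam : 0 < lam) (ha : ∀ ν, |a ν| ≤ 1) (ν : Bits n) :
    ‖fullMean S P β Ω γ lam a ν (Finset.univ : Finset (Fin na)) -
      (((1 - lam ^ 2 * na / (C * Ω * γ)) * a ν + lam ^ 2 * na / (C * Ω * γ) *
        ∑ μ, S.transition P C β Ω γ μ ν * a μ : ℝ) : ℂ)‖ ≤ cycleErr κ β Ω γ lam na := by
  have h1 := norm_sub_sum_singleton_le (pairErr_nonneg κ Ω γ lam)
    (φ := fun s : Finset (Fin na) => fullMean S P β Ω γ lam a ν s)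
    (fun s i j hij hi hj => norm_fullMean_mixed_le h hκ hγ hΩ hlam ha ν s hij hi hj) Finset.univ
  simp only [fullMean_empty S hγ hΩ, Finset.card_univ, Fintype.card_fin] at h1
  set T := ∑ μ, S.transition P C β Ω γ μ ν * a μ
  have h2 : ∀ j : Fin na, ‖fullMean S P β Ω γ lam a ν {j} - a ν -
      ((lam ^ 2 / (C * Ω * γ) * (T - a ν) : ℝ) : ℂ)‖ ≤
      singleErr κ Ω γ lam + rateErr κ β Ω γ lam := by
    intro j
    have e : fullMean S P β Ω γ lam a ν {j} - a ν - ((lam ^ 2 / (C * Ω * γ) * (T - a ν) : ℝ) : ℂ) =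
      (fullMean S P β Ω γ lam a ν {j} - a ν - (drift S P β Ω γ lam a ν : ℂ)) +
      ((drift S P β Ω γ lam a ν - lam ^ 2 / (C * Ω * γ) * (T - a ν) : ℝ) : ℂ) := by
      push_cast; ring
    rw [e]
    refine (norm_add_le _ _).trans (add_le_add
      (norm_fullMean_singleton_sub_le h hκ hγ hΩ hlam ha ν j) ?_)
    rw [Complex.norm_real]
    exact abs_drift_sub_le h hκ hβ hγ hΩ hC ha ν
  have h3 := (norm_sum_le Finset.univ fun j : Fin na => fullMean S P β Ω γ lam a ν {j} - a ν -
      ((lam ^ 2 / (C * Ω * γ) * (T - a ν) : ℝ) : ℂ)).trans (Finset.sum_le_sum fun j _ => h2 j)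
  rw [Finset.sum_const, Finset.card_univ, Fintype.card_fin, nsmul_eq_mul,
    Finset.sum_sub_distrib, Finset.sum_const, Finset.card_univ, Fintype.card_fin, nsmul_eq_mul] at h3
  have e : fullMean S P β Ω γ lam a ν (Finset.univ : Finset (Fin na)) -
      (((1 - lam ^ 2 * na / (C * Ω * γ)) * a ν + lam ^ 2 * na / (C * Ω * γ) * T : ℝ) : ℂ) =
      (fullMean S P β Ω γ lam a ν (Finset.univ : Finset (Fin na)) - a ν -
        ∑ j : Fin na, (fullMean S P β Ω γ lam a ν {j} - a ν)) +
      (∑ j : Fin na, (fullMean S P β Ω γ lam a ν {j} - a ν) -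
        na * ((lam ^ 2 / (C * Ω * γ) * (T - a ν) : ℝ) : ℂ)) := by
    push_cast; ring
  rw [e, cycleErr]
  exact (norm_add_le _ _).trans (add_le_add h1 h3)

end OneCycle

/-! ### The channel of one cycle in the energy eigenbasis -/

section Kernel

open scoped Matrix.Norms.L2Operator

variable {ι : Type*} [Fintype ι] [DecidableEq ι] {na : ℕ} {β lam : ℝ} {e a : ι → ℝ}

/-- Propagator of one cycle with all the ancillas coupled. -/
def propag (lam : ℝ) (e : ι → ℝ) (q : ℝ × (Fin na → ℝ) × (Fin na → ι → ι → ℂ)) :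
    Matrix (ι × Bits na) (ι × Bits na) ℂ :=
  NormedSpace.exp ((-(Complex.I * (q.1 : ℂ))) •
    partHam e lam (fun m => Matrix.of (q.2.2 m)) Finset.univ q.2.1)

/-- Matrix elements of the channel of one cycle. -/
def kern (β lam : ℝ) (e : ι → ℝ) (i j k l : ι) (q : ℝ × (Fin na → ℝ) × (Fin na → ι → ι → ℂ)) : ℂ :=
  ∑ b, ∑ c, (thermalWeight β q.2.1 c : ℂ) * propag lam e q (i, b) (k, c) *
    star (propag lam e q (j, b) (l, c))

lemma continuous_propag (lam : ℝ) (e : ι → ℝ) : Continuous (propag (na := na) lam e) := by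
  have hham : Continuous fun q : ℝ × (Fin na → ℝ) × (Fin na → ι → ι → ℂ) =>
      partHam e lam (fun m => Matrix.of (q.2.2 m)) Finset.univ q.2.1 :=
    continuous_partHam_param e lam (fun m x y => by simp only [Matrix.of_apply]; fun_prop)
      (by fun_prop) _
  have hc : Continuous fun q : ℝ × (Fin na → ℝ) × (Fin na → ι → ι → ℂ) =>
      (-(Complex.I * (q.1 : ℂ))) := by fun_prop
  exact continuous_exp_cstar.comp (hc.smul hham)

lemma continuous_kern (β lam : ℝ) (e : ι → ℝ) (i j k l : ι) :
    Continuous (kern (na := na) β lam e i j k l) := by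
  refine continuous_finsetSum _ fun b _ => continuous_finsetSum _ fun c _ => ?_
  refine ((Complex.continuous_ofReal.comp ((continuous_thermalWeight β c).comp
    (continuous_fst.comp continuous_snd))).mul ?_).mul (Continuous.star ?_)
  · exact (entryCLM _ (i, b) (k, c)).continuous.comp (continuous_propag lam e)
  · exact (entryCLM _ (j, b) (l, c)).continuous.comp (continuous_propag lam e)

lemma star_propag {q : ℝ × (Fin na → ℝ) × (Fin na → ι → ι → ℂ)}
    (hV : ∀ m, (Matrix.of (q.2.2 m)).IsHermitian) :
    star (propag lam e q) = NormedSpace.exp ((Complex.I * (q.1 : ℂ)) •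
      partHam e lam (fun m => Matrix.of (q.2.2 m)) Finset.univ q.2.1) := by
  have h := isSelfAdjoint_partHam (e := e) (lam := lam) hV Finset.univ q.2.1
  rw [propag, Matrix.star_eq_conjTranspose, ← Matrix.exp_conjTranspose, Matrix.conjTranspose_smul]
  congr 2
  simp

lemma norm_propag_le {q : ℝ × (Fin na → ℝ) × (Fin na → ι → ι → ℂ)}
    (hV : ∀ m, (Matrix.of (q.2.2 m)).IsHermitian) (x y : ι × Bits na) :
    ‖propag lam e q x y‖ ≤ 1 := by
  refine (norm_entry_le _ x y).trans ?_
  have h := isSelfAdjoint_partHam (e := e) (lam := lam) hV Finset.univ q.2.1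
  have h1 : star (propag lam e q) * propag lam e q = 1 := by
    rw [star_propag hV, propag]
    exact exp_mul_exp_neg _ _
  have h2 := CStarRing.norm_star_mul_self (x := propag lam e q)
  rw [h1] at h2
  have h3 : ‖(1 : Matrix (ι × Bits na) (ι × Bits na) ℂ)‖ ≤ 1 := by
    rw [← Matrix.diagonal_one]; exact norm_diagonal_le fun x => by simp
  nlinarith [norm_nonneg (propag lam e q)]

/-- The number of ancilla states is a wasteful bound, needed only for integrability. -/
lemma norm_kern_le {q : ℝ × (Fin na → ℝ) × (Fin na → ι → ι → ℂ)}
    (hV : ∀ m, (Matrix.of (q.2.2 m)).IsHermitian) (i j k l : ι) :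
    ‖kern β lam e i j k l q‖ ≤ Fintype.card (Bits na) := by
  refine (norm_sum_le _ _).trans ?_
  have h : ∀ b : Bits na, ‖∑ c, (thermalWeight β q.2.1 c : ℂ) * propag lam e q (i, b) (k, c) *
      star (propag lam e q (j, b) (l, c))‖ ≤ 1 := by
    intro b
    refine (norm_sum_le _ _).trans ?_
    rw [← sum_thermalWeight β q.2.1]
    refine Finset.sum_le_sum fun c _ => ?_
    have h1 := norm_propag_le (lam := lam) (e := e) hV (i, b) (k, c)
    have h2 := norm_propag_le (lam := lam) (e := e) hV (j, b) (l, c)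
    have h0 := thermalWeight_nonneg β q.2.1 c
    rw [norm_mul, norm_mul, norm_star, Complex.norm_real, Real.norm_eq_abs, abs_of_nonneg h0]
    calc _ ≤ thermalWeight β q.2.1 c * 1 * 1 := by gcongr
      _ = _ := by ring
  refine (Finset.sum_le_sum fun b _ => h b).trans (le_of_eq ?_)
  simp

/-- Passage from the Schrödinger picture of the algorithm to the Heisenberg picture of the
estimates. -/
lemma sum_mul_kern {q : ℝ × (Fin na → ℝ) × (Fin na → ι → ι → ℂ)}
    (hV : ∀ m, (Matrix.of (q.2.2 m)).IsHermitian) (k : ι) :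
    ∑ i, (a i : ℂ) * kern β lam e i i k k q = evolObs β lam e a k Finset.univ q := by
  have h : ∀ c, evol (partHam e lam (fun m => Matrix.of (q.2.2 m)) Finset.univ q.2.1) q.1
      (obs na a) (k, c) (k, c) = ∑ i, ∑ b, (a i : ℂ) * (propag lam e q (i, b) (k, c) *
        star (propag lam e q (i, b) (k, c))) := by
    intro c
    rw [evol, ← star_propag hV, Matrix.mul_assoc]
    change (star (propag lam e q) * (obs na a * propag lam e q)) (k, c) (k, c) = _
    rw [Matrix.mul_apply, Fintype.sum_prod_type]
    refine Finset.sum_congr rfl fun i _ => Finset.sum_congr rfl fun b _ => ?_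
    rw [obs, Matrix.diagonal_mul, Matrix.star_apply]
    ring
  simp only [evolObs, kern, h, Finset.smul_sum, Finset.mul_sum]
  rw [Finset.sum_comm (s := (Finset.univ : Finset (Bits na)))]
  refine Finset.sum_congr rfl fun i _ => ?_
  rw [Finset.sum_comm]
  refine Finset.sum_congr rfl fun c _ => Finset.sum_congr rfl fun b _ => ?_
  rw [Complex.real_smul]
  ring

/-- Change of basis by signs. -/
lemma kern_sign {s : ι → ℝ} (hs : ∀ i, s i * s i = 1)
    (q : ℝ × (Fin na → ℝ) × (Fin na → ι → ι → ℂ)) (i j k l : ι) :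
    kern β lam e i j k l (q.1, q.2.1, fun m μ ν => ((s μ * s ν : ℝ) : ℂ) * q.2.2 m μ ν) =
      ((s i * s j * (s k * s l) : ℝ) : ℂ) * kern β lam e i j k l q := by
  set D : Matrix (ι × Bits na) (ι × Bits na) ℂ := Matrix.diagonal fun x => (s x.1 : ℂ) with hD
  have hs' : ∀ i, (s i : ℂ) * (s i : ℂ) = 1 := fun i => by exact_mod_cast hs i
  have hDD : D * D = 1 := by
    rw [hD, Matrix.diagonal_mul_diagonal, ← Matrix.diagonal_one]
    congr 1
    funext x
    exact hs' x.1
  have hu : IsUnit D := ⟨⟨D, D, hDD, hDD⟩, rfl⟩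
  have hinv : D⁻¹ = D := Matrix.inv_eq_right_inv hDD
  -- Conjugation by `D` fixes the diagonal free part and multiplies the coupling entries by the
  -- signs.
  have hham : partHam e lam (fun m => Matrix.of fun μ ν => ((s μ * s ν : ℝ) : ℂ) * q.2.2 m μ ν)
      Finset.univ q.2.1 =
      D * partHam e lam (fun m => Matrix.of (q.2.2 m)) Finset.univ q.2.1 * D⁻¹ := by
    rw [hinv]
    ext x y
    simp only [partHam, Matrix.add_apply, Matrix.sum_apply, hD, Matrix.mul_diagonal,
      Matrix.diagonal_mul, flipTerm_apply, Matrix.of_apply]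
    rw [mul_add, add_mul, Finset.mul_sum, Finset.sum_mul]
    congr 1
    · rw [freeHam]
      by_cases hxy : x = y
      · subst hxy
        rw [Matrix.diagonal_apply_eq, mul_right_comm, hs', one_mul]
      · rw [Matrix.diagonal_apply_ne _ hxy]; ring
    · refine Finset.sum_congr rfl fun m _ => ?_
      by_cases h : x.2 = flipBit m y.2
      · rw [if_pos h, if_pos h]; push_cast; ring
      · rw [if_neg h, if_neg h]; ring
  have hU : propag lam e (q.1, q.2.1, fun m μ ν => ((s μ * s ν : ℝ) : ℂ) * q.2.2 m μ ν) =
      D * propag lam e q * D := by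
    rw [propag, propag]
    simp only [hham]
    rw [← smul_mul_assoc, ← mul_smul_comm, Matrix.exp_conj _ _ hu, hinv]
  simp only [kern, hU, Finset.mul_sum]
  refine Finset.sum_congr rfl fun b _ => Finset.sum_congr rfl fun c _ => ?_
  simp only [hD, Matrix.mul_diagonal, Matrix.diagonal_mul, star_mul', Complex.star_def,
    Complex.conj_ofReal]
  push_cast
  ring

end Kernel

/-! ### The cycle of the algorithm rewritten in the eigenbasis -/

section CycleChannel

open scoped Matrix.Norms.L2Operator

variable {n na : ℕ} {Θ : Type*} [MeasurableSpace Θ] {S : EthSystem n Θ} {P : Measure Θ}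
  [IsProbabilityMeasure P] {β Ω γ lam κ C : ℝ} {a : Bits n → ℝ}

/-- The data of a cycle, with the couplings as matrices in the energy eigenbasis. -/
def cycleParam (S : EthSystem n Θ) (y : CycleData n na Θ) :
    ℝ × (Fin na → ℝ) × (Fin na → Bits n → Bits n → ℂ) :=
  (y.1, fun m => (y.2 m).1, fun m => S.elem (y.2 m).2)

lemma cycleParam_isHermitian (S : EthSystem n Θ) (y : CycleData n na Θ) (m : Fin na) :
    (Matrix.of ((cycleParam S y).2.2 m)).IsHermitian := S.isHermitian_elemMat (y.2 m).2

lemma traceAnc_kronecker_mul {ι α : Type*} [Fintype ι] [Fintype α] [DecidableEq α]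
    (A B : Matrix ι ι ℂ) (M : Matrix (ι × α) (ι × α) ℂ) :
    traceAnc ((A ⊗ₖ (1 : Matrix α α ℂ)) * M * (B ⊗ₖ (1 : Matrix α α ℂ))) = A * traceAnc M * B := by
  ext i j
  simp only [traceAnc, Matrix.of_apply, Matrix.mul_apply, Fintype.sum_prod_type,
    Matrix.kroneckerMap_apply, Matrix.one_apply, mul_ite, mul_one, mul_zero, ite_mul, zero_mul,
    Finset.sum_ite_eq, Finset.sum_ite_eq', Finset.mem_univ, if_true, Finset.sum_mul,
    Finset.mul_sum]
  rw [Finset.sum_comm]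
  refine Finset.sum_congr rfl fun k _ => ?_
  rw [Finset.sum_comm]

lemma ancHam_eq (ω : Fin na → ℝ) : ancHam ω =
    Matrix.diagonal fun b => (((∑ m, bsgn (b m) * ω m) / 2 : ℝ) : ℂ) := by
  ext b c
  simp only [ancHam, pauliZ, Matrix.smul_apply, Matrix.sum_apply, smul_eq_mul]
  by_cases h : b = c
  · subst h
    simp only [Matrix.diagonal_apply_eq]
    push_cast
    rw [Finset.sum_div, Finset.mul_sum]
    refine Finset.sum_congr rfl fun m _ => ?_
    cases b m <;> simp [bsgn] <;> ring
  · simp [Matrix.diagonal_apply_ne _ h]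

lemma totalHam_eq (S : EthSystem n Θ) (lam : ℝ) (ω : Fin na → ℝ) (x : Fin na → CouplingData n Θ) :
    S.totalHam lam ω x =
      ((S.eig : Matrix (Bits n) (Bits n) ℂ) ⊗ₖ (1 : Matrix (Bits na) (Bits na) ℂ)) *
        partHam S.energy lam (fun m => Matrix.of (S.elem (x m))) Finset.univ ω *
      ((S.eig : Matrix (Bits n) (Bits n) ℂ)ᴴ ⊗ₖ (1 : Matrix (Bits na) (Bits na) ℂ)) := by
  have hW : (S.eig : Matrix (Bits n) (Bits n) ℂ) * (S.eig : Matrix (Bits n) (Bits n) ℂ)ᴴ = 1 :=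
    Matrix.mem_unitaryGroup_iff.1 S.eig.2
  have hfree : freeHam S.energy ω =
      (Matrix.diagonal fun μ => (S.energy μ : ℂ)) ⊗ₖ (1 : Matrix (Bits na) (Bits na) ℂ) +
      (1 : Matrix (Bits n) (Bits n) ℂ) ⊗ₖ ancHam ω := by
    rw [ancHam_eq, freeHam, ← Matrix.diagonal_one, ← Matrix.diagonal_one,
      Matrix.diagonal_kronecker_diagonal, Matrix.diagonal_kronecker_diagonal, Matrix.diagonal_add]
    congr 1
    funext x
    simp [freeEnergy]
  rw [EthSystem.totalHam, partHam, hfree, mul_add, mul_add, add_mul, add_mul, S.ham_eq]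
  simp only [Finset.mul_sum, Finset.sum_mul, flipTerm, Finset.smul_sum, mul_smul_comm,
    smul_mul_assoc, ← Matrix.mul_kronecker_mul, Matrix.one_mul, Matrix.mul_one, hW]
  rfl

lemma ancThermal_eq (β : ℝ) (ω : Fin na → ℝ) :
    ancThermal β ω = Matrix.diagonal fun b => (thermalWeight β ω b : ℂ) := rfl

lemma traceAnc_conj_kronecker_diagonal {ι α : Type*} [Fintype ι] [Fintype α] [DecidableEq α]
    (U : Matrix (ι × α) (ι × α) ℂ) (ρ : Matrix ι ι ℂ) (w : α → ℂ) (i j : ι) :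
    traceAnc (U * (ρ ⊗ₖ Matrix.diagonal w) * Uᴴ) i j = ∑ k, ∑ l,
      (∑ b, ∑ c, w c * U (i, b) (k, c) * star (U (j, b) (l, c))) * ρ k l := by
  simp only [traceAnc, Matrix.of_apply, Matrix.mul_apply, Fintype.sum_prod_type,
    Matrix.kroneckerMap_apply, Matrix.diagonal_apply, mul_ite, mul_zero, Finset.sum_ite_eq',
    Finset.mem_univ, if_true, Matrix.conjTranspose_apply, Finset.sum_mul]
  have h1 : ∀ F : α → ι → α → ι → ℂ, ∑ b, ∑ l, ∑ c, ∑ k, F b l c k =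
      ∑ k, ∑ l, ∑ b, ∑ c, F b l c k := by
    intro F
    calc _ = ∑ b, ∑ l, ∑ k, ∑ c, F b l c k :=
          Finset.sum_congr rfl fun b _ => Finset.sum_congr rfl fun l _ => Finset.sum_comm
      _ = ∑ b, ∑ k, ∑ l, ∑ c, F b l c k := Finset.sum_congr rfl fun b _ => Finset.sum_comm
      _ = ∑ k, ∑ b, ∑ l, ∑ c, F b l c k := Finset.sum_comm
      _ = _ := Finset.sum_congr rfl fun k _ => Finset.sum_comm
  rw [h1]
  refine Finset.sum_congr rfl fun k _ => Finset.sum_congr rfl fun l _ =>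
    Finset.sum_congr rfl fun b _ => Finset.sum_congr rfl fun c _ => ?_
  ring

lemma traceAnc_conj_unitary {ι α : Type*} [Fintype ι] [DecidableEq ι] [Fintype α] [DecidableEq α]
    {W : Matrix ι ι ℂ} (hW : Wᴴ * W = 1) (U : Matrix (ι × α) (ι × α) ℂ) (ρ : Matrix ι ι ℂ)
    (σ : Matrix α α ℂ) :
    traceAnc (((W ⊗ₖ (1 : Matrix α α ℂ)) * U * (Wᴴ ⊗ₖ (1 : Matrix α α ℂ))) * ((W * ρ * Wᴴ) ⊗ₖ σ) *
      ((W ⊗ₖ (1 : Matrix α α ℂ)) * U * (Wᴴ ⊗ₖ (1 : Matrix α α ℂ)))ᴴ) =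
      W * traceAnc (U * (ρ ⊗ₖ σ) * Uᴴ) * Wᴴ := by
  rw [← traceAnc_kronecker_mul]
  set D := W ⊗ₖ (1 : Matrix α α ℂ) with hD
  have hDs : Wᴴ ⊗ₖ (1 : Matrix α α ℂ) = Dᴴ := by
    rw [hD, Matrix.conjTranspose_kronecker, Matrix.conjTranspose_one]
  have h2 : Dᴴ * D = 1 := by
    rw [← hDs, hD, ← Matrix.mul_kronecker_mul, hW, Matrix.one_mul, Matrix.one_kronecker_one]
  have hρ : (W * ρ * Wᴴ) ⊗ₖ σ = D * (ρ ⊗ₖ σ) * Dᴴ := by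
    rw [← hDs, hD, ← Matrix.mul_kronecker_mul, ← Matrix.mul_kronecker_mul, Matrix.one_mul,
      Matrix.mul_one]
  rw [hDs, hρ, Matrix.conjTranspose_mul, Matrix.conjTranspose_mul,
    Matrix.conjTranspose_conjTranspose]
  have e : (D * U * Dᴴ) * (D * (ρ ⊗ₖ σ) * Dᴴ) * (D * (Uᴴ * Dᴴ)) =
      D * U * (Dᴴ * D) * (ρ ⊗ₖ σ) * (Dᴴ * D) * Uᴴ * Dᴴ := by simp only [Matrix.mul_assoc]
  rw [e, h2]
  simp only [Matrix.mul_assoc, Matrix.mul_one]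

lemma exp_totalHam (S : EthSystem n Θ) (lam : ℝ) (y : CycleData n na Θ) :
    NormedSpace.exp ((-(Complex.I * (y.1 : ℂ))) •
      S.totalHam lam (fun m => (y.2 m).1) (fun m => (y.2 m).2)) =
    ((S.eig : Matrix (Bits n) (Bits n) ℂ) ⊗ₖ (1 : Matrix (Bits na) (Bits na) ℂ)) *
      propag lam S.energy (cycleParam S y) *
      ((S.eig : Matrix (Bits n) (Bits n) ℂ)ᴴ ⊗ₖ (1 : Matrix (Bits na) (Bits na) ℂ)) := by
  rw [totalHam_eq]
  set W := (S.eig : Matrix (Bits n) (Bits n) ℂ) with hWdef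
  have hW : W * Wᴴ = 1 := Matrix.mem_unitaryGroup_iff.1 S.eig.2
  have hW' : Wᴴ * W = 1 := Matrix.mem_unitaryGroup_iff'.1 S.eig.2
  set D := W ⊗ₖ (1 : Matrix (Bits na) (Bits na) ℂ) with hD
  have h1 : D * (Wᴴ ⊗ₖ (1 : Matrix (Bits na) (Bits na) ℂ)) = 1 := by
    rw [hD, ← Matrix.mul_kronecker_mul, hW, Matrix.one_mul, Matrix.one_kronecker_one]
  have h2 : (Wᴴ ⊗ₖ (1 : Matrix (Bits na) (Bits na) ℂ)) * D = 1 := by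
    rw [hD, ← Matrix.mul_kronecker_mul, hW', Matrix.one_mul, Matrix.one_kronecker_one]
  have hu : IsUnit D := ⟨⟨D, _, h1, h2⟩, rfl⟩
  have hinv : D⁻¹ = Wᴴ ⊗ₖ (1 : Matrix (Bits na) (Bits na) ℂ) := Matrix.inv_eq_right_inv h1
  rw [← hinv, ← smul_mul_assoc, ← mul_smul_comm, Matrix.exp_conj _ _ hu]
  rfl

/-- One cycle in the energy eigenbasis. -/
lemma cycle_eq (S : EthSystem n Θ) (β lam : ℝ) (y : CycleData n na Θ)
    (ρ : Matrix (Bits n) (Bits n) ℂ) :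
    S.cycle β lam y ((S.eig : Matrix (Bits n) (Bits n) ℂ) * ρ *
      (S.eig : Matrix (Bits n) (Bits n) ℂ)ᴴ) =
    (S.eig : Matrix (Bits n) (Bits n) ℂ) * (Matrix.of fun i j => ∑ k, ∑ l,
        kern β lam S.energy i j k l (cycleParam S y) * ρ k l) *
      (S.eig : Matrix (Bits n) (Bits n) ℂ)ᴴ := by
  rw [EthSystem.cycle]
  rw [exp_totalHam, traceAnc_conj_unitary (Matrix.mem_unitaryGroup_iff'.1 S.eig.2)]
  congr 2
  ext i j
  rw [ancThermal_eq, traceAnc_conj_kronecker_diagonal]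
  rfl

end CycleChannel

/-! ### The averaged channel -/

section MeanChannel

open scoped Matrix.Norms.L2Operator

variable {n na : ℕ} {Θ : Type*} [MeasurableSpace Θ] {S : EthSystem n Θ} {P : Measure Θ}
  [IsProbabilityMeasure P] {β Ω γ lam κ C : ℝ} {a : Bits n → ℝ}

lemma isProbabilityMeasure_cycleLaw (hγ : 0 < γ) (hΩ : 0 < Ω) :
    IsProbabilityMeasure (cycleLaw n na P γ Ω) := by
  have := isProbabilityMeasure_freqLaw hΩ
  have := isProbabilityMeasure_expMeasure hγ
  change IsProbabilityMeasure ((expMeasure γ).prod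
    (Measure.pi fun _ : Fin na => (freqLaw Ω).prod (couplingLaw n P)))
  infer_instance

lemma measurable_cycleParam (S : EthSystem n Θ) : Measurable (cycleParam (na := na) S) := by
  have h : ∀ m : Fin na, Measurable fun y : CycleData n na Θ => y.2 m := fun m =>
    (measurable_pi_apply m).comp measurable_snd
  refine measurable_fst.prodMk ((measurable_pi_iff.2 fun m => (h m).fst).prodMk ?_)
  exact measurable_pi_iff.2 fun m => measurable_pi_iff.2 fun μ => measurable_pi_iff.2 fun ν =>
    (S.measurable_elem μ ν).comp (h m).snd

lemma opensMeasurableSpace_cycleParam :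
    OpensMeasurableSpace (ℝ × (Fin na → ℝ) × (Fin na → Bits n → Bits n → ℂ)) := by
  have : OpensMeasurableSpace (Bits n → Bits n → ℂ) := inferInstance
  have : OpensMeasurableSpace (Fin na → Bits n → Bits n → ℂ) := inferInstance
  have : OpensMeasurableSpace ((Fin na → ℝ) × (Fin na → Bits n → Bits n → ℂ)) := inferInstance
  infer_instance

lemma integrable_kern (S : EthSystem n Θ) (hγ : 0 < γ) (hΩ : 0 < Ω) (i j k l : Bits n) :
    Integrable (fun y => kern β lam S.energy i j k l (cycleParam S y)) (cycleLaw n na P γ Ω) := by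
  have := isProbabilityMeasure_cycleLaw (n := n) (na := na) (P := P) hγ hΩ
  have := opensMeasurableSpace_cycleParam (n := n) (na := na)
  exact (integrable_const (Fintype.card (Bits na) : ℝ)).mono'
    ((continuous_kern β lam S.energy i j k l).measurable.comp
      (measurable_cycleParam S)).aestronglyMeasurable
    (.of_forall fun y => norm_kern_le (cycleParam_isHermitian S y) i j k l)

/-- Matrix elements of the averaged channel. -/
def meanKern (S : EthSystem n Θ) (P : Measure Θ) (β Ω γ lam : ℝ) (na : ℕ) (i j k l : Bits n) : ℂ :=
  ∫ y, kern β lam S.energy i j k l (cycleParam S y) ∂(cycleLaw n na P γ Ω)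

/-- Flip the signs of the Gaussian variables. -/
def signCoupling (s : Bits n → ℝ) (x : CouplingData n Θ) : CouplingData n Θ :=
  (x.1, fun p => Sym2.lift ⟨fun μ ν => s μ * s ν, fun _ _ => mul_comm _ _⟩ p * x.2 p)

lemma measurePreserving_gaussian_mul {c : ℝ} (hc : c * c = 1) :
    MeasurePreserving (fun x => c * x) (gaussianReal 0 1) (gaussianReal 0 1) := by
  refine ⟨by fun_prop, ?_⟩
  rw [gaussianReal_map_const_mul, mul_zero]
  congr 1
  ext
  simp [pow_two, hc]

/-- The product `s μ * s ν` is a well-defined sign on unordered pairs, and centred Gaussians are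
symmetric. -/
lemma measurePreserving_signCoupling {s : Bits n → ℝ} (hs : ∀ i, s i * s i = 1) :
    MeasurePreserving (signCoupling (Θ := Θ) s) (couplingLaw n P) (couplingLaw n P) := by
  refine (MeasurePreserving.id P).prod (measurePreserving_pi _ _ fun p => ?_)
  refine measurePreserving_gaussian_mul ?_
  induction p with
  | _ μ ν => calc _ = (s μ * s μ) * (s ν * s ν) := by simp only [Sym2.lift_mk]; ring
      _ = 1 := by rw [hs, hs, one_mul]

lemma elem_signCoupling (S : EthSystem n Θ) {s : Bits n → ℝ} (hs : ∀ i, s i * s i = 1)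
    (x : CouplingData n Θ) (μ ν : Bits n) :
    S.elem (signCoupling s x) μ ν = ((s μ * s ν : ℝ) : ℂ) * S.elem x μ ν := by
  simp only [EthSystem.elem, signCoupling, Sym2.lift_mk]
  by_cases h : μ = ν
  · subst h; simp [hs]
  · simp only [if_neg h]; push_cast; ring

/-- Flipping the sign of level `i` alone preserves the law and multiplies this kernel by `s i * s j
= -1`, so the mean equals its own negative. On average no coherence is created from populations. -/
lemma meanKern_offDiag (S : EthSystem n Θ) (hΩ : 0 < Ω) (hγ : 0 < γ) {i j : Bits n} (hij : i ≠ j)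
    (k : Bits n) : meanKern S P β Ω γ lam na i j k k = 0 := by
  have := isProbabilityMeasure_freqLaw hΩ
  have := isProbabilityMeasure_expMeasure hγ
  let s : Bits n → ℝ := fun x => if x = i then -1 else 1
  have hs : ∀ x, s x * s x = 1 := fun x => by
    simp only [s]; split_ifs <;> norm_num
  have hmp : MeasurePreserving
      (Prod.map id fun (y : Fin na → ℝ × CouplingData n Θ) m => Prod.map id (signCoupling s) (y m))
      (cycleLaw n na P γ Ω) (cycleLaw n na P γ Ω) := by
    change MeasurePreserving _ ((expMeasure γ).prod
      (Measure.pi fun _ : Fin na => (freqLaw Ω).prod (couplingLaw n P))) ((expMeasure γ).prod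
      (Measure.pi fun _ : Fin na => (freqLaw Ω).prod (couplingLaw n P)))
    exact (MeasurePreserving.id _).prod (measurePreserving_pi _ _ fun m =>
      (MeasurePreserving.id _).prod (measurePreserving_signCoupling hs))
  have h1 : ∀ y : CycleData n na Θ, kern β lam S.energy i j k k (cycleParam S
      (Prod.map id (fun (y : Fin na → ℝ × CouplingData n Θ) m =>
        Prod.map id (signCoupling s) (y m)) y)) = -kern β lam S.energy i j k k (cycleParam S y) := by
    intro y
    have e : cycleParam S (Prod.map id (fun (y : Fin na → ℝ × CouplingData n Θ) m =>
        Prod.map id (signCoupling s) (y m)) y) = ((cycleParam S y).1, (cycleParam S y).2.1,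
        fun m μ ν => ((s μ * s ν : ℝ) : ℂ) * (cycleParam S y).2.2 m μ ν) := by
      refine Prod.ext rfl (Prod.ext rfl ?_)
      funext m μ ν
      exact elem_signCoupling S hs _ μ ν
    rw [e, kern_sign hs]
    have e2 : s i * s j * (s k * s k) = -1 := by
      rw [hs]; simp [s, hij.symm]
    rw [e2]; simp
  have h2 : meanKern S P β Ω γ lam na i j k k = -meanKern S P β Ω γ lam na i j k k := by
    conv_lhs => rw [meanKern, ← hmp.map_eq]
    rw [integral_map hmp.measurable.aemeasurable (by
      rw [hmp.map_eq]; exact (integrable_kern S hγ hΩ i j k k).aestronglyMeasurable)]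
    simp only [h1]
    rw [integral_neg]
    rfl
  linear_combination (1 / 2 : ℂ) * h2

lemma conj_kern {ι : Type*} [Fintype ι] [DecidableEq ι] (β lam : ℝ) (e : ι → ℝ) (i k : ι)
    (q : ℝ × (Fin na → ℝ) × (Fin na → ι → ι → ℂ)) :
    (starRingEnd ℂ) (kern β lam e i i k k q) = kern β lam e i i k k q := by
  simp only [kern, map_sum, map_mul, Complex.conj_ofReal]
  refine Finset.sum_congr rfl fun b _ => Finset.sum_congr rfl fun c _ => ?_
  simp only [Complex.star_def, Complex.conj_conj]
  ring

lemma ofReal_re_meanKern (S : EthSystem n Θ) (i k : Bits n) :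
    ((meanKern S P β Ω γ lam na i i k k).re : ℂ) = meanKern S P β Ω γ lam na i i k k := by
  refine Complex.conj_eq_iff_re.1 ?_
  rw [meanKern, ← integral_conj]
  simp only [conj_kern]

lemma sum_mul_meanKern (S : EthSystem n Θ) (hγ : 0 < γ) (hΩ : 0 < Ω) (ha : ∀ ν, |a ν| ≤ 1)
    (k : Bits n) : ∑ i, (a i : ℂ) * meanKern S P β Ω γ lam na i i k k =
      fullMean S P β Ω γ lam a k (Finset.univ : Finset (Fin na)) := by
  have := isProbabilityMeasure_freqLaw hΩ
  have := isProbabilityMeasure_expMeasure hγ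
  have h1 : ∑ i, (a i : ℂ) * meanKern S P β Ω γ lam na i i k k =
      ∫ y, evolObs β lam S.energy a k Finset.univ (cycleParam S y) ∂(cycleLaw n na P γ Ω) := by
    simp only [meanKern, ← integral_const_mul]
    rw [← integral_finsetSum _ fun i _ => (integrable_kern S hγ hΩ i i k k).const_mul _]
    simp only [sum_mul_kern (cycleParam_isHermitian S _)]
  rw [h1]
  let F : ℝ × (Fin na → ℝ) × (Fin na → CouplingData n Θ) → ℂ := fun p =>
    evolObs β lam S.energy a k Finset.univ (p.1, p.2.1, fun m => S.elem (p.2.2 m))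
  have hFm : StronglyMeasurable F := by
    have hs := stronglyMeasurable_evolObs (na := na) S β lam a k Finset.univ
    exact hs.comp_measurable (g := fun p : ℝ × (Fin na → ℝ) × (Fin na → CouplingData n Θ) =>
      ((p.2.2, p.2.1), p.1)) (by fun_prop)
  have hFb : ∀ p, ‖F p‖ ≤ 1 := fun p =>
    norm_evolObs_le ha k Finset.univ p.1 p.2.1 fun m => S.isHermitian_elemMat (p.2.2 m)
  let E := MeasurableEquiv.arrowProdEquivProdArrow ℝ (CouplingData n Θ) (Fin na)
  have hE : MeasurePreserving (Prod.map id E) ((expMeasure γ).prod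
      (Measure.pi fun _ : Fin na => (freqLaw Ω).prod (couplingLaw n P)))
      ((expMeasure γ).prod ((Measure.pi fun _ => freqLaw Ω).prod
        (Measure.pi fun _ => couplingLaw n P))) :=
    (MeasurePreserving.id _).prod (measurePreserving_arrowProdEquivProdArrow _ _ _ _ _)
  have hFi : Integrable F ((expMeasure γ).prod ((Measure.pi fun _ => freqLaw Ω).prod
        (Measure.pi fun _ => couplingLaw n P))) :=
    (integrable_const 1).mono' hFm.aestronglyMeasurable (.of_forall hFb)
  have h2 : ∫ y, evolObs β lam S.energy a k Finset.univ (cycleParam S y) ∂(cycleLaw n na P γ Ω) =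
      ∫ p, F p ∂((expMeasure γ).prod ((Measure.pi fun _ => freqLaw Ω).prod
        (Measure.pi fun _ => couplingLaw n P))) := by
    rw [← hE.map_eq, integral_map hE.measurable.aemeasurable hFm.aestronglyMeasurable]
    rfl
  rw [h2, integral_prod_symm _ hFi, integral_prod_symm _ hFi.integral_prod_right, fullMean]
  congr 1
  funext x
  rw [dataMean, freqMean]
  congr 1
  funext ω
  have h3 := integral_evolObs (β := β) (lam := lam) (e := S.energy) (a := a) hγ k Finset.univ ω
    (V := fun m => S.elem (x m)) fun m => S.isHermitian_elemMat (x m)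
  exact h3

end MeanChannel

/-! ### The expected output -/

section Output

variable {n na : ℕ} {Θ : Type*} [MeasurableSpace Θ] {S : EthSystem n Θ} {P : Measure Θ}
  [IsProbabilityMeasure P] {β Ω γ lam κ C : ℝ} {a : Bits n → ℝ}

lemma eig_mul_conjTranspose (S : EthSystem n Θ) :
    (S.eig : Matrix (Bits n) (Bits n) ℂ) * (S.eig : Matrix (Bits n) (Bits n) ℂ)ᴴ = 1 :=
  Matrix.mem_unitaryGroup_iff.1 S.eig.2

lemma conjTranspose_mul_eig (S : EthSystem n Θ) :
    (S.eig : Matrix (Bits n) (Bits n) ℂ)ᴴ * (S.eig : Matrix (Bits n) (Bits n) ℂ) = 1 :=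
  Matrix.mem_unitaryGroup_iff'.1 S.eig.2

/-- The random state after `d` cycles, in the energy eigenbasis. -/
def eigRun (S : EthSystem n Θ) (β lam : ℝ) (z : Bits n) :
    (d : ℕ) → (Fin d → CycleData n na Θ) → Matrix (Bits n) (Bits n) ℂ
  | 0, _ => (S.eig : Matrix (Bits n) (Bits n) ℂ)ᴴ * Matrix.single z z 1 *
      (S.eig : Matrix (Bits n) (Bits n) ℂ)
  | d + 1, y => Matrix.of fun i j => ∑ k, ∑ l,
      kern β lam S.energy i j k l (cycleParam S (y (Fin.last d))) *
        eigRun S β lam z d (fun k => y k.castSucc) k l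

lemma run_eq (S : EthSystem n Θ) (β lam : ℝ) (z : Bits n) (d : ℕ) (y : Fin d → CycleData n na Θ) :
    S.run β lam z d y = (S.eig : Matrix (Bits n) (Bits n) ℂ) * eigRun S β lam z d y *
      (S.eig : Matrix (Bits n) (Bits n) ℂ)ᴴ := by
  induction d with
  | zero =>
    have e : ∀ W M : Matrix (Bits n) (Bits n) ℂ, W * (Wᴴ * M * W) * Wᴴ = (W * Wᴴ) * M * (W * Wᴴ) :=
      fun W M => by simp only [Matrix.mul_assoc]
    rw [EthSystem.run, eigRun, e, eig_mul_conjTranspose, Matrix.one_mul, Matrix.mul_one]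
  | succ d ih =>
    rw [EthSystem.run, ih, cycle_eq]
    rfl

/-- The last cycle is independent of the earlier ones, so the mean of kernel times state factorizes.
Integrability is propagated alongside. -/
lemma eigRun_mean (S : EthSystem n Θ) (hγ : 0 < γ) (hΩ : 0 < Ω) (z : Bits n) (d : ℕ) :
    (∀ i j, Integrable (fun y => eigRun (na := na) S β lam z d y i j)
      (Measure.pi fun _ : Fin d => cycleLaw n na P γ Ω)) ∧
    ∀ i j, ∫ y, eigRun (na := na) S β lam z (d + 1) y i j
      ∂(Measure.pi fun _ : Fin (d + 1) => cycleLaw n na P γ Ω) =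
      ∑ k, ∑ l, meanKern S P β Ω γ lam na i j k l *
        ∫ y, eigRun (na := na) S β lam z d y k l
          ∂(Measure.pi fun _ : Fin d => cycleLaw n na P γ Ω) := by
  have := isProbabilityMeasure_cycleLaw (n := n) (na := na) (P := P) hγ hΩ
  have key : ∀ d, (∀ i j, Integrable (fun y => eigRun (na := na) S β lam z d y i j)
      (Measure.pi fun _ : Fin d => cycleLaw n na P γ Ω)) → ∀ i j k l,
      Integrable (fun y : Fin (d + 1) → CycleData n na Θ =>
        kern β lam S.energy i j k l (cycleParam S (y (Fin.last d))) *
        eigRun S β lam z d (fun k => y k.castSucc) k l)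
        (Measure.pi fun _ : Fin (d + 1) => cycleLaw n na P γ Ω) ∧
      ∫ y : Fin (d + 1) → CycleData n na Θ,
        kern β lam S.energy i j k l (cycleParam S (y (Fin.last d))) *
        eigRun S β lam z d (fun k => y k.castSucc) k l
        ∂(Measure.pi fun _ : Fin (d + 1) => cycleLaw n na P γ Ω) =
      meanKern S P β Ω γ lam na i j k l * ∫ y, eigRun (na := na) S β lam z d y k l
          ∂(Measure.pi fun _ : Fin d => cycleLaw n na P γ Ω) := by
    intro d hd i j k l
    have hmp := measurePreserving_piFinSuccAbove
      (fun _ : Fin (d + 1) => cycleLaw n na P γ Ω) (Fin.last d)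
    have hi := (integrable_kern (β := β) (lam := lam) (P := P) (na := na) S hγ hΩ i j k l).mul_prod
      (hd k l)
    have e : (fun y : Fin (d + 1) → CycleData n na Θ =>
        kern β lam S.energy i j k l (cycleParam S (y (Fin.last d))) *
        eigRun S β lam z d (fun k => y k.castSucc) k l) =
        (fun p : CycleData n na Θ × (Fin d → CycleData n na Θ) =>
          kern β lam S.energy i j k l (cycleParam S p.1) * eigRun S β lam z d p.2 k l) ∘
        (MeasurableEquiv.piFinSuccAbove (fun _ => CycleData n na Θ) (Fin.last d)) := by
      funext y
      have h0 : (fun k : Fin d => y k.castSucc) = (Fin.last d).removeNth y := by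
        funext k
        simp [Fin.removeNth]
      rw [h0]
      rfl
    rw [e]
    refine ⟨hmp.integrable_comp_of_integrable hi, ?_⟩
    have h1 := hmp.integral_comp' (fun p : CycleData n na Θ × (Fin d → CycleData n na Θ) =>
          kern β lam S.energy i j k l (cycleParam S p.1) * eigRun S β lam z d p.2 k l)
    refine Eq.trans h1 ?_
    exact integral_prod_mul (fun y => kern β lam S.energy i j k l (cycleParam S y))
      (fun y => eigRun S β lam z d y k l)
  have hint : ∀ d, ∀ i j, Integrable (fun y => eigRun (na := na) S β lam z d y i j)
      (Measure.pi fun _ : Fin d => cycleLaw n na P γ Ω) := by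
    intro d
    induction d with
    | zero =>
      intro i j
      simp only [eigRun]
      exact integrable_const _
    | succ d ih =>
      intro i j
      simp only [eigRun, Matrix.of_apply]
      exact integrable_finsetSum _ fun k _ => integrable_finsetSum _ fun l _ => (key d ih i j k l).1
  refine ⟨hint d, fun i j => ?_⟩
  simp only [eigRun, Matrix.of_apply]
  have hk := key d (hint d) i j
  rw [integral_finsetSum _ fun k _ => integrable_finsetSum _ fun l _ => (hk k l).1]
  refine Finset.sum_congr rfl fun k _ => ?_
  rw [integral_finsetSum _ fun l _ => (hk k l).1]
  exact Finset.sum_congr rfl fun l _ => (hk k l).2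

/-- Transition matrix of the populations in one cycle. -/
def popKern (S : EthSystem n Θ) (P : Measure Θ) (β Ω γ lam : ℝ) (na : ℕ) :
    Matrix (Bits n) (Bits n) ℝ :=
  Matrix.of fun i k => (meanKern S P β Ω γ lam na i i k k).re

/-- Populations after `d` cycles. -/
def pop (S : EthSystem n Θ) (P : Measure Θ) (β Ω γ lam : ℝ) (na : ℕ) : ℕ → Bits n → ℝ
  | 0 => fun _ => (Fintype.card (Bits n) : ℝ)⁻¹
  | d + 1 => popKern S P β Ω γ lam na *ᵥ pop S P β Ω γ lam na d

/-- The initial states average to a multiple of the identity, which is diagonal in every basis, and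
`meanKern_offDiag` keeps the average diagonal. -/
lemma mean_eigRun (S : EthSystem n Θ) (hγ : 0 < γ) (hΩ : 0 < Ω) (d : ℕ) (i j : Bits n) :
    (Fintype.card (Bits n) : ℂ)⁻¹ * ∑ z, ∫ y, eigRun (na := na) S β lam z d y i j
      ∂(Measure.pi fun _ : Fin d => cycleLaw n na P γ Ω) =
    Matrix.diagonal (fun μ => (pop S P β Ω γ lam na d μ : ℂ)) i j := by
  have := isProbabilityMeasure_cycleLaw (n := n) (na := na) (P := P) hγ hΩ
  induction d generalizing i j with
  | zero =>
    have h1 : ∑ z : Bits n, Matrix.single z z (1 : ℂ) = 1 := by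
      ext x y
      rw [Matrix.sum_apply, Finset.sum_eq_single x (fun z _ hz => by simp [hz])
        (by simp)]
      simp [Matrix.single_apply, Matrix.one_apply]
    simp only [eigRun, integral_const, probReal_univ, one_smul]
    rw [← Matrix.sum_apply, ← Finset.sum_mul, ← Finset.mul_sum, h1, Matrix.mul_one,
      conjTranspose_mul_eig]
    by_cases h : i = j
    · subst h; simp [pop]
    · simp [Matrix.one_apply_ne h, Matrix.diagonal_apply_ne _ h]
  | succ d ih =>
    simp only [fun z => (eigRun_mean (β := β) (lam := lam) (P := P) (na := na) S hγ hΩ z d).2 i j]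
    have e : (Fintype.card (Bits n) : ℂ)⁻¹ * ∑ z, ∑ k, ∑ l, meanKern S P β Ω γ lam na i j k l *
        ∫ y, eigRun (na := na) S β lam z d y k l
          ∂(Measure.pi fun _ : Fin d => cycleLaw n na P γ Ω) =
        ∑ k, ∑ l, meanKern S P β Ω γ lam na i j k l * ((Fintype.card (Bits n) : ℂ)⁻¹ * ∑ z,
        ∫ y, eigRun (na := na) S β lam z d y k l
          ∂(Measure.pi fun _ : Fin d => cycleLaw n na P γ Ω)) := by
      rw [Finset.sum_comm, Finset.mul_sum]
      refine Finset.sum_congr rfl fun k _ => ?_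
      rw [Finset.sum_comm, Finset.mul_sum]
      refine Finset.sum_congr rfl fun l _ => ?_
      rw [← Finset.mul_sum]
      ring
    rw [e]
    simp only [ih, Matrix.diagonal_apply, mul_ite, mul_zero, Finset.sum_ite_eq, Finset.mem_univ,
      if_true]
    by_cases h : i = j
    · subst h
      rw [if_pos rfl, pop, Matrix.mulVec, dotProduct]
      push_cast
      refine Finset.sum_congr rfl fun k _ => ?_
      rw [popKern, Matrix.of_apply, ofReal_re_meanKern]
    · rw [if_neg h]
      exact Finset.sum_eq_zero fun k _ => by rw [meanKern_offDiag S hΩ hγ h, zero_mul]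

theorem expectedOutput_eq (S : EthSystem n Θ) (hγ : 0 < γ) (hΩ : 0 < Ω) (d : ℕ) :
    S.expectedOutput P β Ω γ lam na d = (S.eig : Matrix (Bits n) (Bits n) ℂ) *
      Matrix.diagonal (fun μ => (pop S P β Ω γ lam na d μ : ℂ)) *
      (S.eig : Matrix (Bits n) (Bits n) ℂ)ᴴ := by
  ext i j
  rw [EthSystem.expectedOutput, Matrix.of_apply]
  have hi := fun z => (eigRun_mean (β := β) (lam := lam) (P := P) (na := na) S hγ hΩ z d).1
  have h : ∀ z, ∫ y, S.run β lam z d y i j ∂(Measure.pi fun _ : Fin d => cycleLaw n na P γ Ω) =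
      ∑ l, ∑ k, (S.eig : Matrix (Bits n) (Bits n) ℂ) i k *
        (∫ y, eigRun (na := na) S β lam z d y k l
          ∂(Measure.pi fun _ : Fin d => cycleLaw n na P γ Ω)) *
        (S.eig : Matrix (Bits n) (Bits n) ℂ)ᴴ l j := by
    intro z
    simp only [run_eq, Matrix.mul_apply, Finset.sum_mul]
    rw [integral_finsetSum _ fun l _ => integrable_finsetSum _ fun k _ =>
      ((hi z k l).const_mul _).mul_const _]
    refine Finset.sum_congr rfl fun l _ => ?_
    rw [integral_finsetSum _ fun k _ => ((hi z k l).const_mul _).mul_const _]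
    refine Finset.sum_congr rfl fun k _ => ?_
    rw [integral_mul_const, integral_const_mul]
  simp only [h, Matrix.mul_apply, Finset.sum_mul, ← mean_eigRun S hγ hΩ d]
  rw [Finset.sum_comm, Finset.mul_sum]
  refine Finset.sum_congr rfl fun l _ => ?_
  rw [Finset.sum_comm, Finset.mul_sum]
  refine Finset.sum_congr rfl fun k _ => ?_
  rw [← Finset.sum_mul, ← Finset.mul_sum]
  ring

end Output

/-! ### Accuracy of the expected output -/

section TraceNorm

variable {ι : Type*} [Fintype ι] [DecidableEq ι]

/-- The product `Aᴴ * A` is unitarily equivalent to the diagonal of squares. Comparing multisets of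
characteristic roots avoids matching an ordering of the eigenvalues. -/
lemma traceNorm_eq_of_diagonal {W : Matrix ι ι ℂ} (hW : Wᴴ * W = 1) (f : ι → ℝ) :
    traceNorm (W * Matrix.diagonal (fun i => (f i : ℂ)) * Wᴴ) = ∑ i, |f i| := by
  set A := W * Matrix.diagonal (fun i => (f i : ℂ)) * Wᴴ with hA
  have hAA : Aᴴ * A = W * (Matrix.diagonal (fun i => ((f i ^ 2 : ℝ) : ℂ)) * Wᴴ) := by
    have e : Aᴴ * A = W * Matrix.diagonal (fun i => (f i : ℂ)) * (Wᴴ * W) *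
        Matrix.diagonal (fun i => (f i : ℂ)) * Wᴴ := by
      rw [hA, Matrix.conjTranspose_mul, Matrix.conjTranspose_mul, Matrix.conjTranspose_conjTranspose,
        Matrix.diagonal_conjTranspose]
      have : (star fun i => (f i : ℂ)) = fun i => (f i : ℂ) := by funext i; simp
      rw [this]
      simp only [Matrix.mul_assoc]
    rw [e, hW, Matrix.mul_one, Matrix.mul_assoc W, Matrix.diagonal_mul_diagonal, Matrix.mul_assoc]
    congr 3
    funext i
    push_cast
    ring
  have hroots := (Matrix.isHermitian_conjTranspose_mul_self A).roots_charpoly_eq_eigenvalues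
  have hchar : (Aᴴ * A).charpoly.roots =
      Multiset.map (fun i => ((f i ^ 2 : ℝ) : ℂ)) Finset.univ.val := by
    generalize (fun i => ((f i ^ 2 : ℝ) : ℂ)) = g at hAA ⊢
    rw [hAA, Matrix.charpoly_mul_comm, Matrix.mul_assoc, hW, Matrix.mul_one,
      Matrix.charpoly_diagonal, Polynomial.roots_prod _ _ (by
        simp [Finset.prod_ne_zero_iff, Polynomial.X_sub_C_ne_zero])]
    simp
  rw [hchar] at hroots
  have h := congrArg (fun s : Multiset ℂ => (s.map fun z => Real.sqrt z.re).sum) hroots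
  simp only [Multiset.map_map, Function.comp_def, Complex.ofReal_re, Real.sqrt_sq_eq_abs] at h
  exact h.symm

/-- Duality of `ℓ¹` and `ℓ∞`, tested at the signs of `f`. It converts bounds for observables into
column norms of population matrices. -/
lemma sum_abs_le_of_forall {f : ι → ℝ} {c : ℝ}
    (h : ∀ a : ι → ℝ, (∀ i, |a i| ≤ 1) → |∑ i, a i * f i| ≤ c) : ∑ i, |f i| ≤ c := by
  refine le_trans (le_of_eq ?_) ((le_abs_self _).trans (h (fun i => if 0 ≤ f i then 1 else -1) ?_))
  · refine Finset.sum_congr rfl fun i _ => ?_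
    split_ifs with hi
    · rw [abs_of_nonneg hi, one_mul]
    · rw [abs_of_neg (not_le.1 hi)]; ring
  · intro i
    split_ifs <;> simp

end TraceNorm

/-! ### Trace distance to the Gibbs state and expected running time -/

section Accuracy

variable {n na : ℕ} {Θ : Type*} [MeasurableSpace Θ] {S : EthSystem n Θ} {P : Measure Θ}
  [IsProbabilityMeasure P] {β Ω γ lam κ C : ℝ} {a : Bits n → ℝ}

lemma gibbs_eq (S : EthSystem n Θ) (β : ℝ) :
    gibbs β S.ham = (S.eig : Matrix (Bits n) (Bits n) ℂ) *
      Matrix.diagonal (fun μ => (S.gibbsWeight β μ : ℂ)) *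
      (S.eig : Matrix (Bits n) (Bits n) ℂ)ᴴ := by
  set W := (S.eig : Matrix (Bits n) (Bits n) ℂ) with hWdef
  have h1 : W * Wᴴ = 1 := eig_mul_conjTranspose S
  have h2 : Wᴴ * W = 1 := conjTranspose_mul_eig S
  have hu : IsUnit W := ⟨⟨W, Wᴴ, h1, h2⟩, rfl⟩
  have hinv : W⁻¹ = Wᴴ := Matrix.inv_eq_right_inv h1
  have hexp : NormedSpace.exp (-(β : ℂ) • S.ham) =
      W * Matrix.diagonal (fun μ => ((Real.exp (-(β * S.energy μ)) : ℝ) : ℂ)) * Wᴴ := by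
    rw [S.ham_eq, ← hWdef, ← hinv, ← smul_mul_assoc, ← mul_smul_comm, Matrix.exp_conj _ _ hu,
      ← Matrix.diagonal_smul, Matrix.exp_diagonal]
    congr 3
    funext μ
    rw [Pi.coe_exp, ← Complex.exp_eq_exp_ℂ]
    simp
  rw [gibbs, hexp, Matrix.trace_mul_comm, ← Matrix.mul_assoc, h2, Matrix.one_mul,
    Matrix.trace_diagonal, ← smul_mul_assoc, ← mul_smul_comm, ← Matrix.diagonal_smul]
  congr 3
  funext μ
  simp only [Pi.smul_apply, smul_eq_mul, EthSystem.gibbsWeight]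
  push_cast
  rw [div_eq_inv_mul]

lemma sum_mul_popKern (S : EthSystem n Θ) (hγ : 0 < γ) (hΩ : 0 < Ω) (ha : ∀ ν, |a ν| ≤ 1)
    (k : Bits n) : ((∑ i, a i * popKern S P β Ω γ lam na i k : ℝ) : ℂ) =
      fullMean S P β Ω γ lam a k (Finset.univ : Finset (Fin na)) := by
  rw [← sum_mul_meanKern S hγ hΩ ha k]
  push_cast
  exact Finset.sum_congr rfl fun i _ => by rw [popKern, Matrix.of_apply, ofReal_re_meanKern]

/-- Positivity of the populations is not needed: contraction in `ℓ¹` is dual to the bound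
`norm_fullMean_le` on observables. -/
lemma lone_pop_le (S : EthSystem n Θ) (hγ : 0 < γ) (hΩ : 0 < Ω) (d : ℕ) :
    lone (pop S P β Ω γ lam na d) ≤ 1 := by
  induction d with
  | zero => simp [lone, pop]
  | succ d ih =>
    refine (lone_mulVec_le (c := 1) (fun k => sum_abs_le_of_forall fun a ha => ?_) _).trans
      (by rw [one_mul]; exact ih)
    rw [← Real.norm_eq_abs, ← Complex.norm_real, sum_mul_popKern S hγ hΩ ha]
    exact norm_fullMean_le S hγ hΩ ha k _

lemma lone_pop_step_le (h : S.CouplingSize P κ) (hκ : 0 < κ) (hβ : 0 < β) (hγ : 0 < γ)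
    (hΩ : 0 < Ω) (hC : 0 < C) (hlam : 0 < lam) (d : ℕ) :
    lone (pop S P β Ω γ lam na (d + 1) -
      ((1 - lam ^ 2 * na / (C * Ω * γ)) • pop S P β Ω γ lam na d +
        (lam ^ 2 * na / (C * Ω * γ)) •
          (S.transition P C β Ω γ *ᵥ pop S P β Ω γ lam na d))) ≤ cycleErr κ β Ω γ lam na := by
  set α := lam ^ 2 * na / (C * Ω * γ) with hα
  set T := S.transition P C β Ω γ with hT
  set q := pop S P β Ω γ lam na d
  set G := popKern S P β Ω γ lam na
  have e : pop S P β Ω γ lam na (d + 1) - ((1 - α) • q + α • (T *ᵥ q)) =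
      (G - ((1 - α) • (1 : Matrix (Bits n) (Bits n) ℝ) + α • T)) *ᵥ q := by
    rw [Matrix.sub_mulVec, Matrix.add_mulVec, Matrix.smul_mulVec, Matrix.smul_mulVec,
      Matrix.one_mulVec]
    rfl
  rw [e]
  have h1 : ∀ k, ∑ i, |(G - ((1 - α) • (1 : Matrix (Bits n) (Bits n) ℝ) + α • T)) i k| ≤
      cycleErr κ β Ω γ lam na := fun k => sum_abs_le_of_forall fun a ha => by
    have h2 := norm_fullMean_sub_le (na := na) h hκ hβ hγ hΩ hC hlam ha k
    rw [← sum_mul_popKern S hγ hΩ ha, ← Complex.ofReal_sub, Complex.norm_real, Real.norm_eq_abs]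
      at h2
    refine le_trans (le_of_eq ?_) h2
    congr 1
    simp only [Matrix.sub_apply, Matrix.add_apply, Matrix.smul_apply, smul_eq_mul, mul_sub, mul_add,
      Finset.sum_sub_distrib, Finset.sum_add_distrib, Matrix.one_apply, mul_ite, mul_one, mul_zero,
      Finset.sum_ite_eq', Finset.mem_univ, if_true, Finset.mul_sum]
    congr 1
    rw [← hα]
    congr 1
    · ring
    · exact Finset.sum_congr rfl fun i _ => by ring
  have hne : Nonempty (Bits n) := inferInstance
  have h0 : 0 ≤ cycleErr κ β Ω γ lam na :=
    (Finset.sum_nonneg fun i _ => abs_nonneg _).trans (h1 hne.some)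
  exact (lone_mulVec_le h1 q).trans (mul_le_of_le_one_right h0 (lone_pop_le S hγ hΩ d))

/-- Accuracy of the algorithm for general parameters. -/
theorem traceNorm_expectedOutput_sub_gibbs_le (h : S.CouplingSize P κ) (hκ : 0 < κ) (hβ : 0 < β)
    (hγ : 0 < γ) (hΩ : 0 < Ω) (hC : 0 < C) (hlam : 0 < lam)
    (hα : lam ^ 2 * na / (C * Ω * γ) ≤ 1) {m : ℕ} (hm : 1 ≤ m)
    (h0 : ∀ μ ν, 0 ≤ S.transition P C β Ω γ μ ν)
    (hmix : mixingTime (S.transition P C β Ω γ) (S.gibbsWeight β) ≤ m) (d : ℕ) :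
    traceNorm (S.expectedOutput P β Ω γ lam na d - gibbs β S.ham) ≤
      d * cycleErr κ β Ω γ lam na +
        4 * Real.exp (-(lam ^ 2 * na / (C * Ω * γ) * d / (2 * m))) := by
  have e : S.expectedOutput P β Ω γ lam na d - gibbs β S.ham =
      (S.eig : Matrix (Bits n) (Bits n) ℂ) * Matrix.diagonal
        (fun μ => ((pop S P β Ω γ lam na d μ - S.gibbsWeight β μ : ℝ) : ℂ)) *
      (S.eig : Matrix (Bits n) (Bits n) ℂ)ᴴ := by
    rw [expectedOutput_eq S hγ hΩ, gibbs_eq, ← Matrix.sub_mul, ← Matrix.mul_sub,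
      Matrix.diagonal_sub]
    simp only [Complex.ofReal_sub]
  rw [e, traceNorm_eq_of_diagonal (conjTranspose_mul_eig S)]
  have hp1 : lone (S.gibbsWeight β) = 1 := by
    rw [lone, ← S.sum_gibbsWeight β]
    exact Finset.sum_congr rfl fun μ _ => abs_of_pos (S.gibbsWeight_pos β μ)
  have hsum : ∑ i, pop S P β Ω γ lam na 0 i = ∑ i, S.gibbsWeight β i := by
    rw [S.sum_gibbsWeight]
    simp [pop]
  have key := lone_perturbed_chain_le hm h0 (S.sum_transition P C β Ω γ) hmix
    (S.transition_mulVec_gibbsWeight P C β Ω γ) (α := lam ^ 2 * na / (C * Ω * γ)) (by positivity) hα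
    (pop S P β Ω γ lam na) hsum (lone_pop_step_le h hκ hβ hγ hΩ hC hlam) d
  have h2 : lone (pop S P β Ω γ lam na 0 - S.gibbsWeight β) ≤ 2 := by
    rw [sub_eq_add_neg]
    refine (lone_add_le _ _).trans ?_
    have e1 : lone (-S.gibbsWeight β) = lone (S.gibbsWeight β) := by simp [lone]
    rw [e1, hp1]
    have h3 : lone (pop S P β Ω γ lam na 0) ≤ 1 := lone_pop_le S hγ hΩ 0
    linarith
  refine key.trans (add_le_add le_rfl (mul_le_mul_of_nonneg_right (by linarith) (Real.exp_nonneg _)))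

lemma expectedTime_eq (hγ : 0 < γ) (hΩ : 0 < Ω) (d : ℕ) :
    expectedTime n na P γ Ω d = d / γ := by
  have := isProbabilityMeasure_cycleLaw (n := n) (na := na) (P := P) hγ hΩ
  have := isProbabilityMeasure_freqLaw hΩ
  have := isProbabilityMeasure_expMeasure hγ
  have hfst : MeasurePreserving (Prod.fst : CycleData n na Θ → ℝ) (cycleLaw n na P γ Ω)
      (expMeasure γ) := by
    change MeasurePreserving _ ((expMeasure γ).prod
      (Measure.pi fun _ : Fin na => (freqLaw Ω).prod (couplingLaw n P))) _
    exact measurePreserving_fst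
  have hmp : ∀ k : Fin d, MeasurePreserving (fun y : Fin d → CycleData n na Θ => (y k).1)
      (Measure.pi fun _ : Fin d => cycleLaw n na P γ Ω) (expMeasure γ) := fun k =>
    hfst.comp (measurePreserving_eval (fun _ : Fin d => cycleLaw n na P γ Ω) k)
  have hi := integrable_id_expMeasure hγ
  have hv : ∀ k : Fin d, ∫ y : Fin d → CycleData n na Θ, (y k).1
      ∂(Measure.pi fun _ : Fin d => cycleLaw n na P γ Ω) = γ⁻¹ := fun k => by
    rw [← integral_id_expMeasure hγ, ← (hmp k).map_eq, integral_map (hmp k).measurable.aemeasurable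
      (by fun_prop)]
  have hik : ∀ k : Fin d, Integrable (fun y : Fin d → CycleData n na Θ => (y k).1)
      (Measure.pi fun _ : Fin d => cycleLaw n na P γ Ω) := fun k =>
    (hmp k).integrable_comp_of_integrable hi
  rw [expectedTime, integral_finsetSum _ fun k _ => hik k]
  simp only [hv]
  simp [div_eq_mul_inv]

end Accuracy

/-! ### Choice of the parameters -/

section Parameters

/-- Admissible constants. -/
structure GoodConst (κ C cγ cl : ℝ) : Prop where
  gamma_pos : 0 < cγ
  lam_pos : 0 < cl
  lazy : 2 * (cl ^ 2 * cγ) ≤ C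
  pair : 2 ^ 43 * (κ ^ 4 * C * (4 + Real.log (1 + cγ)) ^ 2 * cl ^ 2 * cγ) ≤ 1 / 20
  single : 2 ^ 33 * (κ ^ 4 * C * (4 + Real.log (1 + cγ)) * cl ^ 2 * cγ ^ 2) ≤ 1 / 20
  rate : 1024 * (κ ^ 2 * C * (4 + Real.log (1 + cγ)) / cγ) ≤ 1 / 20
  large : 13 ≤ 1 / (128 * κ * cγ * cl)
  tail : 21760 * C / (cl ^ 2 * cγ) ≤ Real.exp (1 / (128 * κ * cγ * cl) - 13)

-- The constant `cγ` is taken large first, for the rate error. At fixed `cγ` all other conditions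
-- hold as `cl → 0`, the tail condition because an exponential in `1 / cl` beats `1 / cl ^ 2`.
open Filter Topology in
lemma exists_goodConst {κ C : ℝ} (hκ : 0 < κ) (hC : 0 < C) : ∃ cγ cl, GoodConst κ C cγ cl := by
  have h1 : Tendsto (fun c : ℝ => 1024 * (κ ^ 2 * C) * ((4 + Real.log (1 + c)) / c)) atTop
      (𝓝 (1024 * (κ ^ 2 * C) * 0)) := by
    refine Tendsto.const_mul _ ?_
    have e : Tendsto (fun c : ℝ => Real.log c / c) atTop (𝓝 0) := by
      simpa using Real.tendsto_pow_log_div_mul_add_atTop 1 0 1 one_ne_zero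
    have e1 : Tendsto (fun c : ℝ => 4 / c + (Real.log 2 / c + Real.log c / c)) atTop
        (𝓝 (0 + (0 + 0))) :=
      (tendsto_const_nhds.div_atTop tendsto_id).add
        ((tendsto_const_nhds.div_atTop tendsto_id).add e)
    simp only [add_zero] at e1
    refine tendsto_of_tendsto_of_tendsto_of_le_of_le' tendsto_const_nhds e1 ?_ ?_
    · filter_upwards [eventually_ge_atTop 1] with c hc
      have : 0 ≤ Real.log (1 + c) := Real.log_nonneg (by linarith)
      positivity
    · filter_upwards [eventually_ge_atTop 1] with c hc
      have h2 : Real.log (1 + c) ≤ Real.log 2 + Real.log c := by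
        rw [← Real.log_mul (by norm_num) (by positivity)]
        exact Real.log_le_log (by positivity) (by linarith)
      rw [← add_div, ← add_div]
      gcongr
  rw [mul_zero] at h1
  obtain ⟨cγ, hc1, hc⟩ := ((h1.eventually (ge_mem_nhds (by norm_num : (0 : ℝ) < 1 / 20))).and
    (eventually_gt_atTop 0)).exists
  set A := 4 + Real.log (1 + cγ) with hA
  -- the remaining constant is `1 / (128 κ cγ w)` for a large `w`
  have hsq : ∀ K : ℝ, Tendsto (fun w : ℝ => K * (1 / (128 * κ * cγ * w)) ^ 2) atTop (𝓝 0) := by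
    intro K
    have e : Tendsto (fun w : ℝ => 1 / (128 * κ * cγ * w)) atTop (𝓝 0) :=
      tendsto_const_nhds.div_atTop (tendsto_id.const_mul_atTop (by positivity))
    simpa using (e.pow 2).const_mul K
  have hexp : Tendsto (fun w : ℝ => 21760 * C * (128 * κ * cγ) ^ 2 / cγ * Real.exp 13 *
      (w ^ 2 * Real.exp (-w))) atTop (𝓝 0) := by
    simpa using (Real.tendsto_pow_mul_exp_neg_atTop_nhds_zero 2).const_mul
      (21760 * C * (128 * κ * cγ) ^ 2 / cγ * Real.exp 13)
  obtain ⟨w, hw1, hw2, hw3, hw4, hw5⟩ := (((hsq (2 * cγ)).eventually (ge_mem_nhds hC)).and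
    (((hsq (2 ^ 43 * (κ ^ 4 * C * A ^ 2 * cγ))).eventually
      (ge_mem_nhds (by norm_num : (0 : ℝ) < 1 / 20))).and
    (((hsq (2 ^ 33 * (κ ^ 4 * C * A * cγ ^ 2))).eventually
      (ge_mem_nhds (by norm_num : (0 : ℝ) < 1 / 20))).and
    ((eventually_ge_atTop 13).and (hexp.eventually (ge_mem_nhds one_pos)))))).exists
  have hw : 0 < w := by linarith
  have ew : 1 / (128 * κ * cγ * (1 / (128 * κ * cγ * w))) = w := by field_simp
  refine ⟨cγ, 1 / (128 * κ * cγ * w), hc, by positivity, ?_, ?_, ?_, ?_, by rwa [ew], ?_⟩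
  · exact le_trans (le_of_eq (by ring)) hw1
  · exact le_trans (le_of_eq (by ring)) hw2
  · exact le_trans (le_of_eq (by ring)) hw3
  · exact le_trans (le_of_eq (by ring)) hc1
  · rw [ew, sub_eq_neg_add, Real.exp_add]
    have e : 21760 * C / ((1 / (128 * κ * cγ * w)) ^ 2 * cγ) =
        21760 * C * (128 * κ * cγ) ^ 2 / cγ * w ^ 2 := by field_simp
    rw [e]
    rw [Real.exp_neg] at hw5 ⊢
    have e1 := Real.exp_pos 13
    have e2 := Real.exp_pos w
    rw [← div_eq_inv_mul, le_div_iff₀ e1]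
    have e3 : 21760 * C * (128 * κ * cγ) ^ 2 / cγ * Real.exp 13 * (w ^ 2 * (Real.exp w)⁻¹) =
        (21760 * C * (128 * κ * cγ) ^ 2 / cγ * w ^ 2 * Real.exp 13) / Real.exp w := by
      field_simp
    rwa [e3, div_le_one e2] at hw5

/-- The logarithms in the errors have arguments polynomial in `u` and `L`. The `4` collects `1 ≤ L`,
`log u ≤ L` and `2 log L ≤ 2 L`. -/
lemma one_add_log_le {c u L : ℝ} (hc : 0 < c) (hu : 1 ≤ u) (hL : 1 ≤ L) (huL : u ≤ Real.exp L) :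
    1 + Real.log (1 + c * u * L ^ 2) ≤ (4 + Real.log (1 + c)) * L := by
  have h1 : 1 + c * u * L ^ 2 ≤ (1 + c) * (u * L ^ 2) := by
    have : 1 ≤ u * L ^ 2 := one_le_mul_of_one_le_of_one_le hu (one_le_pow₀ hL)
    linarith
  have h2 : Real.log (1 + c * u * L ^ 2) ≤ Real.log (1 + c) + (Real.log u + 2 * Real.log L) := by
    refine (Real.log_le_log (by positivity) h1).trans (le_of_eq ?_)
    rw [Real.log_mul (by positivity) (by positivity), Real.log_mul (by positivity) (by positivity),
      Real.log_pow]
    norm_num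
  have h3 : Real.log u ≤ L := (Real.log_le_iff_le_exp (by positivity)).2 huL
  have h4 : Real.log L ≤ L := (Real.log_le_sub_one_of_pos (by positivity)).trans (by linarith)
  have h5 : 0 ≤ Real.log (1 + c) := Real.log_nonneg (by linarith)
  nlinarith

variable {κ C cγ cl β Ω γ lam ε x L : ℝ} {na d : ℕ}

/-- The scaling of the parameters, with `x = m / ε`. -/
structure Scaling (C cγ cl β Ω γ lam ε x L : ℝ) (na d : ℕ) : Prop where
  beta_pos : 0 < β
  freq_pos : 0 < Ω
  eps_pos : 0 < ε
  one_le_x : 1 ≤ x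
  one_le_y : 1 ≤ β * x * Ω
  one_le_log : 1 ≤ L
  x_le : x ≤ Real.exp L
  y_le : β * x * Ω ≤ Real.exp L
  eps_ge : Real.exp (-L) ≤ ε
  gamma_eq : γ = (cγ * (β * x) * L ^ 2)⁻¹
  lam_pos : 0 < lam
  lam_sq : lam ^ 2 = cl ^ 2 / (β ^ 2 * x ^ 3 * L ^ 8)
  le_anc : β * x * Ω ≤ na
  anc_le : na ≤ 2 * (β * x * Ω)
  le_steps : 8 * C / (cl ^ 2 * cγ) * (ε * x ^ 2) * L ^ 7 ≤ d
  steps_le : d ≤ 16 * C / (cl ^ 2 * cγ) * (ε * x ^ 2) * L ^ 7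

namespace Scaling

variable (s : Scaling C cγ cl β Ω γ lam ε x L na d) (g : GoodConst κ C cγ cl)
include s g

lemma gamma_pos : 0 < γ := by
  have := s.beta_pos; have := s.one_le_x; have := s.one_le_log; have := g.gamma_pos
  rw [s.gamma_eq]; positivity

lemma gainConst_le : gainConst Ω γ ≤ 4 / Ω * ((4 + Real.log (1 + cγ)) * L) := by
  have := s.freq_pos
  have e : Ω / γ = cγ * (β * x * Ω) * L ^ 2 := by rw [s.gamma_eq]; field_simp
  rw [gainConst, e]
  gcongr
  exact one_add_log_le g.gamma_pos s.one_le_y s.one_le_log s.y_le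

lemma log_le : 1 + Real.log (1 + 1 / (β * γ)) ≤ (4 + Real.log (1 + cγ)) * L := by
  have := s.beta_pos
  have e : 1 / (β * γ) = cγ * x * L ^ 2 := by rw [s.gamma_eq]; field_simp
  rw [e]
  exact one_add_log_le g.gamma_pos s.one_le_x s.one_le_log s.x_le

lemma lazy_eq : lam ^ 2 * na / (C * Ω * γ) =
    cl ^ 2 * cγ / (C * x * L ^ 6) * (na / (β * x * Ω)) := by
  have := s.beta_pos; have := s.one_le_x; have := s.one_le_log; have := g.gamma_pos
  have := s.freq_pos
  rw [s.lam_sq, s.gamma_eq]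
  field_simp

lemma lazy_le_one (hC : 0 < C) : lam ^ 2 * na / (C * Ω * γ) ≤ 1 := by
  have := s.beta_pos; have := s.one_le_x; have := s.one_le_log; have := g.gamma_pos
  have := s.freq_pos; have := g.lazy
  rw [s.lazy_eq g]
  have h1 : na / (β * x * Ω) ≤ 2 := by
    rw [div_le_iff₀ (by positivity)]; exact s.anc_le
  have h2 : 1 ≤ x * L ^ 6 := one_le_mul_of_one_le_of_one_le s.one_le_x (one_le_pow₀ s.one_le_log)
  calc _ ≤ cl ^ 2 * cγ / (C * x * L ^ 6) * 2 := by gcongr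
    _ = 2 * (cl ^ 2 * cγ) / (C * (x * L ^ 6)) := by ring
    _ ≤ C / (C * 1) := by gcongr
    _ = 1 := by field_simp

/-- Here `ε * x` is `m`, so this is the relaxation exponent. One `L` pays for `ε`, and the other
three absorb the constant prefactor. -/
lemma four_le_lazy_mul (hC : 0 < C) :
    4 * L ≤ lam ^ 2 * na / (C * Ω * γ) * d / (2 * (ε * x)) := by
  have := s.beta_pos; have := s.one_le_x; have := s.one_le_log; have := g.gamma_pos
  have := s.freq_pos; have := s.eps_pos; have := g.lam_pos
  rw [s.lazy_eq g]
  have h1 : 1 ≤ na / (β * x * Ω) := by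
    rw [le_div_iff₀ (by positivity), one_mul]; exact s.le_anc
  have h2 := s.le_steps
  calc 4 * L = cl ^ 2 * cγ / (C * x * L ^ 6) * 1 *
        (8 * C / (cl ^ 2 * cγ) * (ε * x ^ 2) * L ^ 7) / (2 * (ε * x)) := by field_simp; norm_num
    _ ≤ _ := by gcongr

lemma exp_le (hC : 0 < C) :
    4 * Real.exp (-(lam ^ 2 * na / (C * Ω * γ) * d / (2 * (ε * x)))) ≤ ε / 2 := by
  have h1 := s.four_le_lazy_mul g hC
  have h2 : Real.exp (-(lam ^ 2 * na / (C * Ω * γ) * d / (2 * (ε * x)))) ≤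
      Real.exp (-L) * Real.exp (-3) := by
    rw [← Real.exp_add]
    exact Real.exp_le_exp.2 (by linarith [s.one_le_log])
  have h3 : Real.exp (-3) ≤ 1 / 8 := by
    rw [Real.exp_neg, one_div]
    refine inv_anti₀ (by norm_num) ?_
    have h4 := Real.add_one_le_exp (1 : ℝ)
    calc (8 : ℝ) = 2 ^ 3 := by norm_num
      _ ≤ Real.exp 1 ^ 3 := by gcongr; linarith
      _ = Real.exp 3 := by rw [← Real.exp_nat_mul]; norm_num
  have h5 := s.eps_ge
  have h6 := Real.exp_pos (-L)
  nlinarith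

/-- Per cycle this is `α²` up to logarithms. As `d α` is of order `m L` and `α` of order `ε / (m L ^
6)`, the sum is of order `ε` with powers of `L` to spare. -/
lemma pair_le (hκ : 0 < κ) (hC : 0 < C) :
    d * (na ^ 2 * (2 ^ 33 * (lam ^ 4 * κ ^ 4 * gainConst Ω γ ^ 2 / γ ^ 2))) ≤ ε / 20 := by
  have hβ := s.beta_pos; have := s.one_le_x; have hL := s.one_le_log; have := g.gamma_pos
  have := s.freq_pos; have := s.eps_pos; have := g.lam_pos; have hγ := s.gamma_pos g
  have hB := s.gainConst_le g
  have hB0 := gainConst_pos s.freq_pos hγ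
  have hA : 0 ≤ Real.log (1 + cγ) := Real.log_nonneg (by linarith)
  have e4 : lam ^ 4 = (cl ^ 2 / (β ^ 2 * x ^ 3 * L ^ 8)) ^ 2 := by rw [← s.lam_sq]; ring
  have hp := g.pair
  set A := 4 + Real.log (1 + cγ)
  calc _ ≤ (16 * C / (cl ^ 2 * cγ) * (ε * x ^ 2) * L ^ 7) * ((2 * (β * x * Ω)) ^ 2 * (2 ^ 33 *
        ((cl ^ 2 / (β ^ 2 * x ^ 3 * L ^ 8)) ^ 2 * κ ^ 4 * (4 / Ω * (A * L)) ^ 2 / γ ^ 2))) := by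
        rw [e4]; gcongr
        · exact s.steps_le
        · exact s.anc_le
    _ = 2 ^ 43 * (κ ^ 4 * C * A ^ 2 * cl ^ 2 * cγ) * ε / L ^ 3 := by
        rw [s.gamma_eq]; field_simp; norm_num
    _ ≤ 1 / 20 * ε / 1 := by
        gcongr
        exact one_le_pow₀ hL
    _ = _ := by ring

lemma single_le (hκ : 0 < κ) (hC : 0 < C) :
    d * (na * (2 ^ 26 * (lam ^ 4 * κ ^ 4 * gainConst Ω γ / γ ^ 3))) ≤ ε / 20 := by
  have hβ := s.beta_pos; have := s.one_le_x; have hL := s.one_le_log; have := g.gamma_pos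
  have := s.freq_pos; have := s.eps_pos; have := g.lam_pos; have hγ := s.gamma_pos g
  have hB := s.gainConst_le g
  have hB0 := gainConst_pos s.freq_pos hγ
  have hA : 0 ≤ Real.log (1 + cγ) := Real.log_nonneg (by linarith)
  have e4 : lam ^ 4 = (cl ^ 2 / (β ^ 2 * x ^ 3 * L ^ 8)) ^ 2 := by rw [← s.lam_sq]; ring
  have hp := g.single
  set A := 4 + Real.log (1 + cγ)
  calc _ ≤ (16 * C / (cl ^ 2 * cγ) * (ε * x ^ 2) * L ^ 7) * ((2 * (β * x * Ω)) * (2 ^ 26 *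
        ((cl ^ 2 / (β ^ 2 * x ^ 3 * L ^ 8)) ^ 2 * κ ^ 4 * (4 / Ω * (A * L)) / γ ^ 3))) := by
        rw [e4]; gcongr
        · exact s.steps_le
        · exact s.anc_le
    _ = 2 ^ 33 * (κ ^ 4 * C * A * cl ^ 2 * cγ ^ 2) * ε / L ^ 2 := by
        rw [s.gamma_eq]; field_simp; norm_num
    _ ≤ 1 / 20 * ε / 1 := by
        gcongr
        exact one_le_pow₀ hL
    _ = _ := by ring

/-- The relative error of the rates is `β γ` times a logarithm, of order `ε / (m L)`, against `d α`
of order `m L`. No power of `L` is left, so smallness rests on a large `cγ`. -/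
lemma rate_le (hκ : 0 < κ) (hC : 0 < C) : d * (na * rateErr κ β Ω γ lam) ≤ ε / 20 := by
  have hβ := s.beta_pos; have := s.one_le_x; have hL := s.one_le_log; have := g.gamma_pos
  have := s.freq_pos; have := s.eps_pos; have := g.lam_pos; have hγ := s.gamma_pos g
  have hB := s.log_le g
  have hlog : 0 ≤ Real.log (1 + 1 / (β * γ)) := Real.log_nonneg (by
    have : 0 < 1 / (β * γ) := by positivity
    linarith)
  have hA : 0 ≤ Real.log (1 + cγ) := Real.log_nonneg (by linarith)
  have hp := g.rate
  rw [rateErr, s.lam_sq]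
  set A := 4 + Real.log (1 + cγ)
  calc _ ≤ (16 * C / (cl ^ 2 * cγ) * (ε * x ^ 2) * L ^ 7) * ((2 * (β * x * Ω)) * (32 *
        (cl ^ 2 / (β ^ 2 * x ^ 3 * L ^ 8) * κ ^ 2 * (β / Ω) * (A * L)))) := by
        gcongr
        · exact s.steps_le
        · exact s.anc_le
    _ = 1024 * (κ ^ 2 * C * A / cγ) * ε := by field_simp; ring
    _ ≤ 1 / 20 * ε := by gcongr
    _ = _ := by ring

/-- It makes the probability of large couplings a power of `exp (-L)`, with an exponent that grows
as `cl` decreases. -/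
lemma lam_div_le : lam / γ ≤ cγ * cl / L := by
  have hβ := s.beta_pos; have hx := s.one_le_x; have hL := s.one_le_log; have := g.gamma_pos
  have := g.lam_pos; have hγ := s.gamma_pos g
  have hlam := s.lam_pos
  refine le_of_sq_le_sq ?_ (by positivity)
  rw [div_pow, s.lam_sq, s.gamma_eq]
  have h1 : L ^ 2 ≤ x * L ^ 4 := by
    have : L ^ 2 ≤ L ^ 4 := pow_le_pow_right₀ hL (by norm_num)
    calc L ^ 2 ≤ L ^ 4 := this
      _ ≤ x * L ^ 4 := le_mul_of_one_le_left (by positivity) hx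
  calc _ = cγ ^ 2 * cl ^ 2 / (x * L ^ 4) := by field_simp
    _ ≤ cγ ^ 2 * cl ^ 2 / L ^ 2 := by gcongr
    _ = _ := by ring

/-- The polynomial prefactor is at most `exp (11 L)`, with `11 = 2 + 2 + 7`, and the tail beats it
because `w ≥ 13`. The `17` is the `16` of `pairErr` plus one copy that covers the tail of
`singleErr`. -/
lemma tail_le (hκ : 0 < κ) (hC : 0 < C) :
    d * (na ^ 2 * (17 * Real.exp (-(γ / (128 * (lam * κ)))))) ≤ ε / 20 := by
  have hβ := s.beta_pos; have hx := s.one_le_x; have hL := s.one_le_log; have := g.gamma_pos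
  have := s.freq_pos; have := s.eps_pos; have := g.lam_pos; have hγ := s.gamma_pos g
  have hlam := s.lam_pos
  have hlg := s.lam_div_le g
  have hlarge := g.large
  have htail := g.tail
  set w := 1 / (128 * κ * cγ * cl) with hw
  have h1 : w * L ≤ γ / (128 * (lam * κ)) := by
    have e1 : γ / (128 * (lam * κ)) = 1 / (128 * κ * (lam / γ)) := by field_simp
    have e2 : w * L = 1 / (128 * κ * (cγ * cl / L)) := by rw [hw]; field_simp
    rw [e1, e2]
    gcongr
  have h2 : Real.exp (-(γ / (128 * (lam * κ)))) ≤ Real.exp (-(11 * L)) * Real.exp (-(w - 13)) := by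
    rw [← Real.exp_add]
    exact Real.exp_le_exp.2 (by nlinarith)
  have h3 : x ^ 2 * (β * x * Ω) ^ 2 * L ^ 7 ≤ Real.exp (11 * L) := by
    have hLe : L ≤ Real.exp L := by linarith [Real.add_one_le_exp L]
    calc _ ≤ Real.exp L ^ 2 * Real.exp L ^ 2 * Real.exp L ^ 7 := by
          gcongr
          · exact s.x_le
          · exact s.y_le
      _ = Real.exp (11 * L) := by
          rw [← pow_add, ← pow_add, ← Real.exp_nat_mul]; norm_num
  have h4 : Real.exp (11 * L) * Real.exp (-(11 * L)) = 1 := by rw [← Real.exp_add]; simp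
  have h5 : 21760 * C / (cl ^ 2 * cγ) * Real.exp (-(w - 13)) ≤ 1 := by
    rw [Real.exp_neg, ← div_eq_mul_inv, div_le_one (Real.exp_pos _)]
    exact htail
  calc _ ≤ (16 * C / (cl ^ 2 * cγ) * (ε * x ^ 2) * L ^ 7) * ((2 * (β * x * Ω)) ^ 2 *
        (17 * (Real.exp (-(11 * L)) * Real.exp (-(w - 13))))) := by
        gcongr
        · exact s.steps_le
        · exact s.anc_le
    _ = ε / 20 * (x ^ 2 * (β * x * Ω) ^ 2 * L ^ 7) * Real.exp (-(11 * L)) *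
        (21760 * C / (cl ^ 2 * cγ) * Real.exp (-(w - 13))) := by ring
    _ ≤ ε / 20 * Real.exp (11 * L) * Real.exp (-(11 * L)) * 1 := by gcongr
    _ = ε / 20 := by rw [mul_assoc (ε / 20), h4]; ring

theorem cycleErr_le (hκ : 0 < κ) (hC : 0 < C) : d * cycleErr κ β Ω γ lam na ≤ ε / 2 := by
  have h1 := s.pair_le g hκ hC
  have h2 := s.single_le g hκ hC
  have h3 := s.rate_le g hκ hC
  have h4 := s.tail_le g hκ hC
  have hγ := s.gamma_pos g
  have hL := s.one_le_log; have := g.gamma_pos; have := g.lam_pos; have := s.eps_pos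
  have hlam := s.lam_pos
  have hn : (1 : ℝ) ≤ na := s.one_le_y.trans s.le_anc
  have h5 : lam * κ / γ ≤ 1 / 128 := by
    have h6 := s.lam_div_le g
    have h7 := g.large
    rw [le_div_iff₀ (by positivity)] at h7
    have h8 : cγ * cl / L ≤ cγ * cl := div_le_self (by positivity) hL
    have h9 : lam * κ / γ = κ * (lam / γ) := by ring
    rw [h9]
    have h10 : κ * (lam / γ) ≤ κ * (cγ * cl) := by gcongr; exact h6.trans h8
    linarith
  set E := Real.exp (-(γ / (128 * (lam * κ)))) with hE
  have hE0 : 0 ≤ E := Real.exp_nonneg _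
  have h6 : 12288 * (lam ^ 4 * κ ^ 4 / γ ^ 4 * E) ≤ E := by
    have e : lam ^ 4 * κ ^ 4 / γ ^ 4 = (lam * κ / γ) ^ 4 := by ring
    have h7 : (lam * κ / γ) ^ 4 ≤ (1 / 128) ^ 4 := by gcongr
    rw [e]
    have h8 : (lam * κ / γ) ^ 4 * E ≤ (1 / 128) ^ 4 * E := by gcongr
    norm_num at h8
    linarith
  have h7 : d * (na * (12288 * (lam ^ 4 * κ ^ 4 / γ ^ 4 * E))) ≤ d * (na ^ 2 * E) := by
    gcongr
    exact le_self_pow₀ hn (by norm_num)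
  have e : d * cycleErr κ β Ω γ lam na =
      d * (na ^ 2 * (2 ^ 33 * (lam ^ 4 * κ ^ 4 * gainConst Ω γ ^ 2 / γ ^ 2))) +
      d * (na * (2 ^ 26 * (lam ^ 4 * κ ^ 4 * gainConst Ω γ / γ ^ 3))) +
      d * (na * rateErr κ β Ω γ lam) + d * (na * (12288 * (lam ^ 4 * κ ^ 4 / γ ^ 4 * E))) +
      16 * (d * (na ^ 2 * E)) := by
    rw [cycleErr, pairErr, singleErr, ← hE]; ring
  have e2 : d * (na ^ 2 * (17 * E)) = 17 * (d * (na ^ 2 * E)) := by ring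
  rw [e2] at h4
  rw [e]
  linarith

end Scaling

end Parameters

end ErgodicGibbs

end

/-! ### Assembly of the theorem -/

theorem theoremS1 (κ C : ℝ) (hκ : 0 < κ) (hC : 0 < C) :
    ∃ cd cγ cl ca ct cm : ℝ, 0 < cd ∧ 0 < cγ ∧ 0 < cl ∧ 0 < ca ∧ 0 < ct ∧ 0 < cm ∧
    ∃ pd pγ pl pa pt : ℕ,
    ∀ (n : ℕ) (Θ : Type*) [MeasurableSpace Θ] (P : MeasureTheory.Measure Θ)
      [MeasureTheory.IsProbabilityMeasure P] (S : ErgodicGibbs.EthSystem n Θ),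
      S.CouplingSize P κ →
    ∀ β Ω : ℝ, 0 < β → 0 < Ω →
      -- the mixing time is of order `n / Δ`, for an extensive Hamiltonian
      (∀ γ h : ℝ, 0 < γ → (∀ μ, |S.energy μ| ≤ h * n) →
        (∀ μ ν, 0 ≤ S.transition P C β Ω γ μ ν) →
        0 < ErgodicGibbs.spectralGap (S.transition P C β Ω γ) →
        ErgodicGibbs.mixingTime (S.transition P C β Ω γ) (S.gibbsWeight β) ≤
          (⌈cm * (1 + β * h) * n / ErgodicGibbs.spectralGap (S.transition P C β Ω γ)⌉₊ : ℕ∞)) ∧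
      -- accuracy and runtime
      (∀ (ε : ℝ) (m : ℕ), 0 < ε → ε ≤ 1 → 1 ≤ m →
        ∀ (L γ lam : ℝ) (na d : ℕ),
        L = Real.log (2 + m * (1 + β * Ω) / ε) →
        γ = (cγ * (β * m / ε) * L ^ pγ)⁻¹ →
        lam = cl * (ε ^ (3 / 2 : ℝ) / (β * (m : ℝ) ^ (3 / 2 : ℝ))) / L ^ pl →
        na = ⌈ca * (β * m * Ω / ε) * L ^ pa⌉₊ →
        d = ⌈cd * ((m : ℝ) ^ 2 / ε) * L ^ pd⌉₊ →
        ε ≤ β * m * Ω →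
        (∀ μ ν, 0 ≤ S.transition P C β Ω γ μ ν) →
        ErgodicGibbs.mixingTime (S.transition P C β Ω γ) (S.gibbsWeight β) ≤ m →
        ErgodicGibbs.traceNorm
            (S.expectedOutput P β Ω γ lam na d - ErgodicGibbs.gibbs β S.ham) ≤ ε ∧
          ErgodicGibbs.expectedTime n na P γ Ω d = d / γ ∧
          d / γ ≤ ct * (β * (m : ℝ) ^ 3 / ε ^ 2) * L ^ pt) := by
  obtain ⟨cγ, cl, g⟩ := ErgodicGibbs.exists_goodConst hκ hC
  have hcγ := g.gamma_pos
  have hcl := g.lam_pos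
  have hcd : 16 ≤ 8 * C / (cl ^ 2 * cγ) := by
    rw [le_div_iff₀ (by positivity)]
    linarith [g.lazy]
  -- The exponents are `pd = 7`, `pγ = 2`, `pl = 4`, `pa = 0` and `pt = pd + pγ`. They make `α` of
  -- order `ε / (m L ^ 6)`, so `pd = 7` leaves one power of `L` for the relaxation.
  refine ⟨8 * C / (cl ^ 2 * cγ), cγ, cl, 1, 16 * C / (cl ^ 2 * cγ) * cγ, 2, by positivity, hcγ, hcl,
    one_pos, by positivity, two_pos, 7, 2, 4, 0, 9, ?_⟩
  intro n Θ _ P _ S h β Ω hβ hΩ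
  refine ⟨fun _ _ _ he _ hgap => S.mixingTime_transition_le P hβ he hgap, ?_⟩
  intro ε m hε hε1 hm L γ lam na d hL hγ hlam hna hd hy h0 hmix
  have hm' : (1 : ℝ) ≤ m := by exact_mod_cast hm
  obtain ⟨x, hx⟩ : ∃ x : ℝ, x = m / ε := ⟨_, rfl⟩
  have hmx : (m : ℝ) = ε * x := by rw [hx]; field_simp
  have hx1 : 1 ≤ x := by rw [hx, one_le_div hε]; linarith
  have hy1 : 1 ≤ β * x * Ω := by
    have : β * x * Ω = β * m * Ω / ε := by rw [hx]; ring
    rw [this, one_le_div hε]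
    exact hy
  -- The definition of `L` is made so that `exp L` dominates `x` and `β x Ω`, and also `ε⁻¹`, which
  -- is at most `x`.
  have hexp : Real.exp L = 2 + x + β * x * Ω := by
    rw [hL, Real.exp_log (by positivity), hx]; ring
  have hL1 : 1 ≤ L := by
    rw [← Real.exp_le_exp, hexp]
    linarith [Real.exp_one_lt_d9]
  have hna' : na = ⌈β * x * Ω⌉₊ := by
    rw [hna, hx]; congr 1; ring
  have hd' : d = ⌈8 * C / (cl ^ 2 * cγ) * (ε * x ^ 2) * L ^ 7⌉₊ := by
    rw [hd, hmx]; congr 3; field_simp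
  -- Both ceilings act on numbers that are at least `1`, so rounding at most doubles them. For `na`
  -- this is the hypothesis `ε ≤ β m Ω`.
  have hbig : 1 ≤ 8 * C / (cl ^ 2 * cγ) * (ε * x ^ 2) * L ^ 7 := by
    have h1 : 1 ≤ ε * x ^ 2 := by
      have : ε * x ^ 2 = m * x := by rw [hmx]; ring
      rw [this]
      exact one_le_mul_of_one_le_of_one_le hm' hx1
    exact one_le_mul_of_one_le_of_one_le (one_le_mul_of_one_le_of_one_le (by linarith) h1)
      (one_le_pow₀ hL1)
  have hsq : ∀ u : ℝ, 0 ≤ u → (u ^ (3 / 2 : ℝ)) ^ 2 = u ^ 3 := fun u hu => by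
    rw [← Real.rpow_natCast, ← Real.rpow_mul hu, ← Real.rpow_natCast]
    norm_num
  have s : ErgodicGibbs.Scaling C cγ cl β Ω γ lam ε x L na d :=
    { beta_pos := hβ
      freq_pos := hΩ
      eps_pos := hε
      one_le_x := hx1
      one_le_y := hy1
      one_le_log := hL1
      x_le := by rw [hexp]; linarith
      y_le := by rw [hexp]; linarith
      eps_ge := by
        rw [Real.exp_neg, hexp, inv_le_comm₀ (by positivity) hε]
        have : ε⁻¹ ≤ x := by
          rw [hx, inv_eq_one_div]; gcongr
        linarith
      gamma_eq := by rw [hγ, hx, mul_div_assoc]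
      lam_pos := by rw [hlam]; positivity
      lam_sq := by
        rw [hlam, div_pow, mul_pow, div_pow, mul_pow, hsq ε hε.le, hsq _ (by positivity), hmx]
        field_simp
      le_anc := by rw [hna']; exact Nat.le_ceil _
      anc_le := by
        rw [hna']
        linarith [(Nat.ceil_lt_add_one (by positivity : 0 ≤ β * x * Ω)).le]
      le_steps := by rw [hd']; exact Nat.le_ceil _
      steps_le := by
        rw [hd']
        have h1 := (Nat.ceil_lt_add_one (le_trans zero_le_one hbig)).le
        have e : 16 * C / (cl ^ 2 * cγ) * (ε * x ^ 2) * L ^ 7 =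
          2 * (8 * C / (cl ^ 2 * cγ) * (ε * x ^ 2) * L ^ 7) := by ring
        linarith }
  have hγ0 := s.gamma_pos g
  refine ⟨?_, ErgodicGibbs.expectedTime_eq hγ0 hΩ d, ?_⟩
  · have h1 := ErgodicGibbs.traceNorm_expectedOutput_sub_gibbs_le h hκ hβ hγ0 hΩ hC s.lam_pos
      (s.lazy_le_one g hC) hm h0 hmix d
    have h2 := s.cycleErr_le g hκ hC
    have h3 := s.exp_le g hC
    rw [← hmx] at h3
    linarith
  · have h1 : (d : ℝ) / γ = d * (cγ * (β * x) * L ^ 2) := by rw [s.gamma_eq, div_inv_eq_mul]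
    rw [h1]
    calc _ ≤ (16 * C / (cl ^ 2 * cγ) * (ε * x ^ 2) * L ^ 7) * (cγ * (β * x) * L ^ 2) := by
          gcongr
          exact s.steps_le
      _ = _ := by rw [hmx]; field_simp
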